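/- **Setup.** Let $X$ be a running variable with cutoff $0$, $Y$ an outcome and $D\in\{0,1\}$ a treatment. In the sharp design $W_i=(X_i,Y_i)$ is i.i.d., in the fuzzy design $W_i=(X_i,D_i,Y_i)$ is i.i.d. Let $k^*$ be a kernel that is symmetric, bounded, zero outside $[-A,A]$, with a bounded, uniformly continuous first derivative on $(0,A)$ and $\int k^*\neq 0$, such that the one-sided local linear problem is well posed: $\int_0^\infty (a+bu)^2k^*(u)\,du>0$ for all $(a,b)\ne(0,0)$ (automatic if $k^*\ge 0$). Let $\mu_{k^*,j}=\int_0^\infty u^jk^*(u)\,du$ and $$k(u)=(\mu_{k^*,2}-\mu_{k^*,1}|u|)\,k^*(u).$$ For $V\in\{Y,D\}$ let $(\hat\alpha_{u,V}(h),\hat\beta_{u,V}(h))$ minimize $\sum_{i\le n}(V_i-\alpha-\beta X_i)^2I(X_i\ge0)k^*(X_i/h)$ over $(\alpha,\beta)$, let $(\hat\alpha_{\ell,V}(h),\hat\beta_{\ell,V}(h))$ be the same with $I(X_i<0)$, and let $\alpha_{u,V}(h),\alpha_{\ell,V}(h)$ be the intercepts of the minimizers of the corresponding population criteria (the sum replaced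 by an expectation). In the sharp design $\hat\theta(h)=\hat\alpha_{u,Y}(h)-\hat\alpha_{\ell,Y}(h)$ and $\theta(h)=\alpha_{u,Y}(h)-\alpha_{\ell,Y}(h)$; in the fuzzy design $$\hat\theta(h)=\frac{\hat\alpha_{u,Y}(h)-\hat\alpha_{\ell,Y}(h)}{\hat\alpha_{u,D}(h)-\hat\alpha_{\ell,D}(h)},\qquad \theta(h)=\frac{\alpha_{u,Y}(h)-\alpha_{\ell,Y}(h)}{\alpha_{u,D}(h)-\alpha_{\ell,D}(h)}.$$ Let $\hat\sigma(h)^2/(nh)$ be the Eicker–Huber–White variance estimate of $\hat\theta(h)$: the sum over the two sides of the $(1,1)$ entries of $G^{-1}\big(\sum_i w_i^2\hat r_i^2z_iz_i'\big)G^{-1}$, with $z_i=(1,X_i)'$, $w_i$ the regression weight of observation $i$ on that side, $G=\sum_iw_iz_iz_i'$, and $\hat r_i$ the residual of $Y$ (sharp), or the residual of $Y$ minus $\hat\theta(h)$ times that of $D$ (fuzzy); in the fuzzy design the sum is divided by $(\hat\alpha_{u,D}(h)-\hat\alpha_{\ell,D}(h))^2$. **Assumptions on the design.** $Y$ is bounded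 and $X$ has a density $f_X$. For some deterministic $\ell$ with $\ell(t)\log\log t^{-1}\to0$ as $t\downarrow0$, the functions $f_X(x)$, $E(Y|X=x)$, $\mathrm{var}(Y|X=x)$ and, in the fuzzy design, $E(D|X=x)$ and all entries of $\mathrm{var}((D,Y)'|X=x)$ have one-sided limits at $0$ and are within $\ell(|x|)$ of the limit on the same side for all $x\ne0$ close enough to $0$. Moreover $f_X(0_+)>0$ and $f_X(0_-)>0$, and * sharp: $\mathrm{var}(Y|X=0_+)\neq0$ or $\mathrm{var}(Y|X=0_-)\ne0$; * fuzzy: $P(D=1|X=0_+)\neq P(D=1|X=0_-)$, and for some $d\in\{0,1\}$ and one of the sides $s\in\{+,-\}$ with $P(D=d|X=0_s)>0$, the limit $\mathrm{var}(Y|D=d,X=0_s)$ exists and is nonzero. **Conclusion (in either design).** There are a constant $\eta>0$ and a function $\psi(w,h)$, measurable in $w$, for which the following hold. 1. *(Regularity.)* The kernel $k$ is symmetric, bounded, zero outside $[-A,A]$, with a bounded, uniformly continuous first derivative on $(0,A)$ and $\int k\ne0$. The variables $\psi(W_i,h)k(X_i/h)$ are bounded almost surely, uniformly over $0<h\le\eta$,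 and $\psi(W_i,0)$ is bounded almost surely. The variable $|X_i|$ has a density $f_{|X|}$ with $f_{|X|}(0)>0$, and $\mathrm{var}[\psi(W_i,0)\mid|X_i|=0]>0$. For some deterministic $\tilde\ell$ with $\tilde\ell(t)\log\log t^{-1}\to0$ as $t\downarrow 0$, the following are bounded by $\tilde\ell(t)$ for $0<t\le\eta$: $|f_{|X|}(t)-f_{|X|}(0)|$; $|E[\psi(W_i,0)\mid|X_i|=t]-E[\psi(W_i,0)\mid|X_i|=0]|$; $|\mathrm{var}[\psi(W_i,0)\mid|X_i|=t]-\mathrm{var}[\psi(W_i,0)\mid|X_i|=0]|$; and, almost surely, $|(\psi(W_i,t)-\psi(W_i,0))k(X_i/t)|$. 2. *(Influence function representation.)* For all sequences $0<\underline h_n\le\overline h_n\le\eta$ with $n\underline h_n/(\log\log\underline h_n^{-1})^3\to\infty$: for $0<h\le\eta$, $E\,\psi(W_i,h)k(X_i/h)=0$ and $\frac1h\mathrm{var}(\psi(W_i,h)k(X_i/h))=1$; the classes $\{w\mapsto\psi(w,h)k(x(w)/h):0<h\le\eta\}$ (where $x(w)$ is the running-variable coordinate of $w$) and $\{x\mapsto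 k(x/h):0<h\le\eta\}$ have polynomial uniform covering numbers (their $L^2(Q)$ covering numbers at radius $\varepsilon\in(0,1)$ are at most $C\varepsilon^{-v}$ for all probability measures $Q$, with constants $C,v>0$); and, uniformly over $h\in[\underline h_n,\overline h_n]$, $$\frac{\sqrt{nh}\,(\hat\theta(h)-\theta(h))}{\hat\sigma(h)}=\frac1{\sqrt{nh}}\sum_{i=1}^n\psi(W_i,h)k(X_i/h)+o_P\Big(\big(\max\{1,\log\log(\overline h_n/\underline h_n)\}\big)^{-1/2}\Big),$$ that is, the supremum over $h$ of the absolute remainder, multiplied by $\max\{1,\log\log(\overline h_n/\underline h_n)\}^{1/2}$, tends to $0$ in outer probability. -/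

import Mathlib

open MeasureTheory ProbabilityTheory Filter Topology

noncomputable section

namespace RDSnoop

/-! ### Kernels -/

/-- Regularity of a kernel: symmetric, zero outside `[-A, A]`, bounded, with a bounded and
uniformly continuous first derivative on `(0, A)`, and with nonzero integral. -/
structure KernelRegular (k : ℝ → ℝ) (A : ℝ) : Prop where
  pos : 0 < A
  symm : ∀ u, k (-u) = k u
  support : Function.support k ⊆ Set.Icc (-A) A
  bounded : ∃ B, ∀ u, |k u| ≤ B
  differentiable : ∀ u ∈ Set.Ioo 0 A, DifferentiableAt ℝ k u
  deriv_bounded : ∃ B, ∀ u ∈ Set.Ioo 0 A, |deriv k u| ≤ B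
  deriv_uniformContinuous : UniformContinuousOn (deriv k) (Set.Ioo 0 A)
  integral_ne_zero : ∫ u, k u ≠ 0

/-- The one-sided moment `∫_{u > 0} u ^ j k(u) du`. -/
def kernelMoment (k : ℝ → ℝ) (j : ℕ) : ℝ := ∫ u in Set.Ioi (0 : ℝ), u ^ j * k u

/-- The equivalent kernel `(μ₂ - μ₁ |u|) k(u)` of the local linear estimator at a boundary. -/
def equivKernel (k : ℝ → ℝ) (u : ℝ) : ℝ :=
  (kernelMoment k 2 - kernelMoment k 1 * |u|) * k u

/-- The limiting one-sided weighted least squares problem is well posed. This is automatic for a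
nonnegative kernel with nonzero integral. -/
def WellPosed (k : ℝ → ℝ) : Prop :=
  ∀ a b : ℝ, (a, b) ≠ (0, 0) → 0 < ∫ u in Set.Ioi (0 : ℝ), (a + b * u) ^ 2 * k u

/-! ### Local linear regression on one side of the cutoff

The set `S` is `Set.Ici 0` (above the cutoff) or `Set.Iio 0` (below the cutoff). -/

/-- The weight `I(x ∈ S) k(x / h)` of an observation. -/
def weight (k : ℝ → ℝ) (S : Set ℝ) (h x : ℝ) : ℝ := S.indicator (fun x => k (x / h)) x

/-- The sample criterion at (intercept, slope) `p`, from the first `n` observations. -/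
def sampleLoss (k : ℝ → ℝ) (S : Set ℝ) (h : ℝ) (n : ℕ) (x y : ℕ → ℝ) (p : ℝ × ℝ) : ℝ :=
  ∑ i ∈ Finset.range n, (y i - p.1 - p.2 * x i) ^ 2 * weight k S h (x i)

/-- A minimizer (intercept, slope) of the sample criterion; arbitrary if there is none. -/
def sampleFit (k : ℝ → ℝ) (S : Set ℝ) (h : ℝ) (n : ℕ) (x y : ℕ → ℝ) : ℝ × ℝ :=
  Classical.epsilon fun p => ∀ q, sampleLoss k S h n x y p ≤ sampleLoss k S h n x y q

/-- The regression residual of observation `i`. -/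
def sampleResid (k : ℝ → ℝ) (S : Set ℝ) (h : ℝ) (n : ℕ) (x y : ℕ → ℝ) (i : ℕ) : ℝ :=
  y i - (sampleFit k S h n x y).1 - (sampleFit k S h n x y).2 * x i

/-- The population criterion at (intercept, slope) `p`. -/
def popLoss {Ω : Type*} [MeasurableSpace Ω] (μ : Measure Ω) (k : ℝ → ℝ) (S : Set ℝ) (h : ℝ)
    (X Y : Ω → ℝ) (p : ℝ × ℝ) : ℝ :=
  ∫ ω, (Y ω - p.1 - p.2 * X ω) ^ 2 * weight k S h (X ω) ∂μ

/-- A minimizer (intercept, slope) of the population criterion; arbitrary if there is none. -/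
def popFit {Ω : Type*} [MeasurableSpace Ω] (μ : Measure Ω) (k : ℝ → ℝ) (S : Set ℝ) (h : ℝ)
    (X Y : Ω → ℝ) : ℝ × ℝ :=
  Classical.epsilon fun p => ∀ q, popLoss μ k S h X Y p ≤ popLoss μ k S h X Y q

/-- The estimated jump at the cutoff: difference of the two fitted intercepts. -/
def sampleJump (k : ℝ → ℝ) (h : ℝ) (n : ℕ) (x y : ℕ → ℝ) : ℝ :=
  (sampleFit k (Set.Ici 0) h n x y).1 - (sampleFit k (Set.Iio 0) h n x y).1

/-- The population counterpart of `sampleJump`. -/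
def popJump {Ω : Type*} [MeasurableSpace Ω] (μ : Measure Ω) (k : ℝ → ℝ) (h : ℝ)
    (X Y : Ω → ℝ) : ℝ :=
  (popFit μ k (Set.Ici 0) h X Y).1 - (popFit μ k (Set.Iio 0) h X Y).1

/-- The Eicker-Huber-White (sandwich) variance estimate of the intercept of the weighted least
squares regression on `(1, x)` over the side `S`, computed with the residuals `r`. -/
def ehwIntercept (k : ℝ → ℝ) (S : Set ℝ) (h : ℝ) (n : ℕ) (x r : ℕ → ℝ) : ℝ :=
  let G : Matrix (Fin 2) (Fin 2) ℝ :=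
    ∑ i ∈ Finset.range n, weight k S h (x i) • !![1, x i; x i, x i ^ 2]
  let V : Matrix (Fin 2) (Fin 2) ℝ :=
    ∑ i ∈ Finset.range n, (weight k S h (x i) ^ 2 * r i ^ 2) • !![1, x i; x i, x i ^ 2]
  (G⁻¹ * V * G⁻¹) 0 0

/-! ### Sharp and fuzzy estimators, estimands and standard errors -/

/-- The fuzzy estimator: ratio of the estimated jumps of `y` and `d`. -/
def fuzzyEst (k : ℝ → ℝ) (h : ℝ) (n : ℕ) (x d y : ℕ → ℝ) : ℝ :=
  sampleJump k h n x y / sampleJump k h n x d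

/-- The fuzzy estimand `θ(h)`. -/
def fuzzyTarget {Ω : Type*} [MeasurableSpace Ω] (μ : Measure Ω) (k : ℝ → ℝ) (X D Y : Ω → ℝ)
    (h : ℝ) : ℝ :=
  popJump μ k h X Y / popJump μ k h X D

/-- `σ̂(h)` in the sharp design: `σ̂(h)² / (n h)` is the robust variance estimate of the
difference of the intercepts of the two regressions. -/
def sharpSigma (k : ℝ → ℝ) (h : ℝ) (n : ℕ) (x y : ℕ → ℝ) : ℝ :=
  Real.sqrt (n * h *
    (ehwIntercept k (Set.Ici 0) h n x (sampleResid k (Set.Ici 0) h n x y) +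
      ehwIntercept k (Set.Iio 0) h n x (sampleResid k (Set.Iio 0) h n x y)))

/-- The residuals of `y - θ̂(h) d` on the side `S`. -/
def fuzzyResid (k : ℝ → ℝ) (S : Set ℝ) (h : ℝ) (n : ℕ) (x d y : ℕ → ℝ) (i : ℕ) : ℝ :=
  sampleResid k S h n x y i - fuzzyEst k h n x d y * sampleResid k S h n x d i

/-- `σ̂(h)` in the fuzzy design: `σ̂(h)² / (n h)` is the robust variance estimate of the
ratio of jumps (equivalently, of the weighted instrumental variables estimate). -/
def fuzzySigma (k : ℝ → ℝ) (h : ℝ) (n : ℕ) (x d y : ℕ → ℝ) : ℝ :=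
  Real.sqrt (n * h *
    (ehwIntercept k (Set.Ici 0) h n x (fuzzyResid k (Set.Ici 0) h n x d y) +
      ehwIntercept k (Set.Iio 0) h n x (fuzzyResid k (Set.Iio 0) h n x d y)) /
    sampleJump k h n x d ^ 2)

/-! ### Conditional moments, moduli of continuity, i.i.d. samples -/

/-- `m(v)` is (a version of) `E[Z | V = v]`. -/
def IsCondMean {Ω β : Type*} [MeasurableSpace Ω] [mβ : MeasurableSpace β] (μ : Measure Ω)
    (V : Ω → β) (Z : Ω → ℝ) (m : β → ℝ) : Prop :=
  Measurable m ∧ (fun ω => m (V ω)) =ᵐ[μ] μ[Z | mβ.comap V]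

/-- `c(v)` is (a version of) `cov(Z, Z' | V = v)`; with `Z' = Z` it is `var(Z | V = v)`. -/
def IsCondCov {Ω β : Type*} [MeasurableSpace Ω] [mβ : MeasurableSpace β] (μ : Measure Ω)
    (V : Ω → β) (Z Z' : Ω → ℝ) (c : β → ℝ) : Prop :=
  Measurable c ∧ (fun ω => c (V ω)) =ᵐ[μ]
    μ[fun ω => (Z ω - (μ[Z | mβ.comap V]) ω) * (Z' ω - (μ[Z' | mβ.comap V]) ω) | mβ.comap V]

/-- `g` has the one-sided limits `gR = g(0+)` and `gL = g(0-)`, and is right- and left-continuous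
at `0` with local modulus of continuity `ell`. -/
def OneSidedModulus (ell g : ℝ → ℝ) (gR gL : ℝ) : Prop :=
  (∀ᶠ x in 𝓝[>] (0 : ℝ), |g x - gR| ≤ ell |x|) ∧ (∀ᶠ x in 𝓝[<] (0 : ℝ), |g x - gL| ≤ ell |x|)

/-- `ell(t) log log (1 / t) → 0` as `t ↓ 0`. -/
def LogLogSmall (ell : ℝ → ℝ) : Prop :=
  Tendsto (fun t => ell t * Real.log (Real.log t⁻¹)) (𝓝[>] 0) (𝓝 0)

/-- The observations `W 0, W 1, …` are measurable, independent and identically distributed. -/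
def IsIID {Ω 𝒲 : Type*} [MeasurableSpace Ω] [MeasurableSpace 𝒲] (μ : Measure Ω)
    (W : ℕ → Ω → 𝒲) : Prop :=
  (∀ i, Measurable (W i)) ∧ iIndepFun W μ ∧ ∀ i, IdentDistrib (W i) (W 0) μ μ

/-- A class of functions has polynomial uniform covering numbers: the `L²(Q)` covering numbers
are at most `C ε ^ (-v)`, uniformly over all probability measures `Q`. -/
def PolyUniformCovering {𝒵 : Type*} [MeasurableSpace 𝒵] (𝒢 : Set (𝒵 → ℝ)) : Prop :=
  ∃ C v : ℝ, 0 < C ∧ 0 < v ∧ ∀ Q : Measure 𝒵, IsProbabilityMeasure Q →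
    ∀ ε : ℝ, 0 < ε → ε < 1 → ∃ T : Finset (𝒵 → ℝ), (T : Set (𝒵 → ℝ)) ⊆ 𝒢 ∧
      (T.card : ℝ) ≤ C * ε ^ (-v) ∧
      ∀ g ∈ 𝒢, ∃ t ∈ T, eLpNorm (fun z => g z - t z) 2 Q ≤ ENNReal.ofReal ε

/-! ### The two high-level assumptions

The observation is `W i`, with real coordinate `X i = xc (W i)`. The constant `hmax` is an upper
bound for the bandwidths. -/

/-- Uniform influence function representation over the bandwidths in `[hlo n, hhi n]`. The
`o_P` statement is about the supremum over `h`, in outer probability; the rate is read as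
`o_P(1)` when `hhi n / hlo n` stays bounded. -/
structure InfluenceAssumption {Ω 𝒲 : Type*} [MeasurableSpace Ω] [MeasurableSpace 𝒲]
    (μ : Measure Ω) (W : ℕ → Ω → 𝒲) (xc : 𝒲 → ℝ)
    (est sig : ℝ → ℕ → Ω → ℝ) (target : ℝ → ℝ)
    (ψ : 𝒲 → ℝ → ℝ) (k : ℝ → ℝ) (hmax : ℝ) (hlo hhi : ℕ → ℝ) : Prop where
  measurable : ∀ h ∈ Set.Icc 0 hmax, Measurable fun w => ψ w h
  integrable : ∀ h ∈ Set.Ioc 0 hmax,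
    MemLp (fun ω => ψ (W 0 ω) h * k (xc (W 0 ω) / h)) 2 μ
  centered : ∀ h ∈ Set.Ioc 0 hmax, ∫ ω, ψ (W 0 ω) h * k (xc (W 0 ω) / h) ∂μ = 0
  normalized : ∀ h ∈ Set.Ioc 0 hmax,
    1 / h * variance (fun ω => ψ (W 0 ω) h * k (xc (W 0 ω) / h)) μ = 1
  covering : PolyUniformCovering
    ((fun (h : ℝ) (w : 𝒲) => ψ w h * k (xc w / h)) '' Set.Ioc 0 hmax)
  covering_kernel : PolyUniformCovering ((fun (h x : ℝ) => k (x / h)) '' Set.Ioc 0 hmax)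
  representation : ∀ ε : ℝ, 0 < ε → Tendsto (fun n : ℕ => μ {ω | ∃ h ∈ Set.Icc (hlo n) (hhi n),
      ε < Real.sqrt (max 1 (Real.log (Real.log (hhi n / hlo n)))) *
        |Real.sqrt (n * h) * (est h n ω - target h) / sig h n ω -
          1 / Real.sqrt (n * h) *
            ∑ i ∈ Finset.range n, ψ (W i ω) h * k (xc (W i ω) / h)|}) atTop (𝓝 0)

/-- Regularity of the kernel and of the distribution of the data near `0`. The function `f` is a
density of `|X|`, and `m`, `v` are the mean and variance of `ψ(W, 0)` conditional on `|X|`. -/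
structure DGPAssumption {Ω 𝒲 : Type*} [MeasurableSpace Ω] [MeasurableSpace 𝒲]
    (μ : Measure Ω) (W : ℕ → Ω → 𝒲) (xc : 𝒲 → ℝ)
    (ψ : 𝒲 → ℝ → ℝ) (k : ℝ → ℝ) (A hmax : ℝ) : Prop where
  kernel : KernelRegular k A
  bounded : ∃ B, ∀ h ∈ Set.Ioc 0 hmax, ∀ᵐ ω ∂μ, |ψ (W 0 ω) h * k (xc (W 0 ω) / h)| ≤ B
  bounded_zero : ∃ B, ∀ᵐ ω ∂μ, |ψ (W 0 ω) 0| ≤ B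
  regular : ∃ f m v ell : ℝ → ℝ,
    Measurable f ∧ (∀ t, 0 ≤ f t) ∧
    μ.map (fun ω => |xc (W 0 ω)|) =
      (volume.restrict (Set.Ici 0)).withDensity (fun t => ENNReal.ofReal (f t)) ∧
    IsCondMean μ (fun ω => |xc (W 0 ω)|) (fun ω => ψ (W 0 ω) 0) m ∧
    IsCondCov μ (fun ω => |xc (W 0 ω)|) (fun ω => ψ (W 0 ω) 0) (fun ω => ψ (W 0 ω) 0) v ∧
    0 < f 0 ∧ 0 < v 0 ∧ LogLogSmall ell ∧
    ∀ t ∈ Set.Ioc 0 hmax,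
      |f t - f 0| ≤ ell t ∧ |m t - m 0| ≤ ell t ∧ |v t - v 0| ≤ ell t ∧
      ∀ᵐ ω ∂μ, |(ψ (W 0 ω) t - ψ (W 0 ω) 0) * k (xc (W 0 ω) / t)| ≤ ell t

/-- Both assumptions hold, with kernel `k` and one function `ψ`, whenever the upper bandwidth is
below a small enough constant and `n hlo / (log log (1 / hlo)) ^ 3 → ∞`. -/
def AssumptionsHold {Ω 𝒲 : Type*} [MeasurableSpace Ω] [MeasurableSpace 𝒲]
    (μ : Measure Ω) (W : ℕ → Ω → 𝒲) (xc : 𝒲 → ℝ)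
    (est sig : ℝ → ℕ → Ω → ℝ) (target : ℝ → ℝ) (k : ℝ → ℝ) (A : ℝ) : Prop :=
  ∃ hmax : ℝ, 0 < hmax ∧ ∃ ψ : 𝒲 → ℝ → ℝ,
    DGPAssumption μ W xc ψ k A hmax ∧
    ∀ hlo hhi : ℕ → ℝ, (∀ n, 0 < hlo n ∧ hlo n ≤ hhi n ∧ hhi n ≤ hmax) →
      Tendsto (fun n : ℕ => n * hlo n / Real.log (Real.log (hlo n)⁻¹) ^ 3) atTop atTop →
      InfluenceAssumption μ W xc est sig target ψ k hmax hlo hhi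

/-! ### Primitive conditions -/

/-- The running variable `X` has density `f`, with positive one-sided limits at `0`. -/
structure RunningVariable {Ω : Type*} [MeasurableSpace Ω] (μ : Measure Ω) (X : Ω → ℝ)
    (ell f : ℝ → ℝ) (fR fL : ℝ) : Prop where
  measurable : Measurable f
  nonneg : ∀ x, 0 ≤ f x
  density : μ.map X = volume.withDensity fun x => ENNReal.ofReal (f x)
  modulus : OneSidedModulus ell f fR fL
  pos_right : 0 < fR
  pos_left : 0 < fL

/-- Conditions for the sharp design; `yR`, `yL`, `vR`, `vL` are the one-sided limits at `0` of the
conditional mean and variance of `Y` given `X`. -/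
structure SharpConditions {Ω : Type*} [MeasurableSpace Ω] (μ : Measure Ω) (X Y : ℕ → Ω → ℝ)
    (ell f mY vY : ℝ → ℝ) (fR fL yR yL vR vL : ℝ) : Prop where
  iid : IsIID μ fun i ω => (X i ω, Y i ω)
  bounded : ∃ B, ∀ᵐ ω ∂μ, |Y 0 ω| ≤ B
  small : LogLogSmall ell
  running : RunningVariable μ (X 0) ell f fR fL
  mean_Y : IsCondMean μ (X 0) (Y 0) mY
  var_Y : IsCondCov μ (X 0) (Y 0) (Y 0) vY
  modulus_mean_Y : OneSidedModulus ell mY yR yL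
  modulus_var_Y : OneSidedModulus ell vY vR vL
  nondegenerate : vR ≠ 0 ∨ vL ≠ 0

/-- Conditions for the fuzzy design, with binary treatment `D`; `vYD (d, x)` is
`var(Y | D = d, X = x)`, and `dR`, `dL` are `P(D = 1 | X = 0+)` and `P(D = 1 | X = 0-)`. -/
structure FuzzyConditions {Ω : Type*} [MeasurableSpace Ω] (μ : Measure Ω) (X D Y : ℕ → Ω → ℝ)
    (ell f mY mD vY vD cDY : ℝ → ℝ) (vYD : ℝ × ℝ → ℝ) (fR fL dR dL : ℝ) : Prop where
  iid : IsIID μ fun i ω => (X i ω, D i ω, Y i ω)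
  binary : ∀ᵐ ω ∂μ, D 0 ω = 0 ∨ D 0 ω = 1
  bounded : ∃ B, ∀ᵐ ω ∂μ, |Y 0 ω| ≤ B
  small : LogLogSmall ell
  running : RunningVariable μ (X 0) ell f fR fL
  mean_Y : IsCondMean μ (X 0) (Y 0) mY
  mean_D : IsCondMean μ (X 0) (D 0) mD
  var_Y : IsCondCov μ (X 0) (Y 0) (Y 0) vY
  var_D : IsCondCov μ (X 0) (D 0) (D 0) vD
  cov_DY : IsCondCov μ (X 0) (D 0) (Y 0) cDY
  modulus_mean_Y : ∃ yR yL, OneSidedModulus ell mY yR yL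
  modulus_mean_D : OneSidedModulus ell mD dR dL
  modulus_var_Y : ∃ vR vL, OneSidedModulus ell vY vR vL
  modulus_var_D : ∃ vR vL, OneSidedModulus ell vD vR vL
  modulus_cov_DY : ∃ cR cL, OneSidedModulus ell cDY cR cL
  jump : dR - dL ≠ 0
  var_YD : IsCondCov μ (fun ω => (D 0 ω, X 0 ω)) (Y 0) (Y 0) vYD
  nondegenerate : ∃ s : ℝ, s ≠ 0 ∧
    ((Tendsto (fun x => vYD (1, x)) (𝓝[>] 0) (𝓝 s) ∧ 0 < dR) ∨
     (Tendsto (fun x => vYD (0, x)) (𝓝[>] 0) (𝓝 s) ∧ 0 < 1 - dR) ∨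
     (Tendsto (fun x => vYD (1, x)) (𝓝[<] 0) (𝓝 s) ∧ 0 < dL) ∨
     (Tendsto (fun x => vYD (0, x)) (𝓝[<] 0) (𝓝 s) ∧ 0 < 1 - dL))

end RDSnoop

end

/-! The studentized estimate is a smooth function of finitely many local averages: on each side of
the cutoff, averages of k(u) u^j V and k(u)² u^j V, where u = x / h and V is a product of the
features y, d, 1. The sharp design is the fuzzy one with d = 1{x ≥ 0}: then d jumps by exactly 1 and
has no residual on either side. Both designs are thus instances of `LocalModel`.

Write L = log log(1 / hlo) and δ = √(L / (n h)). Off an event of small probability, all local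
averages are within C δ of their expectations, simultaneously for all bandwidths
(`exists_bad_set_gram`). A kernel times a power is a difference of bounded antitone functions
(`AntiDiff`), and by the layer cake formula only half-lines matter for these. Half-lines are handled
by Bernstein's inequality on dyadic cells of [-T, T) and chaining (`exists_bad_set_of_scale`). Of
the order of log(1 / hlo) scales T are needed, and a union bound over them costs only an iterated
logarithm.

The linear term of the expansion is a score that vanishes in the population by the normal equations.
The remainder is a change of weights, O(δ), times a score, O(δ), so it is O(δ²)
(`studentized_expansion`). Multiplied by √(n h) √L it becomes L^{3/2} / √(n h), which explains the
third power in the rate condition.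

At every h the linear term is exactly centered with variance h, by the normal equations and the
definition of the sandwich. The influence function ψ is this term divided by the factor μ₂ - μ₁|u|
of the equivalent kernel. In the limit h → 0 the first row of the inverse Gram matrix is
proportional to (μ₂, ∓μ₁), so the factor cancels and ψ(·, 0) depends on x only through its side. The
factor may vanish at ±μ₂ / μ₁; as X has a density, almost surely at most one observation is affected
at each h, an error of order 1 / √(n h).

For fixed x the map h ↦ a(x / h) with a antitone is monotone in h, which reduces covering numbers to
nets in boundedly many real parameters (`exists_param_of_antitone`). Conditional moments given |X|
are density-weighted averages of those at x and -x (`IsCondMean.abs`). In the fuzzy design the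
residual variance is nonzero by the law of total variance (`condVar_lower_bound`). -/

set_option linter.unusedSectionVars false

namespace RDSnoop

/-! ### Differences of bounded antitone functions -/

/-- `φ` is a difference of two nonnegative bounded antitone functions. -/
def AntiDiff (φ : ℝ → ℝ) : Prop :=
  ∃ (a b : ℝ → ℝ) (K : ℝ), Antitone a ∧ Antitone b ∧ (∀ u, 0 ≤ a u ∧ a u ≤ K) ∧
    (∀ u, 0 ≤ b u ∧ b u ≤ K) ∧ ∀ u, φ u = a u - b u

namespace AntiDiff

theorem measurable {φ : ℝ → ℝ} (h : AntiDiff φ) : Measurable φ := by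
  obtain ⟨a, b, K, ha, hb, -, -, h⟩ := h
  have : φ = fun u => a u - b u := funext h
  rw [this]
  exact ha.measurable.sub hb.measurable

theorem bounded {φ : ℝ → ℝ} (h : AntiDiff φ) : ∃ K, 0 ≤ K ∧ ∀ u, |φ u| ≤ K := by
  obtain ⟨a, b, K, -, -, ha, hb, h⟩ := h
  refine ⟨K, (ha 0).1.trans (ha 0).2, fun u => ?_⟩
  rw [h, abs_le]
  constructor <;> linarith [ha u, hb u, (ha u).1, (ha u).2, (hb u).1, (hb u).2]

theorem of_antitone {φ : ℝ → ℝ} (hφ : Antitone φ) {K : ℝ} (hK : ∀ u, |φ u| ≤ K) :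
    AntiDiff φ := by
  refine ⟨fun u => φ u + K, fun _ => K, 2 * K, fun x y h => ?_, fun x y _ => le_rfl,
    fun u => ?_, fun u => ?_, fun u => by ring⟩
  · simpa using hφ h
  · have := abs_le.1 (hK u)
    constructor <;> linarith [this.1, this.2]
  · have := (abs_nonneg _).trans (hK u)
    constructor <;> linarith

theorem neg {φ : ℝ → ℝ} (h : AntiDiff φ) : AntiDiff fun u => -φ u := by
  obtain ⟨a, b, K, ha, hb, ha', hb', h⟩ := h
  exact ⟨b, a, K, hb, ha, hb', ha', fun u => by simp only [h]; ring⟩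

theorem of_monotone {φ : ℝ → ℝ} (hφ : Monotone φ) {K : ℝ} (hK : ∀ u, |φ u| ≤ K) :
    AntiDiff φ := by
  have : AntiDiff fun u => -φ u :=
    of_antitone (fun x y h => neg_le_neg (hφ h)) (K := K) (fun u => by simpa using hK u)
  simpa using this.neg

theorem const (c : ℝ) : AntiDiff fun _ => c :=
  of_antitone (fun _ _ _ => le_rfl) (K := |c|) fun _ => le_rfl

theorem add {φ χ : ℝ → ℝ} (h : AntiDiff φ) (h' : AntiDiff χ) : AntiDiff fun u => φ u + χ u := by
  obtain ⟨a, b, K, ha, hb, ha', hb', h⟩ := h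
  obtain ⟨c, d, L, hc, hd, hc', hd', h'⟩ := h'
  refine ⟨fun u => a u + c u, fun u => b u + d u, K + L, fun x y h => add_le_add (ha h) (hc h),
    fun x y h => add_le_add (hb h) (hd h), fun u => ?_, fun u => ?_,
    fun u => by simp only [h, h']; ring⟩
  · exact ⟨add_nonneg (ha' u).1 (hc' u).1, add_le_add (ha' u).2 (hc' u).2⟩
  · exact ⟨add_nonneg (hb' u).1 (hd' u).1, add_le_add (hb' u).2 (hd' u).2⟩

theorem sub {φ χ : ℝ → ℝ} (h : AntiDiff φ) (h' : AntiDiff χ) : AntiDiff fun u => φ u - χ u := by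
  simpa [sub_eq_add_neg] using h.add h'.neg

theorem mul {φ χ : ℝ → ℝ} (h : AntiDiff φ) (h' : AntiDiff χ) : AntiDiff fun u => φ u * χ u := by
  obtain ⟨a, b, K, ha, hb, ha', hb', h⟩ := h
  obtain ⟨c, d, L, hc, hd, hc', hd', h'⟩ := h'
  have hK : 0 ≤ K := (ha' 0).1.trans (ha' 0).2
  have hm : ∀ p q : ℝ → ℝ, Antitone p → Antitone q → (∀ u, 0 ≤ p u ∧ p u ≤ K) →
      (∀ u, 0 ≤ q u ∧ q u ≤ L) → Antitone (fun u => p u * q u) ∧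
      ∀ u, 0 ≤ p u * q u ∧ p u * q u ≤ K * L := fun p q hp hq hp' hq' =>
    ⟨fun x y hxy => mul_le_mul (hp hxy) (hq hxy) (hq' _).1 (hp' _).1, fun u =>
      ⟨mul_nonneg (hp' u).1 (hq' u).1, mul_le_mul (hp' u).2 (hq' u).2 (hq' u).1 hK⟩⟩
  have h1 := hm a c ha hc ha' hc'
  have h2 := hm b d hb hd hb' hd'
  have h3 := hm a d ha hd ha' hd'
  have h4 := hm b c hb hc hb' hc'
  refine ⟨fun u => a u * c u + b u * d u, fun u => a u * d u + b u * c u, K * L + K * L,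
    fun x y h => add_le_add (h1.1 h) (h2.1 h), fun x y h => add_le_add (h3.1 h) (h4.1 h),
    fun u => ?_, fun u => ?_, fun u => by simp only [h, h']; ring⟩
  · exact ⟨add_nonneg (h1.2 u).1 (h2.2 u).1, add_le_add (h1.2 u).2 (h2.2 u).2⟩
  · exact ⟨add_nonneg (h3.2 u).1 (h4.2 u).1, add_le_add (h3.2 u).2 (h4.2 u).2⟩

theorem pow {φ : ℝ → ℝ} (h : AntiDiff φ) (n : ℕ) : AntiDiff fun u => φ u ^ n := by
  induction n with
  | zero => simpa using const 1
  | succ n ih => simpa [pow_succ] using ih.mul h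

theorem comp_neg {φ : ℝ → ℝ} (h : AntiDiff φ) : AntiDiff fun u => φ (-u) := by
  obtain ⟨a, b, K, ha, hb, ha', hb', h⟩ := h
  refine ⟨fun u => K - b (-u), fun u => K - a (-u), K,
    fun x y h => sub_le_sub_left (hb (neg_le_neg h)) _,
    fun x y h => sub_le_sub_left (ha (neg_le_neg h)) _, fun u => ?_, fun u => ?_,
    fun u => by simp only [h]; ring⟩
  · constructor <;> linarith [(hb' (-u)).1, (hb' (-u)).2]
  · constructor <;> linarith [(ha' (-u)).1, (ha' (-u)).2]

theorem indicator_of_isLowerSet {s : Set ℝ} (hs : IsLowerSet s) :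
    AntiDiff (s.indicator fun _ => 1) := by
  classical
  refine of_antitone (K := 1) (fun x y h => ?_) (fun u => ?_)
  · by_cases hy : y ∈ s
    · simp [hy, hs h hy]
    · rw [Set.indicator_of_notMem hy]
      exact Set.indicator_nonneg (fun _ _ => zero_le_one) x
  · by_cases hu : u ∈ s <;> simp [hu]

theorem indicator_of_isUpperSet {s : Set ℝ} (hs : IsUpperSet s) :
    AntiDiff (s.indicator fun _ => 1) := by
  have : s.indicator (fun _ => (1 : ℝ)) = fun u => 1 - sᶜ.indicator (fun _ => 1) u := by
    funext u
    by_cases hu : u ∈ s <;> simp [hu]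
  rw [this]
  exact (const 1).sub (indicator_of_isLowerSet hs.compl)

theorem indicator {φ : ℝ → ℝ} {s : Set ℝ} (h : AntiDiff φ)
    (hs : AntiDiff (s.indicator fun _ => 1)) : AntiDiff (s.indicator φ) := by
  have : s.indicator φ = fun u => φ u * s.indicator (fun _ => 1) u := by
    funext u
    by_cases hu : u ∈ s <;> simp [hu]
  rw [this]
  exact h.mul hs

theorem indicator_compl {s : Set ℝ} (hs : AntiDiff (s.indicator fun _ => 1)) :
    AntiDiff (sᶜ.indicator fun _ => 1) := by
  have : sᶜ.indicator (fun _ => (1 : ℝ)) = fun u => 1 - s.indicator (fun _ => 1) u := by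
    funext u
    by_cases hu : u ∈ s <;> simp [hu]
  rw [this]
  exact (const 1).sub hs

theorem indicator_inter {s t : Set ℝ} (hs : AntiDiff (s.indicator fun _ => 1))
    (ht : AntiDiff (t.indicator fun _ => 1)) : AntiDiff ((s ∩ t).indicator fun _ => 1) := by
  have : (s ∩ t).indicator (fun _ => (1 : ℝ)) = s.indicator (t.indicator fun _ => 1) := by
    rw [Set.indicator_indicator]
  rw [this]
  exact ht.indicator hs

theorem indicator_singleton (c : ℝ) : AntiDiff (({c} : Set ℝ).indicator fun _ => 1) := by
  have := indicator_inter (indicator_of_isLowerSet (isLowerSet_Iic c))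
    (indicator_of_isUpperSet (isUpperSet_Ici c))
  rwa [Set.Iic_inter_Ici, Set.Icc_self] at this

/-- Adding L u + K to g on (0, A), and continuing by 0 to the left and by a large constant M to the
right, gives a monotone function on the line. The same continuation of the zero function is monotone
too, and the difference of the two is g cut off outside (0, A). -/
theorem of_lipschitzOn {g : ℝ → ℝ} {A K L : ℝ} (hL : 0 ≤ L) (hK : ∀ u ∈ Set.Ioo 0 A, |g u| ≤ K)
    (hg : ∀ u ∈ Set.Ioo 0 A, ∀ v ∈ Set.Ioo 0 A, |g u - g v| ≤ L * |u - v|) :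
    AntiDiff ((Set.Ioo 0 A).indicator g) := by
  classical
  rcases le_or_gt A 0 with hA | hA
  · rw [Set.Ioo_eq_empty (not_lt.2 hA)]
    simpa using const 0
  have hK0 : 0 ≤ K := (abs_nonneg _).trans (hK (A / 2) ⟨by linarith, by linarith⟩)
  set M := 2 * K + L * A with hM
  have hM0 : 0 ≤ M := by positivity
  have key : ∀ q : ℝ → ℝ, (∀ u ∈ Set.Ioo 0 A, |q u| ≤ K) →
      (∀ u ∈ Set.Ioo 0 A, ∀ v ∈ Set.Ioo 0 A, |q u - q v| ≤ L * |u - v|) →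
      AntiDiff fun u => if u ≤ 0 then 0 else if u < A then q u + L * u + K else M := by
    intro q hq hq'
    have hb : ∀ u, 0 < u → u < A → 0 ≤ q u + L * u + K ∧ q u + L * u + K ≤ M := fun u h0 h1 => by
      have := abs_le.1 (hq u ⟨h0, h1⟩)
      have h2 := mul_le_mul_of_nonneg_left h1.le hL
      have h3 := mul_nonneg hL h0.le
      constructor <;> linarith [this.1, this.2]
    refine of_monotone (K := M) (fun x y hxy => ?_) (fun u => ?_)
    · rcases le_or_gt x 0 with hx | hx
      · rw [if_pos hx]
        split_ifs with h1 h2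
        · exact le_rfl
        · exact (hb y (not_le.1 h1) h2).1
        · exact hM0
      · rw [if_neg (not_le.2 hx), if_neg (not_le.2 (hx.trans_le hxy))]
        split_ifs with h1 h2 h2
        · have := hq' x ⟨hx, h1⟩ y ⟨hx.trans_le hxy, h2⟩
          rw [abs_of_nonpos (sub_nonpos.2 hxy)] at this
          linarith [(abs_le.1 this).2]
        · exact (hb x hx h1).2
        · exact absurd (hxy.trans_lt h2) h1
        · exact le_rfl
    · split_ifs with h1 h2
      · simpa using hM0
      · rw [abs_of_nonneg (hb u (not_le.1 h1) h2).1]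
        exact (hb u (not_le.1 h1) h2).2
      · rw [abs_of_nonneg hM0]
  have := (key g hK hg).sub (key (fun _ => 0) (fun u _ => by simpa using hK0)
    (fun u _ v _ => by simpa using mul_nonneg hL (abs_nonneg _)))
  convert this using 1
  funext u
  by_cases h0 : 0 < u
  · by_cases h1 : u < A
    · rw [Set.indicator_of_mem (show u ∈ Set.Ioo 0 A from ⟨h0, h1⟩)]
      simp [not_le.2 h0, h1]
    · rw [Set.indicator_of_notMem (fun h => h1 h.2)]
      simp [not_le.2 h0, h1]
  · rw [Set.indicator_of_notMem (fun h => h0 h.1)]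
    simp [not_lt.1 h0]

end AntiDiff

/-- The bounded derivative makes k Lipschitz on (0, A), and symmetry transports this to (-A, 0). The
derivative says nothing about the points 0, A and -A, whose values enter as multiples of indicators
of points. -/
theorem KernelRegular.antiDiff {k : ℝ → ℝ} {A : ℝ} (hk : KernelRegular k A) : AntiDiff k := by
  obtain ⟨B, hB⟩ := hk.bounded
  obtain ⟨L, hL⟩ := hk.deriv_bounded
  have hA := hk.pos
  have hL0 : 0 ≤ L := (abs_nonneg _).trans (hL (A / 2) ⟨by linarith, by linarith⟩)
  have hlip : ∀ u ∈ Set.Ioo 0 A, ∀ v ∈ Set.Ioo 0 A, |k u - k v| ≤ L * |u - v| := by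
    intro u hu v hv
    have := (convex_Ioo (0 : ℝ) A).norm_image_sub_le_of_norm_deriv_le (f := k) (C := L)
      hk.differentiable (fun x hx => by simpa using hL x hx) hv hu
    simpa using this
  have h1 := AntiDiff.of_lipschitzOn hL0 (fun u _ => hB u) hlip
  have h2 := h1.comp_neg
  have hp : ∀ c : ℝ, AntiDiff fun u => k c * ({c} : Set ℝ).indicator (fun _ => 1) u := fun c =>
    (AntiDiff.const _).mul (AntiDiff.indicator_singleton c)
  convert (((h1.add h2).add (hp 0)).add (hp A)).add (hp (-A)) using 1
  funext u
  have hs : ∀ v, A < |v| → k v = 0 := fun v hv => by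
    by_contra h
    have := hk.support (Function.mem_support.2 h)
    exact not_lt.2 (abs_le.2 this) hv
  have e1 : (-A = 0) = False := by simp [hA.ne']
  rcases lt_trichotomy u 0 with h | h | h
  · have n0 : u ≠ 0 := h.ne
    have nA : u ≠ A := by linarith
    have g1 : u ∉ Set.Ioo 0 A := fun h' => by linarith [h'.1]
    rcases lt_trichotomy (-u) A with h' | h' | h'
    · have g2 : -u ∈ Set.Ioo 0 A := ⟨by linarith, h'⟩
      have : u ≠ -A := fun h'' => by linarith
      simp [g1, n0, nA, this, Set.indicator_of_mem g2, hk.symm]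
    · have g2 : -u ∉ Set.Ioo 0 A := fun h'' => by linarith [h''.2]
      have : u = -A := by linarith
      have h3 : -A ≠ A := by linarith
      simp [this, hA.ne', hk.symm, hA.le, h3]
    · have g2 : -u ∉ Set.Ioo 0 A := fun h'' => by linarith [h''.2]
      have h3 : u ≠ -A := fun h'' => by linarith
      rw [hs u (by rw [abs_of_neg h]; exact h')]
      simp [g1, g2, n0, nA, h3]
  · subst h
    simp [hA.ne, hA.ne']
  · have n0 : u ≠ 0 := h.ne'
    have nA : u ≠ -A := by linarith
    have g1 : -u ∉ Set.Ioo 0 A := fun h' => by linarith [h'.1]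
    rcases lt_trichotomy u A with h' | h' | h'
    · have g2 : u ∈ Set.Ioo 0 A := ⟨h, h'⟩
      simp [g1, n0, nA, h'.ne, Set.indicator_of_mem g2]
    · subst h'
      simp [n0, nA, h.le]
    · have g2 : u ∉ Set.Ioo 0 A := fun h'' => by linarith [h''.2]
      rw [hs u (by rw [abs_of_pos h]; exact h')]
      simp [g1, g2, n0, nA, h'.ne']

/-- Multiplication by a power of the argument is harmless for functions of compact support. -/
theorem AntiDiff.mul_pow_self {φ : ℝ → ℝ} {A : ℝ} (hφ : AntiDiff φ)
    (hA : ∀ u, A < |u| → φ u = 0) (n : ℕ) : AntiDiff fun u => φ u * u ^ n := by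
  -- The argument truncated to [-|A|, |A|] is bounded and monotone, and equals u wherever φ is
  -- nonzero.
  have h1 : AntiDiff fun u : ℝ => max (-|A|) (min u |A|) := by
    refine AntiDiff.of_monotone (K := |A|) (fun x y h => ?_) (fun u => ?_)
    · exact max_le_max le_rfl (min_le_min h le_rfl)
    · rw [abs_le]
      exact ⟨le_max_left _ _, max_le (by linarith [abs_nonneg A]) (min_le_right _ _)⟩
  convert hφ.mul (h1.pow n) using 1
  funext u
  by_cases h : A < |u|
  · simp [hA u h]
  · have h2 := abs_le.1 ((not_lt.1 h).trans (le_abs_self A))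
    rw [min_eq_left h2.2, max_eq_right h2.1]


/-! ### Polynomial uniform covering numbers -/

/-- The integer parts of `Θ h m / η` take boundedly many values, and points with the same integer
parts are within η of each other. Keeping one element of `H` for each vector that occurs gives a net
inside `H`. -/
theorem exists_finset_net {α κ : Type*} [Fintype κ] (H : Set α) (Θ : α → κ → ℝ) {K η : ℝ}
    (hη : 0 < η) (hΘ : ∀ h ∈ H, ∀ m, |Θ h m| ≤ K) :
    ∃ T : Finset α, (T : Set α) ⊆ H ∧ (T.card : ℝ) ≤ (2 * |K| / η + 3) ^ Fintype.card κ ∧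
      ∀ h ∈ H, ∃ t ∈ T, ∀ m, |Θ h m - Θ t m| ≤ η := by
  classical
  let b : α → κ → ℤ := fun h m => ⌊Θ h m / η⌋
  let N : ℤ := ⌈|K| / η⌉
  let B : Finset (κ → ℤ) := Fintype.piFinset fun _ => Finset.Icc (-N) N
  have hbB : ∀ h ∈ H, b h ∈ B := by
    intro h hh
    rw [Fintype.mem_piFinset]
    intro m
    have h1 := abs_le.1 ((hΘ h hh m).trans (le_abs_self K))
    have h2 : |K| / η ≤ N := Int.le_ceil _
    rw [Finset.mem_Icc]
    constructor
    · refine Int.le_floor.2 ?_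
      push_cast
      have : -(|K| / η) ≤ Θ h m / η := by rw [← neg_div]; gcongr; exact h1.1
      linarith
    · have : Θ h m / η ≤ |K| / η := by gcongr; exact h1.2
      have h3 : ((⌊Θ h m / η⌋ : ℤ) : ℝ) ≤ N := (Int.floor_le _).trans (this.trans h2)
      exact_mod_cast h3
  let B' := B.filter fun c => ∃ h ∈ H, b h = c
  rcases H.eq_empty_or_nonempty with hH | ⟨h0, -⟩
  · exact ⟨∅, by simp, by simp; positivity, by simp [hH]⟩
  have : Nonempty α := ⟨h0⟩
  have hB' : ∀ c ∈ B', ∃ h ∈ H, b h = c := fun c hc => (Finset.mem_filter.1 hc).2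
  choose! r hr using hB'
  refine ⟨B'.image r, ?_, ?_, ?_⟩
  · intro x hx
    obtain ⟨c, hc, rfl⟩ := Finset.mem_image.1 (Finset.mem_coe.1 hx)
    exact (hr c hc).1
  · have h1 : (B'.image r).card ≤ B.card :=
      Finset.card_image_le.trans (Finset.card_filter_le _ _)
    have h2 : B.card = (2 * N + 1).toNat ^ Fintype.card κ := by
      simp only [B, Fintype.card_piFinset, Int.card_Icc, Finset.prod_const, Finset.card_univ]
      congr 2
      ring
    have hN0 : 0 ≤ N := Int.ceil_nonneg (by positivity)
    have h3 : (((2 * N + 1).toNat : ℕ) : ℝ) = 2 * N + 1 := by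
      have : (((2 * N + 1).toNat : ℕ) : ℤ) = 2 * N + 1 := Int.toNat_of_nonneg (by omega)
      exact_mod_cast this
    have h4 : (N : ℝ) ≤ |K| / η + 1 := (Int.ceil_lt_add_one _).le
    calc ((B'.image r).card : ℝ) ≤ B.card := by exact_mod_cast h1
      _ = (2 * N + 1) ^ Fintype.card κ := by rw [h2, Nat.cast_pow, h3]
      _ ≤ _ := by
        refine pow_le_pow_left₀ (by positivity) ?_ _
        rw [mul_div_assoc]; linarith
  · intro h hh
    have hm : b h ∈ B' := Finset.mem_filter.2 ⟨hbB h hh, h, hh, rfl⟩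
    refine ⟨r (b h), Finset.mem_image_of_mem _ hm, fun m => ?_⟩
    have h1 : ⌊Θ (r (b h)) m / η⌋ = ⌊Θ h m / η⌋ := congrFun (hr _ hm).2 m
    have h2 := Int.abs_sub_lt_one_of_floor_eq_floor h1.symm
    rw [← sub_div, abs_div, abs_of_pos hη, div_lt_one hη] at h2
    exact h2.le

theorem eLpNorm_two_le_of_integral_sq_le {α : Type*} [MeasurableSpace α] {Q : Measure α}
    {g : α → ℝ} (hg : MemLp g 2 Q) {ε : ℝ} (hε : 0 ≤ ε) (h : ∫ z, g z ^ 2 ∂Q ≤ ε ^ 2) :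
    eLpNorm g 2 Q ≤ ENNReal.ofReal ε := by
  rw [hg.eLpNorm_eq_integral_rpow_norm (by norm_num) (by norm_num)]
  refine ENNReal.ofReal_le_ofReal ?_
  have : ∀ z, ‖g z‖ ^ (ENNReal.toReal 2) = g z ^ 2 := fun z => by simp
  simp only [this]
  rw [ENNReal.toReal_ofNat, ← one_div, ← Real.sqrt_eq_rpow]
  exact Real.sqrt_le_iff.2 ⟨hε, h⟩

/-- If an ℓ¹ distance of parameters bounds the squared L²(Q) distance, a grid of mesh of order ε² is
an ε-net. The parametrization may depend on Q; its dimension and its bound K may not, and these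
determine the constants of the covering number. -/
theorem polyUniformCovering_of_param {𝒵 κ : Type*} [MeasurableSpace 𝒵] [Fintype κ] [Nonempty κ]
    (H : Set ℝ) (g : ℝ → 𝒵 → ℝ) (K : ℝ)
    (hg : ∀ Q : Measure 𝒵, IsProbabilityMeasure Q → ∀ h ∈ H, MemLp (g h) 2 Q)
    (hΘ : ∀ Q : Measure 𝒵, IsProbabilityMeasure Q → ∃ Θ : ℝ → κ → ℝ,
      (∀ h ∈ H, ∀ m, |Θ h m| ≤ K) ∧ ∀ h ∈ H, ∀ h' ∈ H,
        ∫ z, (g h z - g h' z) ^ 2 ∂Q ≤ K * ∑ m, |Θ h m - Θ h' m|) :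
    PolyUniformCovering (g '' H) := by
  classical
  set N := Fintype.card κ with hN
  have hN0 : 0 < N := Fintype.card_pos
  set L := |K| + 1 with hL
  have hL1 : 1 ≤ L := by rw [hL]; linarith [abs_nonneg K]
  refine ⟨(2 * L * (L * N) + 3) ^ N, 2 * N, by positivity, by positivity, ?_⟩
  intro Q hQ ε hε hε1
  obtain ⟨Θ, hΘ1, hΘ2⟩ := hΘ Q hQ
  have hη : 0 < ε ^ 2 / (L * N) := by positivity
  obtain ⟨T, hTH, hTc, hT⟩ := exists_finset_net H Θ hη hΘ1
  refine ⟨T.image g, ?_, ?_, ?_⟩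
  · rw [Finset.coe_image]
    exact Set.image_mono hTH
  · have h1 : ((T.image g).card : ℝ) ≤ T.card := by exact_mod_cast Finset.card_image_le
    refine h1.trans (hTc.trans ?_)
    have h2 : ε ^ (-(2 * (N : ℝ))) = ((ε ^ 2)⁻¹) ^ N := by
      rw [Real.rpow_neg hε.le, inv_pow, ← pow_mul]
      congr 1
      rw [← Real.rpow_natCast]
      push_cast
      rfl
    rw [h2, ← mul_pow]
    refine pow_le_pow_left₀ (by positivity) ?_ _
    have h3 : 1 ≤ (ε ^ 2)⁻¹ := (one_le_inv₀ (by positivity)).2 (by nlinarith)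
    have h4 : 2 * |K| / (ε ^ 2 / (L * N)) = 2 * |K| * (L * N) * (ε ^ 2)⁻¹ := by
      field_simp
    rw [h4, add_mul (2 * L * (L * (N : ℝ))) 3]
    refine add_le_add ?_ (le_mul_of_one_le_right zero_le_three h3)
    gcongr
    rw [hL]; linarith
  · rintro _ ⟨h, hh, rfl⟩
    obtain ⟨t, ht, htm⟩ := hT h hh
    refine ⟨g t, Finset.mem_image_of_mem _ ht, ?_⟩
    refine eLpNorm_two_le_of_integral_sq_le ((hg Q hQ h hh).sub (hg Q hQ t (hTH ht))) hε.le ?_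
    refine (hΘ2 h hh t (hTH ht)).trans ?_
    have h5 : ∑ m, |Θ h m - Θ t m| ≤ N * (ε ^ 2 / (L * N)) := by
      refine (Finset.sum_le_sum fun m _ => htm m).trans ?_
      simp [hN]
    have h6 : 0 ≤ ∑ m, |Θ h m - Θ t m| := Finset.sum_nonneg fun _ _ => abs_nonneg _
    calc K * ∑ m, |Θ h m - Θ t m| ≤ L * (N * (ε ^ 2 / (L * N))) :=
          mul_le_mul (by rw [hL]; linarith [le_abs_self K]) h5 h6 (by positivity)
      _ = ε ^ 2 := by field_simp

/-- The map h ↦ a(x / h) is increasing for x > 0 and decreasing for x ≤ 0. On each of these two sets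
the difference at two bandwidths has a constant sign, so its L¹(Q) norm is a difference of two
integrals; these integrals are the parameters P and N. -/
theorem exists_param_of_antitone {𝒵 : Type*} [MeasurableSpace 𝒵] (Q : Measure 𝒵)
    [IsProbabilityMeasure Q] {x : 𝒵 → ℝ} (hx : Measurable x) {a : ℝ → ℝ} (ha : Antitone a) {K : ℝ}
    (hK : ∀ u, 0 ≤ a u ∧ a u ≤ K) :
    ∃ P N : ℝ → ℝ, (∀ h, |P h| ≤ K) ∧ (∀ h, |N h| ≤ K) ∧ ∀ h, 0 < h → ∀ h', 0 < h' →
      ∫ z, |a (x z / h) - a (x z / h')| ∂Q ≤ |P h - P h'| + |N h - N h'| := by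
  classical
  set S : Set 𝒵 := {z | 0 < x z} with hS
  have hSm : MeasurableSet S := measurableSet_lt measurable_const hx
  have hm : ∀ h, Measurable fun z => a (x z / h) := fun h =>
    ha.measurable.comp (hx.div_const h)
  have hi : ∀ h, Integrable (fun z => a (x z / h)) Q := fun h =>
    Integrable.of_bound (hm h).aestronglyMeasurable K
      (ae_of_all _ fun z => by rw [Real.norm_eq_abs, abs_of_nonneg (hK _).1]; exact (hK _).2)
  have hb : ∀ (s : Set 𝒵), MeasurableSet s → ∀ h, |∫ z in s, a (x z / h) ∂Q| ≤ K := by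
    intro s hs h
    have h1 : 0 ≤ ∫ z in s, a (x z / h) ∂Q := integral_nonneg fun z => (hK _).1
    rw [abs_of_nonneg h1]
    calc ∫ z in s, a (x z / h) ∂Q ≤ ∫ z, a (x z / h) ∂Q :=
          setIntegral_le_integral (hi h) (ae_of_all _ fun z => (hK _).1)
      _ ≤ ∫ _, K ∂Q := integral_mono (hi h) (integrable_const _) fun z => (hK _).2
      _ = K := by simp
  refine ⟨fun h => ∫ z in S, a (x z / h) ∂Q, fun h => ∫ z in Sᶜ, a (x z / h) ∂Q, hb S hSm,
    hb _ hSm.compl, ?_⟩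
  have key : ∀ h, 0 < h → ∀ h', h ≤ h' →
      ∫ z, |a (x z / h) - a (x z / h')| ∂Q ≤
        |(∫ z in S, a (x z / h) ∂Q) - ∫ z in S, a (x z / h') ∂Q| +
        |(∫ z in Sᶜ, a (x z / h) ∂Q) - ∫ z in Sᶜ, a (x z / h') ∂Q| := by
    intro h h0 h' hh
    have h0' := h0.trans_le hh
    have hi' : Integrable (fun z => |a (x z / h) - a (x z / h')|) Q := ((hi h).sub (hi h')).abs
    rw [← integral_add_compl hSm hi']
    refine add_le_add ?_ ?_
    · rw [abs_sub_comm, ← integral_sub (hi h').integrableOn (hi h).integrableOn]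
      refine le_trans (le_of_eq ?_) (le_abs_self _)
      refine setIntegral_congr_fun hSm fun z hz => ?_
      have : a (x z / h) ≤ a (x z / h') := ha (div_le_div_of_nonneg_left (le_of_lt hz) h0 hh)
      rw [abs_of_nonpos (by linarith)]; ring
    · rw [← integral_sub (hi h).integrableOn (hi h').integrableOn]
      refine le_trans (le_of_eq ?_) (le_abs_self _)
      refine setIntegral_congr_fun hSm.compl fun z hz => ?_
      have hz' : x z ≤ 0 := not_lt.1 hz
      have : a (x z / h') ≤ a (x z / h) := by
        refine ha ?_
        rw [div_le_div_iff₀ h0 h0']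
        nlinarith
      rw [abs_of_nonneg (by linarith)]
  intro h h0 h' h0'
  rcases le_total h h' with hh | hh
  · exact key h h0 h' hh
  · have := key h' h0' h hh
    simp only [abs_sub_comm (a (x _ / h')), abs_sub_comm (∫ z in S, a (x z / h') ∂Q),
      abs_sub_comm (∫ z in Sᶜ, a (x z / h') ∂Q)] at this
    exact this

/-- Each term gets five parameters: its coefficient and the pairs (P, N) of the two antitone parts
of `φ i`. As all functions are bounded, the squared L² distance is at most a constant times the L¹
distance, which these parameters control. -/
theorem polyUniformCovering_sum {𝒵 ι : Type*} [MeasurableSpace 𝒵] [Fintype ι] [Nonempty ι]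
    {H : Set ℝ} (hH : ∀ h ∈ H, 0 < h) {x : 𝒵 → ℝ} (hx : Measurable x) {φ : ι → ℝ → ℝ}
    (hφ : ∀ i, AntiDiff (φ i)) {V : ι → 𝒵 → ℝ} (hV : ∀ i, Measurable (V i)) {K : ℝ}
    (hVK : ∀ i z, |V i z| ≤ K) (c : ℝ → ι → ℝ) (hc : ∀ h ∈ H, ∀ i, |c h i| ≤ K) :
    PolyUniformCovering ((fun (h : ℝ) (z : 𝒵) => ∑ i, c h i * φ i (x z / h) * V i z) '' H) := by
  classical
  choose a b L ha hb haL hbL hab using hφ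
  obtain ⟨M, hM1, hKM, hLM⟩ : ∃ M : ℝ, 1 ≤ M ∧ |K| ≤ M ∧ ∀ i, L i ≤ M := by
    refine ⟨1 + |K| + ∑ i, |L i|, ?_, ?_, fun i => ?_⟩
    · have : 0 ≤ ∑ i, |L i| := Finset.sum_nonneg fun _ _ => abs_nonneg _
      linarith [abs_nonneg K]
    · have : 0 ≤ ∑ i, |L i| := Finset.sum_nonneg fun _ _ => abs_nonneg _
      linarith
    · have : |L i| ≤ ∑ i, |L i| :=
        Finset.single_le_sum (f := fun i => |L i|) (fun _ _ => abs_nonneg _) (Finset.mem_univ i)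
      linarith [abs_nonneg K, le_abs_self (L i)]
  have hM0 : 0 ≤ M := by linarith
  have haM : ∀ i u, 0 ≤ a i u ∧ a i u ≤ M := fun i u => ⟨(haL i u).1, (haL i u).2.trans (hLM i)⟩
  have hbM : ∀ i u, 0 ≤ b i u ∧ b i u ≤ M := fun i u => ⟨(hbL i u).1, (hbL i u).2.trans (hLM i)⟩
  have hφM : ∀ i u, |φ i u| ≤ M := fun i u => by
    rw [hab, abs_le]
    constructor <;> linarith [(haM i u).1, (haM i u).2, (hbM i u).1, (hbM i u).2]
  have hVM : ∀ i z, |V i z| ≤ M := fun i z => (hVK i z).trans ((le_abs_self K).trans hKM)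
  have hcM : ∀ h ∈ H, ∀ i, |c h i| ≤ M := fun h hh i => (hc h hh i).trans ((le_abs_self K).trans hKM)
  have hφm : ∀ i, Measurable (φ i) := fun i => by
    rw [show φ i = fun u => a i u - b i u from funext (hab i)]
    exact (ha i).measurable.sub (hb i).measurable
  set n : ℝ := (Fintype.card ι : ℝ) with hn
  have hn0 : 0 ≤ n := Nat.cast_nonneg _
  have hgm : ∀ h, Measurable fun z : 𝒵 => ∑ i, c h i * φ i (x z / h) * V i z := fun h =>
    Finset.measurable_sum _ fun i _ =>
      (((hφm i).comp (hx.div_const h)).const_mul _).mul (hV i)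
  have hgb : ∀ h ∈ H, ∀ z, |∑ i, c h i * φ i (x z / h) * V i z| ≤ n * M ^ 3 := by
    intro h hh z
    refine (Finset.abs_sum_le_sum_abs _ _).trans ?_
    refine (Finset.sum_le_card_nsmul _ _ (M ^ 3) fun i _ => ?_).trans (by simp [hn])
    rw [abs_mul, abs_mul, pow_succ, pow_two]
    exact mul_le_mul (mul_le_mul (hcM h hh i) (hφM i _) (abs_nonneg _) hM0) (hVM i z)
      (abs_nonneg _) (by positivity)
  have hLp : ∀ Q : Measure 𝒵, IsProbabilityMeasure Q → ∀ h ∈ H, ∀ p,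
      MemLp (fun z => ∑ i, c h i * φ i (x z / h) * V i z) p Q := fun Q hQ h hh p =>
    MemLp.of_bound (hgm h).aestronglyMeasurable (n * M ^ 3) (ae_of_all _ (hgb h hh))
  set K' : ℝ := max M (2 * n * M ^ 3 * M ^ 2) with hK'
  refine polyUniformCovering_of_param (κ := ι × Fin 5) H _ K' (fun Q hQ h hh => hLp Q hQ h hh 2) ?_
  intro Q hQ
  choose Pa Na hPa hNa hPNa using fun i => exists_param_of_antitone Q hx (ha i) (haM i)
  choose Pb Nb hPb hNb hPNb using fun i => exists_param_of_antitone Q hx (hb i) (hbM i)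
  refine ⟨fun h m => ![c h m.1, Pa m.1 h, Na m.1 h, Pb m.1 h, Nb m.1 h] m.2, ?_, ?_⟩
  · rintro h hh ⟨i, m⟩
    refine le_trans ?_ (le_max_left _ _)
    fin_cases m
    · exact hcM h hh i
    · exact hPa i h
    · exact hNa i h
    · exact hPb i h
    · exact hNb i h
  · intro h hh h' hh'
    have hint : ∀ (q : ι → ℝ → ℝ), (∀ i, Antitone (q i)) → (∀ i u, 0 ≤ q i u ∧ q i u ≤ M) → ∀ i,
        Integrable (fun z => |q i (x z / h) - q i (x z / h')|) Q := by
      intro q hq hqM i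
      refine Integrable.of_bound ?_ M (ae_of_all _ fun z => ?_)
      · exact (((hq i).measurable.comp (hx.div_const h)).sub
          ((hq i).measurable.comp (hx.div_const h'))).abs.aestronglyMeasurable
      · rw [Real.norm_eq_abs, abs_abs, abs_le]
        constructor <;> linarith [(hqM i (x z / h)).1, (hqM i (x z / h)).2,
          (hqM i (x z / h')).1, (hqM i (x z / h')).2]
    have hpt : ∀ z, (∑ i, c h i * φ i (x z / h) * V i z -
        ∑ i, c h' i * φ i (x z / h') * V i z) ^ 2 ≤ 2 * n * M ^ 3 * (M ^ 2 * ∑ i,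
          (|c h i - c h' i| + |a i (x z / h) - a i (x z / h')| +
            |b i (x z / h) - b i (x z / h')|)) := by
      intro z
      rw [← sq_abs, pow_two]
      refine mul_le_mul ?_ ?_ (abs_nonneg _) (by positivity)
      · refine (abs_sub _ _).trans ?_
        linarith [hgb h hh z, hgb h' hh' z]
      · rw [← Finset.sum_sub_distrib, Finset.mul_sum]
        refine (Finset.abs_sum_le_sum_abs _ _).trans (Finset.sum_le_sum fun i _ => ?_)
        have e : c h i * φ i (x z / h) * V i z - c h' i * φ i (x z / h') * V i z =
            ((c h i - c h' i) * φ i (x z / h) + c h' i * (φ i (x z / h) - φ i (x z / h'))) *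
              V i z := by ring
        have e2 : |φ i (x z / h) - φ i (x z / h')| ≤ |a i (x z / h) - a i (x z / h')| +
            |b i (x z / h) - b i (x z / h')| := by
          rw [hab, hab]
          refine le_trans (le_of_eq ?_) (abs_sub _ _)
          congr 1; ring
        rw [e, abs_mul, mul_comm]
        have e3 : |(c h i - c h' i) * φ i (x z / h) + c h' i * (φ i (x z / h) - φ i (x z / h'))| ≤
            M * (|c h i - c h' i| + |a i (x z / h) - a i (x z / h')| +
            |b i (x z / h) - b i (x z / h')|) := by
          refine (abs_add_le _ _).trans ?_
          rw [abs_mul, abs_mul]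
          have f1 := mul_le_mul_of_nonneg_left (hφM i (x z / h)) (abs_nonneg (c h i - c h' i))
          have f2 := mul_le_mul (hcM h' hh' i) e2 (abs_nonneg _) hM0
          linarith
        calc _ ≤ M * (M * (|c h i - c h' i| + |a i (x z / h) - a i (x z / h')| +
            |b i (x z / h) - b i (x z / h')|)) := mul_le_mul (hVM i z) e3 (abs_nonneg _) hM0
          _ = _ := by ring
    have hterm : ∀ i, Integrable (fun z => |c h i - c h' i| + |a i (x z / h) - a i (x z / h')| +
        |b i (x z / h) - b i (x z / h')|) Q := fun i =>
      ((integrable_const _).add (hint a ha haM i)).add (hint b hb hbM i)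
    have hval : ∀ i, ∫ z, (|c h i - c h' i| + |a i (x z / h) - a i (x z / h')| +
        |b i (x z / h) - b i (x z / h')|) ∂Q = |c h i - c h' i| +
        ∫ z, |a i (x z / h) - a i (x z / h')| ∂Q + ∫ z, |b i (x z / h) - b i (x z / h')| ∂Q := by
      intro i
      have h2 : Integrable (fun z => |c h i - c h' i| + |a i (x z / h) - a i (x z / h')|) Q :=
        (integrable_const _).add (hint a ha haM i)
      rw [integral_add h2 (hint b hb hbM i), integral_add (integrable_const _) (hint a ha haM i)]
      simp
    have hsum := integrable_finsetSum Finset.univ fun i _ => hterm i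
    have hsq : Integrable (fun z => (∑ i, c h i * φ i (x z / h) * V i z -
        ∑ i, c h' i * φ i (x z / h') * V i z) ^ 2) Q :=
      ((hLp Q hQ h hh 2).sub (hLp Q hQ h' hh' 2)).integrable_sq
    refine (integral_mono hsq ((hsum.const_mul _).const_mul _) hpt).trans ?_
    rw [integral_const_mul, integral_const_mul, ← mul_assoc]
    refine mul_le_mul (le_max_right _ _) ?_ (integral_nonneg fun z => by positivity)
      (hM0.trans (le_max_left _ _))
    rw [integral_finsetSum _ fun i _ => hterm i, Fintype.sum_prod_type]
    refine Finset.sum_le_sum fun i _ => ?_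
    rw [hval]
    simp only [Fin.sum_univ_five]
    have g1 := hPNa i h (hH h hh) h' (hH h' hh')
    have g2 := hPNb i h (hH h hh) h' (hH h' hh')
    simp only [Matrix.cons_val]
    linarith


/-! ### Discrepancy of two measures on lower sets -/

/-- By the layer cake formula: superlevel sets of an antitone function are lower sets. One bound for
half-lines thus serves all antitone functions at once. -/
theorem abs_integral_sub_le_of_isLowerSet {ν₁ ν₂ : Measure ℝ} [IsFiniteMeasure ν₁]
    [IsFiniteMeasure ν₂] {M : ℝ} (hM : ∀ I, IsLowerSet I → |ν₁.real I - ν₂.real I| ≤ M)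
    {a : ℝ → ℝ} (ha : Antitone a) {K : ℝ} (hK : ∀ u, 0 ≤ a u ∧ a u ≤ K) :
    |∫ u, a u ∂ν₁ - ∫ u, a u ∂ν₂| ≤ K * M := by
  have hK0 : 0 ≤ K := (hK 0).1.trans (hK 0).2
  have hi : ∀ ν : Measure ℝ, IsFiniteMeasure ν → Integrable a ν := fun ν _ =>
    Integrable.of_bound ha.measurable.aestronglyMeasurable K
      (ae_of_all _ fun u => by rw [Real.norm_eq_abs, abs_of_nonneg (hK u).1]; exact (hK u).2)
  have hl : ∀ ν : Measure ℝ, IsFiniteMeasure ν →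
      ∫ u, a u ∂ν = ∫ t in Set.Ioc 0 K, ν.real {u | t ≤ a u} := fun ν hν =>
    (hi ν hν).integral_eq_integral_Ioc_meas_le (ae_of_all _ fun u => (hK u).1)
      (ae_of_all _ fun u => (hK u).2)
  have hi2 : ∀ ν : Measure ℝ, IsFiniteMeasure ν →
      IntegrableOn (fun t => ν.real {u | t ≤ a u}) (Set.Ioc 0 K) := by
    intro ν hν
    refine AntitoneOn.integrableOn_isCompact isCompact_Icc (fun s _ t _ hst => ?_) |>.mono_set
      Set.Ioc_subset_Icc_self
    exact measureReal_mono (fun u hu => le_trans hst hu)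
  rw [hl ν₁ inferInstance, hl ν₂ inferInstance, ← integral_sub (hi2 _ inferInstance)
    (hi2 _ inferInstance), ← Real.norm_eq_abs]
  have := norm_setIntegral_le_of_norm_le_const (μ := volume) (s := Set.Ioc 0 K)
    (f := fun t => ν₁.real {u | t ≤ a u} - ν₂.real {u | t ≤ a u}) (C := M) (by simp)
    (fun t _ => hM _ fun u v huv hu => le_trans hu (ha huv))
  refine this.trans (le_of_eq ?_)
  simp [hK0, mul_comm]

/-- The dyadic grid point number `m` of level `l` of `[-T, T]`. -/
noncomputable def gridPoint (T : ℝ) (l m : ℕ) : ℝ := -T + 2 * T * m / 2 ^ l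

/-- The dyadic cell number `m` of level `l` of `[-T, T]`. -/
def gridCell (T : ℝ) (l m : ℕ) : Set ℝ := Set.Ico (gridPoint T l m) (gridPoint T l (m + 1))

theorem gridPoint_mono {T : ℝ} (hT : 0 ≤ T) (l m : ℕ) :
    gridPoint T l m ≤ gridPoint T l (m + 1) := by
  unfold gridPoint
  push_cast
  gcongr
  linarith

theorem measurableSet_gridCell (T : ℝ) (l m : ℕ) : MeasurableSet (gridCell T l m) :=
  measurableSet_Ico

theorem measureReal_Iio_gridPoint_succ {T : ℝ} (hT : 0 ≤ T) (ν : Measure ℝ) [IsFiniteMeasure ν]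
    (l m : ℕ) : ν.real (Set.Iio (gridPoint T l (m + 1))) =
      ν.real (Set.Iio (gridPoint T l m)) + ν.real (gridCell T l m) := by
  rw [← measureReal_union _ (measurableSet_gridCell T l m), gridCell,
    Set.Iio_union_Ico_eq_Iio (gridPoint_mono hT l m)]
  rw [Set.disjoint_left]
  exact fun x hx hx' => not_lt.2 hx'.1 hx

/-- Chaining: an even grid point of level l + 1 is a grid point of level l, and an odd one is
reached from an even one by adding a single cell. Each level costs the discrepancy of at most one
cell. -/
theorem abs_measureReal_Iio_gridPoint_sub_le {T : ℝ} (hT : 0 ≤ T) {ν₁ ν₂ : Measure ℝ}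
    [IsFiniteMeasure ν₁] [IsFiniteMeasure ν₂] (h₁ : ν₁ (Set.Iio (-T)) = 0)
    (h₂ : ν₂ (Set.Iio (-T)) = 0) {y : ℕ → ℝ} {L : ℕ} (hy : ∀ l ≤ L, 0 ≤ y l)
    (hc : ∀ l ≤ L, ∀ m < 2 ^ l, |ν₁.real (gridCell T l m) - ν₂.real (gridCell T l m)| ≤ y l)
    (l : ℕ) (hl : l ≤ L) (m : ℕ) (hm : m ≤ 2 ^ l) :
    |ν₁.real (Set.Iio (gridPoint T l m)) - ν₂.real (Set.Iio (gridPoint T l m))| ≤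
      ∑ j ∈ Finset.range (l + 1), y j := by
  have h0 : ∀ ν : Measure ℝ, ν (Set.Iio (-T)) = 0 → ∀ l,
      ν.real (Set.Iio (gridPoint T l 0)) = 0 := fun ν hν l => by
    simp [gridPoint, Measure.real, hν]
  have hstep : ∀ l m, ν₁.real (Set.Iio (gridPoint T l (m + 1))) -
      ν₂.real (Set.Iio (gridPoint T l (m + 1))) = (ν₁.real (Set.Iio (gridPoint T l m)) -
      ν₂.real (Set.Iio (gridPoint T l m))) +
        (ν₁.real (gridCell T l m) - ν₂.real (gridCell T l m)) := fun l m => by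
    rw [measureReal_Iio_gridPoint_succ hT, measureReal_Iio_gridPoint_succ hT]
    ring
  have hdouble : ∀ l k, gridPoint T (l + 1) (2 * k) = gridPoint T l k := fun l k => by
    unfold gridPoint
    push_cast
    rw [pow_succ]
    field_simp
  induction l generalizing m with
  | zero =>
    rw [Finset.sum_range_one]
    have hm' : m = 0 ∨ m = 1 := by rw [pow_zero] at hm; omega
    rcases hm' with rfl | rfl
    · rw [h0 _ h₁, h0 _ h₂]
      simpa using hy 0 hl
    · rw [hstep, h0 _ h₁, h0 _ h₂]
      simpa using hc 0 hl 0 (by norm_num)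
  | succ l ih =>
    rw [Finset.sum_range_succ]
    obtain ⟨k, hk | hk⟩ := m.even_or_odd'
    · subst hk
      rw [hdouble]
      have := ih (by omega) k (by rw [pow_succ] at hm; omega)
      linarith [hy (l + 1) hl]
    · subst hk
      rw [hstep, hdouble]
      have h1 := ih (by omega) k (by rw [pow_succ] at hm; omega)
      have h2 := hc (l + 1) hl (2 * k) (by rw [pow_succ] at hm ⊢; omega)
      exact (abs_add_le _ _).trans (add_le_add h1 h2)

/-- Apart from the degenerate cases beyond the ends of the grid, a lower set lies between half-lines
ending at consecutive points of the finest grid. Its discrepancy exceeds that of the endpoints by at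
most the ν₂-mass of one finest cell. -/
theorem abs_measureReal_sub_le_of_gridCell {T : ℝ} (hT : 0 ≤ T) {ν₁ ν₂ : Measure ℝ}
    [IsFiniteMeasure ν₁] [IsFiniteMeasure ν₂] (h₁ : ν₁ (Set.Iio (-T)) = 0)
    (h₂ : ν₂ (Set.Iio (-T)) = 0) (h₁' : ν₁ (Set.Ici T) = 0) (h₂' : ν₂ (Set.Ici T) = 0)
    {y : ℕ → ℝ} {a : ℝ} {L : ℕ} (hy : ∀ l ≤ L, 0 ≤ y l)
    (hc : ∀ l ≤ L, ∀ m < 2 ^ l, |ν₁.real (gridCell T l m) - ν₂.real (gridCell T l m)| ≤ y l)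
    (ha : ∀ m < 2 ^ L, ν₂.real (gridCell T L m) ≤ a) {I : Set ℝ} (hI : IsLowerSet I) :
    |ν₁.real I - ν₂.real I| ≤ ∑ j ∈ Finset.range (L + 1), y j + a := by
  classical
  have hS := abs_measureReal_Iio_gridPoint_sub_le hT h₁ h₂ hy hc L le_rfl
  have ha0 : 0 ≤ a := measureReal_nonneg.trans (ha 0 (by positivity))
  have hnull : ∀ ν : Measure ℝ, IsFiniteMeasure ν → ν (Set.Iio (-T)) = 0 → I ⊆ Set.Iio (-T) →
      ν.real I = 0 := fun ν _ hν hs => by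
    have := measure_mono_null hs hν
    simp [Measure.real, this]
  by_cases h0 : Set.Iio (gridPoint T L 0) ⊆ I
  · obtain ⟨m, hm, hmI, hmax⟩ : ∃ m ≤ 2 ^ L, Set.Iio (gridPoint T L m) ⊆ I ∧
        (m = 2 ^ L ∨ m < 2 ^ L ∧ ¬ Set.Iio (gridPoint T L (m + 1)) ⊆ I) := by
      by_contra hcon
      push Not at hcon
      have : ∀ m, m ≤ 2 ^ L → Set.Iio (gridPoint T L m) ⊆ I := by
        intro m
        induction m with
        | zero => exact fun _ => h0
        | succ m ih => exact fun hm => (hcon m (by omega) (ih (by omega))).2 (by omega)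
      exact (hcon (2 ^ L) le_rfl (this _ le_rfl)).1 rfl
    have hlow : ∀ ν : Measure ℝ, IsFiniteMeasure ν →
        ν.real (Set.Iio (gridPoint T L m)) ≤ ν.real I := fun ν _ => measureReal_mono hmI
    rcases hmax with rfl | ⟨hm', hmax⟩
    · have hT' : gridPoint T L (2 ^ L) = T := by
        unfold gridPoint
        push_cast
        field_simp
        ring
      have hup : ∀ ν : Measure ℝ, IsFiniteMeasure ν → ν (Set.Ici T) = 0 →
          ν.real I = ν.real (Set.Iio (gridPoint T L (2 ^ L))) := fun ν hν h => by
        refine le_antisymm ?_ (hlow ν hν)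
        calc ν.real I ≤ ν.real (Set.Iio T ∪ Set.Ici T) := measureReal_mono (fun x _ => by simp)
          _ ≤ ν.real (Set.Iio T) + ν.real (Set.Ici T) := measureReal_union_le _ _
          _ = ν.real (Set.Iio (gridPoint T L (2 ^ L))) := by
              rw [hT', Measure.real, Measure.real, h]; simp
      rw [hup ν₁ inferInstance h₁', hup ν₂ inferInstance h₂']
      exact (hS _ hm).trans (by linarith)
    · have hsub : I ⊆ Set.Iio (gridPoint T L (m + 1)) := by
        intro x hx
        by_contra hx'
        exact hmax fun z hz => hI ((le_of_lt hz).trans (not_lt.1 hx')) hx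
      have hup : ∀ ν : Measure ℝ, IsFiniteMeasure ν →
          ν.real I ≤ ν.real (Set.Iio (gridPoint T L (m + 1))) := fun ν _ => measureReal_mono hsub
      have e1 := measureReal_Iio_gridPoint_succ hT ν₂ L m
      have f1 := abs_le.1 (hS m hm)
      have f2 := abs_le.1 (hS (m + 1) hm')
      have f3 := ha m hm'
      have f4 := hlow ν₁ inferInstance
      have f5 := hlow ν₂ inferInstance
      have f6 := hup ν₁ inferInstance
      have f7 := hup ν₂ inferInstance
      rw [abs_le]
      constructor <;> linarith [f1.1, f1.2, f2.1, f2.2]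
  · have hs : I ⊆ Set.Iio (-T) := by
      intro x hx
      by_contra hx'
      refine h0 fun z hz => hI (le_trans (le_of_lt hz) ?_) hx
      simpa [gridPoint] using hx'
    rw [hnull ν₁ inferInstance h₁ hs, hnull ν₂ inferInstance h₂ hs]
    simpa using add_nonneg (Finset.sum_nonneg fun j hj =>
      hy j (by rw [Finset.mem_range] at hj; omega)) ha0

/-! ### A Bernstein inequality -/

/-- Bernstein's method with e^z ≤ 1 + z + z² for |z| ≤ 1. As 0 ≤ ζ ≤ 1, the variance of ζ is at most
its mean and hence at most v. The parameter t is left free, to be optimized later. -/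
theorem abs_sum_sub_ge_le_exp {Ω 𝒲 : Type*} [MeasurableSpace Ω] [MeasurableSpace 𝒲]
    {μ : Measure Ω} [IsProbabilityMeasure μ] {W : ℕ → Ω → 𝒲} (hW : IsIID μ W) {ζ : 𝒲 → ℝ}
    (hζ : Measurable ζ) (h0 : ∀ w, 0 ≤ ζ w) (h1 : ∀ w, ζ w ≤ 1) {v : ℝ}
    (hv : ∫ ω, ζ (W 0 ω) ∂μ ≤ v) {t : ℝ} (ht0 : 0 ≤ t) (ht1 : t ≤ 1) (n : ℕ) (y : ℝ) :
    μ.real {ω | y ≤ |∑ i ∈ Finset.range n, ζ (W i ω) - n * ∫ ω, ζ (W 0 ω) ∂μ|} ≤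
      2 * Real.exp (-t * y + t ^ 2 * (n * v)) := by
  obtain ⟨hWm, hWi, hWd⟩ := hW
  set m := ∫ ω, ζ (W 0 ω) ∂μ with hm
  have hint : ∀ i, Integrable (fun ω => ζ (W i ω)) μ := fun i =>
    Integrable.of_bound (hζ.comp (hWm i)).aestronglyMeasurable 1 (ae_of_all _ fun ω => by
      rw [Real.norm_eq_abs, abs_of_nonneg (h0 _)]; exact h1 _)
  have hm0 : 0 ≤ m := integral_nonneg fun ω => h0 _
  have hm1 : m ≤ 1 := by
    have := integral_mono (hint 0) (integrable_const (1 : ℝ)) fun ω => h1 (W 0 ω)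
    simpa using this
  set Z : ℕ → Ω → ℝ := fun i ω => ζ (W i ω) - m with hZ
  have hZm : ∀ i, Measurable (Z i) := fun i => (hζ.comp (hWm i)).sub_const _
  have hZb : ∀ i ω, |Z i ω| ≤ 1 := fun i ω => by
    rw [abs_le]
    constructor <;> simp only [hZ] <;> linarith [h0 (W i ω), h1 (W i ω)]
  have hZind : iIndepFun Z μ :=
    hWi.comp (fun _ w => ζ w - m) fun _ => hζ.sub_const _
  have hZid : ∀ i, IdentDistrib (Z i) (Z 0) μ μ := fun i => (hWd i).comp (hζ.sub_const m)
  have hmgf : ∀ s : ℝ, |s| ≤ 1 → mgf (Z 0) μ s ≤ Real.exp (s ^ 2 * v) := by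
    intro s hs
    have hpt : ∀ ω, Real.exp (s * Z 0 ω) ≤ 1 + s * Z 0 ω + s ^ 2 * (ζ (W 0 ω) - 2 * m *
        ζ (W 0 ω) + m ^ 2) := by
      intro ω
      have h2 : |s * Z 0 ω| ≤ 1 := by
        rw [abs_mul]
        exact mul_le_one₀ hs (abs_nonneg _) (hZb 0 ω)
      have h3 := (abs_le.1 (Real.abs_exp_sub_one_sub_id_le h2)).2
      have h4 : Z 0 ω ^ 2 ≤ ζ (W 0 ω) - 2 * m * ζ (W 0 ω) + m ^ 2 := by
        simp only [hZ]
        nlinarith [h0 (W 0 ω), h1 (W 0 ω)]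
      have h5 := mul_le_mul_of_nonneg_left h4 (sq_nonneg s)
      nlinarith
    have hZint : Integrable (Z 0) μ := (hint 0).sub (integrable_const _)
    have hi1 : Integrable (fun ω => 1 + s * Z 0 ω) μ :=
      (integrable_const _).add (hZint.const_mul s)
    have hi2 : Integrable (fun ω => ζ (W 0 ω) - 2 * m * ζ (W 0 ω)) μ :=
      (hint 0).sub ((hint 0).const_mul _)
    have hi3 : Integrable (fun ω => s ^ 2 * (ζ (W 0 ω) - 2 * m * ζ (W 0 ω) + m ^ 2)) μ :=
      (hi2.add (integrable_const _)).const_mul _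
    have hle : mgf (Z 0) μ s ≤ ∫ ω, (1 + s * Z 0 ω + s ^ 2 * (ζ (W 0 ω) - 2 * m *
        ζ (W 0 ω) + m ^ 2)) ∂μ := by
      refine integral_mono ?_ (hi1.add hi3) hpt
      refine Integrable.of_bound ((hZm 0).const_mul s).exp.aestronglyMeasurable
        (Real.exp 1) (ae_of_all _ fun ω => ?_)
      rw [Real.norm_eq_abs, Real.abs_exp]
      refine Real.exp_le_exp.2 ((le_abs_self _).trans ?_)
      rw [abs_mul]
      exact mul_le_one₀ hs (abs_nonneg _) (hZb 0 ω)
    refine hle.trans ?_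
    have hEZ : ∫ ω, Z 0 ω ∂μ = 0 := by
      simp only [hZ]
      rw [integral_sub (hint 0) (integrable_const _)]
      simp [hm]
    rw [integral_add hi1 hi3, integral_add (integrable_const _) (hZint.const_mul s),
      integral_const_mul, integral_const_mul, hEZ, integral_add hi2 (integrable_const _),
      integral_sub (hint 0) ((hint 0).const_mul _), integral_const_mul, ← hm]
    simp only [integral_const, probReal_univ, one_smul]
    have h6 : s ^ 2 * (m - 2 * m * m + m ^ 2) ≤ s ^ 2 * v :=
      mul_le_mul_of_nonneg_left (by nlinarith) (sq_nonneg s)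
    linarith [Real.add_one_le_exp (s ^ 2 * v)]
  have hsum : ∀ s : ℝ, |s| ≤ 1 →
      mgf (∑ i ∈ Finset.range n, Z i) μ s ≤ Real.exp (s ^ 2 * (n * v)) := by
    intro s hs
    rcases n.eq_zero_or_pos with hn | hn
    · subst hn; simp
    rw [mgf_sum_of_identDistrib hZm hZind (fun i _ j _ => (hZid i).trans (hZid j).symm)
      (Finset.mem_range.2 hn) s, Finset.card_range]
    refine (pow_le_pow_left₀ mgf_nonneg (hmgf s hs) n).trans (le_of_eq ?_)
    rw [← Real.exp_nat_mul]
    congr 1; ring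
  have hSb : ∀ s : ℝ, Integrable (fun ω => Real.exp (s * (∑ i ∈ Finset.range n, Z i) ω)) μ := by
    intro s
    simp only [Finset.sum_apply]
    refine Integrable.of_bound (((Finset.measurable_sum _ fun i _ => hZm i).const_mul
      s).exp.aestronglyMeasurable) (Real.exp (|s| * n)) (ae_of_all _ fun ω => ?_)
    rw [Real.norm_eq_abs, Real.abs_exp]
    refine Real.exp_le_exp.2 ((le_abs_self _).trans ?_)
    rw [abs_mul]
    refine mul_le_mul_of_nonneg_left ?_ (abs_nonneg _)
    refine (Finset.abs_sum_le_sum_abs _ _).trans ?_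
    exact (Finset.sum_le_card_nsmul _ _ 1 fun i _ => hZb i ω).trans (by simp)
  have hS : ∀ ω, ∑ i ∈ Finset.range n, ζ (W i ω) - n * m = (∑ i ∈ Finset.range n, Z i) ω := by
    intro ω
    simp [hZ, Finset.sum_apply, Finset.sum_sub_distrib]
  have hup := measure_ge_le_exp_mul_mgf (μ := μ) (X := ∑ i ∈ Finset.range n, Z i) y ht0 (hSb t)
  have hdn := measure_le_le_exp_mul_mgf (μ := μ) (X := ∑ i ∈ Finset.range n, Z i) (-y)
    (t := -t) (by linarith) (hSb (-t))
  have hsub : {ω | y ≤ |∑ i ∈ Finset.range n, ζ (W i ω) - n * m|} ⊆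
      {ω | y ≤ (∑ i ∈ Finset.range n, Z i) ω} ∪ {ω | (∑ i ∈ Finset.range n, Z i) ω ≤ -y} := by
    intro ω hω
    have hω' : y ≤ |(∑ i ∈ Finset.range n, Z i) ω| := by rw [← hS]; exact hω
    rcases le_abs'.1 hω' with h | h
    · exact Or.inr h
    · exact Or.inl h
  refine (measureReal_mono hsub).trans ((measureReal_union_le _ _).trans ?_)
  have ha : |t| ≤ 1 := by rw [abs_of_nonneg ht0]; exact ht1
  have g1 := mul_le_mul_of_nonneg_left (hsum t ha) (Real.exp_pos (-t * y)).le
  have g2 := mul_le_mul_of_nonneg_left (hsum (-t) (by rwa [abs_neg]))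
    (Real.exp_pos (-(-t) * (-y))).le
  rw [← Real.exp_add] at g1 g2
  have e : -(-t) * (-y) + (-t) ^ 2 * (n * v) = -t * y + t ^ 2 * (n * v) := by ring
  rw [e] at g2
  linarith


/-! ### The maximal inequality at one scale -/

/-- Bernoulli's inequality for the base 2 (7/8)² = 1 + 17/32. -/
theorem sqrt_succ_div_two_pow_le (l : ℕ) : √(((l : ℝ) + 1) / 2 ^ l) ≤ 3 / 2 * (7 / 8) ^ l := by
  refine Real.sqrt_le_iff.2 ⟨by positivity, ?_⟩
  have h := one_add_mul_le_pow (a := (17 / 32 : ℝ)) (by norm_num) l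
  have e : (3 / 2 * (7 / 8 : ℝ) ^ l) ^ 2 = 9 / 4 * (1 + 17 / 32 : ℝ) ^ l / 2 ^ l := by
    rw [mul_pow, ← pow_mul, mul_comm l 2, pow_mul, mul_div_assoc, ← div_pow]
    norm_num
  rw [e]
  gcongr
  have : (0 : ℝ) ≤ l := Nat.cast_nonneg _
  linarith

theorem sum_sqrt_succ_div_two_pow_le (n : ℕ) :
    ∑ l ∈ Finset.range n, √(((l : ℝ) + 1) / 2 ^ l) ≤ 12 := by
  refine (Finset.sum_le_sum fun l _ => sqrt_succ_div_two_pow_le l).trans ?_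
  rw [← Finset.mul_sum, geom_sum_eq (by norm_num)]
  have : (0 : ℝ) ≤ (7 / 8) ^ n := by positivity
  rw [show ((7 / 8 : ℝ) ^ n - 1) / (7 / 8 - 1) = 8 * (1 - (7 / 8) ^ n) by ring]
  linarith

theorem integral_sum_smul_dirac {α : Type*} [MeasurableSpace α] (n : ℕ) (c : ℕ → ℝ)
    (hc : ∀ i, 0 ≤ c i) (x : ℕ → α) {g : α → ℝ} (hg : Measurable g) {K : ℝ}
    (hK : ∀ u, |g u| ≤ K) :
    ∫ u, g u ∂(∑ i ∈ Finset.range n, ENNReal.ofReal (c i) • Measure.dirac (x i)) =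
      ∑ i ∈ Finset.range n, g (x i) * c i := by
  rw [integral_finsetSum_measure]
  · refine Finset.sum_congr rfl fun i _ => ?_
    rw [integral_smul_measure, integral_dirac' _ _ hg.stronglyMeasurable,
      ENNReal.toReal_ofReal (hc i), smul_eq_mul, mul_comm]
  · intro i _
    refine Integrable.smul_measure ?_ ENNReal.ofReal_ne_top
    exact Integrable.of_bound hg.aestronglyMeasurable K (ae_of_all _ hK)

/-- Bernstein's inequality on all dyadic cells of [-T, T) up to a level L, followed by chaining. The
bad set is chosen before the antitone function, so the bound is uniform in a. Here x bounds the
expected number of observations in [-T, T), and r sets the failure probability. -/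
theorem exists_bad_set_of_scale {Ω 𝒲 : Type*} [MeasurableSpace Ω] [MeasurableSpace 𝒲]
    {μ : Measure Ω} [IsProbabilityMeasure μ] {W : ℕ → Ω → 𝒲} (hW : IsIID μ W) {xc : 𝒲 → ℝ}
    (hx : Measurable xc) {G : 𝒲 → ℝ} (hG : Measurable G) (hG0 : ∀ w, 0 ≤ G w)
    (hG1 : ∀ w, G w ≤ 1) {T c : ℝ} (hT : 0 ≤ T)
    (hc : ∀ s t, -T ≤ s → s ≤ t → t ≤ T →
      μ.real {ω | xc (W 0 ω) ∈ Set.Ico s t} ≤ c * (t - s)) (n : ℕ) {x r : ℝ}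
    (hxdef : x = n * (c * (2 * T))) (hr : 2 ≤ r) (hxr : r ≤ x) :
    ∃ bad : Set Ω, μ.real bad ≤ 4 * Real.exp (-r) ∧ ∀ ω, ω ∉ bad → ∀ (a : ℝ → ℝ) (K : ℝ),
      Antitone a → (∀ u, 0 ≤ a u ∧ a u ≤ K) →
      |∑ i ∈ Finset.range n, (Set.Ico (-T) T).indicator a (xc (W i ω)) * G (W i ω) -
        n * ∫ ω, (Set.Ico (-T) T).indicator a (xc (W 0 ω)) * G (W 0 ω) ∂μ| ≤
        K * (26 * √(r * x)) := by
  classical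
  obtain ⟨hWm, -, -⟩ := id hW
  have hr0 : 0 < r := by linarith
  have hx0 : 0 < x := by linarith
  -- 2^L is of the order of √(x / r): small enough for the Bernstein parameter t to stay below 1 at
  -- all levels, large enough for a finest cell to carry expected weight of order √(r x).
  obtain ⟨L, hL1, hL2⟩ := exists_nat_pow_near (x := √(x / r)) (y := 2)
    (by rw [Real.one_le_sqrt, one_le_div hr0]; exact hxr) (by norm_num)
  have hL1' : (2 : ℝ) ^ L * 2 ^ L ≤ x / r := by
    have := pow_le_pow_left₀ (by positivity) hL1 2
    rwa [Real.sq_sqrt (by positivity), sq] at this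
  let ζ : ℕ → ℕ → 𝒲 → ℝ := fun l m w => (gridCell T l m).indicator (fun _ => 1) (xc w) * G w
  have hind : ∀ s : Set ℝ, MeasurableSet s → Measurable (s.indicator fun _ : ℝ => (1 : ℝ)) :=
    fun s hs => measurable_const.indicator hs
  have hζm : ∀ l m, Measurable (ζ l m) := fun l m =>
    ((hind _ (measurableSet_gridCell T l m)).comp hx).mul hG
  have hζ0 : ∀ l m w, 0 ≤ ζ l m w := fun l m w =>
    mul_nonneg (Set.indicator_nonneg (fun _ _ => zero_le_one) _) (hG0 w)
  have hi1 : ∀ (s : Set ℝ) u, s.indicator (fun _ => (1 : ℝ)) u ≤ 1 := fun s u => by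
    by_cases hu : u ∈ s <;> simp [hu]
  have hζ1 : ∀ l m w, ζ l m w ≤ 1 := fun l m w =>
    mul_le_one₀ (hi1 _ _) (hG0 w) (hG1 w)
  have hlow : ∀ l m, -T ≤ gridPoint T l m := fun l m => by
    unfold gridPoint
    have : 0 ≤ 2 * T * m / 2 ^ l := by positivity
    linarith
  have hcell : ∀ l m, m < 2 ^ l → ∫ ω, ζ l m (W 0 ω) ∂μ ≤ c * (2 * T / 2 ^ l) := by
    intro l m hm
    have h1 : ∫ ω, ζ l m (W 0 ω) ∂μ ≤ μ.real {ω | xc (W 0 ω) ∈ gridCell T l m} := by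
      have hmeas : MeasurableSet {ω | xc (W 0 ω) ∈ gridCell T l m} :=
        (hx.comp (hWm 0)) (measurableSet_gridCell T l m)
      rw [← integral_indicator_one hmeas]
      refine integral_mono ?_ ?_ fun ω => ?_
      · exact Integrable.of_bound ((hζm l m).comp (hWm 0)).aestronglyMeasurable 1
          (ae_of_all _ fun ω => by
            rw [Real.norm_eq_abs, abs_of_nonneg (hζ0 _ _ _)]; exact hζ1 _ _ _)
      · exact (integrable_const (1 : ℝ)).indicator hmeas
      · by_cases h : xc (W 0 ω) ∈ gridCell T l m
        · simp [ζ, Set.indicator, h, hG1]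
        · simp [ζ, Set.indicator, h]
    refine h1.trans ((hc _ _ (hlow l m) (gridPoint_mono hT l m) ?_).trans (le_of_eq ?_))
    · unfold gridPoint
      have : ((m + 1 : ℕ) : ℝ) ≤ 2 ^ l := by exact_mod_cast hm
      have : 2 * T * ((m + 1 : ℕ) : ℝ) / 2 ^ l ≤ 2 * T := by
        rw [div_le_iff₀ (by positivity)]
        exact mul_le_mul_of_nonneg_left this (by positivity)
      linarith
    · unfold gridPoint
      push_cast
      ring
  -- Level l has 2^l cells of expected weight at most x / 2^l. The factor l + 1 makes the failure
  -- probability 2 exp(-r (l + 1)) per cell, which beats the number of cells, while the thresholds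
  -- remain summable in l.
  let y : ℕ → ℝ := fun l => 2 * √(r * x) * √(((l : ℝ) + 1) / 2 ^ l)
  let E : ℕ → ℕ → Set Ω := fun l m =>
    {ω | y l ≤ |∑ i ∈ Finset.range n, ζ l m (W i ω) - n * ∫ ω, ζ l m (W 0 ω) ∂μ|}
  have hE : ∀ l ≤ L, ∀ m < 2 ^ l, μ.real (E l m) ≤ 2 * Real.exp (-r) ^ (l + 1) := by
    intro l hl m hm
    -- The minimizer of the Bernstein exponent: t y = 2 r (l + 1) and t² x / 2^l = r (l + 1).
    set t := √(r * (l + 1) * 2 ^ l / x) with ht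
    have ht1 : t ≤ 1 := by
      rw [ht]
      refine Real.sqrt_le_iff.2 ⟨zero_le_one, ?_⟩
      rw [one_pow, div_le_one hx0]
      have h1 : ((l : ℝ) + 1) ≤ 2 ^ L := by
        have : l + 1 ≤ 2 ^ L := (Nat.lt_two_pow_self (n := l)).trans_le
          (Nat.pow_le_pow_right (by norm_num) hl)
        exact_mod_cast this
      have h2 : (2 : ℝ) ^ l ≤ 2 ^ L := pow_le_pow_right₀ (by norm_num) hl
      have h3 : ((l : ℝ) + 1) * 2 ^ l ≤ x / r :=
        (mul_le_mul h1 h2 (by positivity) (by positivity)).trans hL1'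
      rw [le_div_iff₀ hr0] at h3
      linarith
    have hB := abs_sum_sub_ge_le_exp hW (hζm l m) (hζ0 l m) (hζ1 l m) (hcell l m hm)
      (Real.sqrt_nonneg _) ht1 n (y l)
    refine hB.trans (le_of_eq ?_)
    rw [← Real.exp_nat_mul]
    congr 2
    have e1 : t * y l = 2 * (r * (l + 1)) := by
      have : t * (√(r * x) * √(((l : ℝ) + 1) / 2 ^ l)) = r * (l + 1) := by
        rw [ht, ← Real.sqrt_mul (by positivity), ← Real.sqrt_mul (by positivity)]
        rw [show r * ((l : ℝ) + 1) * 2 ^ l / x * (r * x * ((l + 1) / 2 ^ l)) =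
          (r * (l + 1)) ^ 2 by field_simp]
        exact Real.sqrt_sq (by positivity)
      simp only [y]
      linarith
    have e2 : t ^ 2 * (n * (c * (2 * T / 2 ^ l))) = r * (l + 1) := by
      rw [ht, Real.sq_sqrt (by positivity)]
      rw [show n * (c * (2 * T / 2 ^ l)) = x / 2 ^ l by rw [hxdef]; ring]
      field_simp
    rw [e2, neg_mul, e1]
    push_cast
    ring
  let bad : Set Ω := ⋃ l ∈ Finset.range (L + 1), ⋃ m ∈ Finset.range (2 ^ l), E l m
  -- As r ≥ 2, the bounds (2 e^{-r})^{l + 1} of the levels are dominated by a geometric series of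
  -- ratio 1/2.
  have hq : 2 * Real.exp (-r) ≤ 1 / 2 := by
    have h1 : Real.exp 2 ≤ Real.exp r := Real.exp_le_exp.2 hr
    have h2 : (4 : ℝ) ≤ Real.exp 2 := by
      have := Real.add_one_le_exp (1 : ℝ)
      have h3 : Real.exp 2 = Real.exp 1 * Real.exp 1 := by rw [← Real.exp_add]; norm_num
      rw [h3]; nlinarith
    rw [Real.exp_neg, ← div_eq_mul_inv, div_le_div_iff₀ (by positivity) (by norm_num)]
    linarith
  refine ⟨bad, ?_, ?_⟩
  · have h1 : μ.real bad ≤ ∑ l ∈ Finset.range (L + 1), (2 * Real.exp (-r)) ^ (l + 1) := by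
      refine (measureReal_biUnion_finset_le _ _).trans (Finset.sum_le_sum fun l hl => ?_)
      refine (measureReal_biUnion_finset_le _ _).trans ?_
      refine (Finset.sum_le_sum fun m hm => hE l (by rw [Finset.mem_range] at hl; omega) m
        (Finset.mem_range.1 hm)).trans (le_of_eq ?_)
      rw [Finset.sum_const, Finset.card_range, nsmul_eq_mul, mul_pow, pow_succ (2 : ℝ)]
      push_cast
      ring
    refine h1.trans ?_
    have h2 : ∀ l, (2 * Real.exp (-r)) ^ (l + 1) ≤ 2 * Real.exp (-r) * (1 / 2) ^ l := fun l => by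
      rw [pow_succ, mul_comm]
      exact mul_le_mul_of_nonneg_left (pow_le_pow_left₀ (by positivity) hq l) (by positivity)
    refine (Finset.sum_le_sum fun l _ => h2 l).trans ?_
    rw [← Finset.mul_sum]
    have h3 : ∑ l ∈ Finset.range (L + 1), (1 / 2 : ℝ) ^ l ≤ 2 := by
      rw [geom_sum_eq (by norm_num)]
      have : (0 : ℝ) ≤ (1 / 2) ^ (L + 1) := by positivity
      rw [show ((1 / 2 : ℝ) ^ (L + 1) - 1) / (1 / 2 - 1) = 2 * (1 - (1 / 2) ^ (L + 1)) by ring]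
      linarith
    nlinarith [Real.exp_pos (-r)]
  · intro ω hω a K ha haK
    have hgood : ∀ l ≤ L, ∀ m < 2 ^ l,
        |∑ i ∈ Finset.range n, ζ l m (W i ω) - n * ∫ ω, ζ l m (W 0 ω) ∂μ| ≤ y l := by
      intro l hl m hm
      by_contra hcon
      refine hω ?_
      simp only [bad, Set.mem_iUnion]
      exact ⟨l, Finset.mem_range.2 (by omega), m, Finset.mem_range.2 hm, (not_le.1 hcon).le⟩
    set J := Set.Ico (-T) T with hJ
    have hJm : MeasurableSet J := measurableSet_Ico
    -- The weighted empirical measure of the running variable and n times its expectation; the two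
    -- sides of the claim are integrals of a against them over [-T, T).
    let κ₁ : Measure ℝ :=
      ∑ i ∈ Finset.range n, ENNReal.ofReal (G (W i ω)) • Measure.dirac (xc (W i ω))
    let κ₂ : Measure ℝ :=
      (μ.withDensity fun ω => ENNReal.ofReal (n * G (W 0 ω))).map fun ω => xc (W 0 ω)
    have hGm0 : Measurable fun ω => n * G (W 0 ω) := (hG.comp (hWm 0)).const_mul _
    have hGnn : ∀ ω, 0 ≤ n * G (W 0 ω) := fun ω => mul_nonneg (Nat.cast_nonneg _) (hG0 _)
    have hκ₁f : IsFiniteMeasure κ₁ := by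
      refine ⟨?_⟩
      simp only [κ₁, Measure.finsetSum_apply, Measure.smul_apply, smul_eq_mul, measure_univ,
        mul_one]
      exact ENNReal.sum_lt_top.2 fun i _ => ENNReal.ofReal_lt_top
    have hint : Integrable (fun ω => n * G (W 0 ω)) μ :=
      Integrable.of_bound hGm0.aestronglyMeasurable n (ae_of_all _ fun ω => by
        rw [Real.norm_eq_abs, abs_of_nonneg (hGnn ω)]
        exact mul_le_of_le_one_right (Nat.cast_nonneg _) (hG1 _))
    have hf2 : IsFiniteMeasure (μ.withDensity fun ω => ENNReal.ofReal (n * G (W 0 ω))) :=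
      isFiniteMeasure_withDensity_ofReal hint.2
    have hκ₂f : IsFiniteMeasure κ₂ := by infer_instance
    have hI1 : ∀ g : ℝ → ℝ, Measurable g → (∃ K, ∀ u, |g u| ≤ K) →
        ∫ u, g u ∂(κ₁.restrict J) = ∑ i ∈ Finset.range n, J.indicator g (xc (W i ω)) *
          G (W i ω) := by
      rintro g hg ⟨K, hK⟩
      rw [← integral_indicator hJm]
      refine integral_sum_smul_dirac n _ (fun i => hG0 _) _ (hg.indicator hJm) (K := K)
        fun u => ?_
      by_cases hu : u ∈ J
      · simpa [hu] using hK u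
      · simpa [hu] using (abs_nonneg _).trans (hK u)
    have hI2 : ∀ g : ℝ → ℝ, Measurable g →
        ∫ u, g u ∂(κ₂.restrict J) = n * ∫ ω, J.indicator g (xc (W 0 ω)) * G (W 0 ω) ∂μ := by
      intro g hg
      have hXm : Measurable fun ω => xc (W 0 ω) := hx.comp (hWm 0)
      rw [← integral_indicator hJm, integral_map hXm.aemeasurable
        (hg.indicator hJm).aestronglyMeasurable,
        integral_withDensity_eq_integral_toReal_smul hGm0.ennreal_ofReal
          (ae_of_all _ fun _ => ENNReal.ofReal_lt_top), ← integral_const_mul]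
      refine integral_congr_ae (ae_of_all _ fun ω => ?_)
      simp only [smul_eq_mul]
      rw [ENNReal.toReal_ofReal (hGnn ω)]
      ring
    have hcells : ∀ l m, m < 2 ^ l → ∀ u, J.indicator ((gridCell T l m).indicator fun _ => (1 : ℝ)) u =
        (gridCell T l m).indicator (fun _ => 1) u := by
      intro l m hm u
      by_cases hu : u ∈ J
      · rw [Set.indicator_of_mem hu]
      · rw [Set.indicator_of_notMem hu, Set.indicator_of_notMem]
        intro hu'
        refine hu ⟨(hlow l m).trans hu'.1, hu'.2.trans_le ?_⟩
        unfold gridPoint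
        have : ((m + 1 : ℕ) : ℝ) ≤ 2 ^ l := by exact_mod_cast hm
        have : 2 * T * ((m + 1 : ℕ) : ℝ) / 2 ^ l ≤ 2 * T := by
          rw [div_le_iff₀ (by positivity)]
          exact mul_le_mul_of_nonneg_left this (by positivity)
        linarith
    have hreal : ∀ (ν : Measure ℝ) l m, ν.real (gridCell T l m) =
        ∫ u, (gridCell T l m).indicator (fun _ => (1 : ℝ)) u ∂ν := fun ν l m =>
      (integral_indicator_one (measurableSet_gridCell T l m)).symm
    have hb1 : ∀ l m, ∃ K : ℝ, ∀ u, |(gridCell T l m).indicator (fun _ => (1 : ℝ)) u| ≤ K :=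
      fun l m => ⟨1, fun u => by by_cases hu : u ∈ gridCell T l m <;> simp [hu]⟩
    have hr1 : ∀ l m, m < 2 ^ l → (κ₁.restrict J).real (gridCell T l m) =
        ∑ i ∈ Finset.range n, ζ l m (W i ω) := by
      intro l m hm
      rw [hreal, hI1 _ (hind _ (measurableSet_gridCell T l m)) (hb1 l m)]
      simp only [hcells l m hm, ζ]
    have hr2 : ∀ l m, m < 2 ^ l → (κ₂.restrict J).real (gridCell T l m) =
        n * ∫ ω, ζ l m (W 0 ω) ∂μ := by
      intro l m hm
      rw [hreal, hI2 _ (hind _ (measurableSet_gridCell T l m))]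
      simp only [hcells l m hm, ζ]
    have hz1 : ∀ ν : Measure ℝ, (ν.restrict J) (Set.Iio (-T)) = 0 := fun ν => by
      rw [Measure.restrict_apply measurableSet_Iio]
      convert measure_empty (μ := ν)
      ext u
      simp [hJ]
      intros; linarith
    have hz2 : ∀ ν : Measure ℝ, (ν.restrict J) (Set.Ici T) = 0 := fun ν => by
      rw [Measure.restrict_apply measurableSet_Ici]
      convert measure_empty (μ := ν)
      ext u
      simp [hJ]
      intros; linarith
    -- The constant 26 is 2 · 12 from the sum over levels plus 2 from one finest cell.
    have hdisc : ∀ I, IsLowerSet I →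
        |(κ₁.restrict J).real I - (κ₂.restrict J).real I| ≤ 26 * √(r * x) := by
      intro I hI
      have hch := abs_measureReal_sub_le_of_gridCell hT (hz1 κ₁) (hz1 κ₂) (hz2 κ₁) (hz2 κ₂)
        (y := y) (a := x / 2 ^ L) (L := L) (fun l _ => by positivity)
        (fun l hl m hm => by rw [hr1 l m hm, hr2 l m hm]; exact hgood l hl m hm)
        (fun m hm => by
          rw [hr2 L m hm, hxdef, mul_div_assoc, mul_div_assoc]
          exact mul_le_mul_of_nonneg_left (hcell L m hm) (Nat.cast_nonneg _)) hI
      refine hch.trans ?_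
      have s1 : ∑ j ∈ Finset.range (L + 1), y j ≤ 24 * √(r * x) := by
        simp only [y]
        rw [← Finset.mul_sum]
        have := mul_le_mul_of_nonneg_left (sum_sqrt_succ_div_two_pow_le (L + 1))
          (by positivity : 0 ≤ 2 * √(r * x))
        linarith
      have s2 : x / 2 ^ L ≤ 2 * √(r * x) := by
        rw [div_le_iff₀ (by positivity)]
        have h1 : √(x / r) < 2 * 2 ^ L := by rwa [pow_succ'] at hL2
        have h2 : √(x / r) * √(r * x) = x := by
          rw [← Real.sqrt_mul (by positivity), show x / r * (r * x) = x ^ 2 by field_simp,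
            Real.sqrt_sq hx0.le]
        nlinarith [Real.sqrt_nonneg (r * x)]
      linarith
    have hfin := abs_integral_sub_le_of_isLowerSet hdisc ha haK
    rwa [hI1 a ha.measurable ⟨K, fun u => by
      rw [abs_of_nonneg (haK u).1]; exact (haK u).2⟩, hI2 a ha.measurable] at hfin


/-! ### The maximal inequality, uniformly over bandwidths -/

theorem one_le_log_log_inv {h : ℝ} (h0 : 0 < h) (h1 : h ≤ Real.exp (-Real.exp 1)) :
    1 ≤ Real.log (Real.log h⁻¹) := by
  have h2 : Real.exp 1 ≤ Real.log h⁻¹ := by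
    rw [Real.log_inv]
    have := Real.log_le_log h0 h1
    rw [Real.log_exp] at this
    linarith
  have := Real.log_le_log (Real.exp_pos 1) h2
  rwa [Real.log_exp] at this

/-- The bandwidths are covered by dyadic scales T, at most 3 log(1 / hlo) in number. With r = κ log
log(1 / hlo) at each scale, the union bound costs a factor of order exp(log log(1 / hlo)), which κ ≥
2 absorbs. This is why only an iterated logarithm appears. -/
theorem exists_bad_set_antitone {Ω 𝒲 : Type*} [MeasurableSpace Ω] [MeasurableSpace 𝒲]
    {μ : Measure Ω} [IsProbabilityMeasure μ] {W : ℕ → Ω → 𝒲} (hW : IsIID μ W) {xc : 𝒲 → ℝ}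
    (hx : Measurable xc) {G : 𝒲 → ℝ} (hG : Measurable G) (hG0 : ∀ w, 0 ≤ G w)
    (hG1 : ∀ w, G w ≤ 1) {A c hmax : ℝ} (hA : 0 < A) (hc0 : 0 < c) (hm0 : 0 < hmax)
    (hm1 : hmax ≤ Real.exp (-Real.exp 1))
    (hc : ∀ s t, -(2 * A * hmax) ≤ s → s ≤ t → t ≤ 2 * A * hmax →
      μ.real {ω | xc (W 0 ω) ∈ Set.Ico s t} ≤ c * (t - s)) {hlo : ℕ → ℝ}
    (hlo0 : ∀ n, 0 < hlo n) (hlo1 : ∀ n, hlo n ≤ hmax)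
    (hrate : Tendsto (fun n : ℕ => n * hlo n / Real.log (Real.log (hlo n)⁻¹) ^ 3) atTop atTop)
    {δ : ℝ} (hδ : 0 < δ) :
    ∃ C : ℝ, ∀ᶠ n : ℕ in atTop, ∃ bad : Set Ω, μ.real bad ≤ δ ∧ ∀ ω, ω ∉ bad →
      ∀ h, hlo n ≤ h → h ≤ hmax → ∃ T, A * h < T ∧ ∀ (a : ℝ → ℝ) (K : ℝ),
      Antitone a → (∀ u, 0 ≤ a u ∧ a u ≤ K) →
      |∑ i ∈ Finset.range n, (Set.Ico (-T) T).indicator a (xc (W i ω)) * G (W i ω) -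
        n * ∫ ω, (Set.Ico (-T) T).indicator a (xc (W 0 ω)) * G (W 0 ω) ∂μ| ≤
        K * (C * √(n * h * Real.log (Real.log (hlo n)⁻¹))) := by
  classical
  -- The 12 is the product of the constant 4 of a single scale and the 3 in the number of scales.
  set κ : ℝ := max 2 (1 + Real.log (12 / δ)) with hκ
  have hκ2 : 2 ≤ κ := le_max_left _ _
  have hκδ : 12 * Real.exp (-(κ - 1)) ≤ δ := by
    have : Real.log (12 / δ) ≤ κ - 1 := by linarith [le_max_right 2 (1 + Real.log (12 / δ))]
    have h2 := (Real.log_le_iff_le_exp (by positivity)).1 this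
    rw [Real.exp_neg, ← div_eq_mul_inv, div_le_iff₀ (Real.exp_pos _)]
    rw [div_le_iff₀ hδ] at h2
    linarith
  refine ⟨26 * √(8 * κ * c * A), ?_⟩
  have hden : 0 < c * (4 * A * hmax) := by positivity
  filter_upwards [hrate.eventually_ge_atTop (κ / (c * (4 * A * hmax)))] with n hn
  set LL := Real.log (Real.log (hlo n)⁻¹) with hLL
  have hLL1 : 1 ≤ LL := one_le_log_log_inv (hlo0 n) ((hlo1 n).trans hm1)
  have hn' : κ * LL ≤ n * hlo n * (c * (4 * A * hmax)) := by
    rw [div_le_div_iff₀ hden (by positivity)] at hn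
    -- The deviation bound only needs n hlo to be large compared with LL; the third power serves the
    -- quadratic remainder.
    have : LL ≤ LL ^ 3 := by nlinarith [sq_nonneg (LL - 1), sq_nonneg LL]
    have := mul_le_mul_of_nonneg_left this (by linarith : 0 ≤ κ)
    linarith
  have hlo1' : hlo n < 1 := (hlo1 n).trans_lt (hm1.trans_lt (by
    rw [Real.exp_lt_one_iff]; linarith [Real.exp_pos 1]))
  have hmax1 : hmax ≤ 1 := hm1.trans (by
    rw [Real.exp_le_one_iff]; linarith [Real.exp_pos 1])
  have hlog0 : 0 < Real.log (hlo n)⁻¹ := Real.log_pos ((one_lt_inv₀ (hlo0 n)).2 hlo1')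
  have hexp : Real.exp LL = Real.log (hlo n)⁻¹ := Real.exp_log hlog0
  let N : ℕ := ⌊Real.log (hlo n)⁻¹ / Real.log 2⌋₊ + 1
  have hlog2 : 1 / 2 ≤ Real.log 2 := by linarith [Real.log_two_gt_d9]
  have hlog2' : 0 < Real.log 2 := by linarith
  have hN : (N : ℝ) ≤ 3 * Real.exp LL := by
    have h1 : (⌊Real.log (hlo n)⁻¹ / Real.log 2⌋₊ : ℝ) ≤ Real.log (hlo n)⁻¹ / Real.log 2 :=
      Nat.floor_le (by positivity)
    have h2 : Real.log (hlo n)⁻¹ / Real.log 2 ≤ 2 * Real.log (hlo n)⁻¹ := by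
      rw [div_le_iff₀ hlog2']; nlinarith
    have h3 : 1 ≤ Real.exp LL := Real.one_le_exp (by linarith)
    simp only [N]
    push_cast
    rw [hexp] at h3 ⊢
    linarith
  let T : ℕ → ℝ := fun j => 2 * A * hmax / 2 ^ j
  have hT0 : ∀ j, 0 < T j := fun j => by positivity
  have hTle : ∀ j, T j ≤ 2 * A * hmax := fun j =>
    div_le_self (by positivity) (one_le_pow₀ (by norm_num))
  have hpow : ∀ j < N, (2 : ℝ) ^ j ≤ (hlo n)⁻¹ := by
    intro j hj
    have h1 : (j : ℝ) ≤ Real.log (hlo n)⁻¹ / Real.log 2 :=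
      (Nat.le_floor_iff (by positivity)).1 (by omega)
    rw [le_div_iff₀ hlog2', ← Real.log_pow] at h1
    exact (Real.log_le_log_iff (by positivity) (inv_pos.2 (hlo0 n))).1 h1
  have hex : ∀ j, j < N → _ := fun j hj => exists_bad_set_of_scale hW hx hG hG0 hG1 (hT0 j).le
    (fun s t h1 h2 h3 => hc s t (by linarith [hTle j]) h2 (h3.trans (hTle j))) n
    (x := n * (c * (2 * T j))) (r := κ * LL) rfl (by nlinarith) (by
      have h1 : 2 * A * hmax * hlo n ≤ T j := by
        have := hpow j hj
        rw [le_inv_comm₀ (by positivity) (hlo0 n)] at this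
        calc 2 * A * hmax * hlo n ≤ 2 * A * hmax * ((2 : ℝ) ^ j)⁻¹ := by gcongr
          _ = T j := by simp only [T]; ring
      calc κ * LL ≤ n * hlo n * (c * (4 * A * hmax)) := hn'
        _ = n * (c * (2 * (2 * A * hmax * hlo n))) := by ring
        _ ≤ _ := by gcongr)
  choose! bad hbad1 hbad2 using hex
  refine ⟨⋃ j ∈ Finset.range N, bad j, ?_, ?_⟩
  · refine (measureReal_biUnion_finset_le _ _).trans ?_
    refine (Finset.sum_le_sum fun j hj => hbad1 j (Finset.mem_range.1 hj)).trans ?_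
    rw [Finset.sum_const, Finset.card_range, nsmul_eq_mul]
    calc (N : ℝ) * (4 * Real.exp (-(κ * LL))) ≤ 3 * Real.exp LL * (4 * Real.exp (-(κ * LL))) := by
          gcongr
      _ = 12 * Real.exp (-((κ - 1) * LL)) := by
          rw [show -((κ - 1) * LL) = LL + -(κ * LL) by ring, Real.exp_add]; ring
      _ ≤ 12 * Real.exp (-(κ - 1)) := by
          gcongr
          nlinarith
      _ ≤ δ := hκδ
  · intro ω hω h hh1 hh2
    have h0 : 0 < h := (hlo0 n).trans_le hh1
    -- The scale j satisfies 2 A h ≤ T j ≤ 4 A h: wide enough for the support of the kernel at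
    -- bandwidth h, and with probability still of order h.
    obtain ⟨j, hj1, hj2⟩ := exists_nat_pow_near (x := hmax / h) (y := 2)
      ((one_le_div h0).2 hh2) (by norm_num)
    have hjN : j < N := by
      have h1 : (2 : ℝ) ^ j ≤ (hlo n)⁻¹ := hj1.trans (by
        rw [div_le_iff₀ h0, inv_mul_eq_div, le_div_iff₀ (hlo0 n)]
        nlinarith [hlo0 n])
      have h2 := Real.log_le_log (by positivity) h1
      rw [Real.log_pow, ← le_div_iff₀ hlog2'] at h2
      exact Nat.lt_succ_of_le ((Nat.le_floor_iff (by positivity)).2 h2)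
    have hωj : ω ∉ bad j := fun hcon => hω (by
      simp only [Set.mem_iUnion]
      exact ⟨j, Finset.mem_range.2 hjN, hcon⟩)
    have hTj1 : 2 * A * h ≤ T j := by
      simp only [T]
      rw [le_div_iff₀ (by positivity)]
      rw [le_div_iff₀ h0] at hj1
      nlinarith
    have hTj2 : T j ≤ 4 * A * h := by
      simp only [T]
      rw [div_le_iff₀ (by positivity)]
      rw [div_lt_iff₀ h0, pow_succ] at hj2
      nlinarith
    refine ⟨T j, by nlinarith, fun a K ha haK => ?_⟩
    have hK0 : 0 ≤ K := (haK 0).1.trans (haK 0).2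
    refine (hbad2 j hjN ω hωj a K ha haK).trans (mul_le_mul_of_nonneg_left ?_ hK0)
    rw [mul_assoc (26 : ℝ), ← Real.sqrt_mul (by positivity)]
    refine mul_le_mul_of_nonneg_left (Real.sqrt_le_sqrt ?_) (by norm_num)
    calc κ * LL * (n * (c * (2 * T j))) ≤ κ * LL * (n * (c * (2 * (4 * A * h)))) := by gcongr
      _ = _ := by ring

/-- V is an affine function of a weight G with values in [0, 1], and φ is a difference of antitone
functions, so the antitone bound applies to each piece. The truncation to [-T, T) is harmless,
because φ(x / h) vanishes for |x| > A h and A h < T. -/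
theorem exists_bad_set_antiDiff {Ω 𝒲 : Type*} [MeasurableSpace Ω] [MeasurableSpace 𝒲]
    {μ : Measure Ω} [IsProbabilityMeasure μ] {W : ℕ → Ω → 𝒲} (hW : IsIID μ W) {xc : 𝒲 → ℝ}
    (hx : Measurable xc) {V : 𝒲 → ℝ} (hV : Measurable V) {B : ℝ} (hVB : ∀ w, |V w| ≤ B)
    {A c hmax : ℝ} (hA : 0 < A) (hc0 : 0 < c) (hm0 : 0 < hmax)
    (hm1 : hmax ≤ Real.exp (-Real.exp 1))
    (hc : ∀ s t, -(2 * A * hmax) ≤ s → s ≤ t → t ≤ 2 * A * hmax →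
      μ.real {ω | xc (W 0 ω) ∈ Set.Ico s t} ≤ c * (t - s)) {hlo : ℕ → ℝ}
    (hlo0 : ∀ n, 0 < hlo n) (hlo1 : ∀ n, hlo n ≤ hmax)
    (hrate : Tendsto (fun n : ℕ => n * hlo n / Real.log (Real.log (hlo n)⁻¹) ^ 3) atTop atTop)
    {φ : ℝ → ℝ} (hφ : AntiDiff φ) (hφA : ∀ u, A < |u| → φ u = 0) {δ : ℝ} (hδ : 0 < δ) :
    ∃ C : ℝ, ∀ᶠ n : ℕ in atTop, ∃ bad : Set Ω, μ.real bad ≤ δ ∧ ∀ ω, ω ∉ bad →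
      ∀ h, hlo n ≤ h → h ≤ hmax →
      |∑ i ∈ Finset.range n, φ (xc (W i ω) / h) * V (W i ω) -
        n * ∫ ω, φ (xc (W 0 ω) / h) * V (W 0 ω) ∂μ| ≤
        C * √(n * h * Real.log (Real.log (hlo n)⁻¹)) := by
  classical
  obtain ⟨p, q, K, hp, hq, hpK, hqK, hpq⟩ := id hφ
  set B' := |B| + 1 with hB'
  have hB0 : 0 < B' := by positivity
  have hVB' : ∀ w, |V w| ≤ B' := fun w => (hVB w).trans (by linarith [le_abs_self B])
  let G : 𝒲 → ℝ := fun w => (V w + B') / (2 * B')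
  have hG : Measurable G := (hV.add_const _).div_const _
  have hG0 : ∀ w, 0 ≤ G w := fun w =>
    div_nonneg (by linarith [(abs_le.1 (hVB' w)).1]) (by positivity)
  have hG1 : ∀ w, G w ≤ 1 := fun w =>
    (div_le_one (by positivity)).2 (by linarith [(abs_le.1 (hVB' w)).2])
  obtain ⟨C₁, h₁⟩ := exists_bad_set_antitone hW hx hG hG0 hG1 hA hc0 hm0 hm1 hc hlo0 hlo1 hrate
    (half_pos hδ)
  obtain ⟨C₂, h₂⟩ := exists_bad_set_antitone hW hx (G := fun _ => 1) measurable_const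
    (fun _ => zero_le_one) (fun _ => le_rfl) hA hc0 hm0 hm1 hc hlo0 hlo1 hrate (half_pos hδ)
  refine ⟨2 * B' * (2 * (K * C₁)) + B' * (2 * (K * C₂)), ?_⟩
  filter_upwards [h₁, h₂] with n hn₁ hn₂
  obtain ⟨bad₁, hb₁, hn₁⟩ := hn₁
  obtain ⟨bad₂, hb₂, hn₂⟩ := hn₂
  refine ⟨bad₁ ∪ bad₂, (measureReal_union_le _ _).trans (by linarith), ?_⟩
  intro ω hω h hh1 hh2
  have h0 : 0 < h := (hlo0 n).trans_le hh1
  have hWm := hW.1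
  have hmono : ∀ a : ℝ → ℝ, Antitone a → Antitone fun x => a (x / h) := fun a ha x y hxy =>
    ha (div_le_div_of_nonneg_right hxy h0.le)
  set R := √(n * h * Real.log (Real.log (hlo n)⁻¹)) with hR
  have key : ∀ (g : 𝒲 → ℝ) (C : ℝ), Measurable g → (∃ L, ∀ w, |g w| ≤ L) → (∃ T, A * h < T ∧
      ∀ (a : ℝ → ℝ) (K : ℝ), Antitone a → (∀ u, 0 ≤ a u ∧ a u ≤ K) →
      |∑ i ∈ Finset.range n, (Set.Ico (-T) T).indicator a (xc (W i ω)) * g (W i ω) -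
        n * ∫ ω, (Set.Ico (-T) T).indicator a (xc (W 0 ω)) * g (W 0 ω) ∂μ| ≤
        K * (C * R)) →
      |∑ i ∈ Finset.range n, φ (xc (W i ω) / h) * g (W i ω) -
        n * ∫ ω, φ (xc (W 0 ω) / h) * g (W 0 ω) ∂μ| ≤ 2 * (K * C) * R := by
    rintro g C hg ⟨L, hL⟩ ⟨T, hT, hTa⟩
    have e1 := hTa (fun x => p (x / h)) K (hmono p hp) fun u => hpK _
    have e2 := hTa (fun x => q (x / h)) K (hmono q hq) fun u => hqK _
    have hpt : ∀ w, φ (xc w / h) * g w =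
        (Set.Ico (-T) T).indicator (fun x => p (x / h)) (xc w) * g w -
        (Set.Ico (-T) T).indicator (fun x => q (x / h)) (xc w) * g w := by
      intro w
      by_cases hw : xc w ∈ Set.Ico (-T) T
      · rw [Set.indicator_of_mem hw, Set.indicator_of_mem hw, hpq]; ring
      · rw [Set.indicator_of_notMem hw, Set.indicator_of_notMem hw, hφA]
        · ring
        · rw [abs_div, abs_of_pos h0, lt_div_iff₀ h0]
          refine hT.trans_le ?_
          by_contra hcon
          have := abs_lt.1 (not_le.1 hcon)
          exact hw ⟨this.1.le, this.2⟩
    have hint : ∀ a : ℝ → ℝ, Antitone a → (∀ u, 0 ≤ a u ∧ a u ≤ K) → Integrable (fun ω =>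
        (Set.Ico (-T) T).indicator (fun x => a (x / h)) (xc (W 0 ω)) * g (W 0 ω)) μ := by
      intro a ha haK
      refine Integrable.of_bound (((((hmono a ha).measurable.indicator
        measurableSet_Ico).comp hx).mul hg).comp (hWm 0)).aestronglyMeasurable (K * L)
        (ae_of_all _ fun ω => ?_)
      have hK0 : 0 ≤ K := (haK 0).1.trans (haK 0).2
      rw [Real.norm_eq_abs, abs_mul]
      refine mul_le_mul ?_ (hL _) (abs_nonneg _) hK0
      by_cases hw : xc (W 0 ω) ∈ Set.Ico (-T) T
      · rw [Set.indicator_of_mem hw, abs_of_nonneg (haK _).1]; exact (haK _).2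
      · rw [Set.indicator_of_notMem hw, abs_zero]; exact hK0
    simp only [hpt]
    rw [integral_sub (hint p hp hpK) (hint q hq hqK), Finset.sum_sub_distrib]
    refine le_trans (le_of_eq ?_) ((abs_sub _ _).trans ((add_le_add e1 e2).trans (le_of_eq ?_)))
    · congr 1; ring
    · ring
  have k₁ := key G C₁ hG ⟨1, fun w => by rw [abs_of_nonneg (hG0 w)]; exact hG1 w⟩
    (hn₁ ω (fun hc => hω (Or.inl hc)) h hh1 hh2)
  have k₂ := key (fun _ => 1) C₂ measurable_const ⟨1, fun w => by simp⟩
    (hn₂ ω (fun hc => hω (Or.inr hc)) h hh1 hh2)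
  have hφm := hφ.measurable
  obtain ⟨Kφ, hKφ0, hKφ⟩ := hφ.bounded
  have hint : ∀ g : 𝒲 → ℝ, Measurable g → (∀ w, |g w| ≤ 1) →
      Integrable (fun ω => φ (xc (W 0 ω) / h) * g (W 0 ω)) μ := by
    intro g hg hg1
    refine Integrable.of_bound (((hφm.comp (hx.div_const h)).mul hg).comp
      (hWm 0)).aestronglyMeasurable (Kφ * 1) (ae_of_all _ fun ω => ?_)
    rw [Real.norm_eq_abs, abs_mul]
    exact mul_le_mul (hKφ _) (hg1 _) (abs_nonneg _) hKφ0
  have hV' : ∀ w, V w = 2 * B' * G w - B' * 1 := fun w => by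
    simp only [G]
    field_simp
    ring
  have hpt : ∀ w, φ (xc w / h) * V w =
      2 * B' * (φ (xc w / h) * G w) - B' * (φ (xc w / h) * 1) := fun w => by
    rw [hV' w]; ring
  simp only [hpt]
  rw [integral_sub ((hint G hG fun w => by
      rw [abs_of_nonneg (hG0 w)]; exact hG1 w).const_mul _)
    ((hint (fun _ => 1) measurable_const fun _ => by simp).const_mul _),
    integral_const_mul, integral_const_mul, Finset.sum_sub_distrib, ← Finset.mul_sum,
    ← Finset.mul_sum]
  have f1 := mul_le_mul_of_nonneg_left k₁ (by positivity : 0 ≤ 2 * B')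
  have f2 := mul_le_mul_of_nonneg_left k₂ hB0.le
  rw [← abs_of_pos (by positivity : 0 < 2 * B'), ← abs_mul,
    abs_of_pos (by positivity : 0 < 2 * B')] at f1
  rw [← abs_of_pos hB0, ← abs_mul, abs_of_pos hB0] at f2
  refine le_trans (le_of_eq ?_) ((abs_sub _ _).trans ((add_le_add f1 f2).trans (le_of_eq ?_)))
  · congr 1; ring
  · ring


/-! ### Approximation along a filter -/

open Asymptotics in
/-- `p` is bounded along `l` and `g` differs from `p` by `O(δ)`. -/
def Approx {ι : Type*} (l : Filter ι) (δ g p : ι → ℝ) : Prop :=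
  p =O[l] (fun _ => (1 : ℝ)) ∧ (fun i => g i - p i) =O[l] δ

/-- `p` is bounded away from zero along `l`. -/
def Away {ι : Type*} (l : Filter ι) (p : ι → ℝ) : Prop := ∃ c : ℝ, 0 < c ∧ ∀ᶠ i in l, c ≤ |p i|

theorem Away.isBigO_inv {ι : Type*} {l : Filter ι} {p : ι → ℝ} (h : Away l p) :
    (fun i => (p i)⁻¹) =O[l] (fun _ => (1 : ℝ)) := by
  obtain ⟨c, hc, h⟩ := h
  refine Asymptotics.IsBigO.of_bound c⁻¹ ?_
  filter_upwards [h] with i hi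
  rw [norm_inv, Real.norm_eq_abs, norm_one, mul_one]
  exact inv_anti₀ hc hi

theorem Away.ne_zero {ι : Type*} {l : Filter ι} {p : ι → ℝ} (h : Away l p) :
    ∀ᶠ i in l, p i ≠ 0 := by
  obtain ⟨c, hc, h⟩ := h
  filter_upwards [h] with i hi h0
  rw [h0, abs_zero] at hi
  linarith

namespace Approx

variable {ι : Type*} {l : Filter ι} {δ : ι → ℝ}

theorem const (c : ℝ) : Approx l δ (fun _ => c) fun _ => c :=
  ⟨Asymptotics.isBigO_const_const _ one_ne_zero _, by
    simpa using Asymptotics.isBigO_zero _ _⟩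

theorem add {g p g' p' : ι → ℝ} (h : Approx l δ g p) (h' : Approx l δ g' p') :
    Approx l δ (fun i => g i + g' i) fun i => p i + p' i :=
  ⟨h.1.add h'.1, (h.2.add h'.2).congr_left fun i => by ring⟩

theorem neg {g p : ι → ℝ} (h : Approx l δ g p) : Approx l δ (fun i => -g i) fun i => -p i :=
  ⟨h.1.neg_left, h.2.neg_left.congr_left fun i => by ring⟩

theorem sub {g p g' p' : ι → ℝ} (h : Approx l δ g p) (h' : Approx l δ g' p') :
    Approx l δ (fun i => g i - g' i) fun i => p i - p' i :=
  ⟨h.1.sub h'.1, (h.2.sub h'.2).congr_left fun i => by ring⟩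

theorem sum {κ : Type*} (s : Finset κ) {g p : κ → ι → ℝ} (h : ∀ k ∈ s, Approx l δ (g k) (p k)) :
    Approx l δ (fun i => ∑ k ∈ s, g k i) fun i => ∑ k ∈ s, p k i :=
  ⟨Asymptotics.IsBigO.fun_sum fun k hk => (h k hk).1,
    (Asymptotics.IsBigO.fun_sum fun k hk => (h k hk).2).congr_left fun i => by
      rw [Finset.sum_sub_distrib]⟩

theorem isBigO_delta_one (hδ : Tendsto δ l (𝓝 0)) : δ =O[l] fun _ => (1 : ℝ) :=
  hδ.isBigO_one ℝ

theorem isBigO_left (hδ : Tendsto δ l (𝓝 0)) {g p : ι → ℝ} (h : Approx l δ g p) :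
    g =O[l] fun _ => (1 : ℝ) :=
  (h.1.add (h.2.trans (isBigO_delta_one hδ))).congr_left fun i => by ring

theorem mul (hδ : Tendsto δ l (𝓝 0)) {g p g' p' : ι → ℝ} (h : Approx l δ g p)
    (h' : Approx l δ g' p') : Approx l δ (fun i => g i * g' i) fun i => p i * p' i := by
  refine ⟨by simpa using h.1.mul h'.1, ?_⟩
  have h1 := (h.isBigO_left hδ).mul h'.2
  have h2 := h.2.mul h'.1
  simp only [one_mul, mul_one] at h1 h2
  exact (h1.add h2).congr_left fun i => by ring

theorem away {g p : ι → ℝ} (hδ : Tendsto δ l (𝓝 0)) (h : Approx l δ g p) (hp : Away l p) :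
    Away l g := by
  obtain ⟨c, hc, hp⟩ := hp
  have h0 : Tendsto (fun i => g i - p i) l (𝓝 0) := h.2.trans_tendsto hδ
  refine ⟨c / 2, half_pos hc, ?_⟩
  filter_upwards [hp, (Metric.tendsto_nhds.1 h0) (c / 2) (half_pos hc)] with i h1 h2
  rw [Real.dist_eq, sub_zero] at h2
  have := abs_sub_abs_le_abs_sub (p i) (g i)
  rw [abs_sub_comm] at this
  linarith

theorem inv (hδ : Tendsto δ l (𝓝 0)) {g p : ι → ℝ} (h : Approx l δ g p) (hp : Away l p) :
    Approx l δ (fun i => (g i)⁻¹) fun i => (p i)⁻¹ := by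
  have hg := h.away hδ hp
  refine ⟨hp.isBigO_inv, ?_⟩
  have h1 := (hg.isBigO_inv.mul hp.isBigO_inv).mul h.2.neg_left
  simp only [one_mul] at h1
  refine h1.congr' ?_ EventuallyEq.rfl
  filter_upwards [hg.ne_zero, hp.ne_zero] with i h1 h2
  field_simp
  ring

theorem div (hδ : Tendsto δ l (𝓝 0)) {g p g' p' : ι → ℝ} (h : Approx l δ g p)
    (h' : Approx l δ g' p') (hp : Away l p') :
    Approx l δ (fun i => g i / g' i) fun i => p i / p' i := by
  simpa [div_eq_mul_inv] using h.mul hδ (h'.inv hδ hp)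

theorem abs {g p : ι → ℝ} (h : Approx l δ g p) : Approx l δ (fun i => |g i|) fun i => |p i| :=
  ⟨h.1.abs_left, (Asymptotics.IsBigO.of_bound 1 (Eventually.of_forall fun i => by
    simpa using abs_abs_sub_abs_le_abs_sub (g i) (p i))).trans h.2⟩

theorem sqrt (hδ : Tendsto δ l (𝓝 0)) {g p : ι → ℝ} (h : Approx l δ g p) {c : ℝ} (hc : 0 < c)
    (hp : ∀ᶠ i in l, c ≤ p i) : Approx l δ (fun i => √(g i)) fun i => √(p i) := by
  have h0 : Tendsto (fun i => g i - p i) l (𝓝 0) := h.2.trans_tendsto hδ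
  have hg : ∀ᶠ i in l, 0 ≤ g i := by
    filter_upwards [hp, (Metric.tendsto_nhds.1 h0) c hc] with i h1 h2
    rw [Real.dist_eq, sub_zero] at h2
    linarith [(abs_lt.1 h2).1]
  refine ⟨?_, ?_⟩
  · obtain ⟨K, hK⟩ := h.1.bound
    refine Asymptotics.IsBigO.of_bound (√K) ?_
    filter_upwards [hK, hp] with i h1 h2
    rw [norm_one, mul_one, Real.norm_eq_abs] at *
    rw [abs_of_nonneg (Real.sqrt_nonneg _)]
    exact Real.sqrt_le_sqrt ((le_abs_self _).trans h1)
  · refine (Asymptotics.IsBigO.of_bound (√c)⁻¹ ?_).trans h.2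
    filter_upwards [hp, hg] with i h1 h2
    have h3 : √c ≤ √(p i) := Real.sqrt_le_sqrt h1
    have h4 : 0 < √c := Real.sqrt_pos.2 hc
    have h5 : (√(g i) - √(p i)) * (√(g i) + √(p i)) = g i - p i := by
      have e1 := Real.mul_self_sqrt h2
      have e2 := Real.mul_self_sqrt (hc.le.trans h1)
      nlinarith
    rw [Real.norm_eq_abs, Real.norm_eq_abs, ← h5, abs_mul, inv_mul_eq_div, le_div_iff₀ h4]
    refine mul_le_mul_of_nonneg_left ?_ (abs_nonneg _)
    rw [abs_of_nonneg (by positivity)]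
    linarith [Real.sqrt_nonneg (g i)]

end Approx

/-! ### The estimators as functions of weighted averages

On each side `b` (`true` above the cutoff, `false` below), `M b p r` stands for a weighted average
of `z p * F r`, with regressors `z = (1, u)` and features `F = (y, d, 1, u)`, and `N b p q r s` for
an average of `z p * z q * F r * F s` with squared weights. -/

/-- Determinant of the Gram matrix. -/
def gramDet (M : Fin 2 → Fin 4 → ℝ) : ℝ := M 0 2 * M 1 3 - M 0 3 * M 1 2

/-- First row of the inverse of the Gram matrix. -/
noncomputable def gramRow (M : Fin 2 → Fin 4 → ℝ) : Fin 2 → ℝ :=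
  ![M 1 3 / gramDet M, -(M 0 3 / gramDet M)]

/-- Intercept of the regression of feature `r`. -/
noncomputable def lsIntercept (M : Fin 2 → Fin 4 → ℝ) (r : Fin 4) : ℝ :=
  (M 1 3 * M 0 r - M 0 3 * M 1 r) / gramDet M

/-- Slope of the regression of feature `r`. -/
noncomputable def lsSlope (M : Fin 2 → Fin 4 → ℝ) (r : Fin 4) : ℝ :=
  (M 0 2 * M 1 r - M 1 2 * M 0 r) / gramDet M

/-- Difference between the two intercepts. -/
noncomputable def lsJump (M : Bool → Fin 2 → Fin 4 → ℝ) (r : Fin 4) : ℝ :=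
  lsIntercept (M true) r - lsIntercept (M false) r

/-- Ratio of the jumps of `y` and `d`. -/
noncomputable def lsRatio (M : Bool → Fin 2 → Fin 4 → ℝ) : ℝ := lsJump M 0 / lsJump M 1

/-- Coefficients on the features of the residual of `y - θ d`. -/
noncomputable def residCoef (M : Bool → Fin 2 → Fin 4 → ℝ) (b : Bool) : Fin 4 → ℝ :=
  ![1, -lsRatio M, -(lsIntercept (M b) 0 - lsRatio M * lsIntercept (M b) 1),
    -(lsSlope (M b) 0 - lsRatio M * lsSlope (M b) 1)]

/-- The sandwich variance of the jump of `y - θ d`. -/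
noncomputable def sandwich (M : Bool → Fin 2 → Fin 4 → ℝ)
    (N : Bool → Fin 2 → Fin 2 → Fin 4 → Fin 4 → ℝ) : ℝ :=
  ∑ b, ∑ p, ∑ q, ∑ r, ∑ s, gramRow (M b) p * gramRow (M b) q *
    (residCoef M b r * residCoef M b s) * N b p q r s

/-- `1` above the cutoff and `-1` below. -/
def sideSign (b : Bool) : ℝ := if b then 1 else -1

/-- The normal equations: the residuals of y and of d are orthogonal to both regressors, hence so is
any combination of them. -/
theorem sum_residCoef_mul {M : Bool → Fin 2 → Fin 4 → ℝ} {b : Bool} (h : gramDet (M b) ≠ 0)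
    (p : Fin 2) : ∑ r, residCoef M b r * M b p r = 0 := by
  have h1 : lsIntercept (M b) 0 * M b p 2 + lsSlope (M b) 0 * M b p 3 = M b p 0 := by
    unfold lsIntercept lsSlope
    rw [div_mul_eq_mul_div, div_mul_eq_mul_div, ← add_div, div_eq_iff h]
    unfold gramDet
    fin_cases p <;> simp only [Fin.zero_eta, Fin.mk_one] <;> ring
  have h2 : lsIntercept (M b) 1 * M b p 2 + lsSlope (M b) 1 * M b p 3 = M b p 1 := by
    unfold lsIntercept lsSlope
    rw [div_mul_eq_mul_div, div_mul_eq_mul_div, ← add_div, div_eq_iff h]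
    unfold gramDet
    fin_cases p <;> simp only [Fin.zero_eta, Fin.mk_one] <;> ring
  simp only [residCoef, Fin.sum_univ_four, Matrix.cons_val]
  rw [← h1, ← h2]
  ring

/-- The first row of the inverse Gram matrix sends the moments of a feature to its intercept; the
constant feature has intercept 1 and the linear one intercept 0. -/
theorem sum_gramRow_mul {M : Fin 2 → Fin 4 → ℝ} (h : gramDet M ≠ 0) (c : Fin 4 → ℝ) :
    ∑ p, gramRow M p * ∑ r, c r * M p r =
      c 0 * lsIntercept M 0 + c 1 * lsIntercept M 1 + c 2 := by
  have h2 : gramRow M 0 * M 0 2 + gramRow M 1 * M 1 2 = 1 := by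
    simp only [gramRow, Matrix.cons_val]
    rw [← sub_eq_zero]
    field_simp
    unfold gramDet
    ring
  simp only [Fin.sum_univ_two, Fin.sum_univ_four]
  have h3 : gramRow M 0 * M 0 3 + gramRow M 1 * M 1 3 = 0 := by
    simp only [gramRow, Matrix.cons_val]
    ring
  have h4 : ∀ r, gramRow M 0 * M 0 r + gramRow M 1 * M 1 r = lsIntercept M r := fun r => by
    simp only [gramRow, lsIntercept, Matrix.cons_val]
    ring
  rw [← h4, ← h4]
  linear_combination c 2 * h2 + c 3 * h3

/-- An exact identity, not an expansion. The constant terms of the two sides combine to minus the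
jump of y - θ d under m with θ = `lsRatio m`, which is zero; what is left is the jump of y - θ d
under M. -/
theorem sum_sideSign_gramRow_mul {M m : Bool → Fin 2 → Fin 4 → ℝ} (h : ∀ b, gramDet (M b) ≠ 0)
    (hj : lsJump M 1 ≠ 0) (hj' : lsJump m 1 ≠ 0) :
    ∑ b, sideSign b * ∑ p, gramRow (M b) p * ∑ r, residCoef m b r * M b p r =
      (lsRatio M - lsRatio m) * lsJump M 1 := by
  simp only [Fintype.sum_bool, sum_gramRow_mul (h _), sideSign, residCoef, Matrix.cons_val]
  have e1 : lsRatio M * lsJump M 1 = lsJump M 0 := div_mul_cancel₀ _ hj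
  have e2 : lsRatio m * lsJump m 1 = lsJump m 0 := div_mul_cancel₀ _ hj'
  rw [sub_mul, e1]
  unfold lsJump at *
  simp only [if_true, Bool.false_eq_true, if_false]
  linear_combination e2

section

variable {ι : Type*} {l : Filter ι} {δ : ι → ℝ}
  {M m : ι → Bool → Fin 2 → Fin 4 → ℝ} {N ν : ι → Bool → Fin 2 → Fin 2 → Fin 4 → Fin 4 → ℝ}

theorem approx_gramDet (hδ : Tendsto δ l (𝓝 0))
    (hM : ∀ b p r, Approx l δ (fun i => M i b p r) fun i => m i b p r) (b : Bool) :
    Approx l δ (fun i => gramDet (M i b)) fun i => gramDet (m i b) :=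
  ((hM b 0 2).mul hδ (hM b 1 3)).sub ((hM b 0 3).mul hδ (hM b 1 2))

theorem approx_gramRow (hδ : Tendsto δ l (𝓝 0))
    (hM : ∀ b p r, Approx l δ (fun i => M i b p r) fun i => m i b p r) {b : Bool}
    (hd : Away l fun i => gramDet (m i b)) (p : Fin 2) :
    Approx l δ (fun i => gramRow (M i b) p) fun i => gramRow (m i b) p := by
  have h := approx_gramDet hδ hM b
  fin_cases p
  · exact (hM b 1 3).div hδ h hd
  · exact ((hM b 0 3).div hδ h hd).neg

theorem approx_lsIntercept (hδ : Tendsto δ l (𝓝 0))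
    (hM : ∀ b p r, Approx l δ (fun i => M i b p r) fun i => m i b p r) {b : Bool}
    (hd : Away l fun i => gramDet (m i b)) (r : Fin 4) :
    Approx l δ (fun i => lsIntercept (M i b) r) fun i => lsIntercept (m i b) r :=
  (((hM b 1 3).mul hδ (hM b 0 r)).sub ((hM b 0 3).mul hδ (hM b 1 r))).div hδ
    (approx_gramDet hδ hM b) hd

theorem approx_lsSlope (hδ : Tendsto δ l (𝓝 0))
    (hM : ∀ b p r, Approx l δ (fun i => M i b p r) fun i => m i b p r) {b : Bool}
    (hd : Away l fun i => gramDet (m i b)) (r : Fin 4) :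
    Approx l δ (fun i => lsSlope (M i b) r) fun i => lsSlope (m i b) r :=
  (((hM b 0 2).mul hδ (hM b 1 r)).sub ((hM b 1 2).mul hδ (hM b 0 r))).div hδ
    (approx_gramDet hδ hM b) hd

theorem approx_lsJump (hδ : Tendsto δ l (𝓝 0))
    (hM : ∀ b p r, Approx l δ (fun i => M i b p r) fun i => m i b p r)
    (hd : ∀ b, Away l fun i => gramDet (m i b)) (r : Fin 4) :
    Approx l δ (fun i => lsJump (M i) r) fun i => lsJump (m i) r :=
  (approx_lsIntercept hδ hM (hd true) r).sub (approx_lsIntercept hδ hM (hd false) r)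

theorem approx_lsRatio (hδ : Tendsto δ l (𝓝 0))
    (hM : ∀ b p r, Approx l δ (fun i => M i b p r) fun i => m i b p r)
    (hd : ∀ b, Away l fun i => gramDet (m i b)) (hj : Away l fun i => lsJump (m i) 1) :
    Approx l δ (fun i => lsRatio (M i)) fun i => lsRatio (m i) :=
  (approx_lsJump hδ hM hd 0).div hδ (approx_lsJump hδ hM hd 1) hj

theorem approx_residCoef (hδ : Tendsto δ l (𝓝 0))
    (hM : ∀ b p r, Approx l δ (fun i => M i b p r) fun i => m i b p r)
    (hd : ∀ b, Away l fun i => gramDet (m i b)) (hj : Away l fun i => lsJump (m i) 1)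
    (b : Bool) (r : Fin 4) :
    Approx l δ (fun i => residCoef (M i) b r) fun i => residCoef (m i) b r := by
  have h := approx_lsRatio hδ hM hd hj
  fin_cases r
  · exact Approx.const 1
  · exact h.neg
  · exact ((approx_lsIntercept hδ hM (hd b) 0).sub
      (h.mul hδ (approx_lsIntercept hδ hM (hd b) 1))).neg
  · exact ((approx_lsSlope hδ hM (hd b) 0).sub (h.mul hδ (approx_lsSlope hδ hM (hd b) 1))).neg

theorem approx_sandwich (hδ : Tendsto δ l (𝓝 0))
    (hM : ∀ b p r, Approx l δ (fun i => M i b p r) fun i => m i b p r)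
    (hN : ∀ b p q r s, Approx l δ (fun i => N i b p q r s) fun i => ν i b p q r s)
    (hd : ∀ b, Away l fun i => gramDet (m i b)) (hj : Away l fun i => lsJump (m i) 1) :
    Approx l δ (fun i => sandwich (M i) (N i)) fun i => sandwich (m i) (ν i) :=
  Approx.sum _ fun b _ => Approx.sum _ fun p _ => Approx.sum _ fun q _ => Approx.sum _ fun r _ =>
    Approx.sum _ fun s _ => ((((approx_gramRow hδ hM (hd b) p).mul hδ
      (approx_gramRow hδ hM (hd b) q)).mul hδ ((approx_residCoef hδ hM hd hj b r).mul hδ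
      (approx_residCoef hδ hM hd hj b s))).mul hδ (hN b p q r s))

/-- The sign of the jump of `d` over the standard deviation. -/
noncomputable def studentScale (M : Bool → Fin 2 → Fin 4 → ℝ)
    (N : Bool → Fin 2 → Fin 2 → Fin 4 → Fin 4 → ℝ) : ℝ :=
  |lsJump M 1| / lsJump M 1 / √(sandwich M N)

theorem approx_studentScale (hδ : Tendsto δ l (𝓝 0))
    (hM : ∀ b p r, Approx l δ (fun i => M i b p r) fun i => m i b p r)
    (hN : ∀ b p q r s, Approx l δ (fun i => N i b p q r s) fun i => ν i b p q r s)
    (hd : ∀ b, Away l fun i => gramDet (m i b)) (hj : Away l fun i => lsJump (m i) 1) {c : ℝ}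
    (hc : 0 < c) (hs : ∀ᶠ i in l, c ≤ sandwich (m i) (ν i)) :
    Approx l δ (fun i => studentScale (M i) (N i)) fun i => studentScale (m i) (ν i) := by
  have h := approx_lsJump hδ hM hd 1
  refine (h.abs.div hδ h hj).div hδ ((approx_sandwich hδ hM hN hd hj).sqrt hδ hc hs)
    ⟨√c, Real.sqrt_pos.2 hc, ?_⟩
  filter_upwards [hs] with i hi
  rw [abs_of_nonneg (Real.sqrt_nonneg _)]
  exact Real.sqrt_le_sqrt hi

/-- Quadratic remainder in the linearization of the studentized ratio of jumps. -/
theorem studentized_expansion (hδ : Tendsto δ l (𝓝 0))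
    (hM : ∀ b p r, Approx l δ (fun i => M i b p r) fun i => m i b p r)
    (hN : ∀ b p q r s, Approx l δ (fun i => N i b p q r s) fun i => ν i b p q r s)
    (hd : ∀ b, Away l fun i => gramDet (m i b)) (hj : Away l fun i => lsJump (m i) 1) {c : ℝ}
    (hc : 0 < c) (hs : ∀ᶠ i in l, c ≤ sandwich (m i) (ν i)) :
    (fun i => (lsRatio (M i) - lsRatio (m i)) / √(sandwich (M i) (N i) / lsJump (M i) 1 ^ 2) -
      studentScale (m i) (ν i) * ∑ b, sideSign b * ∑ p, gramRow (m i b) p *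
        ∑ r, residCoef (m i) b r * M i b p r) =O[l] fun i => δ i ^ 2 := by
  have hsc := approx_studentScale hδ hM hN hd hj hc hs
  -- The score vanishes at m by the normal equations, so its value at M is linear in M - m and hence
  -- O(δ).
  have hscore : ∀ b p, (fun i => ∑ r, residCoef (m i) b r * M i b p r) =O[l] δ := by
    intro b p
    have h1 : (fun i => ∑ r, residCoef (m i) b r * (M i b p r - m i b p r)) =O[l] δ :=
      Asymptotics.IsBigO.fun_sum fun r _ => by
        have := (approx_residCoef hδ hM hd hj b r).1.mul (hM b p r).2
        simpa using this
    refine h1.congr' ?_ EventuallyEq.rfl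
    filter_upwards [(hd b).ne_zero] with i hi
    simp only [mul_sub, Finset.sum_sub_distrib]
    rw [sum_residCoef_mul hi, sub_zero]
  -- Replacing the weights at m by those at M is a change of O(δ), multiplied by scores that are
  -- O(δ).
  have hrem : (fun i => ∑ b, sideSign b * ∑ p, (studentScale (M i) (N i) * gramRow (M i b) p -
      studentScale (m i) (ν i) * gramRow (m i b) p) * ∑ r, residCoef (m i) b r * M i b p r)
      =O[l] fun i => δ i ^ 2 := by
    refine Asymptotics.IsBigO.fun_sum fun b _ => Asymptotics.IsBigO.const_mul_left
      (Asymptotics.IsBigO.fun_sum fun p _ => ?_) _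
    have := (hsc.mul hδ (approx_gramRow hδ hM (hd b) p)).2.mul (hscore b p)
    simpa [sq] using this
  refine hrem.congr' ?_ EventuallyEq.rfl
  have hdet : ∀ b, ∀ᶠ i in l, gramDet (M i b) ≠ 0 := fun b =>
    ((approx_gramDet hδ hM b).away hδ (hd b)).ne_zero
  have hjM := (approx_lsJump hδ hM hd 1).away hδ hj
  filter_upwards [hdet true, hdet false, hjM.ne_zero, hj.ne_zero] with i h1 h2 h3 h4
  have e := sum_sideSign_gramRow_mul (M := M i) (m := m i)
    (fun b => by cases b; exacts [h2, h1]) h3 h4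
  have e1 : ∑ b, sideSign b * ∑ p, (studentScale (M i) (N i) * gramRow (M i b) p -
      studentScale (m i) (ν i) * gramRow (m i b) p) * ∑ r, residCoef (m i) b r * M i b p r =
      studentScale (M i) (N i) * (∑ b, sideSign b * ∑ p, gramRow (M i b) p *
        ∑ r, residCoef (m i) b r * M i b p r) -
      studentScale (m i) (ν i) * ∑ b, sideSign b * ∑ p, gramRow (m i b) p *
        ∑ r, residCoef (m i) b r * M i b p r := by
    simp only [Finset.mul_sum, ← Finset.sum_sub_distrib]
    refine Finset.sum_congr rfl fun b _ => Finset.sum_congr rfl fun p _ =>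
      Finset.sum_congr rfl fun r _ => by ring
  rw [e1, e]
  congr 1
  rw [studentScale, Real.sqrt_div' _ (sq_nonneg _), Real.sqrt_sq_eq_abs]
  have h5 : |lsJump (M i) 1| ≠ 0 := abs_ne_zero.2 h3
  field_simp

end


/-! ### Explicit least squares fits -/

/-- Completing the square: s₀ times the excess loss over the candidate is a sum of squares with
positive weights. The minimizer is therefore unique, and the choice made by `Classical.epsilon` is
determined. -/
theorem epsilon_forall_le_eq {L : ℝ × ℝ → ℝ} {c t₀ t₁ s₀ s₁ s₂ : ℝ}
    (hL : ∀ p : ℝ × ℝ, L p = c - 2 * p.1 * t₀ - 2 * p.2 * t₁ + p.1 ^ 2 * s₀ +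
      2 * p.1 * p.2 * s₁ + p.2 ^ 2 * s₂) (h₀ : 0 < s₀) (hd : 0 < s₀ * s₂ - s₁ * s₁) :
    (Classical.epsilon fun p => ∀ q, L p ≤ L q) =
      ((s₂ * t₀ - s₁ * t₁) / (s₀ * s₂ - s₁ * s₁), (s₀ * t₁ - s₁ * t₀) / (s₀ * s₂ - s₁ * s₁)) := by
  set D := s₀ * s₂ - s₁ * s₁ with hD
  set α := (s₂ * t₀ - s₁ * t₁) / D with hα
  set β := (s₀ * t₁ - s₁ * t₀) / D with hβ
  have e₀ : t₀ = α * s₀ + β * s₁ := by rw [hα, hβ]; field_simp; rw [hD]; ring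
  have e₁ : t₁ = α * s₁ + β * s₂ := by rw [hα, hβ]; field_simp; rw [hD]; ring
  have hdiff : ∀ q : ℝ × ℝ, s₀ * (L q - L (α, β)) =
      (s₀ * (q.1 - α) + s₁ * (q.2 - β)) ^ 2 + D * (q.2 - β) ^ 2 := by
    intro q
    rw [hL, hL, e₀, e₁, hD]
    ring
  have hmin : ∀ q, L (α, β) ≤ L q := by
    intro q
    have h1 : 0 ≤ s₀ * (L q - L (α, β)) := by rw [hdiff]; positivity
    linarith [nonneg_of_mul_nonneg_right h1 h₀]
  have hspec := Classical.epsilon_spec (p := fun p => ∀ q, L p ≤ L q) ⟨_, hmin⟩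
  set e := Classical.epsilon fun p => ∀ q, L p ≤ L q with he
  have h1 := hdiff e
  have h2 : L e - L (α, β) ≤ 0 := by linarith [hspec (α, β)]
  have h3 : s₀ * (L e - L (α, β)) ≤ 0 := mul_nonpos_of_nonneg_of_nonpos h₀.le h2
  have h4 : D * (e.2 - β) ^ 2 ≤ 0 := by nlinarith [sq_nonneg (s₀ * (e.1 - α) + s₁ * (e.2 - β))]
  have h5 : (e.2 - β) ^ 2 = 0 := le_antisymm (by nlinarith) (sq_nonneg _)
  have h6 : e.2 - β = 0 := by simpa using h5
  have h7 : (s₀ * (e.1 - α)) ^ 2 ≤ 0 := by rw [h6] at h1; nlinarith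
  have h8 : s₀ * (e.1 - α) = 0 := by simpa using le_antisymm h7 (sq_nonneg _)
  have h9 : e.1 - α = 0 := (mul_eq_zero.1 h8).resolve_left h₀.ne'
  exact Prod.ext (by linarith) (by linarith)

/-- The half-line above (`true`) or below (`false`) the cutoff. -/
def side (b : Bool) : Set ℝ := if b then Set.Ici 0 else Set.Iio 0

theorem div_mem_side {b : Bool} {x h : ℝ} (hh : 0 < h) : x / h ∈ side b ↔ x ∈ side b := by
  cases b
  · simp [side, div_neg_iff, hh, not_lt.2 hh.le]
  · simp [side, div_nonneg_iff, hh.le, not_le.2 hh]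

theorem measurableSet_side (b : Bool) : MeasurableSet (side b) := by
  cases b
  · exact measurableSet_Iio
  · exact measurableSet_Ici

/-- The kernel on one side, times a power. -/
noncomputable def sideKernel (k : ℝ → ℝ) (b : Bool) (j : ℕ) (u : ℝ) : ℝ :=
  (side b).indicator k u * u ^ j

theorem weight_eq (k : ℝ → ℝ) (b : Bool) {h : ℝ} (hh : 0 < h) (x : ℝ) :
    weight k (side b) h x = (side b).indicator k (x / h) := by
  unfold weight
  by_cases hx : x ∈ side b
  · rw [Set.indicator_of_mem hx, Set.indicator_of_mem ((div_mem_side hh).2 hx)]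
  · rw [Set.indicator_of_notMem hx, Set.indicator_of_notMem (mt (div_mem_side hh).1 hx)]

theorem weight_sq_eq (k : ℝ → ℝ) (b : Bool) {h : ℝ} (hh : 0 < h) (x : ℝ) :
    weight k (side b) h x ^ 2 = (side b).indicator (fun u => k u ^ 2) (x / h) := by
  rw [weight_eq k b hh]
  by_cases hx : x / h ∈ side b <;> simp [hx]

/-- Local sample moment. -/
noncomputable def sampleMoment (k : ℝ → ℝ) (b : Bool) (h : ℝ) (n : ℕ) (x v : ℕ → ℝ) (j : ℕ) : ℝ :=
  (n * h)⁻¹ * ∑ i ∈ Finset.range n, sideKernel k b j (x i / h) * v i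

/-- Local population moment. -/
noncomputable def popMoment {Ω : Type*} [MeasurableSpace Ω] (μ : Measure Ω) (k : ℝ → ℝ) (b : Bool)
    (h : ℝ) (X V : Ω → ℝ) (j : ℕ) : ℝ :=
  h⁻¹ * ∫ ω, sideKernel k b j (X ω / h) * V ω ∂μ

/-- The features `(y, d, 1, u)` without the powers of `u`. -/
def rawFeature (y d : ℝ) : Fin 4 → ℝ := ![y, d, 1, 1]

/-- The powers of `u` in the features `(y, d, 1, u)`. -/
def featureExp : Fin 4 → ℕ := ![0, 0, 0, 1]

/-- Sample averages of the products of regressors and features. -/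
noncomputable def sampleGram (k : ℝ → ℝ) (h : ℝ) (n : ℕ) (x y d : ℕ → ℝ) (b : Bool) (p : Fin 2)
    (r : Fin 4) : ℝ :=
  sampleMoment k b h n x (fun i => rawFeature (y i) (d i) r) (p + featureExp r)

/-- Sample averages of the products of two regressors and two features, with squared weights. -/
noncomputable def sampleMeat (k : ℝ → ℝ) (h : ℝ) (n : ℕ) (x y d : ℕ → ℝ) (b : Bool) (p q : Fin 2)
    (r s : Fin 4) : ℝ :=
  sampleMoment (fun u => k u ^ 2) b h n x
    (fun i => rawFeature (y i) (d i) r * rawFeature (y i) (d i) s)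
    (p + q + (featureExp r + featureExp s))

/-- Population counterpart of `sampleGram`. -/
noncomputable def popGram {Ω : Type*} [MeasurableSpace Ω] (μ : Measure Ω) (k : ℝ → ℝ)
    (X Y D : Ω → ℝ) (h : ℝ) (b : Bool) (p : Fin 2) (r : Fin 4) : ℝ :=
  popMoment μ k b h X (fun ω => rawFeature (Y ω) (D ω) r) (p + featureExp r)

/-- Population counterpart of `sampleMeat`. -/
noncomputable def popMeat {Ω : Type*} [MeasurableSpace Ω] (μ : Measure Ω) (k : ℝ → ℝ)
    (X Y D : Ω → ℝ) (h : ℝ) (b : Bool) (p q : Fin 2) (r s : Fin 4) : ℝ :=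
  popMoment μ (fun u => k u ^ 2) b h X
    (fun ω => rawFeature (Y ω) (D ω) r * rawFeature (Y ω) (D ω) s)
    (p + q + (featureExp r + featureExp s))

theorem sum_weight_mul_pow {k : ℝ → ℝ} {b : Bool} {h : ℝ} (hh : 0 < h) {n : ℕ} (hn : 0 < n)
    (x v : ℕ → ℝ) (j : ℕ) :
    ∑ i ∈ Finset.range n, weight k (side b) h (x i) * v i * x i ^ j =
      n * h * (h ^ j * sampleMoment k b h n x v j) := by
  have hn' : (0 : ℝ) < n := by exact_mod_cast hn
  unfold sampleMoment
  rw [show (n : ℝ) * h * (h ^ j * (((n : ℝ) * h)⁻¹ * ∑ i ∈ Finset.range n,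
    sideKernel k b j (x i / h) * v i)) = h ^ j * ∑ i ∈ Finset.range n,
    sideKernel k b j (x i / h) * v i by field_simp, Finset.mul_sum]
  refine Finset.sum_congr rfl fun i _ => ?_
  rw [weight_eq k b hh, sideKernel, div_pow]
  field_simp

/-- The moments are in units of u = x / h, which leaves the intercept alone and divides the slope by
h. -/
theorem sampleFit_eq {k : ℝ → ℝ} {b : Bool} {h : ℝ} (hh : 0 < h) {n : ℕ} (hn : 0 < n)
    (x v : ℕ → ℝ) {a₀ a₁ a₂ : ℝ} (ha₀ : a₀ = sampleMoment k b h n x (fun _ => 1) 0)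
    (ha₁ : a₁ = sampleMoment k b h n x (fun _ => 1) 1)
    (ha₂ : a₂ = sampleMoment k b h n x (fun _ => 1) 2) (h₀ : 0 < a₀)
    (hd : 0 < a₀ * a₂ - a₁ * a₁) :
    sampleFit k (side b) h n x v =
      ((a₂ * sampleMoment k b h n x v 0 - a₁ * sampleMoment k b h n x v 1) /
        (a₀ * a₂ - a₁ * a₁),
      (a₀ * sampleMoment k b h n x v 1 - a₁ * sampleMoment k b h n x v 0) /
        (a₀ * a₂ - a₁ * a₁) / h) := by
  have hn' : (0 : ℝ) < n := by exact_mod_cast hn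
  have hnh : 0 < n * h := by positivity
  have hloss : ∀ p : ℝ × ℝ, sampleLoss k (side b) h n x v p =
      (∑ i ∈ Finset.range n, weight k (side b) h (x i) * v i * v i) -
      2 * p.1 * (n * h * sampleMoment k b h n x v 0) -
      2 * p.2 * (n * h * (h * sampleMoment k b h n x v 1)) +
      p.1 ^ 2 * (n * h * a₀) + 2 * p.1 * p.2 * (n * h * (h * a₁)) +
      p.2 ^ 2 * (n * h * (h ^ 2 * a₂)) := by
    intro p
    have s0 := sum_weight_mul_pow (k := k) (b := b) hh hn x (fun _ => 1) 0
    have s1 := sum_weight_mul_pow (k := k) (b := b) hh hn x (fun _ => 1) 1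
    have s2 := sum_weight_mul_pow (k := k) (b := b) hh hn x (fun _ => 1) 2
    have t0 := sum_weight_mul_pow (k := k) (b := b) hh hn x v 0
    have t1 := sum_weight_mul_pow (k := k) (b := b) hh hn x v 1
    simp only [pow_zero, one_mul, mul_one, pow_one] at s0 s1 s2 t0 t1
    rw [ha₀, ha₁, ha₂, ← s0, ← s1, ← s2, ← t0, ← t1]
    unfold sampleLoss
    simp only [Finset.mul_sum, ← Finset.sum_sub_distrib, ← Finset.sum_add_distrib]
    exact Finset.sum_congr rfl fun i _ => by ring
  unfold sampleFit
  have hD : n * h * a₀ * (n * h * (h ^ 2 * a₂)) - n * h * (h * a₁) * (n * h * (h * a₁)) =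
      (n * h) ^ 2 * h ^ 2 * (a₀ * a₂ - a₁ * a₁) := by ring
  rw [epsilon_forall_le_eq hloss (by positivity) (by rw [hD]; positivity), hD]
  have hd' := hd.ne'
  refine Prod.ext ?_ ?_
  · simp only
    field_simp
  · simp only
    field_simp

theorem popFit_eq {Ω : Type*} [MeasurableSpace Ω] {μ : Measure Ω} [IsProbabilityMeasure μ]
    {k : ℝ → ℝ} {b : Bool} {h : ℝ} (hh : 0 < h) {X V : Ω → ℝ} (hX : Measurable X)
    (hV : Measurable V) {B : ℝ} (hVB : ∀ᵐ ω ∂μ, |V ω| ≤ B)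
    (hk : ∀ j, Measurable (sideKernel k b j))
    (hkb : ∀ j, ∃ K, ∀ u, |sideKernel k b j u| ≤ K) {a₀ a₁ a₂ : ℝ}
    (ha₀ : a₀ = popMoment μ k b h X (fun _ => 1) 0)
    (ha₁ : a₁ = popMoment μ k b h X (fun _ => 1) 1)
    (ha₂ : a₂ = popMoment μ k b h X (fun _ => 1) 2) (h₀ : 0 < a₀)
    (hd : 0 < a₀ * a₂ - a₁ * a₁) :
    popFit μ k (side b) h X V =
      ((a₂ * popMoment μ k b h X V 0 - a₁ * popMoment μ k b h X V 1) / (a₀ * a₂ - a₁ * a₁),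
      (a₀ * popMoment μ k b h X V 1 - a₁ * popMoment μ k b h X V 0) /
        (a₀ * a₂ - a₁ * a₁) / h) := by
  have hint : ∀ (j : ℕ) (U : Ω → ℝ), Measurable U → (∃ K, ∀ᵐ ω ∂μ, |U ω| ≤ K) →
      Integrable (fun ω => sideKernel k b j (X ω / h) * U ω) μ := by
    rintro j U hU ⟨K, hK⟩
    obtain ⟨K', hK'⟩ := hkb j
    refine Integrable.of_bound (((hk j).comp (hX.div_const h)).mul hU).aestronglyMeasurable
      (K' * K) ?_
    filter_upwards [hK] with ω hω
    rw [Real.norm_eq_abs, abs_mul]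
    exact mul_le_mul (hK' _) hω (abs_nonneg _) ((abs_nonneg _).trans (hK' 0))
  have h1 : ∃ K, ∀ᵐ ω ∂μ, |(fun _ : Ω => (1 : ℝ)) ω| ≤ K := ⟨1, by simp⟩
  have hV2 : ∃ K, ∀ᵐ ω ∂μ, |V ω * V ω| ≤ K := by
    refine ⟨B * B, ?_⟩
    filter_upwards [hVB] with ω hω
    rw [abs_mul]
    exact mul_le_mul hω hω (abs_nonneg _) ((abs_nonneg _).trans hω)
  have hloss : ∀ p : ℝ × ℝ, popLoss μ k (side b) h X V p =
      (∫ ω, sideKernel k b 0 (X ω / h) * (V ω * V ω) ∂μ) -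
      2 * p.1 * (h * popMoment μ k b h X V 0) -
      2 * p.2 * (h * (h * popMoment μ k b h X V 1)) +
      p.1 ^ 2 * (h * a₀) + 2 * p.1 * p.2 * (h * (h * a₁)) + p.2 ^ 2 * (h * (h ^ 2 * a₂)) := by
    intro p
    have hpm : ∀ U j, h * popMoment μ k b h X U j = ∫ ω, sideKernel k b j (X ω / h) * U ω ∂μ :=
      fun U j => by unfold popMoment; field_simp
    have hpt : ∀ ω, (V ω - p.1 - p.2 * X ω) ^ 2 * weight k (side b) h (X ω) =
        sideKernel k b 0 (X ω / h) * (V ω * V ω) -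
        2 * p.1 * (sideKernel k b 0 (X ω / h) * V ω) -
        2 * p.2 * h * (sideKernel k b 1 (X ω / h) * V ω) +
        p.1 ^ 2 * (sideKernel k b 0 (X ω / h) * 1) +
        2 * p.1 * p.2 * h * (sideKernel k b 1 (X ω / h) * 1) +
        p.2 ^ 2 * h ^ 2 * (sideKernel k b 2 (X ω / h) * 1) := by
      intro ω
      rw [weight_eq k b hh]
      simp only [sideKernel]
      field_simp
      ring
    have i0 := hint 0 (fun ω => V ω * V ω) (hV.mul hV) hV2
    have i1 := (hint 0 V hV ⟨B, hVB⟩).const_mul (2 * p.1)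
    have i2 := (hint 1 V hV ⟨B, hVB⟩).const_mul (2 * p.2 * h)
    have i3 := (hint 0 _ measurable_const h1).const_mul (p.1 ^ 2)
    have i4 := (hint 1 _ measurable_const h1).const_mul (2 * p.1 * p.2 * h)
    have i5 := (hint 2 _ measurable_const h1).const_mul (p.2 ^ 2 * h ^ 2)
    unfold popLoss
    simp only [hpt]
    have j1 : Integrable (fun ω => sideKernel k b 0 (X ω / h) * (V ω * V ω) -
      2 * p.1 * (sideKernel k b 0 (X ω / h) * V ω)) μ := i0.sub i1
    have j2 : Integrable (fun ω => sideKernel k b 0 (X ω / h) * (V ω * V ω) -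
      2 * p.1 * (sideKernel k b 0 (X ω / h) * V ω) -
      2 * p.2 * h * (sideKernel k b 1 (X ω / h) * V ω)) μ := j1.sub i2
    have j3 : Integrable (fun ω => sideKernel k b 0 (X ω / h) * (V ω * V ω) -
      2 * p.1 * (sideKernel k b 0 (X ω / h) * V ω) -
      2 * p.2 * h * (sideKernel k b 1 (X ω / h) * V ω) +
      p.1 ^ 2 * (sideKernel k b 0 (X ω / h) * 1)) μ := j2.add i3
    have j4 : Integrable (fun ω => sideKernel k b 0 (X ω / h) * (V ω * V ω) -
      2 * p.1 * (sideKernel k b 0 (X ω / h) * V ω) -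
      2 * p.2 * h * (sideKernel k b 1 (X ω / h) * V ω) +
      p.1 ^ 2 * (sideKernel k b 0 (X ω / h) * 1) +
      2 * p.1 * p.2 * h * (sideKernel k b 1 (X ω / h) * 1)) μ := j3.add i4
    rw [integral_add j4 i5, integral_add j3 i4, integral_add j2 i3, integral_sub j1 i2,
      integral_sub i0 i1]
    simp only [integral_const_mul]
    rw [ha₀, ha₁, ha₂]
    rw [← hpm V 0, ← hpm V 1, ← hpm (fun _ => 1) 0, ← hpm (fun _ => 1) 1, ← hpm (fun _ => 1) 2]
    ring
  unfold popFit
  have hD : h * a₀ * (h * (h ^ 2 * a₂)) - h * (h * a₁) * (h * (h * a₁)) =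
      h ^ 2 * h ^ 2 * (a₀ * a₂ - a₁ * a₁) := by ring
  rw [epsilon_forall_le_eq hloss (by positivity) (by rw [hD]; positivity), hD]
  have hd' := hd.ne'
  refine Prod.ext ?_ ?_
  · simp only
    field_simp
  · simp only
    field_simp

/-! ### The sandwich formula -/

theorem nh_mul_ehwIntercept {k : ℝ → ℝ} {b : Bool} {h : ℝ} (hh : 0 < h) {n : ℕ} (hn : 0 < n)
    (x ρ : ℕ → ℝ) {a₀ a₁ a₂ : ℝ} (ha₀ : a₀ = sampleMoment k b h n x (fun _ => 1) 0)
    (ha₁ : a₁ = sampleMoment k b h n x (fun _ => 1) 1)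
    (ha₂ : a₂ = sampleMoment k b h n x (fun _ => 1) 2)
    (hd : 0 < a₀ * a₂ - a₁ * a₁) :
    n * h * ehwIntercept k (side b) h n x ρ =
      (a₂ ^ 2 * sampleMoment (fun u => k u ^ 2) b h n x (fun i => ρ i ^ 2) 0 -
        2 * a₁ * a₂ * sampleMoment (fun u => k u ^ 2) b h n x (fun i => ρ i ^ 2) 1 +
        a₁ ^ 2 * sampleMoment (fun u => k u ^ 2) b h n x (fun i => ρ i ^ 2) 2) /
        (a₀ * a₂ - a₁ * a₁) ^ 2 := by
  have hn' : (0 : ℝ) < n := by exact_mod_cast hn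
  have hnh : 0 < n * h := by positivity
  have s0 := sum_weight_mul_pow (k := k) (b := b) hh hn x (fun _ => 1) 0
  have s1 := sum_weight_mul_pow (k := k) (b := b) hh hn x (fun _ => 1) 1
  have s2 := sum_weight_mul_pow (k := k) (b := b) hh hn x (fun _ => 1) 2
  simp only [pow_zero, one_mul, mul_one, pow_one] at s0 s1 s2
  rw [← ha₀] at s0
  rw [← ha₁] at s1
  rw [← ha₂] at s2
  have hw2 : ∀ j, ∑ i ∈ Finset.range n, weight k (side b) h (x i) ^ 2 * ρ i ^ 2 * x i ^ j =
      n * h * (h ^ j * sampleMoment (fun u => k u ^ 2) b h n x (fun i => ρ i ^ 2) j) := by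
    intro j
    rw [← sum_weight_mul_pow (k := fun u => k u ^ 2) (b := b) hh hn]
    refine Finset.sum_congr rfl fun i _ => ?_
    rw [weight_sq_eq k b hh, weight_eq _ b hh]
  have v0 := hw2 0
  have v1 := hw2 1
  have v2 := hw2 2
  simp only [pow_zero, one_mul, mul_one, pow_one] at v0 v1 v2
  set m₀ := sampleMoment (fun u => k u ^ 2) b h n x (fun i => ρ i ^ 2) 0
  set m₁ := sampleMoment (fun u => k u ^ 2) b h n x (fun i => ρ i ^ 2) 1
  set m₂ := sampleMoment (fun u => k u ^ 2) b h n x (fun i => ρ i ^ 2) 2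
  have hG : ∑ i ∈ Finset.range n, weight k (side b) h (x i) • !![1, x i; x i, x i ^ 2] =
      !![n * h * a₀, n * h * (h * a₁); n * h * (h * a₁), n * h * (h ^ 2 * a₂)] := by
    ext i j
    rw [Matrix.sum_apply]
    fin_cases i <;> fin_cases j <;> simp [s0, s1, s2]
  have hV : ∑ i ∈ Finset.range n, (weight k (side b) h (x i) ^ 2 * ρ i ^ 2) •
      !![1, x i; x i, x i ^ 2] =
      !![n * h * m₀, n * h * (h * m₁); n * h * (h * m₁), n * h * (h ^ 2 * m₂)] := by
    ext i j
    rw [Matrix.sum_apply]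
    fin_cases i <;> fin_cases j <;> simp [v0, v1, v2]
  unfold ehwIntercept
  simp only [hG, hV]
  have hdet : (n : ℝ) * h * a₀ * (n * h * (h ^ 2 * a₂)) - n * h * (h * a₁) * (n * h * (h * a₁)) =
      (n * h * h) ^ 2 * (a₀ * a₂ - a₁ * a₁) := by ring
  have hd' := hd.ne'
  simp only [Matrix.inv_def, Matrix.det_fin_two_of, Matrix.adjugate_fin_two_of, Ring.inverse_eq_inv',
    hdet, Matrix.smul_mul, Matrix.smul_apply, smul_eq_mul, Matrix.mul_apply,
    Fin.sum_univ_two, Matrix.of_apply, Matrix.cons_val', Matrix.cons_val_zero,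
    Matrix.cons_val_one, Matrix.cons_val_fin_one]
  field_simp
  ring


/-! ### Estimators and standard errors as functions of local averages. -/

section

variable {k : ℝ → ℝ} {h : ℝ} {n : ℕ} {x y d : ℕ → ℝ}

theorem gramDet_sampleGram (b : Bool) : gramDet (sampleGram k h n x y d b) =
    sampleMoment k b h n x (fun _ => 1) 0 * sampleMoment k b h n x (fun _ => 1) 2 -
      sampleMoment k b h n x (fun _ => 1) 1 * sampleMoment k b h n x (fun _ => 1) 1 := rfl

theorem sampleFit_y (hh : 0 < h) (hn : 0 < n) {b : Bool} (h₀ : 0 < sampleGram k h n x y d b 0 2)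
    (hd : 0 < gramDet (sampleGram k h n x y d b)) :
    sampleFit k (side b) h n x y = (lsIntercept (sampleGram k h n x y d b) 0,
      lsSlope (sampleGram k h n x y d b) 0 / h) :=
  sampleFit_eq hh hn x y rfl rfl rfl h₀ hd

theorem sampleFit_d (hh : 0 < h) (hn : 0 < n) {b : Bool} (h₀ : 0 < sampleGram k h n x y d b 0 2)
    (hd : 0 < gramDet (sampleGram k h n x y d b)) :
    sampleFit k (side b) h n x d = (lsIntercept (sampleGram k h n x y d b) 1,
      lsSlope (sampleGram k h n x y d b) 1 / h) :=
  sampleFit_eq hh hn x d rfl rfl rfl h₀ hd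

/-- The residual needs to be a combination of the features only on its own side, because the kernel
vanishes on the other one. The sharp design relies on this, since there d is constant only within a
side. -/
theorem sampleMoment_sum_sq (b : Bool) (c : Fin 4 → ℝ) {ρ : ℕ → ℝ}
    (hρ : ∀ i, x i / h ∈ side b →
      ρ i = ∑ r, c r * (rawFeature (y i) (d i) r * (x i / h) ^ featureExp r)) (j : ℕ) :
    sampleMoment (fun u => k u ^ 2) b h n x (fun i => ρ i ^ 2) j =
      ∑ r, ∑ s, c r * c s * sampleMoment (fun u => k u ^ 2) b h n x
        (fun i => rawFeature (y i) (d i) r * rawFeature (y i) (d i) s)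
        (j + (featureExp r + featureExp s)) := by
  have hpt : ∀ i, sideKernel (fun u => k u ^ 2) b j (x i / h) * ρ i ^ 2 =
      ∑ r, ∑ s, c r * c s * (sideKernel (fun u => k u ^ 2) b (j + (featureExp r + featureExp s))
        (x i / h) * (rawFeature (y i) (d i) r * rawFeature (y i) (d i) s)) := by
    intro i
    by_cases hi : x i / h ∈ side b
    · rw [hρ i hi, sq, Finset.sum_mul_sum, Finset.mul_sum]
      refine Finset.sum_congr rfl fun r _ => ?_
      rw [Finset.mul_sum]
      refine Finset.sum_congr rfl fun s _ => ?_
      simp only [sideKernel, pow_add]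
      ring
    · simp [sideKernel, Set.indicator_of_notMem hi]
  unfold sampleMoment
  simp only [hpt]
  rw [Finset.sum_comm, Finset.mul_sum]
  refine Finset.sum_congr rfl fun r _ => ?_
  rw [Finset.sum_comm, Finset.mul_sum]
  refine Finset.sum_congr rfl fun s _ => ?_
  rw [← Finset.mul_sum]
  ring

theorem nh_mul_ehwIntercept_eq (hh : 0 < h) (hn : 0 < n) {b : Bool}
    (hd : 0 < gramDet (sampleGram k h n x y d b)) (c : Fin 4 → ℝ) {ρ : ℕ → ℝ}
    (hρ : ∀ i, x i / h ∈ side b →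
      ρ i = ∑ r, c r * (rawFeature (y i) (d i) r * (x i / h) ^ featureExp r)) :
    n * h * ehwIntercept k (side b) h n x ρ =
      ∑ p, ∑ q, ∑ r, ∑ s, gramRow (sampleGram k h n x y d b) p *
        gramRow (sampleGram k h n x y d b) q * (c r * c s) * sampleMeat k h n x y d b p q r s := by
  rw [nh_mul_ehwIntercept hh hn x ρ rfl rfl rfl hd, ← gramDet_sampleGram (y := y) (d := d)]
  have hd' := hd.ne'
  have hin : ∀ p q : Fin 2, ∑ r, ∑ s, gramRow (sampleGram k h n x y d b) p *
        gramRow (sampleGram k h n x y d b) q * (c r * c s) * sampleMeat k h n x y d b p q r s =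
      gramRow (sampleGram k h n x y d b) p * gramRow (sampleGram k h n x y d b) q *
        sampleMoment (fun u => k u ^ 2) b h n x (fun i => ρ i ^ 2) (p + q) := by
    intro p q
    rw [sampleMoment_sum_sq b c hρ, Finset.mul_sum]
    refine Finset.sum_congr rfl fun r _ => ?_
    rw [Finset.mul_sum]
    exact Finset.sum_congr rfl fun s _ => by unfold sampleMeat; ring
  simp only [hin, Fin.sum_univ_two]
  set m : ℕ → ℝ := fun j => sampleMoment (fun u => k u ^ 2) b h n x (fun i => ρ i ^ 2) j with hm
  have r0 : gramRow (sampleGram k h n x y d b) 0 =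
      sampleMoment k b h n x (fun _ => 1) 2 / gramDet (sampleGram k h n x y d b) := rfl
  have r1 : gramRow (sampleGram k h n x y d b) 1 =
      -(sampleMoment k b h n x (fun _ => 1) 1 / gramDet (sampleGram k h n x y d b)) := rfl
  rw [r0, r1]
  have z0 : ((0 : Fin 2) : ℕ) = 0 := rfl
  have z1 : ((1 : Fin 2) : ℕ) = 1 := rfl
  simp only [z0, z1, zero_add, add_zero, one_add_one_eq_two]
  field_simp
  ring

theorem fuzzyEst_eq (hh : 0 < h) (hn : 0 < n)
    (h₀ : ∀ b, 0 < sampleGram k h n x y d b 0 2)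
    (hd : ∀ b, 0 < gramDet (sampleGram k h n x y d b)) :
    fuzzyEst k h n x d y = lsRatio (sampleGram k h n x y d) := by
  have ht : Set.Ici (0 : ℝ) = side true := rfl
  have hf : Set.Iio (0 : ℝ) = side false := rfl
  unfold fuzzyEst sampleJump
  rw [ht, hf, sampleFit_y hh hn (h₀ true) (hd true), sampleFit_y hh hn (h₀ false) (hd false),
    sampleFit_d hh hn (h₀ true) (hd true), sampleFit_d hh hn (h₀ false) (hd false)]
  rfl

theorem fuzzySigma_eq (hh : 0 < h) (hn : 0 < n)
    (h₀ : ∀ b, 0 < sampleGram k h n x y d b 0 2)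
    (hd : ∀ b, 0 < gramDet (sampleGram k h n x y d b)) :
    fuzzySigma k h n x d y = √(sandwich (sampleGram k h n x y d) (sampleMeat k h n x y d) /
      lsJump (sampleGram k h n x y d) 1 ^ 2) := by
  have ht : Set.Ici (0 : ℝ) = side true := rfl
  have hf : Set.Iio (0 : ℝ) = side false := rfl
  have hres : ∀ b i, fuzzyResid k (side b) h n x d y i =
      ∑ r, residCoef (sampleGram k h n x y d) b r *
        (rawFeature (y i) (d i) r * (x i / h) ^ featureExp r) := by
    intro b i
    unfold fuzzyResid sampleResid
    rw [fuzzyEst_eq hh hn h₀ hd, sampleFit_y hh hn (h₀ b) (hd b), sampleFit_d hh hn (h₀ b) (hd b)]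
    simp only [Fin.sum_univ_four, residCoef, rawFeature, featureExp, Matrix.cons_val]
    ring
  unfold fuzzySigma
  rw [mul_add, ht, hf, nh_mul_ehwIntercept_eq hh hn (hd true) _ fun i _ => hres true i,
    nh_mul_ehwIntercept_eq hh hn (hd false) _ fun i _ => hres false i]
  congr 2
  · rw [sandwich, Fintype.sum_bool]
  · congr 1
    unfold sampleJump
    rw [ht, hf, sampleFit_d hh hn (h₀ true) (hd true), sampleFit_d hh hn (h₀ false) (hd false)]
    rfl

/-- A feature with the same moments as a constant c has the fitted line c + 0 · u. The deterministic
treatment of the sharp design is handled this way. -/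
theorem lsIntercept_const {M : Fin 2 → Fin 4 → ℝ} {c : ℝ} (hd : gramDet M ≠ 0)
    (h : ∀ p, M p 1 = c * M p 2) : lsIntercept M 1 = c ∧ lsSlope M 1 = 0 := by
  unfold lsIntercept lsSlope
  rw [h, h, div_eq_iff hd]
  refine ⟨?_, ?_⟩
  · unfold gramDet; ring
  · rw [show M 0 2 * (c * M 1 2) - M 1 2 * (c * M 0 2) = 0 by ring, zero_div]

theorem lsIntercept_sampleGram_indicator {b : Bool} (hh : 0 < h)
    (hdx : ∀ i, d i = if 0 ≤ x i then 1 else 0)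
    (hd : 0 < gramDet (sampleGram k h n x y d b)) :
    lsIntercept (sampleGram k h n x y d b) 1 = (if b then 1 else 0) ∧
      lsSlope (sampleGram k h n x y d b) 1 = 0 := by
  refine lsIntercept_const hd.ne' fun p => ?_
  unfold sampleGram sampleMoment
  rw [mul_left_comm (if b then 1 else 0)]
  refine congrArg _ ?_
  rw [Finset.mul_sum]
  refine Finset.sum_congr rfl fun i _ => ?_
  by_cases hi : x i / h ∈ side b
  · rw [div_mem_side hh] at hi
    have e : d i = if b then 1 else 0 := by
      rw [hdx]
      cases b
      · simp only [side, Bool.false_eq_true, if_false, Set.mem_Iio] at hi ⊢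
        rw [if_neg (not_le.2 hi)]
      · simp only [side, if_true, Set.mem_Ici] at hi ⊢
        rw [if_pos hi]
    simp only [rawFeature, featureExp, Matrix.cons_val, e]
    ring
  · simp [sideKernel, Set.indicator_of_notMem hi]

/-- With d = 1{x ≥ 0} the jump of d is 1 and d is fitted perfectly on each side. The ratio is then
the jump of y, and subtracting θ d leaves the residuals unchanged. -/
theorem sharp_eq (hh : 0 < h) (hn : 0 < n) (hdx : ∀ i, d i = if 0 ≤ x i then 1 else 0)
    (h₀ : ∀ b, 0 < sampleGram k h n x y d b 0 2)
    (hd : ∀ b, 0 < gramDet (sampleGram k h n x y d b)) :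
    sampleJump k h n x y = lsRatio (sampleGram k h n x y d) ∧
    sharpSigma k h n x y = √(sandwich (sampleGram k h n x y d) (sampleMeat k h n x y d) /
      lsJump (sampleGram k h n x y d) 1 ^ 2) := by
  have ht : Set.Ici (0 : ℝ) = side true := rfl
  have hf : Set.Iio (0 : ℝ) = side false := rfl
  have hjump : lsJump (sampleGram k h n x y d) 1 = 1 := by
    unfold lsJump
    rw [(lsIntercept_sampleGram_indicator hh hdx (hd true)).1,
      (lsIntercept_sampleGram_indicator hh hdx (hd false)).1]
    simp
  refine ⟨?_, ?_⟩
  · unfold lsRatio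
    rw [hjump, div_one]
    unfold sampleJump
    rw [ht, hf, sampleFit_y (y := y) (d := d) hh hn (h₀ true) (hd true),
      sampleFit_y (y := y) (d := d) hh hn (h₀ false) (hd false)]
    rfl
  · have hres : ∀ b i, x i / h ∈ side b → sampleResid k (side b) h n x y i =
        ∑ r, residCoef (sampleGram k h n x y d) b r *
          (rawFeature (y i) (d i) r * (x i / h) ^ featureExp r) := by
      intro b i hi
      rw [div_mem_side hh] at hi
      have e : d i = if b then 1 else 0 := by
        rw [hdx]
        cases b
        · simp only [side, Bool.false_eq_true, if_false, Set.mem_Iio] at hi ⊢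
          rw [if_neg (not_le.2 hi)]
        · simp only [side, if_true, Set.mem_Ici] at hi ⊢
          rw [if_pos hi]
      unfold sampleResid
      rw [sampleFit_y (y := y) (d := d) hh hn (h₀ b) (hd b)]
      simp only [Fin.sum_univ_four, residCoef, rawFeature, featureExp, Matrix.cons_val,
        (lsIntercept_sampleGram_indicator hh hdx (hd b)).1,
        (lsIntercept_sampleGram_indicator hh hdx (hd b)).2, e]
      ring
    unfold sharpSigma
    rw [mul_add, ht, hf, nh_mul_ehwIntercept_eq hh hn (hd true) _ fun i => hres true i,
      nh_mul_ehwIntercept_eq hh hn (hd false) _ fun i => hres false i, hjump]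
    rw [sandwich, Fintype.sum_bool, one_pow, div_one]

end

/-! ### Population targets as functions of local moments. -/

section

variable {Ω : Type*} [MeasurableSpace Ω] {μ : Measure Ω} [IsProbabilityMeasure μ] {k : ℝ → ℝ}
  {h : ℝ} {X Y D : Ω → ℝ}

theorem fuzzyTarget_eq (hh : 0 < h) (hX : Measurable X) (hY : Measurable Y) (hD : Measurable D)
    {B : ℝ} (hYB : ∀ᵐ ω ∂μ, |Y ω| ≤ B) (hDB : ∀ᵐ ω ∂μ, |D ω| ≤ B)
    (hk : ∀ b j, Measurable (sideKernel k b j))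
    (hkb : ∀ b j, ∃ K, ∀ u, |sideKernel k b j u| ≤ K)
    (h₀ : ∀ b, 0 < popGram μ k X Y D h b 0 2) (hd : ∀ b, 0 < gramDet (popGram μ k X Y D h b)) :
    fuzzyTarget μ k X D Y h = lsRatio (popGram μ k X Y D h) := by
  have hfY : ∀ b, popFit μ k (side b) h X Y = (lsIntercept (popGram μ k X Y D h b) 0,
      lsSlope (popGram μ k X Y D h b) 0 / h) := fun b =>
    popFit_eq hh hX hY hYB (hk b) (hkb b) rfl rfl rfl (h₀ b) (hd b)
  have hfD : ∀ b, popFit μ k (side b) h X D = (lsIntercept (popGram μ k X Y D h b) 1,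
      lsSlope (popGram μ k X Y D h b) 1 / h) := fun b =>
    popFit_eq hh hX hD hDB (hk b) (hkb b) rfl rfl rfl (h₀ b) (hd b)
  have ht : Set.Ici (0 : ℝ) = side true := rfl
  have hf : Set.Iio (0 : ℝ) = side false := rfl
  unfold fuzzyTarget popJump
  rw [ht, hf, hfY, hfY, hfD, hfD]
  rfl

theorem popJump_eq (hh : 0 < h) (hX : Measurable X) (hY : Measurable Y)
    {B : ℝ} (hYB : ∀ᵐ ω ∂μ, |Y ω| ≤ B) (hDX : ∀ ω, D ω = if 0 ≤ X ω then 1 else 0)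
    (hk : ∀ b j, Measurable (sideKernel k b j))
    (hkb : ∀ b j, ∃ K, ∀ u, |sideKernel k b j u| ≤ K)
    (h₀ : ∀ b, 0 < popGram μ k X Y D h b 0 2) (hd : ∀ b, 0 < gramDet (popGram μ k X Y D h b)) :
    popJump μ k h X Y = lsRatio (popGram μ k X Y D h) := by
  have hfY : ∀ b, popFit μ k (side b) h X Y = (lsIntercept (popGram μ k X Y D h b) 0,
      lsSlope (popGram μ k X Y D h b) 0 / h) := fun b =>
    popFit_eq hh hX hY hYB (hk b) (hkb b) rfl rfl rfl (h₀ b) (hd b)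
  have hD1 : ∀ b, lsIntercept (popGram μ k X Y D h b) 1 = if b then 1 else 0 := by
    intro b
    refine (lsIntercept_const (hd b).ne' fun p => ?_).1
    unfold popGram popMoment
    rw [mul_left_comm (if b then 1 else 0)]
    refine congrArg _ ?_
    rw [← integral_const_mul]
    refine integral_congr_ae (ae_of_all _ fun ω => ?_)
    by_cases hi : X ω / h ∈ side b
    · rw [div_mem_side hh] at hi
      have e : D ω = if b then 1 else 0 := by
        rw [hDX]
        cases b
        · simp only [side, Bool.false_eq_true, if_false, Set.mem_Iio] at hi ⊢
          rw [if_neg (not_le.2 hi)]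
        · simp only [side, if_true, Set.mem_Ici] at hi ⊢
          rw [if_pos hi]
      simp only [rawFeature, featureExp, Matrix.cons_val, e]
      ring
    · simp [sideKernel, Set.indicator_of_notMem hi]
  have ht : Set.Ici (0 : ℝ) = side true := rfl
  have hf : Set.Iio (0 : ℝ) = side false := rfl
  have hjump : lsJump (popGram μ k X Y D h) 1 = 1 := by
    unfold lsJump
    rw [hD1, hD1]
    simp
  unfold lsRatio
  rw [hjump, div_one]
  unfold popJump
  rw [ht, hf, hfY, hfY]
  rfl

end


/-! ### Conditional means and densities -/

theorem integral_mul_condMean {Ω : Type*} [mΩ : MeasurableSpace Ω] {μ : Measure Ω}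
    [IsProbabilityMeasure μ] {X V : Ω → ℝ} (hX : Measurable X) (hV : Integrable V μ) {m : ℝ → ℝ}
    (hm : IsCondMean μ X V m) {g : ℝ → ℝ} (hg : Measurable g) {K : ℝ} (hK : ∀ u, |g u| ≤ K) :
    ∫ ω, g (X ω) * V ω ∂μ = ∫ ω, g (X ω) * m (X ω) ∂μ := by
  have hle : MeasurableSpace.comap X inferInstance ≤ mΩ := hX.comap_le
  have hgs : StronglyMeasurable[MeasurableSpace.comap X inferInstance] fun ω => g (X ω) :=
    (hg.comp (comap_measurable X)).stronglyMeasurable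
  have hint : Integrable (fun ω => g (X ω) * V ω) μ :=
    hV.bdd_mul (hg.comp hX).aestronglyMeasurable (ae_of_all _ fun ω => hK (X ω))
  have h1 := condExp_mul_of_stronglyMeasurable_left hgs hint hV
  rw [← integral_condExp hle]
  refine integral_congr_ae ?_
  filter_upwards [h1, hm.2] with ω h1 h2
  rw [h2]
  exact h1

theorem integral_comp_of_density {Ω : Type*} [MeasurableSpace Ω] {μ : Measure Ω} {X : Ω → ℝ}
    (hX : Measurable X) {f : ℝ → ℝ} (hf : Measurable f) (hf0 : ∀ x, 0 ≤ f x)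
    (hd : μ.map X = volume.withDensity fun x => ENNReal.ofReal (f x)) {g : ℝ → ℝ}
    (hg : Measurable g) : ∫ ω, g (X ω) ∂μ = ∫ x, g x * f x := by
  rw [← integral_map hX.aemeasurable hg.aestronglyMeasurable, hd,
    integral_withDensity_eq_integral_toReal_smul hf.ennreal_ofReal
      (ae_of_all _ fun _ => ENNReal.ofReal_lt_top)]
  refine integral_congr_ae (ae_of_all _ fun x => ?_)
  simp only [ENNReal.toReal_ofReal (hf0 x), smul_eq_mul]
  ring

/-! ### One-sided local approximation -/

/-- Bandwidths `h` tending to zero together with nonzero points `x` of one side, `|x| ≤ A h`. -/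
def localFilter (A : ℝ) (b : Bool) : Filter (ℝ × ℝ) :=
  comap Prod.fst (𝓝[>] 0) ⊓ 𝓟 {p | p.2 ∈ side b ∧ p.2 ≠ 0 ∧ |p.2| ≤ A * p.1}

theorem eventually_localFilter {A : ℝ} {b : Bool} {P : ℝ → ℝ → Prop} :
    (∀ᶠ p in localFilter A b, P p.1 p.2) ↔
      ∀ᶠ h in 𝓝[>] (0 : ℝ), ∀ x ∈ side b, x ≠ 0 → |x| ≤ A * h → P h x := by
  unfold localFilter
  rw [eventually_inf_principal, eventually_comap]
  constructor
  · intro h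
    filter_upwards [h] with a ha x hx h0 hA
    exact ha (a, x) rfl ⟨hx, h0, hA⟩
  · intro h
    filter_upwards [h] with a ha p hp hp2
    subst hp
    exact ha p.2 hp2.1 hp2.2.1 hp2.2.2

/-- Locally, on side `b` of zero, `g` is within `O(ρ(h))` of the constant `c`. -/
def LocalApprox (A : ℝ) (ρ : ℝ → ℝ) (b : Bool) (g : ℝ → ℝ) (c : ℝ) : Prop :=
  Approx (localFilter A b) (fun p => ρ p.1) (fun p => g p.2) fun _ => c

theorem LocalApprox.bound {A : ℝ} {ρ : ℝ → ℝ} {b : Bool} {g : ℝ → ℝ} {c : ℝ}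
    (h : LocalApprox A ρ b g c) : ∃ K, 0 ≤ K ∧ ∀ᶠ h in 𝓝[>] (0 : ℝ), ∀ x ∈ side b, x ≠ 0 →
      |x| ≤ A * h → |g x - c| ≤ K * |ρ h| := by
  obtain ⟨K, hK, h⟩ := h.2.exists_nonneg
  exact ⟨K, hK, eventually_localFilter.1 h.bound⟩

theorem tendsto_localFilter {A : ℝ} {b : Bool} {ρ : ℝ → ℝ} (hρ : Tendsto ρ (𝓝[>] 0) (𝓝 0)) :
    Tendsto (fun p : ℝ × ℝ => ρ p.1) (localFilter A b) (𝓝 0) :=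
  hρ.comp ((tendsto_comap (f := Prod.fst)).mono_left inf_le_left)

/-- Conditioning on X and using its density turns the moment into an integral of the kernel against
f m. On |x| ≤ A h the product f m is within O(ρ(h)) of its one-sided limit, and the factor 1 / h
compensates the length 2 A h of the interval. -/
theorem approx_popMoment {Ω : Type*} [MeasurableSpace Ω] {μ : Measure Ω} [IsProbabilityMeasure μ]
    {X V : Ω → ℝ} (hX : Measurable X) (hV : Integrable V μ) {f : ℝ → ℝ} (hf : Measurable f)
    (hf0 : ∀ x, 0 ≤ f x) (hd : μ.map X = volume.withDensity fun x => ENNReal.ofReal (f x))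
    {m : ℝ → ℝ} (hm : IsCondMean μ X V m) {A : ℝ} (hA : 0 < A) {ρ : ℝ → ℝ}
    (hρ : Tendsto ρ (𝓝[>] 0) (𝓝 0)) {b : Bool} {fl ml : ℝ} (hfl : LocalApprox A ρ b f fl)
    (hml : LocalApprox A ρ b m ml) {k : ℝ → ℝ} {j : ℕ} (hk : Measurable (sideKernel k b j))
    {K : ℝ} (hK : ∀ u, |sideKernel k b j u| ≤ K) (hkA : ∀ u, A < |u| → sideKernel k b j u = 0) :
    Approx (𝓝[>] 0) ρ (fun h => popMoment μ k b h X V j)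
      fun _ => fl * ml * ∫ u, sideKernel k b j u := by
  have hprod : LocalApprox A ρ b (fun x => f x * m x) (fl * ml) :=
    Approx.mul (tendsto_localFilter hρ) hfl hml
  obtain ⟨L, hL0, hL⟩ := hprod.bound
  have hK0 : 0 ≤ K := (abs_nonneg _).trans (hK 0)
  refine ⟨Asymptotics.isBigO_const_const _ one_ne_zero _, ?_⟩
  refine Asymptotics.IsBigO.of_bound (K * L * (2 * A)) ?_
  filter_upwards [hL, self_mem_nhdsWithin] with h hLh hh
  have hh0 : 0 < h := hh
  have hgm : Measurable fun x : ℝ => sideKernel k b j (x / h) := hk.comp (measurable_id.div_const h)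
  have hzero : ∀ x, x ∉ Set.Icc (-(A * h)) (A * h) → sideKernel k b j (x / h) = 0 := by
    intro x hx
    refine hkA _ ?_
    rw [abs_div, abs_of_pos hh0, lt_div_iff₀ hh0]
    by_contra hcon
    exact hx (abs_le.1 (not_lt.1 hcon))
  have hpt : ∀ᵐ x : ℝ, ‖sideKernel k b j (x / h) * (f x * m x - fl * ml)‖ ≤
      (Set.Icc (-(A * h)) (A * h)).indicator (fun _ => K * (L * |ρ h|)) x := by
    -- The local bounds exclude x = 0, which is a null set.
    have h0 : ∀ᵐ x : ℝ, x ≠ 0 := by simp [ae_iff]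
    filter_upwards [h0] with x hx0
    rw [Real.norm_eq_abs, abs_mul]
    by_cases hx : x ∈ Set.Icc (-(A * h)) (A * h)
    · rw [Set.indicator_of_mem hx]
      by_cases hxb : x ∈ side b
      · exact mul_le_mul (hK _) (hLh x hxb hx0 (abs_le.2 hx)) (abs_nonneg _) hK0
      · rw [sideKernel, Set.indicator_of_notMem (mt (div_mem_side hh0).1 hxb)]
        simp only [zero_mul, abs_zero]
        positivity
    · rw [hzero x hx]
      simp [hx]
  have hI : Integrable ((Set.Icc (-(A * h)) (A * h)).indicator fun _ : ℝ => K * (L * |ρ h|)) :=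
    (integrable_indicator_iff measurableSet_Icc).2 continuous_const.integrableOn_Icc
  have hI1 : Integrable fun x => sideKernel k b j (x / h) * (f x * m x - fl * ml) :=
    hI.mono' (hgm.mul ((hf.mul hm.1).sub_const _)).aestronglyMeasurable hpt
  have hI2 : Integrable fun x => sideKernel k b j (x / h) * (fl * ml) := by
    refine Integrable.mul_const ?_ _
    have hI3 : Integrable ((Set.Icc (-(A * h)) (A * h)).indicator fun _ : ℝ => K) :=
      (integrable_indicator_iff measurableSet_Icc).2 continuous_const.integrableOn_Icc
    refine hI3.mono' hgm.aestronglyMeasurable (ae_of_all _ fun x => ?_)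
    by_cases hx : x ∈ Set.Icc (-(A * h)) (A * h)
    · rw [Set.indicator_of_mem hx]; exact hK _
    · rw [hzero x hx]; simp [hx]
  have e1 : ∫ ω, sideKernel k b j (X ω / h) * V ω ∂μ =
      ∫ x, sideKernel k b j (x / h) * (f x * m x) := by
    rw [integral_mul_condMean hX hV hm hgm fun u => hK _,
      integral_comp_of_density hX hf hf0 hd (g := fun x => sideKernel k b j (x / h) * m x)
        (hgm.mul hm.1)]
    exact integral_congr_ae (ae_of_all _ fun x => by ring)
  have e2 : ∫ x, sideKernel k b j (x / h) * (fl * ml) =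
      h * (fl * ml * ∫ u, sideKernel k b j u) := by
    rw [integral_mul_const, Measure.integral_comp_div (sideKernel k b j) h, abs_of_pos hh0,
      smul_eq_mul]
    ring
  have e3 : ∫ x, sideKernel k b j (x / h) * (f x * m x) =
      (∫ x, sideKernel k b j (x / h) * (f x * m x - fl * ml)) +
      ∫ x, sideKernel k b j (x / h) * (fl * ml) := by
    rw [← integral_add hI1 hI2]
    exact integral_congr_ae (ae_of_all _ fun x => by ring)
  have e4 : popMoment μ k b h X V j - fl * ml * ∫ u, sideKernel k b j u =
      h⁻¹ * ∫ x, sideKernel k b j (x / h) * (f x * m x - fl * ml) := by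
    unfold popMoment
    rw [e1, e3, e2]
    field_simp
    ring
  have e5 : ‖∫ x, sideKernel k b j (x / h) * (f x * m x - fl * ml)‖ ≤
      K * (L * |ρ h|) * (2 * (A * h)) := by
    refine (norm_integral_le_of_norm_le hI hpt).trans (le_of_eq ?_)
    rw [integral_indicator measurableSet_Icc, setIntegral_const, smul_eq_mul, Measure.real,
      Real.volume_Icc, ENNReal.toReal_ofReal (by nlinarith)]
    ring
  rw [e4, norm_mul, norm_inv, Real.norm_eq_abs, abs_of_pos hh0, inv_mul_le_iff₀ hh0]
  refine e5.trans (le_of_eq ?_)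
  rw [Real.norm_eq_abs]
  ring

/-! ### One-sided kernel moments -/

theorem sideKernel_zero_of_lt {k : ℝ → ℝ} {A : ℝ} (hk : ∀ u, A < |u| → k u = 0) (b : Bool)
    (j : ℕ) (u : ℝ) (hu : A < |u|) : sideKernel k b j u = 0 := by
  unfold sideKernel
  by_cases h : u ∈ side b <;> simp [h, hk u hu]

theorem antiDiff_side (b : Bool) : AntiDiff ((side b).indicator fun _ => 1) := by
  cases b
  · exact AntiDiff.indicator_of_isLowerSet (isLowerSet_Iio 0)
  · exact AntiDiff.indicator_of_isUpperSet (isUpperSet_Ici 0)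

theorem AntiDiff.sideKernel {k : ℝ → ℝ} {A : ℝ} (hk : AntiDiff k) (hkA : ∀ u, A < |u| → k u = 0)
    (b : Bool) (j : ℕ) : AntiDiff (sideKernel k b j) := by
  refine (hk.indicator (antiDiff_side b)).mul_pow_self (A := A) (fun u hu => ?_) j
  by_cases h : u ∈ side b <;> simp [h, hkA u hu]

theorem KernelRegular.eq_zero {k : ℝ → ℝ} {A : ℝ} (hk : KernelRegular k A) {u : ℝ}
    (hu : A < |u|) : k u = 0 := by
  by_contra h
  exact not_lt.2 (abs_le.2 (hk.support (Function.mem_support.2 h))) hu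

/-- Moments of the kernel over one side. -/
noncomputable def sideMoment (k : ℝ → ℝ) (b : Bool) (j : ℕ) : ℝ := ∫ u, sideKernel k b j u

theorem AntiDiff.integrable {φ : ℝ → ℝ} (h : AntiDiff φ) {A : ℝ} (hA : ∀ u, A < |u| → φ u = 0) :
    Integrable φ := by
  obtain ⟨K, hK0, hK⟩ := h.bounded
  have hI : Integrable ((Set.Icc (-A) A).indicator fun _ : ℝ => K) :=
    (integrable_indicator_iff measurableSet_Icc).2 continuous_const.integrableOn_Icc
  refine hI.mono' h.measurable.aestronglyMeasurable (ae_of_all _ fun x => ?_)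
  by_cases hx : x ∈ Set.Icc (-A) A
  · rw [Set.indicator_of_mem hx]; exact hK _
  · rw [hA x (by by_contra hc; exact hx (abs_le.1 (not_lt.1 hc)))]; simp [hx]

theorem sideMoment_true (k : ℝ → ℝ) (j : ℕ) : sideMoment k true j = kernelMoment k j := by
  unfold sideMoment kernelMoment
  rw [← integral_Ici_eq_integral_Ioi, ← integral_indicator measurableSet_Ici]
  refine integral_congr_ae (ae_of_all _ fun u => ?_)
  unfold sideKernel side
  by_cases hu : u ∈ Set.Ici (0 : ℝ) <;> simp [hu, mul_comm]

theorem sideMoment_false {k : ℝ → ℝ} (hk : ∀ u, k (-u) = k u) (j : ℕ) :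
    sideMoment k false j = (-1) ^ j * kernelMoment k j := by
  unfold sideMoment kernelMoment
  rw [← integral_neg_eq_self, ← integral_indicator measurableSet_Ioi, ← integral_const_mul]
  refine integral_congr_ae (ae_of_all _ fun u => ?_)
  unfold sideKernel side
  by_cases hu : u ∈ Set.Ioi (0 : ℝ)
  · have hu' : 0 < u := hu
    simp only [Bool.false_eq_true, if_false]
    rw [Set.indicator_of_mem (show -u ∈ Set.Iio (0 : ℝ) by simpa using hu'),
      Set.indicator_of_mem hu, hk, neg_pow]
    ring
  · have hu' : ¬ 0 < u := hu
    simp [hu']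

/-- The moments are the entries of the matrix of the positive definite form (a, b) ↦ ∫ (a + b u)² k
over u > 0. Its values at (1, 0), (0, 1) and (μ₁, -μ₀) give the three inequalities. -/
theorem wellPosed_moments {k : ℝ → ℝ} {A : ℝ} (hk : KernelRegular k A) (hw : WellPosed k) :
    0 < kernelMoment k 0 ∧ 0 < kernelMoment k 2 ∧
      0 < kernelMoment k 0 * kernelMoment k 2 - kernelMoment k 1 * kernelMoment k 1 := by
  have hint : ∀ j, IntegrableOn (fun u => u ^ j * k u) (Set.Ioi 0) := fun j => by
    have := (hk.antiDiff.mul_pow_self (A := A) (fun u hu => hk.eq_zero hu) j).integrable (A := A)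
      fun u hu => by rw [hk.eq_zero hu, zero_mul]
    simp only [mul_comm (k _)] at this
    exact this.integrableOn
  have hq : ∀ a b : ℝ, (a, b) ≠ (0, 0) → 0 < a ^ 2 * kernelMoment k 0 +
      2 * a * b * kernelMoment k 1 + b ^ 2 * kernelMoment k 2 := by
    intro a b hab
    have h := hw a b hab
    have e : ∀ u, (a + b * u) ^ 2 * k u = a ^ 2 * (u ^ 0 * k u) + 2 * a * b * (u ^ 1 * k u) +
        b ^ 2 * (u ^ 2 * k u) := fun u => by ring
    simp only [e] at h
    have j1 : Integrable (fun u => a ^ 2 * (u ^ 0 * k u) + 2 * a * b * (u ^ 1 * k u))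
      (volume.restrict (Set.Ioi 0)) := ((hint 0).const_mul _).add ((hint 1).const_mul _)
    rw [integral_add j1 ((hint 2).const_mul _), integral_add ((hint 0).const_mul _)
      ((hint 1).const_mul _)] at h
    simp only [integral_const_mul] at h
    exact h
  have h0 : 0 < kernelMoment k 0 := by simpa using hq 1 0 (by simp)
  have h2 : 0 < kernelMoment k 2 := by simpa using hq 0 1 (by simp)
  refine ⟨h0, h2, ?_⟩
  have h := hq (kernelMoment k 1) (-kernelMoment k 0) (by
    simp only [ne_eq, Prod.mk.injEq, not_and]
    intro _ h'
    linarith)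
  have e : kernelMoment k 1 ^ 2 * kernelMoment k 0 + 2 * kernelMoment k 1 * -kernelMoment k 0 *
      kernelMoment k 1 + (-kernelMoment k 0) ^ 2 * kernelMoment k 2 = kernelMoment k 0 *
      (kernelMoment k 0 * kernelMoment k 2 - kernelMoment k 1 * kernelMoment k 1) := by ring
  rw [e] at h
  exact pos_of_mul_pos_right h h0.le

/-- Reflection changes only the sign of the first moment, which enters the determinant squared. -/
theorem sideMoment_pos {k : ℝ → ℝ} {A : ℝ} (hk : KernelRegular k A) (hw : WellPosed k) (b : Bool) :
    0 < sideMoment k b 0 ∧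
      sideMoment k b 0 * sideMoment k b 2 - sideMoment k b 1 * sideMoment k b 1 =
        kernelMoment k 0 * kernelMoment k 2 - kernelMoment k 1 * kernelMoment k 1 ∧
      0 < sideMoment k b 0 * sideMoment k b 2 - sideMoment k b 1 * sideMoment k b 1 := by
  obtain ⟨h0, h2, hd⟩ := wellPosed_moments hk hw
  cases b
  · simp only [sideMoment_false hk.symm]
    norm_num
    exact ⟨h0, by linarith⟩
  · simp only [sideMoment_true]
    exact ⟨h0, trivial, hd⟩

/-- The expression is ∫ g², where g(u) = (s₂ - s₁ u) k(u) on the side. The integral of g is the Gram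
determinant, which is positive, so g is not almost everywhere zero. The argument allows k to take
both signs. -/
theorem sum_sideMoment_sq_pos {k : ℝ → ℝ} {A : ℝ} (hk : KernelRegular k A) (hw : WellPosed k)
    (b : Bool) :
    0 < sideMoment k b 2 ^ 2 * sideMoment (fun u => k u ^ 2) b 0 -
      2 * sideMoment k b 1 * sideMoment k b 2 * sideMoment (fun u => k u ^ 2) b 1 +
      sideMoment k b 1 ^ 2 * sideMoment (fun u => k u ^ 2) b 2 := by
  have hint : ∀ j, Integrable (sideKernel k b j) := fun j =>
    (hk.antiDiff.sideKernel (fun u hu => hk.eq_zero hu) b j).integrable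
      (sideKernel_zero_of_lt (fun u hu => hk.eq_zero hu) b j)
  have hz2 : ∀ u, A < |u| → k u ^ 2 = 0 := fun u hu => by rw [hk.eq_zero hu]; norm_num
  have hint2 : ∀ j, Integrable (sideKernel (fun u => k u ^ 2) b j) := fun j =>
    ((hk.antiDiff.pow 2).sideKernel hz2 b j).integrable (sideKernel_zero_of_lt hz2 b j)
  set s₁ := sideMoment k b 1 with hs₁
  set s₂ := sideMoment k b 2 with hs₂
  let g : ℝ → ℝ := fun u => s₂ * sideKernel k b 0 u - s₁ * sideKernel k b 1 u
  have hgi : Integrable g := ((hint 0).const_mul _).sub ((hint 1).const_mul _)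
  have hgpos : 0 < ∫ u, g u := by
    have : ∫ u, g u = s₂ * sideMoment k b 0 - s₁ * sideMoment k b 1 := by
      simp only [g]
      rw [integral_sub ((hint 0).const_mul _) ((hint 1).const_mul _), integral_const_mul,
        integral_const_mul]
      rfl
    rw [this]
    have := (sideMoment_pos hk hw b).2.2
    rw [mul_comm (sideMoment k b 0)] at this
    exact this
  have hsq : ∀ u, g u ^ 2 = s₂ ^ 2 * sideKernel (fun u => k u ^ 2) b 0 u -
      2 * s₁ * s₂ * sideKernel (fun u => k u ^ 2) b 1 u +
      s₁ ^ 2 * sideKernel (fun u => k u ^ 2) b 2 u := by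
    intro u
    simp only [g, sideKernel]
    by_cases hu : u ∈ side b
    · simp only [Set.indicator_of_mem hu]; ring
    · simp [Set.indicator_of_notMem hu]
  have j1 : Integrable (fun u => s₂ ^ 2 * sideKernel (fun u => k u ^ 2) b 0 u -
      2 * s₁ * s₂ * sideKernel (fun u => k u ^ 2) b 1 u) :=
    ((hint2 0).const_mul _).sub ((hint2 1).const_mul _)
  have hgsq : Integrable fun u => g u ^ 2 := by
    simp only [hsq]
    exact j1.add ((hint2 2).const_mul _)
  have e : s₂ ^ 2 * sideMoment (fun u => k u ^ 2) b 0 -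
      2 * s₁ * s₂ * sideMoment (fun u => k u ^ 2) b 1 +
      s₁ ^ 2 * sideMoment (fun u => k u ^ 2) b 2 = ∫ u, g u ^ 2 := by
    simp only [hsq]
    rw [integral_add j1 ((hint2 2).const_mul _), integral_sub ((hint2 0).const_mul _)
      ((hint2 1).const_mul _)]
    simp only [integral_const_mul]
    rfl
  rw [e]
  refine lt_of_le_of_ne (integral_nonneg fun u => sq_nonneg _) fun h0 => ?_
  have h1 := (integral_eq_zero_iff_of_nonneg (fun u => sq_nonneg (g u)) hgsq).1 h0.symm
  have h2 : ∫ u, g u = ∫ _ : ℝ, (0 : ℝ) := by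
    refine integral_congr_ae ?_
    filter_upwards [h1] with u hu
    simpa using hu
  rw [h2] at hgpos
  simp at hgpos

/-! ### A local model covering both designs -/

/-- The coordinates `x, y, d` of an observation and the local behaviour of its distribution: the
density `f` of `x`, the conditional second and first moments of `(y, d)` given `x`, and their
one-sided limits at the cutoff, approached at the rate `ρ`. -/
structure LocalModel (𝒲 : Type*) where
  xc : 𝒲 → ℝ
  yc : 𝒲 → ℝ
  dc : 𝒲 → ℝ
  A : ℝ
  B : ℝ
  ρ : ℝ → ℝ
  f : ℝ → ℝ
  fl : Bool → ℝ
  mYY : ℝ → ℝ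
  mYD : ℝ → ℝ
  mY : ℝ → ℝ
  mDD : ℝ → ℝ
  mD : ℝ → ℝ
  lYY : Bool → ℝ
  lYD : Bool → ℝ
  lY : Bool → ℝ
  lDD : Bool → ℝ
  lD : Bool → ℝ

/-- The matrix of second moments of `(y, d, 1, 1)`. -/
def momentMatrix {β : Type*} (yy yd y dd d o : β) : Fin 4 → Fin 4 → β :=
  ![![yy, yd, y, y], ![yd, dd, d, d], ![y, d, o, o], ![y, d, o, o]]

namespace LocalModel

variable {𝒲 : Type*} (c : LocalModel 𝒲)

/-- Limit of the ratio of jumps. -/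
noncomputable def ratio : ℝ := (c.lY true - c.lY false) / (c.lD true - c.lD false)

/-- Limit of the conditional mean of `y - θ d`. -/
noncomputable def residMean (b : Bool) : ℝ := c.lY b - c.ratio * c.lD b

/-- Limit of the conditional variance of `y - θ d`. -/
noncomputable def residVar (b : Bool) : ℝ :=
  c.lYY b - 2 * c.ratio * c.lYD b + c.ratio ^ 2 * c.lDD b - c.residMean b ^ 2

/-- Conditional second moments of the features. -/
def condMat : Fin 4 → Fin 4 → ℝ → ℝ :=
  momentMatrix c.mYY c.mYD c.mY c.mDD c.mD fun _ => 1

/-- Limits of the conditional second moments of the features. -/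
def limMat (b : Bool) : Fin 4 → Fin 4 → ℝ :=
  momentMatrix (c.lYY b) (c.lYD b) (c.lY b) (c.lDD b) (c.lD b) 1

/-- The features of an observation. -/
def feature (w : 𝒲) : Fin 4 → ℝ := rawFeature (c.yc w) (c.dc w)

/-- Limit of `popGram`. -/
noncomputable def limGram (k : ℝ → ℝ) (b : Bool) (p : Fin 2) (r : Fin 4) : ℝ :=
  c.fl b * c.limMat b r 2 * sideMoment k b (p + featureExp r)

/-- Limit of `popMeat`. -/
noncomputable def limMeat (k : ℝ → ℝ) (b : Bool) (p q : Fin 2) (r s : Fin 4) : ℝ :=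
  c.fl b * c.limMat b r s *
    sideMoment (fun u => k u ^ 2) b (p + q + (featureExp r + featureExp s))

end LocalModel

/-- The standing assumptions on a local model. -/
structure LocalModel.Holds {Ω 𝒲 : Type*} [MeasurableSpace Ω] [MeasurableSpace 𝒲]
    (c : LocalModel 𝒲) (μ : Measure Ω) (W : ℕ → Ω → 𝒲) : Prop where
  iid : IsIID μ W
  meas_x : Measurable c.xc
  meas_y : Measurable c.yc
  meas_d : Measurable c.dc
  one_le : 1 ≤ c.B
  bound_y : ∀ w, |c.yc w| ≤ c.B
  bound_d : ∀ w, |c.dc w| ≤ c.B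
  A_pos : 0 < c.A
  rho_small : LogLogSmall c.ρ
  rho_tendsto : Tendsto c.ρ (𝓝[>] 0) (𝓝 0)
  f_meas : Measurable c.f
  f_nonneg : ∀ x, 0 ≤ c.f x
  density : μ.map (fun ω => c.xc (W 0 ω)) = volume.withDensity fun x => ENNReal.ofReal (c.f x)
  f_local : ∀ b, LocalApprox c.A c.ρ b c.f (c.fl b)
  fl_pos : ∀ b, 0 < c.fl b
  condYY : IsCondMean μ (fun ω => c.xc (W 0 ω)) (fun ω => c.yc (W 0 ω) * c.yc (W 0 ω)) c.mYY
  condYD : IsCondMean μ (fun ω => c.xc (W 0 ω)) (fun ω => c.yc (W 0 ω) * c.dc (W 0 ω)) c.mYD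
  condY : IsCondMean μ (fun ω => c.xc (W 0 ω)) (fun ω => c.yc (W 0 ω)) c.mY
  condDD : IsCondMean μ (fun ω => c.xc (W 0 ω)) (fun ω => c.dc (W 0 ω) * c.dc (W 0 ω)) c.mDD
  condD : IsCondMean μ (fun ω => c.xc (W 0 ω)) (fun ω => c.dc (W 0 ω)) c.mD
  localYY : ∀ b, LocalApprox c.A c.ρ b c.mYY (c.lYY b)
  localYD : ∀ b, LocalApprox c.A c.ρ b c.mYD (c.lYD b)
  localY : ∀ b, LocalApprox c.A c.ρ b c.mY (c.lY b)
  localDD : ∀ b, LocalApprox c.A c.ρ b c.mDD (c.lDD b)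
  localD : ∀ b, LocalApprox c.A c.ρ b c.mD (c.lD b)
  jump : c.lD true - c.lD false ≠ 0
  var_nonneg : ∀ b, 0 ≤ c.residVar b
  var_pos : ∃ b, 0 < c.residVar b

/-! ### Limits of the local moments as the bandwidth shrinks. -/

namespace LocalModel.Holds

variable {Ω 𝒲 : Type*} [mΩ : MeasurableSpace Ω] [MeasurableSpace 𝒲] {c : LocalModel 𝒲}
  {μ : Measure Ω} [IsProbabilityMeasure μ] {W : ℕ → Ω → 𝒲}

theorem measurable_feature (H : c.Holds μ W) (r : Fin 4) : Measurable fun w => c.feature w r := by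
  fin_cases r
  · exact H.meas_y
  · exact H.meas_d
  · exact measurable_const
  · exact measurable_const

theorem abs_feature_le (H : c.Holds μ W) (w : 𝒲) (r : Fin 4) : |c.feature w r| ≤ c.B := by
  have h1 : |(1 : ℝ)| ≤ c.B := by simpa using H.one_le
  fin_cases r
  · exact H.bound_y w
  · exact H.bound_d w
  · exact h1
  · exact h1

theorem measurable_X (H : c.Holds μ W) : Measurable fun ω => c.xc (W 0 ω) :=
  H.meas_x.comp (H.iid.1 0)

theorem integrable_feature_mul (H : c.Holds μ W) (r s : Fin 4) :
    Integrable (fun ω => c.feature (W 0 ω) r * c.feature (W 0 ω) s) μ := by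
  refine Integrable.of_bound (((H.measurable_feature r).mul (H.measurable_feature s)).comp
    (H.iid.1 0)).aestronglyMeasurable (c.B * c.B) (ae_of_all _ fun ω => ?_)
  rw [Real.norm_eq_abs, abs_mul]
  exact mul_le_mul (H.abs_feature_le _ r) (H.abs_feature_le _ s) (abs_nonneg _)
    (by linarith [H.one_le])

theorem condMean_feature (H : c.Holds μ W) (r s : Fin 4) :
    IsCondMean μ (fun ω => c.xc (W 0 ω))
      (fun ω => c.feature (W 0 ω) r * c.feature (W 0 ω) s) (c.condMat r s) := by
  have hle : MeasurableSpace.comap (fun ω => c.xc (W 0 ω)) inferInstance ≤ mΩ :=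
    H.measurable_X.comap_le
  have hone : IsCondMean μ (fun ω => c.xc (W 0 ω)) (fun _ => (1 : ℝ)) fun _ => 1 :=
    ⟨measurable_const, by rw [condExp_const hle]⟩
  fin_cases r <;> fin_cases s <;>
    simp only [LocalModel.feature, rawFeature, LocalModel.condMat, momentMatrix, Matrix.cons_val,
      Fin.zero_eta, Fin.mk_one, Fin.reduceFinMk, mul_one, one_mul]
  · exact H.condYY
  · exact H.condYD
  · exact H.condY
  · exact H.condY
  · simpa only [mul_comm] using H.condYD
  · exact H.condDD
  · exact H.condD
  · exact H.condD
  · exact H.condY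
  · exact H.condD
  · exact hone
  · exact hone
  · exact H.condY
  · exact H.condD
  · exact hone
  · exact hone

theorem local_feature (H : c.Holds μ W) (b : Bool) (r s : Fin 4) :
    LocalApprox c.A c.ρ b (c.condMat r s) (c.limMat b r s) := by
  have hone : LocalApprox c.A c.ρ b (fun _ => 1) 1 := Approx.const 1
  fin_cases r <;> fin_cases s
  · exact H.localYY b
  · exact H.localYD b
  · exact H.localY b
  · exact H.localY b
  · exact H.localYD b
  · exact H.localDD b
  · exact H.localD b
  · exact H.localD b
  · exact H.localY b
  · exact H.localD b
  · exact hone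
  · exact hone
  · exact H.localY b
  · exact H.localD b
  · exact hone
  · exact hone

theorem approx_popMoment_feature (H : c.Holds μ W) {k : ℝ → ℝ} (hk : AntiDiff k)
    (hkA : ∀ u, c.A < |u| → k u = 0) (b : Bool) (r s : Fin 4) (j : ℕ) :
    Approx (𝓝[>] 0) c.ρ (fun h => popMoment μ k b h (fun ω => c.xc (W 0 ω))
      (fun ω => c.feature (W 0 ω) r * c.feature (W 0 ω) s) j)
      fun _ => c.fl b * c.limMat b r s * sideMoment k b j := by
  have hs := hk.sideKernel hkA b j
  obtain ⟨K, -, hK⟩ := hs.bounded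
  exact approx_popMoment H.measurable_X (H.integrable_feature_mul r s) H.f_meas H.f_nonneg
    H.density (H.condMean_feature r s) H.A_pos H.rho_tendsto (H.f_local b) (H.local_feature b r s)
    hs.measurable hK (sideKernel_zero_of_lt hkA b j)

theorem approx_popGram (H : c.Holds μ W) {k : ℝ → ℝ} (hk : AntiDiff k)
    (hkA : ∀ u, c.A < |u| → k u = 0) (b : Bool) (p : Fin 2) (r : Fin 4) :
    Approx (𝓝[>] 0) c.ρ (fun h => popGram μ k (fun ω => c.xc (W 0 ω)) (fun ω => c.yc (W 0 ω))
      (fun ω => c.dc (W 0 ω)) h b p r) fun _ => c.limGram k b p r := by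
  have h := H.approx_popMoment_feature hk hkA b r 2 (p + featureExp r)
  have e : ∀ w, c.feature w 2 = 1 := fun w => rfl
  simp only [e, mul_one] at h
  exact h

theorem approx_popMeat (H : c.Holds μ W) {k : ℝ → ℝ} (hk : AntiDiff k)
    (hkA : ∀ u, c.A < |u| → k u = 0) (b : Bool) (p q : Fin 2) (r s : Fin 4) :
    Approx (𝓝[>] 0) c.ρ (fun h => popMeat μ k (fun ω => c.xc (W 0 ω)) (fun ω => c.yc (W 0 ω))
      (fun ω => c.dc (W 0 ω)) h b p q r s) fun _ => c.limMeat k b p q r s :=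
  H.approx_popMoment_feature (hk.pow 2) (fun u hu => by rw [hkA u hu]; norm_num) b r s _

theorem gramDet_limGram (k : ℝ → ℝ) (b : Bool) : gramDet (c.limGram k b) = c.fl b ^ 2 *
    (sideMoment k b 0 * sideMoment k b 2 - sideMoment k b 1 * sideMoment k b 1) := by
  simp only [gramDet, LocalModel.limGram, LocalModel.limMat, momentMatrix, featureExp,
    Matrix.cons_val, Fin.val_zero, Fin.val_one, zero_add, add_zero, one_add_one_eq_two]
  ring

/-- In the limit the conditional means are constant on each side, so the fitted lines of y and d are
flat. -/
theorem lsIntercept_limGram (H : c.Holds μ W) {k : ℝ → ℝ} (hk : KernelRegular k c.A)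
    (hw : WellPosed k) (b : Bool) :
    gramDet (c.limGram k b) ≠ 0 ∧ lsIntercept (c.limGram k b) 0 = c.lY b ∧
      lsIntercept (c.limGram k b) 1 = c.lD b ∧
      lsSlope (c.limGram k b) 0 = 0 ∧ lsSlope (c.limGram k b) 1 = 0 := by
  have hd : gramDet (c.limGram k b) ≠ 0 := by
    rw [gramDet_limGram]
    exact (mul_pos (pow_pos (H.fl_pos b) 2) (sideMoment_pos hk hw b).2.2).ne'
  refine ⟨hd, ?_, ?_, ?_, ?_⟩
  · rw [lsIntercept, div_eq_iff hd, gramDet_limGram]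
    simp only [LocalModel.limGram, LocalModel.limMat, momentMatrix, featureExp,
      Matrix.cons_val, Fin.val_zero, Fin.val_one, zero_add, add_zero, one_add_one_eq_two]
    ring
  · rw [lsIntercept, div_eq_iff hd, gramDet_limGram]
    simp only [LocalModel.limGram, LocalModel.limMat, momentMatrix, featureExp,
      Matrix.cons_val, Fin.val_zero, Fin.val_one, zero_add, add_zero, one_add_one_eq_two]
    ring
  · rw [lsSlope, div_eq_zero_iff]
    left
    simp only [LocalModel.limGram, LocalModel.limMat, momentMatrix, featureExp,
      Matrix.cons_val, Fin.val_zero, Fin.val_one, add_zero]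
    ring
  · rw [lsSlope, div_eq_zero_iff]
    left
    simp only [LocalModel.limGram, LocalModel.limMat, momentMatrix, featureExp,
      Matrix.cons_val, Fin.val_zero, Fin.val_one, add_zero]
    ring

theorem lsJump_limGram (H : c.Holds μ W) {k : ℝ → ℝ} (hk : KernelRegular k c.A)
    (hw : WellPosed k) : lsJump (c.limGram k) 1 = c.lD true - c.lD false ∧
      lsRatio (c.limGram k) = c.ratio := by
  obtain ⟨-, t0, t1, -, -⟩ := H.lsIntercept_limGram hk hw true
  obtain ⟨-, f0, f1, -, -⟩ := H.lsIntercept_limGram hk hw false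
  unfold lsRatio lsJump LocalModel.ratio
  rw [t0, t1, f0, f1]
  exact ⟨rfl, rfl⟩

theorem residCoef_limGram (H : c.Holds μ W) {k : ℝ → ℝ} (hk : KernelRegular k c.A)
    (hw : WellPosed k) (b : Bool) :
    residCoef (c.limGram k) b = ![1, -c.ratio, -c.residMean b, 0] := by
  obtain ⟨-, e0, e1, e2, e3⟩ := H.lsIntercept_limGram hk hw b
  unfold residCoef
  rw [e0, e1, e2, e3, (H.lsJump_limGram hk hw).2]
  simp [LocalModel.residMean]

/-- The row is proportional to (s₂, -s₁); paired with the regressors (1, u) it yields s₂ - s₁ u, the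
factor of the equivalent kernel. -/
theorem gramRow_limGram (H : c.Holds μ W) {k : ℝ → ℝ} (hk : KernelRegular k c.A)
    (hw : WellPosed k) (b : Bool) : gramRow (c.limGram k b) =
      ![sideMoment k b 2 / (c.fl b * (kernelMoment k 0 * kernelMoment k 2 -
          kernelMoment k 1 * kernelMoment k 1)),
        -(sideMoment k b 1 / (c.fl b * (kernelMoment k 0 * kernelMoment k 2 -
          kernelMoment k 1 * kernelMoment k 1)))] := by
  obtain ⟨-, hD, hD0⟩ := sideMoment_pos hk hw b
  have hf := (H.fl_pos b).ne'
  have hD0' := hD0.ne'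
  unfold gramRow
  rw [gramDet_limGram, ← hD]
  simp only [LocalModel.limGram, LocalModel.limMat, momentMatrix, featureExp,
    Matrix.cons_val, Fin.val_zero, Fin.val_one, zero_add, one_add_one_eq_two, mul_one]
  congr 1
  · field_simp
  · congr 2
    field_simp

/-- The limiting residual has no slope term, so its conditional second moment is a constant on each
side and factors out of the kernel integrals. -/
theorem sandwich_limGram (H : c.Holds μ W) {k : ℝ → ℝ} (hk : KernelRegular k c.A)
    (hw : WellPosed k) : sandwich (c.limGram k) (c.limMeat k) =
      ∑ b, c.residVar b * ((sideMoment k b 2 ^ 2 * sideMoment (fun u => k u ^ 2) b 0 -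
        2 * sideMoment k b 1 * sideMoment k b 2 * sideMoment (fun u => k u ^ 2) b 1 +
        sideMoment k b 1 ^ 2 * sideMoment (fun u => k u ^ 2) b 2) /
        (c.fl b * (kernelMoment k 0 * kernelMoment k 2 -
          kernelMoment k 1 * kernelMoment k 1) ^ 2)) := by
  unfold sandwich
  refine Finset.sum_congr rfl fun b _ => ?_
  have hD0 := (wellPosed_moments hk hw).2.2.ne'
  have hf := (H.fl_pos b).ne'
  rw [H.residCoef_limGram hk hw, H.gramRow_limGram hk hw]
  simp only [Fin.sum_univ_two, Fin.sum_univ_four, LocalModel.limMeat, LocalModel.limMat,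
    momentMatrix, featureExp,
    Matrix.cons_val, Fin.val_zero, Fin.val_one, zero_add, add_zero, one_add_one_eq_two, mul_one,
    LocalModel.residVar, LocalModel.residMean]
  generalize kernelMoment k 0 * kernelMoment k 2 - kernelMoment k 1 * kernelMoment k 1 = Δ at hD0 ⊢
  field_simp
  ring

theorem sandwich_limGram_pos (H : c.Holds μ W) {k : ℝ → ℝ} (hk : KernelRegular k c.A)
    (hw : WellPosed k) : 0 < sandwich (c.limGram k) (c.limMeat k) := by
  rw [H.sandwich_limGram hk hw]
  have hpos : ∀ b, 0 < (sideMoment k b 2 ^ 2 * sideMoment (fun u => k u ^ 2) b 0 -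
        2 * sideMoment k b 1 * sideMoment k b 2 * sideMoment (fun u => k u ^ 2) b 1 +
        sideMoment k b 1 ^ 2 * sideMoment (fun u => k u ^ 2) b 2) /
        (c.fl b * (kernelMoment k 0 * kernelMoment k 2 -
          kernelMoment k 1 * kernelMoment k 1) ^ 2) := fun b =>
    div_pos (sum_sideMoment_sq_pos hk hw b)
      (mul_pos (H.fl_pos b) (pow_pos (wellPosed_moments hk hw).2.2 2))
  obtain ⟨b, hb⟩ := H.var_pos
  exact Finset.sum_pos' (fun b _ => mul_nonneg (H.var_nonneg b) (hpos b).le)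
    ⟨b, Finset.mem_univ _, mul_pos hb (hpos b)⟩

end LocalModel.Holds


/-! ### The equivalent kernel -/

/-- The ratio of the equivalent kernel to the kernel. -/
noncomputable def equivFactor (k : ℝ → ℝ) (u : ℝ) : ℝ := kernelMoment k 2 - kernelMoment k 1 * |u|

/-- `sideKernel`, set to zero at the zeros of `equivFactor`. -/
noncomputable def cutKernel (k : ℝ → ℝ) (b : Bool) (j : ℕ) (u : ℝ) : ℝ :=
  {u | equivFactor k u ≠ 0}.indicator (sideKernel k b j) u

/-- If μ₁ = 0, the factor is the nonzero constant μ₂, and the excluded quotient is 0 by convention.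
-/
theorem equivFactor_ne_zero_of {k : ℝ → ℝ} (h2 : kernelMoment k 2 ≠ 0) {u : ℝ}
    (h : u ≠ kernelMoment k 2 / kernelMoment k 1) (h' : u ≠ -(kernelMoment k 2 / kernelMoment k 1)) :
    equivFactor k u ≠ 0 := by
  intro h0
  have e : kernelMoment k 2 = kernelMoment k 1 * |u| := sub_eq_zero.1 h0
  have h1 : kernelMoment k 1 ≠ 0 := fun h1 => h2 (by rw [e, h1, zero_mul])
  have e2 : |u| = kernelMoment k 2 / kernelMoment k 1 := by rw [e, mul_div_cancel_left₀ _ h1]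
  rcases abs_choice u with hu | hu
  · exact h (by rw [← e2, hu])
  · exact h' (by rw [← e2, hu, neg_neg])

/-- Two observations can both lie at zeros of the factor for the same h only if their running
variables agree up to sign. -/
theorem abs_eq_of_equivFactor {k : ℝ → ℝ} (h2 : kernelMoment k 2 ≠ 0) {u v : ℝ}
    (hu : equivFactor k u = 0) (hv : equivFactor k v = 0) : |u| = |v| := by
  have e : kernelMoment k 2 = kernelMoment k 1 * |u| := sub_eq_zero.1 hu
  have e' : kernelMoment k 2 = kernelMoment k 1 * |v| := sub_eq_zero.1 hv
  have h1 : kernelMoment k 1 ≠ 0 := fun h1 => h2 (by rw [e, h1, zero_mul])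
  exact mul_left_cancel₀ h1 (e.symm.trans e')

/-- The cut removes at most the points ±μ₂ / μ₁, and the indicator of the complement of a point is a
difference of antitone functions. For μ₁ ≤ 0 the factor is positive everywhere and nothing is
removed. -/
theorem AntiDiff.cutKernel {k : ℝ → ℝ} {A : ℝ} (hk : AntiDiff k) (hkA : ∀ u, A < |u| → k u = 0)
    (h2 : 0 < kernelMoment k 2) (b : Bool) (j : ℕ) : AntiDiff (cutKernel k b j) := by
  refine (hk.sideKernel hkA b j).indicator ?_
  rcases le_or_gt (kernelMoment k 1) 0 with h1 | h1
  · have : {u | equivFactor k u ≠ 0} = Set.univ := by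
      refine Set.eq_univ_of_forall fun u => ?_
      have := mul_nonpos_of_nonpos_of_nonneg h1 (abs_nonneg u)
      have h3 : 0 < equivFactor k u := by unfold equivFactor; linarith
      exact h3.ne'
    rw [this, Set.indicator_univ]
    exact AntiDiff.const 1
  · have : {u | equivFactor k u ≠ 0} = ({kernelMoment k 2 / kernelMoment k 1} : Set ℝ)ᶜ ∩
        ({-(kernelMoment k 2 / kernelMoment k 1)} : Set ℝ)ᶜ := by
      have hp : 0 ≤ kernelMoment k 2 / kernelMoment k 1 := by positivity
      ext u
      refine ⟨fun h => ⟨fun hu => h ?_, fun hu => h ?_⟩,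
        fun h => equivFactor_ne_zero_of h2.ne' h.1 h.2⟩
      · rw [Set.mem_singleton_iff.1 hu, equivFactor, abs_of_nonneg hp, mul_div_cancel₀ _ h1.ne',
          sub_self]
      · rw [Set.mem_singleton_iff.1 hu, equivFactor, abs_neg, abs_of_nonneg hp,
          mul_div_cancel₀ _ h1.ne', sub_self]
    rw [this]
    exact (AntiDiff.indicator_singleton _).indicator_compl.indicator_inter
      (AntiDiff.indicator_singleton _).indicator_compl

theorem UniformContinuousOn.mul_of_bounded {f g : ℝ → ℝ} {s : Set ℝ} {K L : ℝ}
    (hf : UniformContinuousOn f s) (hg : UniformContinuousOn g s) (hK : ∀ u ∈ s, |f u| ≤ K)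
    (hL : ∀ u ∈ s, |g u| ≤ L) : UniformContinuousOn (fun u => f u * g u) s := by
  rw [Metric.uniformContinuousOn_iff] at *
  intro ε hε
  obtain ⟨δ, hδ, hf⟩ := hf (ε / (2 * (|L| + 1))) (by positivity)
  obtain ⟨δ', hδ', hg⟩ := hg (ε / (2 * (|K| + 1))) (by positivity)
  refine ⟨min δ δ', lt_min hδ hδ', fun x hx y hy hxy => ?_⟩
  have h1 := hf x hx y hy (hxy.trans_le (min_le_left _ _))
  have h2 := hg x hx y hy (hxy.trans_le (min_le_right _ _))
  rw [Real.dist_eq, lt_div_iff₀ (by positivity)] at h1 h2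
  rw [Real.dist_eq]
  have e : f x * g x - f y * g y = f x * (g x - g y) + g y * (f x - f y) := by ring
  have h3 : |f x| ≤ |K| + 1 := (hK x hx).trans ((le_abs_self K).trans (by linarith))
  have h4 : |g y| ≤ |L| + 1 := (hL y hy).trans ((le_abs_self L).trans (by linarith))
  rw [e]
  refine (abs_add_le _ _).trans_lt ?_
  rw [abs_mul, abs_mul]
  have h5 := mul_le_mul_of_nonneg_right h3 (abs_nonneg (g x - g y))
  have h6 := mul_le_mul_of_nonneg_right h4 (abs_nonneg (f x - f y))
  linarith

/-- The kernel is even, so its integral is twice the one over u > 0; this is twice the Gram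
determinant, which well-posedness makes positive. -/
theorem integral_equivKernel {k : ℝ → ℝ} {A : ℝ} (hk : KernelRegular k A) :
    ∫ u, equivKernel k u = 2 * (kernelMoment k 2 * kernelMoment k 0 -
      kernelMoment k 1 * kernelMoment k 1) := by
  have hint : ∀ j, IntegrableOn (fun u => u ^ j * k u) (Set.Ioi 0) := fun j => by
    have := (hk.antiDiff.mul_pow_self (A := A) (fun u hu => hk.eq_zero hu) j).integrable (A := A)
      fun u hu => by rw [hk.eq_zero hu, zero_mul]
    simp only [mul_comm (k _)] at this
    exact this.integrableOn
  have e : ∀ u, equivKernel k u = (fun t => kernelMoment k 2 * (t ^ 0 * k t) -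
      kernelMoment k 1 * (t ^ 1 * k t)) |u| := by
    intro u
    have : k |u| = k u := by
      rcases abs_choice u with hu | hu <;> rw [hu]
      exact hk.symm u
    simp only [this]
    unfold equivKernel
    ring
  simp only [e]
  rw [integral_comp_abs (f := fun t => kernelMoment k 2 * (t ^ 0 * k t) -
      kernelMoment k 1 * (t ^ 1 * k t)), integral_sub ((hint 0).const_mul _) ((hint 1).const_mul _),
    integral_const_mul, integral_const_mul]
  rfl

theorem KernelRegular.equivKernel {k : ℝ → ℝ} {A : ℝ} (hk : KernelRegular k A)
    (hw : WellPosed k) : KernelRegular (equivKernel k) A := by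
  obtain ⟨B, hB⟩ := hk.bounded
  obtain ⟨B', hB'⟩ := hk.deriv_bounded
  set q₂ := kernelMoment k 2 with hq₂
  set q₁ := kernelMoment k 1 with hq₁
  have hB0 : 0 ≤ B := (abs_nonneg _).trans (hB 0)
  have hfac : ∀ u, |u| ≤ A → abs (q₂ - q₁ * |u|) ≤ |q₂| + |q₁| * A := by
    intro u hu
    refine (abs_sub _ _).trans ?_
    rw [abs_mul, abs_abs]
    gcongr
  have hder : ∀ u ∈ Set.Ioo 0 A, HasDerivAt (RDSnoop.equivKernel k)
      ((q₂ - q₁ * u) * deriv k u + (-q₁) * k u) u := by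
    intro u hu
    have h1 : HasDerivAt (fun u => q₂ - q₁ * u) (-q₁) u := by
      simpa using ((hasDerivAt_id u).const_mul q₁).const_sub q₂
    have h2 := h1.mul (hk.differentiable u hu).hasDerivAt
    refine (h2.congr_of_eventuallyEq ?_).congr_deriv (by ring)
    filter_upwards [lt_mem_nhds hu.1] with v hv
    simp [RDSnoop.equivKernel, abs_of_pos hv, hq₁, hq₂]
  have habs : ∀ u ∈ Set.Ioo 0 A, |q₂ - q₁ * u| ≤ |q₂| + |q₁| * A := fun u hu => by
    have := hfac u (by rw [abs_of_pos hu.1]; exact hu.2.le)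
    rwa [abs_of_pos hu.1] at this
  refine ⟨hk.pos, fun u => ?_, fun u hu => hk.support ?_, ⟨(|q₂| + |q₁| * A) * B, fun u => ?_⟩,
    fun u hu => (hder u hu).differentiableAt, ⟨(|q₂| + |q₁| * A) * B' + |q₁| * B, fun u hu => ?_⟩,
    ?_, ?_⟩
  · unfold RDSnoop.equivKernel
    rw [abs_neg, hk.symm]
  · exact right_ne_zero_of_mul hu
  · rcases le_or_gt |u| A with h | h
    · unfold RDSnoop.equivKernel
      rw [abs_mul]
      exact mul_le_mul (hfac u h) (hB u) (abs_nonneg _) ((abs_nonneg _).trans (hfac u h))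
    · unfold RDSnoop.equivKernel
      rw [hk.eq_zero h, mul_zero, abs_zero]
      have := hk.pos
      positivity
  · rw [(hder u hu).deriv]
    refine (abs_add_le _ _).trans (add_le_add ?_ ?_)
    · rw [abs_mul]
      exact mul_le_mul (habs u hu) (hB' u hu) (abs_nonneg _) ((abs_nonneg _).trans (habs u hu))
    · rw [abs_mul, abs_neg]
      exact mul_le_mul_of_nonneg_left (hB u) (abs_nonneg _)
  · have huk : UniformContinuousOn k (Set.Ioo 0 A) := by
      refine (Convex.lipschitzOnWith_of_nnnorm_deriv_le (C := Real.toNNReal B')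
        (fun u hu => hk.differentiable u hu) (fun u hu => ?_) (convex_Ioo 0 A)).uniformContinuousOn
      rw [← NNReal.coe_le_coe]
      exact (hB' u hu).trans (Real.le_coe_toNNReal _)
    have hlin : UniformContinuousOn (fun u => q₂ - q₁ * u) (Set.Ioo 0 A) := by
      have : LipschitzWith ‖q₁‖₊ fun u => q₂ - q₁ * u := by
        refine LipschitzWith.of_dist_le_mul fun x y => ?_
        rw [Real.dist_eq, Real.dist_eq, coe_nnnorm, Real.norm_eq_abs, ← abs_mul, abs_sub_comm]
        refine le_of_eq (congrArg _ ?_)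
        ring
      exact this.uniformContinuous.uniformContinuousOn
    have hneg : UniformContinuousOn (fun _ : ℝ => -q₁) (Set.Ioo 0 A) :=
      uniformContinuous_const.uniformContinuousOn
    have h1 := UniformContinuousOn.mul_of_bounded hlin hk.deriv_uniformContinuous habs hB'
    have h2 := UniformContinuousOn.mul_of_bounded hneg huk (fun u _ => le_rfl) fun u _ => hB u
    rw [uniformContinuousOn_iff_restrict] at h1 h2 ⊢
    convert h1.add h2 using 1
    funext u
    exact (hder u u.2).deriv
  · rw [integral_equivKernel hk]
    have := (wellPosed_moments hk hw).2.2
    rw [mul_comm (kernelMoment k 2)]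
    exact (mul_pos two_pos this).ne'

/-! ### Iterated logarithms -/

/-- Rescaling t shifts log(1 / t) by a constant. Once log(1 / t) is large, the shifted value exceeds
its square root, and the logarithm of a square root is half a logarithm. -/
theorem log_log_inv_le {a : ℝ} (ha : 0 < a) : ∀ᶠ t in 𝓝[>] (0 : ℝ),
    0 ≤ Real.log (Real.log t⁻¹) ∧
      Real.log (Real.log t⁻¹) ≤ 2 * Real.log (Real.log (a * t)⁻¹) := by
  have hL : Tendsto (fun t : ℝ => Real.log t⁻¹) (𝓝[>] 0) atTop :=
    Real.tendsto_log_atTop.comp tendsto_inv_nhdsGT_zero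
  filter_upwards [hL.eventually_ge_atTop (4 + 4 * |Real.log a|), self_mem_nhdsWithin] with t ht ht0
  have ht0' : (0 : ℝ) < t := ht0
  set L := Real.log t⁻¹ with hLdef
  have e : Real.log (a * t)⁻¹ = L - Real.log a := by
    rw [mul_inv, Real.log_mul (inv_pos.2 ha).ne' (inv_pos.2 ht0').ne', Real.log_inv a]
    ring
  have h1 := le_abs_self (Real.log a)
  have h0 := abs_nonneg (Real.log a)
  have h2 : √L ≤ L - Real.log a := by
    have hs : √L * √L = L := Real.mul_self_sqrt (by linarith)
    have hs2 : 2 ≤ √L := Real.le_sqrt_of_sq_le (by linarith)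
    nlinarith
  refine ⟨Real.log_nonneg (by linarith), ?_⟩
  rw [e]
  have h3 := Real.log_le_log (Real.sqrt_pos.2 (by linarith)) h2
  rw [Real.log_sqrt (by linarith)] at h3
  linarith

theorem tendsto_const_mul_nhdsGT {a : ℝ} (ha : 0 < a) :
    Tendsto (fun t => a * t) (𝓝[>] 0) (𝓝[>] 0) := by
  refine tendsto_nhdsWithin_iff.2 ⟨?_, ?_⟩
  · have : Tendsto (fun t : ℝ => a * t) (𝓝 0) (𝓝 (a * 0)) :=
      (continuous_const.mul continuous_id).tendsto 0
    rw [mul_zero] at this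
    exact this.mono_left nhdsWithin_le_nhds
  · filter_upwards [self_mem_nhdsWithin] with t ht
    exact mul_pos ha ht

theorem LogLogSmall.comp_mul {ρ : ℝ → ℝ} (hρ : LogLogSmall ρ) {a : ℝ} (ha : 0 < a) :
    LogLogSmall fun t => ρ (a * t) := by
  have hsc := tendsto_const_mul_nhdsGT ha
  have h := (hρ.comp hsc).abs.const_mul 2
  rw [abs_zero, mul_zero] at h
  refine squeeze_zero_norm' ?_ h
  filter_upwards [log_log_inv_le ha] with t ht
  simp only [Function.comp, Real.norm_eq_abs, abs_mul]
  rw [abs_of_nonneg ht.1, abs_of_nonneg (by linarith [ht.1, ht.2] :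
    0 ≤ Real.log (Real.log (a * t)⁻¹))]
  nlinarith [abs_nonneg (ρ (a * t)), ht.2]

theorem LogLogSmall.const_mul_abs {ρ : ℝ → ℝ} (hρ : LogLogSmall ρ) (K : ℝ) :
    LogLogSmall fun t => K * |ρ t| := by
  have h := hρ.abs.const_mul |K|
  rw [abs_zero, mul_zero] at h
  refine squeeze_zero_norm (fun t => ?_) h
  rw [Real.norm_eq_abs, abs_mul, abs_mul, abs_abs, abs_mul, mul_assoc]

theorem LogLogSmall.add {ρ ρ' : ℝ → ℝ} (hρ : LogLogSmall ρ) (hρ' : LogLogSmall ρ') :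
    LogLogSmall fun t => ρ t + ρ' t := by
  have h := Tendsto.add hρ hρ'
  rw [add_zero] at h
  exact h.congr fun t => by ring

/-! ### The influence function -/

namespace LocalModel

variable {Ω 𝒲 : Type*} [MeasurableSpace Ω] [MeasurableSpace 𝒲] (c : LocalModel 𝒲) (μ : Measure Ω)
  (W : ℕ → Ω → 𝒲) (k : ℝ → ℝ)

open Classical in
/-- The local population Gram matrices, extended by their limit to `h = 0`. -/
noncomputable def gramAt (h : ℝ) : Bool → Fin 2 → Fin 4 → ℝ :=
  if h = 0 then c.limGram k else
    popGram μ k (fun ω => c.xc (W 0 ω)) (fun ω => c.yc (W 0 ω)) (fun ω => c.dc (W 0 ω)) h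

open Classical in
/-- The local population moments with squared weights, extended by their limit to `h = 0`. -/
noncomputable def meatAt (h : ℝ) : Bool → Fin 2 → Fin 2 → Fin 4 → Fin 4 → ℝ :=
  if h = 0 then c.limMeat k else
    popMeat μ k (fun ω => c.xc (W 0 ω)) (fun ω => c.yc (W 0 ω)) (fun ω => c.dc (W 0 ω)) h

/-- Coefficient of the influence function on the term of index (side, regressor, feature). -/
noncomputable def coefAt (h : ℝ) (i : Bool × Fin 2 × Fin 4) : ℝ :=
  studentScale (c.gramAt μ W k h) (c.meatAt μ W k h) * (sideSign i.1 *
    (gramRow (c.gramAt μ W k h i.1) i.2.1 * residCoef (c.gramAt μ W k h) i.1 i.2.2))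

/-- The power of `u` in the term of index (side, regressor, feature). -/
def degree (i : Bool × Fin 2 × Fin 4) : ℕ := i.2.1 + featureExp i.2.2

/-- The influence function. -/
noncomputable def score (w : 𝒲) (h : ℝ) : ℝ :=
  (∑ i, c.coefAt μ W k h i * ((side i.1).indicator (fun _ => 1) (c.xc w) *
    (c.xc w / h) ^ degree i) * c.feature w i.2.2) / equivFactor k (c.xc w / h)

variable {c μ W k}

theorem gramAt_zero : c.gramAt μ W k 0 = c.limGram k := if_pos rfl

theorem meatAt_zero : c.meatAt μ W k 0 = c.limMeat k := if_pos rfl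

theorem gramAt_of_ne {h : ℝ} (hh : h ≠ 0) : c.gramAt μ W k h =
    popGram μ k (fun ω => c.xc (W 0 ω)) (fun ω => c.yc (W 0 ω)) (fun ω => c.dc (W 0 ω)) h :=
  if_neg hh

theorem meatAt_of_ne {h : ℝ} (hh : h ≠ 0) : c.meatAt μ W k h =
    popMeat μ k (fun ω => c.xc (W 0 ω)) (fun ω => c.yc (W 0 ω)) (fun ω => c.dc (W 0 ω)) h :=
  if_neg hh

theorem indicator_side_mul {b : Bool} {x h : ℝ} (hh : 0 < h) :
    (side b).indicator (fun _ => (1 : ℝ)) x * k (x / h) = (side b).indicator k (x / h) := by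
  by_cases hx : x ∈ side b
  · rw [Set.indicator_of_mem hx, Set.indicator_of_mem ((div_mem_side hh).2 hx), one_mul]
  · rw [Set.indicator_of_notMem hx, Set.indicator_of_notMem (mt (div_mem_side hh).1 hx), zero_mul]

theorem sum_mul_kernel {h : ℝ} (hh : 0 < h) (w : 𝒲) (C : Bool × Fin 2 × Fin 4 → ℝ) :
    (∑ i, C i * ((side i.1).indicator (fun _ => 1) (c.xc w) *
      (c.xc w / h) ^ degree i) * c.feature w i.2.2) * k (c.xc w / h) =
    ∑ i, C i * sideKernel k i.1 (degree i) (c.xc w / h) * c.feature w i.2.2 := by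
  rw [Finset.sum_mul]
  refine Finset.sum_congr rfl fun i _ => ?_
  rw [sideKernel, ← indicator_side_mul hh]
  ring

/-- At a zero of the factor both sides are 0. Cutting the kernel there makes the identity hold for
every observation and every h, not only almost surely. -/
theorem score_mul_kernel {h : ℝ} (hh : 0 < h) (w : 𝒲) :
    c.score μ W k w h * equivKernel k (c.xc w / h) =
      ∑ i, c.coefAt μ W k h i * cutKernel k i.1 (degree i) (c.xc w / h) * c.feature w i.2.2 := by
  have e : equivKernel k (c.xc w / h) = equivFactor k (c.xc w / h) * k (c.xc w / h) := rfl
  by_cases h0 : equivFactor k (c.xc w / h) = 0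
  · rw [e, h0, zero_mul, mul_zero]
    refine (Finset.sum_eq_zero fun i _ => ?_).symm
    rw [cutKernel, Set.indicator_of_notMem (by simpa using h0), mul_zero, zero_mul]
  · have e2 : ∀ i : Bool × Fin 2 × Fin 4, cutKernel k i.1 (degree i) (c.xc w / h) =
        sideKernel k i.1 (degree i) (c.xc w / h) := fun i => Set.indicator_of_mem h0 _
    simp only [e2]
    rw [← sum_mul_kernel hh, score, e, ← mul_assoc, div_mul_cancel₀ _ h0]

end LocalModel

namespace LocalModel.Holds

variable {Ω 𝒲 : Type*} [mΩ : MeasurableSpace Ω] [MeasurableSpace 𝒲] {c : LocalModel 𝒲}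
  {μ : Measure Ω} [IsProbabilityMeasure μ] {W : ℕ → Ω → 𝒲} {k : ℝ → ℝ}

open LocalModel

theorem measurable_score (H : c.Holds μ W) (h : ℝ) : Measurable fun w => c.score μ W k w h := by
  have hx := H.meas_x
  have hi : ∀ b, Measurable fun w => (side b).indicator (fun _ => (1 : ℝ)) (c.xc w) := fun b =>
    (measurable_const.indicator (measurableSet_side b)).comp hx
  refine Measurable.div (Finset.measurable_sum _ fun i _ => ?_) ?_
  · exact (((hi i.1).mul ((hx.div_const h).pow_const _)).const_mul _).mul (H.measurable_feature _)
  · exact measurable_const.sub ((measurable_norm.comp (hx.div_const h)).const_mul _)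

/-- The limiting slope coefficient is zero and the limiting row is proportional to (s₂, -s₁). The
full sum is therefore the sum of its degree-zero terms times (s₂ - s₁ u) / s₂, and on either side
this quotient is `equivFactor k u` over μ₂. -/
theorem sum_coefAt_zero (H : c.Holds μ W) (hk : KernelRegular k c.A) (hw : WellPosed k) (x u : ℝ)
    (hxu : ∀ b, x ∈ side b → u ∈ side b) (F : Fin 4 → ℝ) :
    (∑ i, c.coefAt μ W k 0 i * ((side i.1).indicator (fun _ => 1) x * 0 ^ degree i) * F i.2.2) *
      equivFactor k u = kernelMoment k 2 *
    ∑ i, c.coefAt μ W k 0 i * ((side i.1).indicator (fun _ => 1) x * u ^ degree i) * F i.2.2 := by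
  simp only [coefAt, gramAt_zero, H.residCoef_limGram hk hw, H.gramRow_limGram hk hw,
    Fintype.sum_prod_type, Fintype.sum_bool, Fin.sum_univ_two, Fin.sum_univ_four, degree,
    featureExp, Matrix.cons_val, Fin.val_zero, Fin.val_one, sideMoment_true,
    sideMoment_false hk.symm]
  have hsplit : x ∈ side true ∧ x ∉ side false ∨ x ∉ side true ∧ x ∈ side false := by
    simp only [side, if_true, Bool.false_eq_true, if_false, Set.mem_Ici, Set.mem_Iio, not_lt,
      not_le, and_self]
    exact le_or_gt 0 x
  rcases hsplit with ⟨h1, h2⟩ | ⟨h1, h2⟩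
  · have hu : 0 ≤ u := hxu true h1
    simp only [Set.indicator_of_mem h1, Set.indicator_of_notMem h2, equivFactor, abs_of_nonneg hu]
    ring
  · have hu : u < 0 := hxu false h2
    simp only [Set.indicator_of_mem h2, Set.indicator_of_notMem h1, equivFactor, abs_of_neg hu]
    ring

theorem score_zero_mul_kernel (H : c.Holds μ W) (hk : KernelRegular k c.A) (hw : WellPosed k)
    {h : ℝ} (hh : 0 < h) (w : 𝒲) :
    c.score μ W k w 0 * equivKernel k (c.xc w / h) =
      ∑ i, c.coefAt μ W k 0 i * cutKernel k i.1 (degree i) (c.xc w / h) * c.feature w i.2.2 := by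
  have e : equivKernel k (c.xc w / h) = equivFactor k (c.xc w / h) * k (c.xc w / h) := rfl
  by_cases h0 : equivFactor k (c.xc w / h) = 0
  · rw [e, h0, zero_mul, mul_zero]
    refine (Finset.sum_eq_zero fun i _ => ?_).symm
    rw [cutKernel, Set.indicator_of_notMem (by simpa using h0), mul_zero, zero_mul]
  · have e2 : ∀ i : Bool × Fin 2 × Fin 4, cutKernel k i.1 (degree i) (c.xc w / h) =
        sideKernel k i.1 (degree i) (c.xc w / h) := fun i => Set.indicator_of_mem h0 _
    have h2 := (wellPosed_moments hk hw).2.1.ne'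
    -- As x / 0 = 0 by convention, the denominator of the score at bandwidth 0 is the factor at 0,
    -- which is μ₂.
    have e3 : equivFactor k 0 = kernelMoment k 2 := by simp [equivFactor]
    simp only [e2]
    rw [← sum_mul_kernel hh, score, e, ← mul_assoc, div_zero, div_mul_eq_mul_div,
      H.sum_coefAt_zero hk hw (c.xc w) (c.xc w / h) (fun b => (div_mem_side hh).2), e3,
      mul_div_cancel_left₀ _ h2]

end LocalModel.Holds

theorem away_const {ι : Type*} {l : Filter ι} {p : ℝ} (hp : p ≠ 0) : Away l fun _ => p :=
  ⟨|p|, abs_pos.2 hp, Eventually.of_forall fun _ => le_rfl⟩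

theorem Approx.congr_left {ι : Type*} {l : Filter ι} {δ g g' p : ι → ℝ} (h : Approx l δ g p)
    (hg : g =ᶠ[l] g') : Approx l δ g' p :=
  ⟨h.1, h.2.congr' (hg.mono fun i hi => by simp only [hi]) EventuallyEq.rfl⟩

theorem Approx.tendsto {ι : Type*} {l : Filter ι} {δ g : ι → ℝ} {p : ℝ}
    (h : Approx l δ g fun _ => p) (hδ : Tendsto δ l (𝓝 0)) : Tendsto g l (𝓝 p) := by
  have h0 : Tendsto (fun i => g i - p) l (𝓝 0) := h.2.trans_tendsto hδ
  simpa using h0.add_const p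

theorem exists_forall_abs_le {α ι : Type*} [Fintype ι] {l : Filter α} {g : ι → α → ℝ} {δ : α → ℝ}
    (h : ∀ i, g i =O[l] δ) : ∃ K, 0 < K ∧ ∀ᶠ a in l, ∀ i, |g i a| ≤ K * |δ a| := by
  choose K hK hg using fun i => (h i).exists_nonneg
  refine ⟨1 + ∑ i, K i, by have := Finset.sum_nonneg fun i (_ : i ∈ Finset.univ) => hK i; linarith,
    ?_⟩
  filter_upwards [eventually_all.2 fun i => (hg i).bound] with a ha i
  refine (ha i).trans (mul_le_mul_of_nonneg_right ?_ (abs_nonneg _))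
  have := Finset.single_le_sum (fun i _ => hK i) (Finset.mem_univ i)
  linarith

/-- Bounds holding at all small bandwidths. -/
structure LocalModel.GoodBandwidth {Ω 𝒲 : Type*} [MeasurableSpace Ω] [MeasurableSpace 𝒲]
    (c : LocalModel 𝒲) (μ : Measure Ω) (W : ℕ → Ω → 𝒲) (k : ℝ → ℝ) (c₀ K₀ h : ℝ) : Prop where
  count : ∀ b, c₀ ≤ c.gramAt μ W k h b 0 2
  det : ∀ b, c₀ ≤ gramDet (c.gramAt μ W k h b)
  jump : c₀ ≤ |lsJump (c.gramAt μ W k h) 1|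
  sand : c₀ ≤ sandwich (c.gramAt μ W k h) (c.meatAt μ W k h)
  gram_le : ∀ b p r, |c.gramAt μ W k h b p r| ≤ K₀
  meat_le : ∀ b p q r s, |c.meatAt μ W k h b p q r s| ≤ K₀
  coef_le : ∀ i, |c.coefAt μ W k h i| ≤ K₀
  f_le : ∀ x, x ≠ 0 → |x| ≤ 2 * c.A * h → c.f x ≤ K₀

/-! ### Uniform bounds at small bandwidths. -/

namespace LocalModel.Holds

variable {Ω 𝒲 : Type*} [mΩ : MeasurableSpace Ω] [MeasurableSpace 𝒲] {c : LocalModel 𝒲}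
  {μ : Measure Ω} [IsProbabilityMeasure μ] {W : ℕ → Ω → 𝒲} {k : ℝ → ℝ}

open LocalModel

theorem approx_gramAt (H : c.Holds μ W) (hk : KernelRegular k c.A) (b : Bool) (p : Fin 2)
    (r : Fin 4) :
    Approx (𝓝[>] 0) c.ρ (fun h => c.gramAt μ W k h b p r) fun _ => c.limGram k b p r := by
  refine (H.approx_popGram hk.antiDiff (fun u hu => hk.eq_zero hu) b p r).congr_left ?_
  filter_upwards [self_mem_nhdsWithin] with h hh
  rw [gramAt_of_ne (ne_of_gt hh)]

theorem approx_meatAt (H : c.Holds μ W) (hk : KernelRegular k c.A) (b : Bool) (p q : Fin 2)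
    (r s : Fin 4) :
    Approx (𝓝[>] 0) c.ρ (fun h => c.meatAt μ W k h b p q r s) fun _ => c.limMeat k b p q r s := by
  refine (H.approx_popMeat hk.antiDiff (fun u hu => hk.eq_zero hu) b p q r s).congr_left ?_
  filter_upwards [self_mem_nhdsWithin] with h hh
  rw [meatAt_of_ne (ne_of_gt hh)]

theorem lsJump_limGram_ne (H : c.Holds μ W) (hk : KernelRegular k c.A) (hw : WellPosed k) :
    lsJump (c.limGram k) 1 ≠ 0 := by
  rw [(H.lsJump_limGram hk hw).1]
  exact H.jump

theorem gramDet_limGram_pos (H : c.Holds μ W) (hk : KernelRegular k c.A) (hw : WellPosed k)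
    (b : Bool) : 0 < gramDet (c.limGram k b) := by
  rw [gramDet_limGram]
  exact mul_pos (pow_pos (H.fl_pos b) 2) (sideMoment_pos hk hw b).2.2

theorem approx_coefAt (H : c.Holds μ W) (hk : KernelRegular k c.A) (hw : WellPosed k)
    (i : Bool × Fin 2 × Fin 4) :
    Approx (𝓝[>] 0) c.ρ (fun h => c.coefAt μ W k h i) fun _ => c.coefAt μ W k 0 i := by
  have hM := H.approx_gramAt hk
  have hN := H.approx_meatAt hk
  have hd : ∀ b, Away (𝓝[>] (0 : ℝ)) fun _ => gramDet (c.limGram k b) := fun b =>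
    away_const (H.gramDet_limGram_pos hk hw b).ne'
  have hj : Away (𝓝[>] (0 : ℝ)) fun _ => lsJump (c.limGram k) 1 :=
    away_const (H.lsJump_limGram_ne hk hw)
  have hδ := H.rho_tendsto
  unfold coefAt
  rw [gramAt_zero, meatAt_zero]
  exact (approx_studentScale hδ hM hN hd hj (H.sandwich_limGram_pos hk hw)
    (Eventually.of_forall fun _ => le_rfl)).mul hδ ((Approx.const _).mul hδ
      ((approx_gramRow hδ hM (hd i.1) i.2.1).mul hδ (approx_residCoef hδ hM hd hj i.1 i.2.2)))

theorem exists_goodBandwidth (H : c.Holds μ W) (hk : KernelRegular k c.A) (hw : WellPosed k) :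
    ∃ c₀ K₀, 0 < c₀ ∧ 0 < K₀ ∧ ∀ᶠ h in 𝓝[>] (0 : ℝ), c.GoodBandwidth μ W k c₀ K₀ h := by
  have hM := H.approx_gramAt hk
  have hN := H.approx_meatAt hk
  have hδ := H.rho_tendsto
  have hd : ∀ b, Away (𝓝[>] (0 : ℝ)) fun _ => gramDet (c.limGram k b) := fun b =>
    away_const (H.gramDet_limGram_pos hk hw b).ne'
  have hj : Away (𝓝[>] (0 : ℝ)) fun _ => lsJump (c.limGram k) 1 :=
    away_const (H.lsJump_limGram_ne hk hw)
  have hlow : ∀ {g : ℝ → ℝ} {p : ℝ}, Approx (𝓝[>] 0) c.ρ g (fun _ => p) → 0 < p →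
      ∃ e, 0 < e ∧ ∀ᶠ h in 𝓝[>] (0 : ℝ), e ≤ g h := fun {g p} hg hp =>
    ⟨p / 2, half_pos hp, (hg.tendsto hδ).eventually (Ici_mem_nhds (half_lt_self hp))⟩
  have hlim : ∀ b, 0 < c.limGram k b 0 2 := by
    intro b
    have : c.limGram k b 0 2 = c.fl b * sideMoment k b 0 := by
      simp [limGram, limMat, momentMatrix, featureExp]
    rw [this]
    exact mul_pos (H.fl_pos b) (sideMoment_pos hk hw b).1
  choose e₁ he₁ h₁ using fun b => hlow (hM b 0 2) (hlim b)
  choose e₂ he₂ h₂ using fun b =>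
    hlow (approx_gramDet hδ hM b) (H.gramDet_limGram_pos hk hw b)
  obtain ⟨e₃, he₃, h₃⟩ := hlow (approx_lsJump hδ hM hd 1).abs
    (abs_pos.2 (H.lsJump_limGram_ne hk hw))
  obtain ⟨e₄, he₄, h₄⟩ := hlow (approx_sandwich hδ hM hN hd hj) (H.sandwich_limGram_pos hk hw)
  obtain ⟨K₁, hK₁, h₅⟩ := exists_forall_abs_le fun i : Bool × Fin 2 × Fin 4 =>
    (hM i.1 i.2.1 i.2.2).isBigO_left hδ
  obtain ⟨K₂, hK₂, h₆⟩ := exists_forall_abs_le fun i : Bool × Fin 2 × Fin 2 × Fin 4 × Fin 4 =>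
    (hN i.1 i.2.1 i.2.2.1 i.2.2.2.1 i.2.2.2.2).isBigO_left hδ
  obtain ⟨K₃, hK₃, h₇⟩ := exists_forall_abs_le fun i =>
    (H.approx_coefAt hk hw i).isBigO_left hδ
  choose K₅ hK₅ h₉ using fun b => (H.f_local b).bound
  -- The density is to be bounded on |x| ≤ 2 A h, the range of the largest dyadic scale, so the
  -- local approximation is used at bandwidth 2 h.
  have hsc : Tendsto (fun t : ℝ => 2 * t) (𝓝[>] 0) (𝓝[>] 0) := tendsto_const_mul_nhdsGT two_pos
  have hρ1 : ∀ᶠ h in 𝓝[>] (0 : ℝ), |c.ρ (2 * h)| ≤ 1 := by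
    have := (hδ.comp hsc).abs
    rw [abs_zero] at this
    exact this.eventually (Iic_mem_nhds one_pos)
  set c₀ := min (min (min (e₁ true) (e₁ false)) (min (e₂ true) (e₂ false))) (min e₃ e₄) with hc₀
  set K₆ := (c.fl true + K₅ true) + (c.fl false + K₅ false) with hK₆
  set K₀ := K₁ + K₂ + K₃ + K₆ with hK₀
  have hf6 : ∀ b, c.fl b + K₅ b ≤ K₆ := by
    have h1 := H.fl_pos true
    have h2 := H.fl_pos false
    have h3 := hK₅ true
    have h4 := hK₅ false
    intro b
    cases b <;> linarith
  have hK60 : 0 ≤ K₆ := (add_nonneg (H.fl_pos true).le (hK₅ true)).trans (hf6 true)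
  have hb1 : ∀ b, c₀ ≤ e₁ b := by
    intro b
    cases b <;> simp [hc₀]
  have hb2 : ∀ b, c₀ ≤ e₂ b := by
    intro b
    cases b <;> simp [hc₀]
  have hb3 : c₀ ≤ e₃ := by simp [hc₀]
  have hb4 : c₀ ≤ e₄ := by simp [hc₀]
  refine ⟨c₀, K₀, by simp [hc₀, he₁, he₂, he₃, he₄], by linarith, ?_⟩
  filter_upwards [eventually_all.2 h₁, eventually_all.2 h₂, h₃, h₄, h₅, h₆, h₇,
    hsc.eventually (eventually_all.2 h₉), hρ1] with h g1 g2 g3 g4 g5 g6 g7 g9 g10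
  simp only [abs_one, mul_one] at g5 g6 g7
  refine ⟨fun b => (hb1 b).trans (g1 b), fun b => (hb2 b).trans (g2 b), hb3.trans g3,
    hb4.trans g4, fun b p r => (g5 (b, p, r)).trans (by linarith),
    fun b p q r s => (g6 (b, p, q, r, s)).trans (by linarith),
    fun i => (g7 i).trans (by linarith), fun x hx hxA => ?_⟩
  have key : ∀ b, x ∈ side b → c.f x ≤ K₀ := by
    intro b hb
    have h1 := (abs_le.1 (g9 b x hb hx (by linarith))).2
    have h2 := mul_le_mul_of_nonneg_left g10 (hK₅ b)
    linarith [hf6 b]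
  rcases le_or_gt 0 x with h | h
  · exact key true h
  · exact key false h

end LocalModel.Holds

/-- The two half-lines are disjoint, so there are no cross terms between the sides. -/
theorem sideKernel_mul_sideKernel (k : ℝ → ℝ) (b b' : Bool) (i j : ℕ) (u : ℝ) :
    sideKernel k b i u * sideKernel k b' j u =
      if b = b' then sideKernel (fun u => k u ^ 2) b (i + j) u else 0 := by
  unfold sideKernel
  split_ifs with h
  · subst h
    by_cases hu : u ∈ side b <;> simp [hu, pow_add]
    ring
  · have : u ∉ side b ∨ u ∉ side b' := by
      by_contra! hc
      obtain ⟨h1, h2⟩ := hc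
      cases b <;> cases b' <;> simp_all [side]
      · exact absurd h1 (not_lt.2 h2)
      · exact absurd h2 (not_lt.2 h1)
    rcases this with h | h <;> simp [h]

namespace LocalModel

variable {Ω 𝒲 : Type*} [MeasurableSpace Ω] [MeasurableSpace 𝒲] {c : LocalModel 𝒲} {μ : Measure Ω}
  {W : ℕ → Ω → 𝒲} {k : ℝ → ℝ} {c₀ K₀ h : ℝ}

/-- For each side and regressor, the sum over features is a normal equation of the population fit at
bandwidth h. Centering is thus exact at every h. -/
theorem GoodBandwidth.sum_coefAt_mul_gramAt (hg : c.GoodBandwidth μ W k c₀ K₀ h) (hc₀ : 0 < c₀) :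
    ∑ i, c.coefAt μ W k h i * c.gramAt μ W k h i.1 i.2.1 i.2.2 = 0 := by
  have e : ∀ b p r, c.coefAt μ W k h (b, p, r) * c.gramAt μ W k h b p r =
      studentScale (c.gramAt μ W k h) (c.meatAt μ W k h) * (sideSign b *
        (gramRow (c.gramAt μ W k h b) p *
          (residCoef (c.gramAt μ W k h) b r * c.gramAt μ W k h b p r))) := fun b p r => by
    unfold coefAt
    ring
  simp only [Fintype.sum_prod_type, e, ← Finset.mul_sum,
    sum_residCoef_mul (hc₀.trans_le (hg.det _)).ne', mul_zero, Finset.sum_const_zero]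

/-- The signs square to 1 and the double sum is the sandwich form, which the square of
`studentScale` normalizes. -/
theorem GoodBandwidth.sum_coefAt_mul_meatAt (hg : c.GoodBandwidth μ W k c₀ K₀ h) (hc₀ : 0 < c₀) :
    ∑ i, ∑ j, c.coefAt μ W k h i * c.coefAt μ W k h j * (if i.1 = j.1 then
      c.meatAt μ W k h i.1 i.2.1 j.2.1 i.2.2 j.2.2 else 0) = 1 := by
  have hs := hc₀.trans_le hg.sand
  have hj : |lsJump (c.gramAt μ W k h) 1| ≠ 0 := (hc₀.trans_le hg.jump).ne'
  have e1 : studentScale (c.gramAt μ W k h) (c.meatAt μ W k h) ^ 2 *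
      sandwich (c.gramAt μ W k h) (c.meatAt μ W k h) = 1 := by
    unfold studentScale
    rw [div_pow, div_pow, sq_abs, Real.sq_sqrt hs.le,
      div_self (pow_ne_zero 2 (abs_ne_zero.1 hj)), one_div, inv_mul_cancel₀ hs.ne']
  have e2 : ∀ b p r, (∑ j, c.coefAt μ W k h (b, p, r) * c.coefAt μ W k h j * (if b = j.1 then
      c.meatAt μ W k h b p j.2.1 r j.2.2 else 0)) = ∑ q, ∑ s, c.coefAt μ W k h (b, p, r) *
        c.coefAt μ W k h (b, q, s) * c.meatAt μ W k h b p q r s := by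
    intro b p r
    simp only [Fintype.sum_prod_type, Fintype.sum_bool]
    cases b <;> simp
  rw [← e1, sandwich, Finset.mul_sum, Fintype.sum_prod_type]
  refine Finset.sum_congr rfl fun b _ => ?_
  rw [Fintype.sum_prod_type, Finset.mul_sum]
  refine Finset.sum_congr rfl fun p _ => ?_
  simp only [e2]
  rw [Finset.sum_comm, Finset.mul_sum]
  refine Finset.sum_congr rfl fun q _ => ?_
  rw [Finset.mul_sum]
  refine Finset.sum_congr rfl fun r _ => ?_
  rw [Finset.mul_sum]
  refine Finset.sum_congr rfl fun s _ => ?_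
  have e3 : sideSign b * sideSign b = 1 := by cases b <;> simp [sideSign]
  unfold coefAt
  linear_combination (studentScale (c.gramAt μ W k h) (c.meatAt μ W k h) ^ 2 *
    gramRow (c.gramAt μ W k h b) p * gramRow (c.gramAt μ W k h b) q *
    residCoef (c.gramAt μ W k h) b r * residCoef (c.gramAt μ W k h) b s *
    c.meatAt μ W k h b p q r s) * e3

end LocalModel

/-! ### Centering, variance and covering numbers of the influence function. -/

namespace LocalModel.Holds

variable {Ω 𝒲 : Type*} [mΩ : MeasurableSpace Ω] [MeasurableSpace 𝒲] {c : LocalModel 𝒲}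
  {μ : Measure Ω} [IsProbabilityMeasure μ] {W : ℕ → Ω → 𝒲} {k : ℝ → ℝ} {c₀ K₀ h : ℝ}

open LocalModel

theorem ae_notMem_of_finite (H : c.Holds μ W) {s : Set ℝ} (hs : s.Finite) :
    ∀ᵐ ω ∂μ, c.xc (W 0 ω) ∉ s := by
  have h : μ.map (fun ω => c.xc (W 0 ω)) s = 0 := by
    rw [H.density]
    exact withDensity_absolutelyContinuous _ _ (hs.measure_zero _)
  rw [Measure.map_apply H.measurable_X hs.measurableSet] at h
  exact measure_eq_zero_iff_ae_notMem.1 h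

theorem ae_equivFactor_ne (H : c.Holds μ W) (h2 : kernelMoment k 2 ≠ 0) (hh : 0 < h) :
    ∀ᵐ ω ∂μ, equivFactor k (c.xc (W 0 ω) / h) ≠ 0 := by
  filter_upwards [H.ae_notMem_of_finite (Set.toFinite
    {h * (kernelMoment k 2 / kernelMoment k 1), h * -(kernelMoment k 2 / kernelMoment k 1)})]
    with ω hω
  refine equivFactor_ne_zero_of h2 (fun he => hω (Or.inl ?_)) fun he => hω (Or.inr ?_)
  · rw [← he, mul_div_cancel₀ _ hh.ne']
  · rw [Set.mem_singleton_iff, ← he, mul_div_cancel₀ _ hh.ne']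

theorem score_mul_kernel_ae (H : c.Holds μ W) (h2 : kernelMoment k 2 ≠ 0) (hh : 0 < h) :
    (fun ω => c.score μ W k (W 0 ω) h * equivKernel k (c.xc (W 0 ω) / h)) =ᵐ[μ] fun ω =>
      ∑ i, c.coefAt μ W k h i * (sideKernel k i.1 (degree i) (c.xc (W 0 ω) / h) *
        c.feature (W 0 ω) i.2.2) := by
  filter_upwards [H.ae_equivFactor_ne h2 hh] with ω hω
  rw [score_mul_kernel hh]
  refine Finset.sum_congr rfl fun i _ => ?_
  rw [cutKernel, Set.indicator_of_mem (by exact hω), mul_assoc]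

theorem integrable_sideKernel_mul (H : c.Holds μ W) (hk : AntiDiff k)
    (hkA : ∀ u, c.A < |u| → k u = 0) (b : Bool) (j : ℕ) (h : ℝ) {V : 𝒲 → ℝ} (hV : Measurable V)
    {B : ℝ} (hVB : ∀ w, |V w| ≤ B) :
    Integrable (fun ω => sideKernel k b j (c.xc (W 0 ω) / h) * V (W 0 ω)) μ := by
  have hs := hk.sideKernel hkA b j
  obtain ⟨K, hK0, hK⟩ := hs.bounded
  refine Integrable.of_bound ((hs.measurable.comp (H.measurable_X.div_const h)).mul
    (hV.comp (H.iid.1 0))).aestronglyMeasurable (K * B) (ae_of_all _ fun ω => ?_)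
  rw [Real.norm_eq_abs, abs_mul]
  exact mul_le_mul (hK _) (hVB _) (abs_nonneg _) hK0

theorem integral_score (H : c.Holds μ W) (hk : KernelRegular k c.A) (hw : WellPosed k)
    (hg : c.GoodBandwidth μ W k c₀ K₀ h) (hc₀ : 0 < c₀) (hh : 0 < h) :
    ∫ ω, c.score μ W k (W 0 ω) h * equivKernel k (c.xc (W 0 ω) / h) ∂μ = 0 := by
  rw [integral_congr_ae (H.score_mul_kernel_ae (wellPosed_moments hk hw).2.1.ne' hh),
    integral_finsetSum _ fun i _ => (H.integrable_sideKernel_mul hk.antiDiff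
      (fun u hu => hk.eq_zero hu) i.1 (degree i) h (H.measurable_feature i.2.2)
      fun w => H.abs_feature_le w i.2.2).const_mul _]
  have e : ∀ i : Bool × Fin 2 × Fin 4, ∫ ω, sideKernel k i.1 (degree i) (c.xc (W 0 ω) / h) *
      c.feature (W 0 ω) i.2.2 ∂μ = h * c.gramAt μ W k h i.1 i.2.1 i.2.2 := by
    intro i
    rw [gramAt_of_ne hh.ne', popGram, popMoment, mul_inv_cancel_left₀ hh.ne']
    rfl
  simp only [integral_const_mul, e, mul_left_comm _ h]
  rw [← Finset.mul_sum, hg.sum_coefAt_mul_gramAt hc₀, mul_zero]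

theorem integral_score_sq (H : c.Holds μ W) (hk : KernelRegular k c.A) (hw : WellPosed k)
    (hg : c.GoodBandwidth μ W k c₀ K₀ h) (hc₀ : 0 < c₀) (hh : 0 < h) :
    ∫ ω, (c.score μ W k (W 0 ω) h * equivKernel k (c.xc (W 0 ω) / h)) ^ 2 ∂μ = h := by
  have hkA2 : ∀ u, c.A < |u| → k u ^ 2 = 0 := fun u hu => by rw [hk.eq_zero hu]; norm_num
  have hcong : (fun ω => (c.score μ W k (W 0 ω) h * equivKernel k (c.xc (W 0 ω) / h)) ^ 2) =ᵐ[μ]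
      fun ω => ∑ i, ∑ j, c.coefAt μ W k h i * c.coefAt μ W k h j * ((if i.1 = j.1 then 1 else 0) *
        (sideKernel (fun u => k u ^ 2) i.1 (degree i + degree j) (c.xc (W 0 ω) / h) *
        (c.feature (W 0 ω) i.2.2 * c.feature (W 0 ω) j.2.2))) := by
    filter_upwards [H.score_mul_kernel_ae (wellPosed_moments hk hw).2.1.ne' hh] with ω hω
    rw [hω, sq, Finset.sum_mul_sum]
    refine Finset.sum_congr rfl fun i _ => Finset.sum_congr rfl fun j _ => ?_
    have := sideKernel_mul_sideKernel k i.1 j.1 (degree i) (degree j) (c.xc (W 0 ω) / h)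
    have e : (if i.1 = j.1 then (1 : ℝ) else 0) *
        (sideKernel (fun u => k u ^ 2) i.1 (degree i + degree j) (c.xc (W 0 ω) / h) *
        (c.feature (W 0 ω) i.2.2 * c.feature (W 0 ω) j.2.2)) =
        (sideKernel k i.1 (degree i) (c.xc (W 0 ω) / h) *
          sideKernel k j.1 (degree j) (c.xc (W 0 ω) / h)) *
          (c.feature (W 0 ω) i.2.2 * c.feature (W 0 ω) j.2.2) := by
      rw [this]
      split_ifs <;> ring
    rw [e]
    ring
  have hVB : ∀ (r s : Fin 4) (w : 𝒲), |c.feature w r * c.feature w s| ≤ c.B * c.B := fun r s w => by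
    rw [abs_mul]
    exact mul_le_mul (H.abs_feature_le w r) (H.abs_feature_le w s) (abs_nonneg _)
      (by linarith [H.one_le])
  have hint : ∀ i j : Bool × Fin 2 × Fin 4, Integrable (fun ω =>
      c.coefAt μ W k h i * c.coefAt μ W k h j * ((if i.1 = j.1 then 1 else 0) *
        (sideKernel (fun u => k u ^ 2) i.1 (degree i + degree j) (c.xc (W 0 ω) / h) *
        (c.feature (W 0 ω) i.2.2 * c.feature (W 0 ω) j.2.2)))) μ := fun i j =>
    ((H.integrable_sideKernel_mul (hk.antiDiff.pow 2) hkA2 i.1 (degree i + degree j) h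
      ((H.measurable_feature i.2.2).mul (H.measurable_feature j.2.2))
      (hVB i.2.2 j.2.2)).const_mul _).const_mul _
  rw [integral_congr_ae hcong, integral_finsetSum _ fun i _ => integrable_finsetSum _ fun j _ =>
    hint i j]
  have e : ∀ i j : Bool × Fin 2 × Fin 4, ∫ ω, c.coefAt μ W k h i * c.coefAt μ W k h j *
      ((if i.1 = j.1 then 1 else 0) *
        (sideKernel (fun u => k u ^ 2) i.1 (degree i + degree j) (c.xc (W 0 ω) / h) *
        (c.feature (W 0 ω) i.2.2 * c.feature (W 0 ω) j.2.2))) ∂μ =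
      h * (c.coefAt μ W k h i * c.coefAt μ W k h j * (if i.1 = j.1 then
        c.meatAt μ W k h i.1 i.2.1 j.2.1 i.2.2 j.2.2 else 0)) := by
    intro i j
    have e2 : degree i + degree j = i.2.1 + j.2.1 + (featureExp i.2.2 + featureExp j.2.2) := by
      unfold degree
      ring
    rw [integral_const_mul, integral_const_mul, meatAt_of_ne hh.ne', popMeat, popMoment, e2]
    split_ifs
    · rw [one_mul, mul_left_comm h, mul_inv_cancel_left₀ hh.ne']
      rfl
    · ring
  have e3 : ∀ i : Bool × Fin 2 × Fin 4, ∫ ω, ∑ j, c.coefAt μ W k h i * c.coefAt μ W k h j *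
      ((if i.1 = j.1 then 1 else 0) *
        (sideKernel (fun u => k u ^ 2) i.1 (degree i + degree j) (c.xc (W 0 ω) / h) *
        (c.feature (W 0 ω) i.2.2 * c.feature (W 0 ω) j.2.2))) ∂μ =
      ∑ j, h * (c.coefAt μ W k h i * c.coefAt μ W k h j * (if i.1 = j.1 then
        c.meatAt μ W k h i.1 i.2.1 j.2.1 i.2.2 j.2.2 else 0)) := fun i => by
    rw [integral_finsetSum _ fun j _ => hint i j]
    exact Finset.sum_congr rfl fun j _ => e i j
  simp only [e3, ← Finset.mul_sum]
  rw [hg.sum_coefAt_mul_meatAt hc₀, mul_one]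

theorem abs_sum_kernel_le (H : c.Holds μ W) {φ : Bool × Fin 2 × Fin 4 → ℝ → ℝ}
    (hφ : ∀ i, AntiDiff (φ i)) :
    ∃ K, 0 ≤ K ∧ ∀ (C : Bool × Fin 2 × Fin 4 → ℝ) (L : ℝ), (∀ i, |C i| ≤ L) → ∀ (w : 𝒲) (u : ℝ),
      |∑ i, C i * φ i u * c.feature w i.2.2| ≤ K * L := by
  choose K hK0 hK using fun i => (hφ i).bounded
  have hB : 0 ≤ c.B := by linarith [H.one_le]
  refine ⟨∑ i, K i * c.B, Finset.sum_nonneg fun i _ => mul_nonneg (hK0 i) hB,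
    fun C L hC w u => ?_⟩
  rw [Finset.sum_mul]
  refine (Finset.abs_sum_le_sum_abs _ _).trans (Finset.sum_le_sum fun i _ => ?_)
  rw [abs_mul, abs_mul]
  have hL : 0 ≤ L := (abs_nonneg _).trans (hC i)
  calc |C i| * |φ i u| * |c.feature w i.2.2| ≤ L * K i * c.B :=
        mul_le_mul (mul_le_mul (hC i) (hK i u) (abs_nonneg _) hL) (H.abs_feature_le w _)
          (abs_nonneg _) (mul_nonneg hL (hK0 i))
    _ = K i * c.B * L := by ring

theorem abs_sum_cutKernel_le (H : c.Holds μ W) (hk : KernelRegular k c.A) (hw : WellPosed k) :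
    ∃ K, 0 ≤ K ∧ ∀ (C : Bool × Fin 2 × Fin 4 → ℝ) (L : ℝ), (∀ i, |C i| ≤ L) → ∀ (w : 𝒲) (u : ℝ),
      |∑ i, C i * cutKernel k i.1 (degree i) u * c.feature w i.2.2| ≤ K * L :=
  H.abs_sum_kernel_le fun i => hk.antiDiff.cutKernel (fun _ hu => hk.eq_zero hu)
    (wellPosed_moments hk hw).2.1 i.1 (degree i)

theorem abs_score_mul_kernel_le (H : c.Holds μ W) (hk : KernelRegular k c.A) (hw : WellPosed k)
    (K₀ : ℝ) : ∃ K, ∀ h, 0 < h → (∀ i, |c.coefAt μ W k h i| ≤ K₀) → ∀ w : 𝒲,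
      |c.score μ W k w h * equivKernel k (c.xc w / h)| ≤ K := by
  obtain ⟨K, -, hK⟩ := H.abs_sum_cutKernel_le hk hw
  refine ⟨K * K₀, fun h hh hC w => ?_⟩
  rw [score_mul_kernel hh]
  exact hK _ _ hC w _

theorem memLp_score (H : c.Holds μ W) (hk : KernelRegular k c.A) (hw : WellPosed k)
    (hg : c.GoodBandwidth μ W k c₀ K₀ h) (hh : 0 < h) :
    MemLp (fun ω => c.score μ W k (W 0 ω) h * equivKernel k (c.xc (W 0 ω) / h)) 2 μ := by
  obtain ⟨K, hK⟩ := H.abs_score_mul_kernel_le hk hw K₀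
  refine MemLp.of_bound ?_ K (ae_of_all _ fun ω => hK h hh hg.coef_le (W 0 ω))
  exact (((H.measurable_score h).comp (H.iid.1 0)).mul
    ((hk.equivKernel hw).antiDiff.measurable.comp (H.measurable_X.div_const h))).aestronglyMeasurable

theorem variance_score (H : c.Holds μ W) (hk : KernelRegular k c.A) (hw : WellPosed k)
    (hg : c.GoodBandwidth μ W k c₀ K₀ h) (hc₀ : 0 < c₀) (hh : 0 < h) :
    1 / h * variance (fun ω => c.score μ W k (W 0 ω) h * equivKernel k (c.xc (W 0 ω) / h)) μ
      = 1 := by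
  rw [variance_of_integral_eq_zero (H.memLp_score hk hw hg hh).1.aemeasurable
    (H.integral_score hk hw hg hc₀ hh), H.integral_score_sq hk hw hg hc₀ hh,
    one_div_mul_cancel hh.ne']

theorem polyUniformCovering_score (H : c.Holds μ W) (hk : KernelRegular k c.A) (hw : WellPosed k)
    {hmax : ℝ} (hg : ∀ h ∈ Set.Ioc 0 hmax, c.GoodBandwidth μ W k c₀ K₀ h) :
    PolyUniformCovering ((fun (h : ℝ) (w : 𝒲) => c.score μ W k w h *
      equivKernel k (c.xc w / h)) '' Set.Ioc 0 hmax) := by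
  have h := polyUniformCovering_sum (H := Set.Ioc 0 hmax) (fun h hh => hh.1) H.meas_x
    (fun i : Bool × Fin 2 × Fin 4 => hk.antiDiff.cutKernel (fun u hu => hk.eq_zero hu)
      (wellPosed_moments hk hw).2.1 i.1 (degree i)) (fun i => H.measurable_feature i.2.2)
    (K := max K₀ c.B) (fun i w => (H.abs_feature_le w i.2.2).trans (le_max_right _ _))
    (fun h i => c.coefAt μ W k h i) fun h hh i => ((hg h hh).coef_le i).trans (le_max_left _ _)
  rwa [Set.image_congr fun h hh => funext fun w => (score_mul_kernel hh.1 w)]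

end LocalModel.Holds

theorem polyUniformCovering_kernel {k : ℝ → ℝ} {A : ℝ} (hk : KernelRegular k A) (hmax : ℝ) :
    PolyUniformCovering ((fun (h x : ℝ) => k (x / h)) '' Set.Ioc 0 hmax) := by
  have h := polyUniformCovering_sum (H := Set.Ioc 0 hmax) (fun h hh => hh.1) measurable_id
    (fun _ : Unit => hk.antiDiff) (V := fun _ _ => 1) (fun _ => measurable_const) (K := 1)
    (fun _ _ => by simp) (fun _ _ => 1) fun _ _ _ => by simp
  simpa using h

/-! ### Conditional moments -/

section CondMoments

variable {Ω β : Type*} [mΩ : MeasurableSpace Ω] [mβ : MeasurableSpace β] {μ : Measure Ω}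
  [IsProbabilityMeasure μ] {X : Ω → β}

theorem condExp_covariance {m : MeasurableSpace Ω} (hm : m ≤ mΩ) {Z Z' : Ω → ℝ} {B : ℝ}
    (hZ : Integrable Z μ) (hZ' : Integrable Z' μ) (hB : ∀ᵐ ω ∂μ, |Z ω| ≤ B)
    (hB' : ∀ᵐ ω ∂μ, |Z' ω| ≤ B) :
    μ[fun ω => (Z ω - (μ[Z | m]) ω) * (Z' ω - (μ[Z' | m]) ω) | m] =ᵐ[μ]
      fun ω => (μ[fun ω => Z ω * Z' ω | m]) ω - (μ[Z | m]) ω * (μ[Z' | m]) ω := by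
  have hE : ∀ᵐ ω ∂μ, ‖(μ[Z | m]) ω‖ ≤ B := ae_bdd_abs_condExp_of_ae_bdd_abs hB
  have hE' : ∀ᵐ ω ∂μ, ‖(μ[Z' | m]) ω‖ ≤ B := ae_bdd_abs_condExp_of_ae_bdd_abs hB'
  have hEm : AEStronglyMeasurable[mΩ] (μ[Z | m]) μ :=
    (stronglyMeasurable_condExp.mono hm).aestronglyMeasurable
  have hEm' : AEStronglyMeasurable[mΩ] (μ[Z' | m]) μ :=
    (stronglyMeasurable_condExp.mono hm).aestronglyMeasurable
  have i1 : Integrable (fun ω => Z ω * Z' ω) μ := hZ'.bdd_mul hZ.1 hB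
  have i2 : Integrable (μ[Z | m] * Z') μ := hZ'.bdd_mul hEm hE
  have i3 : Integrable (μ[Z' | m] * Z) μ := hZ.bdd_mul hEm' hE'
  have i4 : Integrable (μ[Z | m] * μ[Z' | m]) μ := integrable_condExp.bdd_mul hEm hE
  have e : (fun ω => (Z ω - (μ[Z | m]) ω) * (Z' ω - (μ[Z' | m]) ω)) =
      (fun ω => Z ω * Z' ω) - μ[Z | m] * Z' - μ[Z' | m] * Z + μ[Z | m] * μ[Z' | m] := by
    funext ω
    simp only [Pi.add_apply, Pi.sub_apply, Pi.mul_apply]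
    ring
  rw [e]
  have h1 := condExp_add ((i1.sub i2).sub i3) i4 m
  have h2 := condExp_sub (i1.sub i2) i3 m
  have h3 := condExp_sub i1 i2 m
  have h4 := condExp_mul_of_stronglyMeasurable_left stronglyMeasurable_condExp i2 hZ'
  have h5 := condExp_mul_of_stronglyMeasurable_left stronglyMeasurable_condExp i3 hZ
  have h6 := condExp_of_stronglyMeasurable hm
    (stronglyMeasurable_condExp.mul stronglyMeasurable_condExp) i4
  filter_upwards [h1, h2, h3, h4, h5] with ω h1 h2 h3 h4 h5
  rw [h1, Pi.add_apply, h2, Pi.sub_apply, h3, Pi.sub_apply, h4, h5, h6]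
  simp only [Pi.mul_apply]
  ring

theorem IsCondMean.isCondCov (hX : Measurable X) {Z Z' : Ω → ℝ} {B : ℝ} (hZ : Integrable Z μ)
    (hZ' : Integrable Z' μ) (hB : ∀ᵐ ω ∂μ, |Z ω| ≤ B) (hB' : ∀ᵐ ω ∂μ, |Z' ω| ≤ B)
    {m m' q : β → ℝ} (hm : IsCondMean μ X Z m) (hm' : IsCondMean μ X Z' m')
    (hq : IsCondMean μ X (fun ω => Z ω * Z' ω) q) :
    IsCondCov μ X Z Z' fun x => q x - m x * m' x := by
  refine ⟨hq.1.sub (hm.1.mul hm'.1), ?_⟩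
  filter_upwards [condExp_covariance hX.comap_le hZ hZ' hB hB', hm.2, hm'.2, hq.2]
    with ω h1 h2 h3 h4
  rw [h1, ← h2, ← h3, ← h4]

theorem IsCondCov.isCondMean (hX : Measurable X) {Z Z' : Ω → ℝ} {B : ℝ} (hZ : Integrable Z μ)
    (hZ' : Integrable Z' μ) (hB : ∀ᵐ ω ∂μ, |Z ω| ≤ B) (hB' : ∀ᵐ ω ∂μ, |Z' ω| ≤ B)
    {m m' v : β → ℝ} (hm : IsCondMean μ X Z m) (hm' : IsCondMean μ X Z' m')
    (hv : IsCondCov μ X Z Z' v) :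
    IsCondMean μ X (fun ω => Z ω * Z' ω) fun x => v x + m x * m' x := by
  refine ⟨hv.1.add (hm.1.mul hm'.1), ?_⟩
  filter_upwards [condExp_covariance hX.comap_le hZ hZ' hB hB', hm.2, hm'.2, hv.2]
    with ω h1 h2 h3 h4
  rw [h4, h1, h2, h3]
  ring

theorem IsCondMean.sum_mul {ι : Type*} (s : Finset ι) (hX : Measurable X) {V : ι → Ω → ℝ}
    (hV : ∀ i, Integrable (V i) μ) {m : ι → β → ℝ} (hm : ∀ i, IsCondMean μ X (V i) (m i))
    {a : ι → β → ℝ} (ha : ∀ i, Measurable (a i)) {K : ι → ℝ} (hK : ∀ i x, |a i x| ≤ K i) :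
    IsCondMean μ X (fun ω => ∑ i ∈ s, a i (X ω) * V i ω) fun x => ∑ i ∈ s, a i x * m i x := by
  refine ⟨Finset.measurable_sum _ fun i _ => (ha i).mul (hm i).1, ?_⟩
  have hint : ∀ i, Integrable (fun ω => a i (X ω) * V i ω) μ := fun i =>
    (hV i).bdd_mul ((ha i).comp hX).aestronglyMeasurable (ae_of_all _ fun ω => hK i _)
  have h1 := condExp_finsetSum (s := s) (f := fun i ω => a i (X ω) * V i ω)
    (fun i _ => hint i) (mβ.comap X) (μ := μ)
  have h2 : ∀ i, μ[fun ω => a i (X ω) * V i ω | mβ.comap X] =ᵐ[μ]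
      fun ω => a i (X ω) * m i (X ω) := by
    intro i
    have hs : StronglyMeasurable[mβ.comap X] fun ω => a i (X ω) :=
      ((ha i).comp (comap_measurable X)).stronglyMeasurable
    filter_upwards [condExp_mul_of_stronglyMeasurable_left hs (hint i) (hV i), (hm i).2]
      with ω h1 h2
    rw [h2]
    exact h1
  have h3 : ∀ᵐ ω ∂μ, ∀ i ∈ s, (μ[fun ω => a i (X ω) * V i ω | mβ.comap X]) ω =
      a i (X ω) * m i (X ω) := (ae_ball_iff s.countable_toSet).2 fun i _ => h2 i
  have e : (∑ i ∈ s, fun ω => a i (X ω) * V i ω) = fun ω => ∑ i ∈ s, a i (X ω) * V i ω := by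
    funext ω
    simp
  rw [e] at h1
  filter_upwards [h1, h3] with ω h1 h3
  rw [h1, Finset.sum_apply]
  exact Finset.sum_congr rfl fun i hi => (h3 i hi).symm

end CondMoments

/-! ### Folding at zero -/

/-- The density of `|X|`, with value `g₀` at zero. -/
noncomputable def foldDensity (f : ℝ → ℝ) (g₀ t : ℝ) : ℝ :=
  ({0}ᶜ : Set ℝ).piecewise (fun t => f t + f (-t)) (fun _ => g₀) t

/-- The conditional mean given `|X|`, with value `g₀` at zero. -/
noncomputable def foldMean (f g : ℝ → ℝ) (g₀ t : ℝ) : ℝ :=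
  ({0}ᶜ : Set ℝ).piecewise (fun t => (f t * g t + f (-t) * g (-t)) / (f t + f (-t))) (fun _ => g₀) t

theorem foldDensity_of_ne {f : ℝ → ℝ} {g₀ t : ℝ} (ht : t ≠ 0) :
    foldDensity f g₀ t = f t + f (-t) := Set.piecewise_eq_of_mem _ _ _ ht

theorem foldDensity_zero {f : ℝ → ℝ} {g₀ : ℝ} : foldDensity f g₀ 0 = g₀ :=
  Set.piecewise_eq_of_notMem _ _ _ (by simp)

theorem foldMean_of_ne {f g : ℝ → ℝ} {g₀ t : ℝ} (ht : t ≠ 0) :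
    foldMean f g g₀ t = (f t * g t + f (-t) * g (-t)) / (f t + f (-t)) :=
  Set.piecewise_eq_of_mem _ _ _ ht

theorem foldMean_zero {f g : ℝ → ℝ} {g₀ : ℝ} : foldMean f g g₀ 0 = g₀ :=
  Set.piecewise_eq_of_notMem _ _ _ (by simp)

theorem measurable_foldDensity {f : ℝ → ℝ} (hf : Measurable f) (g₀ : ℝ) :
    Measurable (foldDensity f g₀) :=
  Measurable.piecewise (measurableSet_singleton 0).compl (hf.add (hf.comp measurable_neg))
    measurable_const

theorem measurable_foldMean {f g : ℝ → ℝ} (hf : Measurable f) (hg : Measurable g) (g₀ : ℝ) :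
    Measurable (foldMean f g g₀) :=
  Measurable.piecewise (measurableSet_singleton 0).compl (((hf.mul hg).add
    ((hf.mul hg).comp measurable_neg)).div (hf.add (hf.comp measurable_neg))) measurable_const

theorem foldMean_abs {f g : ℝ → ℝ} {g₀ x : ℝ} (hx : x ≠ 0) :
    foldMean f g g₀ |x| = (f x * g x + f (-x) * g (-x)) / (f x + f (-x)) := by
  rw [foldMean_of_ne (abs_ne_zero.2 hx)]
  rcases abs_choice x with h | h <;> rw [h]
  rw [neg_neg, add_comm, add_comm (f (-x))]

section Fold

variable {Ω : Type*} [mΩ : MeasurableSpace Ω] {μ : Measure Ω} [IsProbabilityMeasure μ] {X : Ω → ℝ}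
  {f : ℝ → ℝ}

/-- The negative half-line is reflected onto the positive one. The value `g₀` at 0 is free because a
point is null; it is later taken to be the limit of the density. -/
theorem map_abs_eq_withDensity (hX : Measurable X) (hf : Measurable f) (hf0 : ∀ x, 0 ≤ f x)
    (hd : μ.map X = volume.withDensity fun x => ENNReal.ofReal (f x)) (g₀ : ℝ) :
    μ.map (fun ω => |X ω|) = (volume.restrict (Set.Ici 0)).withDensity
      fun t => ENNReal.ofReal (foldDensity f g₀ t) := by
  have habs : Measurable fun x : ℝ => |x| := measurable_norm
  have e : μ.map (fun ω => |X ω|) = (μ.map X).map fun x => |x| :=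
    (Measure.map_map habs hX).symm
  rw [e, hd]
  ext T hT
  rw [Measure.map_apply habs hT, withDensity_apply _ (habs hT), withDensity_apply _ hT,
    Measure.restrict_restrict hT,
    ← lintegral_inter_add_sdiff _ ((fun x : ℝ => |x|) ⁻¹' T) (measurableSet_Ici (a := (0 : ℝ)))]
  have h1 : (fun x : ℝ => |x|) ⁻¹' T ∩ Set.Ici 0 = T ∩ Set.Ici 0 := by
    ext x
    refine and_congr_left fun hx => ?_
    rw [Set.mem_preimage, abs_of_nonneg hx]
  have h2 : (fun x : ℝ => |x|) ⁻¹' T \ Set.Ici 0 = Neg.neg ⁻¹' (T ∩ Set.Ioi 0) := by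
    ext x
    simp only [Set.mem_sdiff, Set.mem_preimage, Set.mem_Ici, not_le, Set.mem_inter_iff, Set.mem_Ioi,
      neg_pos]
    refine and_congr_left fun hx => ?_
    rw [abs_of_neg hx]
  have hfm : Measurable fun x => ENNReal.ofReal (f (-x)) :=
    (hf.comp measurable_neg).ennreal_ofReal
  have h3 : ∫⁻ x in Neg.neg ⁻¹' (T ∩ Set.Ioi (0 : ℝ)), ENNReal.ofReal (f x) =
      ∫⁻ x in T ∩ Set.Ioi 0, ENNReal.ofReal (f (-x)) := by
    have := (Measure.measurePreserving_neg (volume : Measure ℝ)).setLIntegral_comp_preimage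
      (hT.inter (measurableSet_Ioi (a := (0 : ℝ)))) hfm
    simpa only [neg_neg] using this
  have h4 : (T ∩ Set.Ioi (0 : ℝ) : Set ℝ) =ᵐ[volume] (T ∩ Set.Ici 0 : Set ℝ) :=
    (ae_eq_refl T).inter Ioi_ae_eq_Ici
  rw [h1, h2, h3, Measure.restrict_congr_set h4, ← lintegral_add_left hf.ennreal_ofReal]
  refine lintegral_congr_ae (ae_restrict_of_ae ?_)
  filter_upwards [compl_mem_ae_iff.2 (measure_singleton (0 : ℝ))] with x hx
  rw [foldDensity_of_ne hx, ENNReal.ofReal_add (hf0 _) (hf0 _)]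

theorem integrable_comp_of_density (hX : Measurable X) (hf : Measurable f) (hf0 : ∀ x, 0 ≤ f x)
    (hd : μ.map X = volume.withDensity fun x => ENNReal.ofReal (f x)) {g : ℝ → ℝ}
    (hg : Measurable g) : Integrable (fun ω => g (X ω)) μ ↔ Integrable fun x => g x * f x := by
  have h1 : Integrable g (μ.map X) ↔ Integrable (fun ω => g (X ω)) μ :=
    integrable_map_measure hg.aestronglyMeasurable hX.aemeasurable
  rw [← h1, hd, integrable_withDensity_iff_integrable_smul' hf.ennreal_ofReal
    (ae_of_all _ fun _ => ENNReal.ofReal_lt_top)]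
  refine integrable_congr (ae_of_all _ fun x => ?_)
  simp only [ENNReal.toReal_ofReal (hf0 x), smul_eq_mul]
  ring

/-- Lebesgue measure is invariant under reflection, so an integral depends only on the even part of
the integrand. -/
theorem integral_eq_of_add_comp_neg {F G : ℝ → ℝ} (hF : Integrable F) (hG : Integrable G)
    (h : ∀ᵐ x, F x + F (-x) = G x + G (-x)) : ∫ x, F x = ∫ x, G x := by
  have e : ∀ {F : ℝ → ℝ}, Integrable F → ∫ x, (F x + F (-x)) = 2 * ∫ x, F x := fun {F} hF => by
    rw [integral_add hF hF.comp_neg, integral_neg_eq_self]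
    ring
  have := integral_congr_ae h
  rw [e hF, e hG] at this
  linarith

/-- Given |X| = t, the odds of X = t against X = -t are f(t) : f(-t). On an event determined by |X|,
the two integrands have the same even part, and this is all that their integrals see. -/
theorem IsCondMean.abs (hX : Measurable X) (hf : Measurable f) (hf0 : ∀ x, 0 ≤ f x)
    (hd : μ.map X = volume.withDensity fun x => ENNReal.ofReal (f x)) {V : Ω → ℝ}
    (hV : Integrable V μ) {m : ℝ → ℝ} (hm : IsCondMean μ X V m) (m₀ : ℝ) :
    IsCondMean μ (fun ω => |X ω|) V (foldMean f m m₀) := by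
  have habs : Measurable fun x : ℝ => |x| := measurable_norm
  have hXa : Measurable fun ω => |X ω| := habs.comp hX
  have hfold := measurable_foldMean hf hm.1 m₀
  have hne : ∀ᵐ x : ℝ, x ≠ 0 := compl_mem_ae_iff.2 (measure_singleton (0 : ℝ))
  have hmX : Integrable (fun ω => m (X ω)) μ := integrable_condExp.congr hm.2.symm
  have hmf : Integrable fun x => m x * f x :=
    (integrable_comp_of_density hX hf hf0 hd hm.1).1 hmX
  -- The weight f(x) / (f(x) + f(-x)) is at most 1, so |m f| at x plus |m f| at -x dominates.
  have hff : Integrable fun x => foldMean f m m₀ |x| * f x := by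
    refine (hmf.norm.add hmf.comp_neg.norm).mono'
      ((hfold.comp habs).mul hf).aestronglyMeasurable ?_
    filter_upwards [hne] with x hx
    rw [foldMean_abs hx, Real.norm_eq_abs, abs_mul, abs_div]
    have h1 := hf0 x
    have h2 := hf0 (-x)
    rw [abs_of_nonneg (add_nonneg h1 h2), abs_of_nonneg h1, div_mul_eq_mul_div]
    have h3 : |f x * m x + f (-x) * m (-x)| ≤ ‖m x * f x‖ + ‖m (-x) * f (-x)‖ := by
      refine (abs_add_le _ _).trans (le_of_eq ?_)
      rw [Real.norm_eq_abs, Real.norm_eq_abs, mul_comm (f x), mul_comm (f (-x))]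
    rcases (add_nonneg h1 h2).eq_or_lt with h0 | h0
    · rw [← h0, div_zero]
      exact add_nonneg (norm_nonneg _) (norm_nonneg _)
    · rw [div_le_iff₀ h0]
      exact mul_le_mul h3 (by linarith) h1 (add_nonneg (norm_nonneg _) (norm_nonneg _))
  have hffX : Integrable (fun ω => foldMean f m m₀ |X ω|) μ :=
    (integrable_comp_of_density hX hf hf0 hd (hfold.comp habs)).2 hff
  refine ⟨hfold, ae_eq_condExp_of_forall_setIntegral_eq hXa.comap_le hV
    (fun _ _ _ => hffX.integrableOn) ?_
    (hfold.comp (comap_measurable _)).stronglyMeasurable.aestronglyMeasurable⟩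
  rintro s ⟨T, hT, rfl⟩ -
  set g : ℝ → ℝ := fun x => T.indicator (fun _ => 1) |x| with hg
  have hgm : Measurable g := (measurable_const.indicator hT).comp habs
  have hgK : ∀ x, |g x| ≤ 1 := by
    intro x
    by_cases hx : |x| ∈ T <;> simp [hg, hx]
  have hset : ∀ V : Ω → ℝ, ∫ ω in (fun ω => |X ω|) ⁻¹' T, V ω ∂μ = ∫ ω, g (X ω) * V ω ∂μ := by
    intro V
    rw [← integral_indicator (hXa hT)]
    refine integral_congr_ae (ae_of_all _ fun ω => ?_)
    by_cases hx : |X ω| ∈ T <;> simp [hg, hx]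
  have e1 := integral_comp_of_density hX hf hf0 hd (g := fun x => g x * foldMean f m m₀ |x|)
    (hgm.mul (hfold.comp habs))
  have e2 := integral_comp_of_density hX hf hf0 hd (g := fun x => g x * m x) (hgm.mul hm.1)
  rw [hset, hset, integral_mul_condMean hX hV hm hgm hgK, e1, e2]
  refine integral_eq_of_add_comp_neg ?_ ?_ ?_
  · simp only [mul_assoc]
    exact hff.bdd_mul hgm.aestronglyMeasurable (ae_of_all _ hgK)
  · simp only [mul_assoc]
    exact hmf.bdd_mul hgm.aestronglyMeasurable (ae_of_all _ hgK)
  · filter_upwards [hne] with x hx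
    have e : g (-x) = g x := by simp [hg]
    rw [e, abs_neg, foldMean_abs hx]
    have h1 := hf0 x
    have h2 := hf0 (-x)
    -- Where f(x) + f(-x) = 0, both sides vanish whatever the quotient is.
    rcases (add_nonneg h1 h2).eq_or_lt with h0 | h0
    · have e1 : f x = 0 := by linarith
      have e2 : f (-x) = 0 := by linarith
      simp [e1, e2]
    · field_simp

end Fold

/-! ### Regularity of the influence function at bandwidth zero -/

/-- Restriction to the extreme points of the local region: |x| = t is admissible at bandwidth t / A.
-/
theorem LocalApprox.approx {A : ℝ} {ρ : ℝ → ℝ} {b : Bool} {g : ℝ → ℝ} {l : ℝ} (hA : 0 < A)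
    (h : LocalApprox A ρ b g l) :
    Approx (𝓝[>] 0) (fun t => ρ (A⁻¹ * t)) (fun t => g (sideSign b * t)) fun _ => l := by
  have hsc : Tendsto (fun t : ℝ => (A⁻¹ * t, sideSign b * t)) (𝓝[>] 0) (localFilter A b) := by
    intro s hs
    change ∀ᶠ t in 𝓝[>] (0 : ℝ), (A⁻¹ * t, sideSign b * t) ∈ s
    have hs' := (eventually_localFilter (P := fun h x => (h, x) ∈ s)).1 hs
    filter_upwards [(tendsto_const_mul_nhdsGT (inv_pos.2 hA)).eventually hs', self_mem_nhdsWithin]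
      with t ht ht0
    have ht1 : (0 : ℝ) < t := ht0
    refine ht _ ?_ ?_ ?_
    · cases b
      · simpa [side, sideSign] using ht1
      · simpa [side, sideSign] using ht1.le
    · cases b <;> simp [sideSign, ht1.ne']
    · rw [mul_inv_cancel_left₀ hA.ne']
      cases b <;> simp [sideSign, abs_of_pos ht1]
  exact ⟨h.1.comp_tendsto hsc, h.2.comp_tendsto hsc⟩

namespace LocalModel

variable {Ω 𝒲 : Type*} [MeasurableSpace Ω] [MeasurableSpace 𝒲] (c : LocalModel 𝒲) (μ : Measure Ω)
  (W : ℕ → Ω → 𝒲) (k : ℝ → ℝ)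

/-- Coefficient of the influence function at bandwidth zero. -/
noncomputable def zeroCoef (i : Bool × Fin 2 × Fin 4) : ℝ :=
  c.coefAt μ W k 0 i * 0 ^ degree i / kernelMoment k 2

/-- Weight, as a function of `x`, of a feature in the influence function at bandwidth zero. -/
noncomputable def zeroWeight (i : Bool × Fin 2 × Fin 4) (x : ℝ) : ℝ :=
  c.zeroCoef μ W k i * (side i.1).indicator (fun _ => 1) x

/-- Conditional mean of the influence function at bandwidth zero given `x`. -/
noncomputable def zeroMean (x : ℝ) : ℝ :=
  ∑ i, c.zeroWeight μ W k i x * c.condMat i.2.2 2 x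

/-- Conditional second moment of the influence function at bandwidth zero given `x`. -/
noncomputable def zeroSq (x : ℝ) : ℝ :=
  ∑ ij : (Bool × Fin 2 × Fin 4) × (Bool × Fin 2 × Fin 4),
    c.zeroWeight μ W k ij.1 x * c.zeroWeight μ W k ij.2 x * c.condMat ij.1.2.2 ij.2.2.2 x

/-- One-sided limit of `zeroSq`. -/
noncomputable def zeroSqLim (b : Bool) : ℝ :=
  ∑ ij : (Bool × Fin 2 × Fin 4) × (Bool × Fin 2 × Fin 4),
    (c.zeroCoef μ W k ij.1 * (if ij.1.1 = b then 1 else 0)) *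
      (c.zeroCoef μ W k ij.2 * (if ij.2.1 = b then 1 else 0)) * c.limMat b ij.1.2.2 ij.2.2.2

variable {c μ W k}

theorem zeroWeight_sideSign {b : Bool} {t : ℝ} (ht : 0 < t) (i : Bool × Fin 2 × Fin 4) :
    c.zeroWeight μ W k i (sideSign b * t) = c.zeroCoef μ W k i * (if i.1 = b then 1 else 0) := by
  unfold zeroWeight
  obtain ⟨b', p, r⟩ := i
  cases b <;> cases b' <;> simp [side, sideSign, ht, ht.le, not_le.2 ht]

theorem abs_zeroWeight_le (i : Bool × Fin 2 × Fin 4) (x : ℝ) :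
    |c.zeroWeight μ W k i x| ≤ |c.zeroCoef μ W k i| := by
  unfold zeroWeight
  by_cases hx : x ∈ side i.1 <;> simp [hx]

theorem measurable_zeroWeight (i : Bool × Fin 2 × Fin 4) : Measurable (c.zeroWeight μ W k i) :=
  (measurable_const.indicator (measurableSet_side i.1)).const_mul _

theorem score_zero (w : 𝒲) :
    c.score μ W k w 0 = ∑ i, c.zeroWeight μ W k i (c.xc w) * c.feature w i.2.2 := by
  have e : equivFactor k 0 = kernelMoment k 2 := by simp [equivFactor]
  rw [score, div_zero, e, Finset.sum_div]
  refine Finset.sum_congr rfl fun i _ => ?_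
  unfold zeroWeight zeroCoef
  ring

end LocalModel

namespace LocalModel.Holds

variable {Ω 𝒲 : Type*} [mΩ : MeasurableSpace Ω] [MeasurableSpace 𝒲] {c : LocalModel 𝒲}
  {μ : Measure Ω} [IsProbabilityMeasure μ] {W : ℕ → Ω → 𝒲} {k : ℝ → ℝ} {c₀ K₀ h : ℝ}

open LocalModel

theorem abs_score_zero_le (H : c.Holds μ W) (w : 𝒲) :
    |c.score μ W k w 0| ≤ ∑ i, |c.zeroCoef μ W k i| * c.B := by
  rw [score_zero]
  refine (Finset.abs_sum_le_sum_abs _ _).trans (Finset.sum_le_sum fun i _ => ?_)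
  rw [abs_mul]
  exact mul_le_mul (abs_zeroWeight_le i _) (H.abs_feature_le w _) (abs_nonneg _) (abs_nonneg _)

theorem integrable_score_zero (H : c.Holds μ W) :
    Integrable (fun ω => c.score μ W k (W 0 ω) 0) μ :=
  Integrable.of_bound ((H.measurable_score 0).comp (H.iid.1 0)).aestronglyMeasurable _
    (ae_of_all _ fun ω => H.abs_score_zero_le (W 0 ω))

theorem isCondMean_score_zero (H : c.Holds μ W) : IsCondMean μ (fun ω => c.xc (W 0 ω))
    (fun ω => c.score μ W k (W 0 ω) 0) (c.zeroMean μ W k) := by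
  have h := IsCondMean.sum_mul Finset.univ H.measurable_X
    (fun i : Bool × Fin 2 × Fin 4 => H.integrable_feature_mul i.2.2 2)
    (fun i => H.condMean_feature i.2.2 2) (a := c.zeroWeight μ W k) measurable_zeroWeight
    abs_zeroWeight_le
  have e : (fun ω => c.score μ W k (W 0 ω) 0) = fun ω => ∑ i : Bool × Fin 2 × Fin 4,
      c.zeroWeight μ W k i (c.xc (W 0 ω)) *
        (c.feature (W 0 ω) i.2.2 * c.feature (W 0 ω) 2) := by
    funext ω
    rw [score_zero]
    refine Finset.sum_congr rfl fun i _ => ?_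
    rw [show c.feature (W 0 ω) 2 = 1 from rfl, mul_one]
  rw [e]
  exact h

theorem isCondMean_score_zero_sq (H : c.Holds μ W) : IsCondMean μ (fun ω => c.xc (W 0 ω))
    (fun ω => c.score μ W k (W 0 ω) 0 * c.score μ W k (W 0 ω) 0) (c.zeroSq μ W k) := by
  have h := IsCondMean.sum_mul Finset.univ H.measurable_X
    (fun ij : (Bool × Fin 2 × Fin 4) × (Bool × Fin 2 × Fin 4) =>
      H.integrable_feature_mul ij.1.2.2 ij.2.2.2)
    (fun ij => H.condMean_feature ij.1.2.2 ij.2.2.2)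
    (a := fun ij x => c.zeroWeight μ W k ij.1 x * c.zeroWeight μ W k ij.2 x)
    (fun ij => (measurable_zeroWeight ij.1).mul (measurable_zeroWeight ij.2))
    (K := fun ij => |c.zeroCoef μ W k ij.1| * |c.zeroCoef μ W k ij.2|)
    (fun ij x => by
      rw [abs_mul]
      exact mul_le_mul (abs_zeroWeight_le _ _) (abs_zeroWeight_le _ _) (abs_nonneg _)
        (abs_nonneg _))
  have e : (fun ω => c.score μ W k (W 0 ω) 0 * c.score μ W k (W 0 ω) 0) = fun ω =>
      ∑ ij : (Bool × Fin 2 × Fin 4) × (Bool × Fin 2 × Fin 4),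
      c.zeroWeight μ W k ij.1 (c.xc (W 0 ω)) * c.zeroWeight μ W k ij.2 (c.xc (W 0 ω)) *
        (c.feature (W 0 ω) ij.1.2.2 * c.feature (W 0 ω) ij.2.2.2) := by
    funext ω
    rw [score_zero, Finset.sum_mul_sum]
    refine Eq.trans ?_ (Fintype.sum_prod_type _).symm
    exact Finset.sum_congr rfl fun i _ => Finset.sum_congr rfl fun j _ => by ring
  rw [e]
  exact h

/-- The residual coefficients subtract from y - θ d exactly its limiting conditional mean on the
side. -/
theorem zeroMean_limit (H : c.Holds μ W) (hk : KernelRegular k c.A) (hw : WellPosed k) (b : Bool) :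
    ∑ i : Bool × Fin 2 × Fin 4, (c.zeroCoef μ W k i * (if i.1 = b then 1 else 0)) *
      c.limMat b i.2.2 2 = 0 := by
  simp only [zeroCoef, coefAt, gramAt_zero, H.residCoef_limGram hk hw, Fintype.sum_prod_type,
    Fintype.sum_bool, Fin.sum_univ_two, Fin.sum_univ_four, degree, featureExp, Matrix.cons_val,
    Fin.val_zero, Fin.val_one, limMat, momentMatrix, residMean]
  cases b <;> simp <;> ring

/-- At bandwidth 0 only the constant regressor survives, so the influence function is a multiple of
the limiting residual of y - θ d on each side. -/
theorem zeroSqLim_eq (H : c.Holds μ W) (hk : KernelRegular k c.A) (hw : WellPosed k) (b : Bool) :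
    c.zeroSqLim μ W k b = (studentScale (c.limGram k) (c.limMeat k) *
      gramRow (c.limGram k b) 0 / kernelMoment k 2) ^ 2 * c.residVar b := by
  have e : c.zeroSqLim μ W k b = ∑ r, ∑ s, c.zeroCoef μ W k (b, 0, r) * c.zeroCoef μ W k (b, 0, s) *
      c.limMat b r s := by
    have hz : ∀ (b : Bool) (r : Fin 4), c.zeroCoef μ W k (b, 1, r) = 0 := fun b r => by
      simp [zeroCoef, degree]
    unfold zeroSqLim
    simp only [Fintype.sum_prod_type, Fintype.sum_bool, Fin.sum_univ_two, hz, zero_mul, mul_zero,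
      Finset.sum_const_zero, add_zero]
    cases b <;> simp
  have hs : sideSign b * sideSign b = 1 := by cases b <;> simp [sideSign]
  have e2 : ∀ r, c.zeroCoef μ W k (b, 0, r) = sideSign b *
      (studentScale (c.limGram k) (c.limMeat k) * gramRow (c.limGram k b) 0 / kernelMoment k 2) *
        ![1, -c.ratio, -c.residMean b, 0] r := by
    intro r
    simp only [zeroCoef, coefAt, gramAt_zero, meatAt_zero, H.residCoef_limGram hk hw, degree]
    fin_cases r <;> simp [featureExp] <;> ring
  rw [e]
  simp only [e2]
  generalize studentScale (c.limGram k) (c.limMeat k) * gramRow (c.limGram k b) 0 /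
    kernelMoment k 2 = a
  simp only [Fin.sum_univ_four, Matrix.cons_val, limMat, momentMatrix, residVar]
  have e3 : c.residMean b = c.lY b - c.ratio * c.lD b := rfl
  rw [e3]
  linear_combination (a ^ 2 * (c.lYY b - 2 * c.ratio * c.lYD b + c.ratio ^ 2 * c.lDD b -
    (c.lY b - c.ratio * c.lD b) ^ 2)) * hs

/-- The multiplier of the residual variance is nonzero on both sides, because |s₂| = μ₂ > 0; one
side has positive residual variance and the other contributes nonnegatively. -/
theorem zeroSqLim_pos (H : c.Holds μ W) (hk : KernelRegular k c.A) (hw : WellPosed k) :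
    0 < c.fl true * c.zeroSqLim μ W k true + c.fl false * c.zeroSqLim μ W k false := by
  have hne : ∀ b, studentScale (c.limGram k) (c.limMeat k) *
      gramRow (c.limGram k b) 0 / kernelMoment k 2 ≠ 0 := by
    intro b
    have h2 := (wellPosed_moments hk hw).2.1.ne'
    have hj := H.lsJump_limGram_ne hk hw
    have h1 : studentScale (c.limGram k) (c.limMeat k) ≠ 0 :=
      div_ne_zero (div_ne_zero (abs_ne_zero.2 hj) hj)
        (Real.sqrt_pos.2 (H.sandwich_limGram_pos hk hw)).ne'
    have h3 : gramRow (c.limGram k b) 0 ≠ 0 := by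
      rw [H.gramRow_limGram hk hw]
      have hs : sideMoment k b 2 ≠ 0 := by
        cases b
        · rw [sideMoment_false hk.symm]
          simpa using h2
        · rwa [sideMoment_true]
      exact div_ne_zero hs (mul_pos (H.fl_pos b) (wellPosed_moments hk hw).2.2).ne'
    exact div_ne_zero (mul_ne_zero h1 h3) h2
  have hnn : ∀ b, 0 ≤ c.fl b * c.zeroSqLim μ W k b := fun b => by
    rw [H.zeroSqLim_eq hk hw]
    exact mul_nonneg (H.fl_pos b).le (mul_nonneg (sq_nonneg _) (H.var_nonneg b))
  obtain ⟨b, hb⟩ := H.var_pos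
  have hp : 0 < c.fl b * c.zeroSqLim μ W k b := by
    rw [H.zeroSqLim_eq hk hw]
    exact mul_pos (H.fl_pos b) (mul_pos (sq_pos_of_ne_zero (hne b)) hb)
  cases b
  · exact add_pos_of_nonneg_of_pos (hnn true) hp
  · exact add_pos_of_pos_of_nonneg hp (hnn false)

theorem rho_tendsto_scaled (H : c.Holds μ W) :
    Tendsto (fun t => c.ρ (c.A⁻¹ * t)) (𝓝[>] 0) (𝓝 0) :=
  H.rho_tendsto.comp (tendsto_const_mul_nhdsGT (inv_pos.2 H.A_pos))

theorem approx_weighted (H : c.Holds μ W) {ι : Type*} [Fintype ι] (b : Bool) (a : ι → ℝ → ℝ)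
    (α : ι → ℝ) (ha : ∀ i t, 0 < t → a i (sideSign b * t) = α i) (r s : ι → Fin 4) :
    Approx (𝓝[>] 0) (fun t => c.ρ (c.A⁻¹ * t))
      (fun t => ∑ i, a i (sideSign b * t) * c.condMat (r i) (s i) (sideSign b * t))
      fun _ => ∑ i, α i * c.limMat b (r i) (s i) := by
  refine Approx.sum _ fun i _ => (Approx.congr_left (Approx.const (α i)) ?_).mul
    H.rho_tendsto_scaled ((H.local_feature b (r i) (s i)).approx H.A_pos)
  filter_upwards [self_mem_nhdsWithin] with t ht
  exact (ha i t ht).symm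

theorem approx_foldMean (H : c.Holds μ W) {g : ℝ → ℝ} {l : Bool → ℝ} (hg : ∀ b,
    Approx (𝓝[>] 0) (fun t => c.ρ (c.A⁻¹ * t)) (fun t => g (sideSign b * t)) fun _ => l b)
    (g₀ : ℝ) :
    Approx (𝓝[>] 0) (fun t => c.ρ (c.A⁻¹ * t)) (foldMean c.f g g₀)
      fun _ => (c.fl true * l true + c.fl false * l false) / (c.fl true + c.fl false) := by
  have hδ := H.rho_tendsto_scaled
  have hf := fun b => (H.f_local b).approx H.A_pos
  refine ((((hf true).mul hδ (hg true)).add ((hf false).mul hδ (hg false))).div hδ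
    ((hf true).add (hf false)) (away_const
      (add_pos (H.fl_pos true) (H.fl_pos false)).ne')).congr_left ?_
  filter_upwards [self_mem_nhdsWithin] with t ht
  rw [foldMean_of_ne (ne_of_gt ht)]
  simp [sideSign]

/-- All functions of |X| receive their limit as value at 0. The modulus has two parts: ρ(t / A) for
the conditional moments at |x| = t, and ρ(t) for the change of the coefficients of ψ between
bandwidths t and 0. -/
theorem exists_regular (H : c.Holds μ W) (hk : KernelRegular k c.A) (hw : WellPosed k) :
    ∃ f m v ell : ℝ → ℝ, Measurable f ∧ (∀ t, 0 ≤ f t) ∧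
      μ.map (fun ω => |c.xc (W 0 ω)|) =
        (volume.restrict (Set.Ici 0)).withDensity (fun t => ENNReal.ofReal (f t)) ∧
      IsCondMean μ (fun ω => |c.xc (W 0 ω)|) (fun ω => c.score μ W k (W 0 ω) 0) m ∧
      IsCondCov μ (fun ω => |c.xc (W 0 ω)|) (fun ω => c.score μ W k (W 0 ω) 0)
        (fun ω => c.score μ W k (W 0 ω) 0) v ∧
      0 < f 0 ∧ 0 < v 0 ∧ LogLogSmall ell ∧ ∀ᶠ t in 𝓝[>] (0 : ℝ),
        |f t - f 0| ≤ ell t ∧ |m t - m 0| ≤ ell t ∧ |v t - v 0| ≤ ell t ∧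
        ∀ᵐ ω ∂μ, |(c.score μ W k (W 0 ω) t - c.score μ W k (W 0 ω) 0) *
          equivKernel k (c.xc (W 0 ω) / t)| ≤ ell t := by
  -- The average of the one-sided limits of the conditional second moment, weighted by the
  -- densities. The conditional mean tends to 0, so this is also the limit of the conditional
  -- variance.
  set q₀ := (c.fl true * c.zeroSqLim μ W k true + c.fl false * c.zeroSqLim μ W k false) /
    (c.fl true + c.fl false) with hq₀
  have hX := H.measurable_X
  have hflpos := add_pos (H.fl_pos true) (H.fl_pos false)
  have hδ := H.rho_tendsto_scaled
  have hB : ∀ᵐ ω ∂μ, |c.score μ W k (W 0 ω) 0| ≤ ∑ i, |c.zeroCoef μ W k i| * c.B :=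
    ae_of_all _ fun ω => H.abs_score_zero_le (W 0 ω)
  have hZ := H.integrable_score_zero (k := k)
  have hZZ : Integrable (fun ω => c.score μ W k (W 0 ω) 0 * c.score μ W k (W 0 ω) 0) μ :=
    hZ.bdd_mul hZ.1 hB
  have hm := H.isCondMean_score_zero.abs hX H.f_meas H.f_nonneg H.density (hZ) 0
  have hq := (H.isCondMean_score_zero_sq (k := k)).abs hX H.f_meas H.f_nonneg H.density hZZ q₀
  have hv := hm.isCondCov (measurable_norm.comp hX) hZ hZ hB hB hm hq
  have af : Approx (𝓝[>] 0) (fun t => c.ρ (c.A⁻¹ * t))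
      (foldDensity c.f (c.fl true + c.fl false)) fun _ => c.fl true + c.fl false := by
    refine (((H.f_local true).approx H.A_pos).add ((H.f_local false).approx H.A_pos)).congr_left ?_
    filter_upwards [self_mem_nhdsWithin] with t ht
    rw [foldDensity_of_ne (ne_of_gt ht)]
    simp [sideSign]
  have am := H.approx_foldMean (g := c.zeroMean μ W k) (l := fun b =>
    ∑ i : Bool × Fin 2 × Fin 4, (c.zeroCoef μ W k i * (if i.1 = b then 1 else 0)) *
      c.limMat b i.2.2 2) (fun b => H.approx_weighted b (c.zeroWeight μ W k) _
    (fun i t ht => zeroWeight_sideSign ht i) (fun i => i.2.2) fun _ => 2) 0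
  simp only [H.zeroMean_limit hk hw, mul_zero, add_zero, zero_div] at am
  have aq := H.approx_foldMean (g := c.zeroSq μ W k) (l := c.zeroSqLim μ W k) (fun b => H.approx_weighted b
    (fun (ij : (Bool × Fin 2 × Fin 4) × (Bool × Fin 2 × Fin 4)) x =>
      c.zeroWeight μ W k ij.1 x * c.zeroWeight μ W k ij.2 x) _
    (fun ij t ht => by rw [zeroWeight_sideSign ht, zeroWeight_sideSign ht])
    (fun ij => ij.1.2.2) fun ij => ij.2.2.2) q₀
  have av := aq.sub (am.mul hδ am)
  obtain ⟨K₁, hK₁, h₁⟩ := af.2.exists_nonneg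
  obtain ⟨K₂, hK₂, h₂⟩ := am.2.exists_nonneg
  obtain ⟨K₃, hK₃, h₃⟩ := av.2.exists_nonneg
  obtain ⟨K₄, hK₄, h₄⟩ := H.abs_sum_cutKernel_le hk hw
  obtain ⟨K₅, hK₅, h₅⟩ := exists_forall_abs_le fun i => (H.approx_coefAt hk hw i).2
  refine ⟨foldDensity c.f (c.fl true + c.fl false), foldMean c.f (c.zeroMean μ W k) 0,
    _, fun t => (K₁ + K₂ + K₃) * |c.ρ (c.A⁻¹ * t)| + K₄ * K₅ * |c.ρ t|,
    measurable_foldDensity H.f_meas _, fun t => ?_,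
    map_abs_eq_withDensity hX H.f_meas H.f_nonneg H.density _, hm, hv, ?_, ?_,
    ((H.rho_small.comp_mul (inv_pos.2 H.A_pos)).const_mul_abs _).add
      (H.rho_small.const_mul_abs _), ?_⟩
  · by_cases ht : t = 0
    · rw [ht, foldDensity_zero]
      exact hflpos.le
    · rw [foldDensity_of_ne ht]
      exact add_nonneg (H.f_nonneg _) (H.f_nonneg _)
  · rw [foldDensity_zero]
    exact hflpos
  · simp only [foldMean_zero, mul_zero, sub_zero]
    exact div_pos (H.zeroSqLim_pos hk hw) hflpos
  · filter_upwards [h₁.bound, h₂.bound, h₃.bound, h₅, self_mem_nhdsWithin]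
      with t g1 g2 g3 g5 ht
    have p0 : 0 ≤ |c.ρ (c.A⁻¹ * t)| := abs_nonneg _
    have p1 : 0 ≤ |c.ρ t| := abs_nonneg _
    have p2 := mul_nonneg hK₁ p0
    have p3 := mul_nonneg hK₂ p0
    have p4 := mul_nonneg hK₃ p0
    have p5 : 0 ≤ K₄ * K₅ * |c.ρ t| := by positivity
    simp only [Real.norm_eq_abs] at g1 g2 g3
    refine ⟨?_, ?_, ?_, ae_of_all _ fun ω => ?_⟩
    · rw [foldDensity_zero]
      refine g1.trans ?_
      linarith
    · rw [foldMean_zero]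
      refine g2.trans ?_
      linarith
    · simp only [foldMean_zero]
      refine g3.trans ?_
      linarith
    · have ht' : (0 : ℝ) < t := ht
      rw [sub_mul, score_mul_kernel ht', H.score_zero_mul_kernel hk hw ht',
        ← Finset.sum_sub_distrib]
      simp only [← sub_mul]
      refine (h₄ _ _ g5 (W 0 ω) _).trans ?_
      linarith

end LocalModel.Holds

/-! ### Uniform deviations of the sample moments -/

theorem abs_sum_le_of_forall_ne {ι : Type*} {s : Finset ι} {D : ι → ℝ} {K : ℝ} (hK : 0 ≤ K)
    (hD : ∀ i, |D i| ≤ K) (h : ∀ i ∈ s, ∀ j ∈ s, i ≠ j → D i = 0 ∨ D j = 0) :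
    |∑ i ∈ s, D i| ≤ K := by
  by_cases h0 : ∃ i ∈ s, D i ≠ 0
  · obtain ⟨i, hi, hi0⟩ := h0
    rw [Finset.sum_eq_single_of_mem i hi fun j hj hij => (h i hi j hj hij.symm).resolve_left hi0]
    exact hD i
  · push Not at h0
    rw [Finset.sum_eq_zero h0, abs_zero]
    exact hK

namespace LocalModel

variable {Ω 𝒲 : Type*} (c : LocalModel 𝒲) (W : ℕ → Ω → 𝒲) (k : ℝ → ℝ)

/-- `sampleGram` of the first `n` observations. -/
noncomputable def empGram (h : ℝ) (n : ℕ) (ω : Ω) : Bool → Fin 2 → Fin 4 → ℝ :=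
  sampleGram k h n (fun i => c.xc (W i ω)) (fun i => c.yc (W i ω)) fun i => c.dc (W i ω)

/-- `sampleMeat` of the first `n` observations. -/
noncomputable def empMeat (h : ℝ) (n : ℕ) (ω : Ω) :
    Bool → Fin 2 → Fin 2 → Fin 4 → Fin 4 → ℝ :=
  sampleMeat k h n (fun i => c.xc (W i ω)) (fun i => c.yc (W i ω)) fun i => c.dc (W i ω)

end LocalModel

namespace LocalModel.Holds

variable {Ω 𝒲 : Type*} [mΩ : MeasurableSpace Ω] [MeasurableSpace 𝒲] {c : LocalModel 𝒲}
  {μ : Measure Ω} [IsProbabilityMeasure μ] {W : ℕ → Ω → 𝒲} {k : ℝ → ℝ} {c₀ K₀ hmax : ℝ}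

open LocalModel

theorem measureReal_Ico_le (H : c.Holds μ W) (hg : c.GoodBandwidth μ W k c₀ K₀ hmax)
    (hK₀ : 0 < K₀) {s t : ℝ} (hs : -(2 * c.A * hmax) ≤ s) (hst : s ≤ t)
    (ht : t ≤ 2 * c.A * hmax) :
    μ.real {ω | c.xc (W 0 ω) ∈ Set.Ico s t} ≤ K₀ * (t - s) := by
  have h1 : μ {ω | c.xc (W 0 ω) ∈ Set.Ico s t} = ∫⁻ x in Set.Ico s t, ENNReal.ofReal (c.f x) := by
    rw [← withDensity_apply _ measurableSet_Ico, ← H.density,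
      Measure.map_apply H.measurable_X measurableSet_Ico]
    rfl
  have h2 : μ {ω | c.xc (W 0 ω) ∈ Set.Ico s t} ≤ ENNReal.ofReal (K₀ * (t - s)) := by
    rw [h1, ENNReal.ofReal_mul hK₀.le, ← Real.volume_Ico, ← setLIntegral_const]
    refine setLIntegral_mono_ae' measurableSet_Ico ?_
    filter_upwards [compl_mem_ae_iff.2 (measure_singleton (0 : ℝ))] with x hx hxI
    refine ENNReal.ofReal_le_ofReal (hg.f_le x hx (abs_le.2 ⟨?_, ?_⟩))
    · linarith [hxI.1]
    · linarith [hxI.2]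
  exact ENNReal.toReal_le_of_le_ofReal (mul_nonneg hK₀.le (by linarith)) h2

/-- By independence and Fubini: each section of {|p₁| = |p₂|} has at most two points, which are null
for a law with a density. -/
theorem ae_abs_ne (H : c.Holds μ W) :
    ∀ᵐ ω ∂μ, ∀ i j, i ≠ j → |c.xc (W i ω)| ≠ |c.xc (W j ω)| := by
  refine ae_all_iff.2 fun i => ae_all_iff.2 fun j => ?_
  by_cases hij : i = j
  · exact ae_of_all _ fun ω h => (h hij).elim
  have hXm : ∀ i, Measurable fun ω => c.xc (W i ω) := fun i => H.meas_x.comp (H.iid.1 i)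
  have hind : IndepFun (fun ω => c.xc (W i ω)) (fun ω => c.xc (W j ω)) μ :=
    (H.iid.2.1.indepFun hij).comp H.meas_x H.meas_x
  have hlaw := (indepFun_iff_map_prod_eq_prod_map_map (hXm i).aemeasurable
    (hXm j).aemeasurable).1 hind
  have hS : MeasurableSet {p : ℝ × ℝ | |p.1| = |p.2|} :=
    measurableSet_eq_fun (measurable_norm.comp measurable_fst) (measurable_norm.comp measurable_snd)
  have hnull : (μ.map fun ω => (c.xc (W i ω), c.xc (W j ω))) {p : ℝ × ℝ | |p.1| = |p.2|} = 0 := by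
    have : IsProbabilityMeasure (μ.map fun ω => c.xc (W j ω)) :=
      Measure.isProbabilityMeasure_map (hXm j).aemeasurable
    rw [hlaw, Measure.measure_prod_null hS]
    refine ae_of_all _ fun x => ?_
    have hsub : Prod.mk x ⁻¹' {p : ℝ × ℝ | |p.1| = |p.2|} ⊆ ({x, -x} : Set ℝ) := by
      intro y hy
      have hy' : |x| = |y| := hy
      rcases abs_eq_abs.1 hy'.symm with h | h
      · exact Or.inl h
      · exact Or.inr h
    have hmap : (μ.map fun ω => c.xc (W j ω)) = μ.map fun ω => c.xc (W 0 ω) :=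
      ((H.iid.2.2 j).comp H.meas_x).map_eq
    refine measure_mono_null hsub ?_
    rw [hmap, H.density]
    exact withDensity_absolutelyContinuous _ _ ((Set.toFinite _).measure_zero _)
  rw [Measure.map_apply ((hXm i).prodMk (hXm j)) hS] at hnull
  filter_upwards [measure_eq_zero_iff_ae_notMem.1 hnull] with ω hω _ h
  exact hω h

theorem exists_bad_set (H : c.Holds μ W) (hg : c.GoodBandwidth μ W k c₀ K₀ hmax)
    (hK₀ : 0 < K₀) (hm0 : 0 < hmax) (hm1 : hmax ≤ Real.exp (-Real.exp 1)) {hlo : ℕ → ℝ}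
    (hlo0 : ∀ n, 0 < hlo n) (hlo1 : ∀ n, hlo n ≤ hmax)
    (hrate : Tendsto (fun n : ℕ => n * hlo n / Real.log (Real.log (hlo n)⁻¹) ^ 3) atTop atTop)
    {ι : Type*} [Fintype ι] {φ : ι → ℝ → ℝ} (hφ : ∀ i, AntiDiff (φ i))
    (hφA : ∀ i u, c.A < |u| → φ i u = 0) {V : ι → 𝒲 → ℝ} (hV : ∀ i, Measurable (V i)) {B : ℝ}
    (hVB : ∀ i w, |V i w| ≤ B) {δ : ℝ} (hδ : 0 < δ) :
    ∃ C : ℝ, 0 ≤ C ∧ ∀ᶠ n : ℕ in atTop, ∃ bad : Set Ω, μ.real bad ≤ δ ∧ ∀ ω, ω ∉ bad →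
      ∀ h, hlo n ≤ h → h ≤ hmax → ∀ i,
      |∑ j ∈ Finset.range n, φ i (c.xc (W j ω) / h) * V i (W j ω) -
        n * ∫ ω, φ i (c.xc (W 0 ω) / h) * V i (W 0 ω) ∂μ| ≤
      C * √(n * h * Real.log (Real.log (hlo n)⁻¹)) := by
  have hcell : ∀ s t, -(2 * c.A * hmax) ≤ s → s ≤ t → t ≤ 2 * c.A * hmax →
      μ.real {ω | c.xc (W 0 ω) ∈ Set.Ico s t} ≤ K₀ * (t - s) := fun s t h1 h2 h3 =>
    H.measureReal_Ico_le hg hK₀ h1 h2 h3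
  -- The 1 added to the cardinality covers an empty index type.
  have hδ' : 0 < δ / (Fintype.card ι + 1) := by positivity
  choose C hC using fun i => exists_bad_set_antiDiff H.iid H.meas_x (hV i) (hVB i) H.A_pos hK₀ hm0
    hm1 hcell hlo0 hlo1 hrate (hφ i) (hφA i) hδ'
  refine ⟨∑ i, |C i|, Finset.sum_nonneg fun i _ => abs_nonneg _, ?_⟩
  filter_upwards [eventually_all.2 hC] with n hn
  choose bad hbad hbound using hn
  refine ⟨⋃ i, bad i, ?_, fun ω hω h h1 h2 i => ?_⟩
  · refine (measureReal_iUnion_fintype_le _).trans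
      ((Finset.sum_le_sum fun i _ => hbad i).trans ?_)
    rw [Finset.sum_const, Finset.card_univ, nsmul_eq_mul, mul_div_assoc', div_le_iff₀ (by positivity)]
    nlinarith
  · rw [Set.mem_iUnion, not_exists] at hω
    refine (hbound i ω (hω i) h h1 h2).trans (mul_le_mul_of_nonneg_right ?_ (Real.sqrt_nonneg _))
    exact (le_abs_self _).trans
      (Finset.single_le_sum (f := fun i => |C i|) (fun i _ => abs_nonneg _) (Finset.mem_univ i))

theorem sqrt_div_eq {n h L : ℝ} (hn : 0 < n) (hh : 0 < h) :
    (n * h)⁻¹ * √(n * h * L) = √(L / (n * h)) := by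
  have hp : 0 < n * h := mul_pos hn hh
  have e : L / (n * h) = (n * h * L) / (n * h) ^ 2 := by field_simp
  rw [e, Real.sqrt_div' _ (sq_nonneg _), Real.sqrt_sq hp.le, inv_mul_eq_div]

/-- The averages with weights k and those with weights k² form one finite family, so a single bad
set serves the estimator and its standard error. Division by n h turns a deviation √(n h L) into √(L
/ (n h)). -/
theorem exists_bad_set_gram (H : c.Holds μ W) (hk : KernelRegular k c.A)
    (hg : c.GoodBandwidth μ W k c₀ K₀ hmax)
    (hK₀ : 0 < K₀) (hm0 : 0 < hmax) (hm1 : hmax ≤ Real.exp (-Real.exp 1)) {hlo : ℕ → ℝ}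
    (hlo0 : ∀ n, 0 < hlo n) (hlo1 : ∀ n, hlo n ≤ hmax)
    (hrate : Tendsto (fun n : ℕ => n * hlo n / Real.log (Real.log (hlo n)⁻¹) ^ 3) atTop atTop)
    {δ : ℝ} (hδ : 0 < δ) :
    ∃ C : ℝ, 0 ≤ C ∧ ∀ᶠ n : ℕ in atTop, ∃ bad : Set Ω, μ.real bad ≤ δ ∧ ∀ ω, ω ∉ bad →
      ∀ h, hlo n ≤ h → h ≤ hmax →
      (∀ b p r, |c.empGram W k h n ω b p r - c.gramAt μ W k h b p r| ≤
        C * √(Real.log (Real.log (hlo n)⁻¹) / (n * h))) ∧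
      ∀ b p q r s, |c.empMeat W k h n ω b p q r s - c.meatAt μ W k h b p q r s| ≤
        C * √(Real.log (Real.log (hlo n)⁻¹) / (n * h)) := by
  have hz : ∀ u, c.A < |u| → k u = 0 := fun u hu => hk.eq_zero hu
  have hz2 : ∀ u, c.A < |u| → k u ^ 2 = 0 := fun u hu => by rw [hk.eq_zero hu]; norm_num
  have hBB : c.B ≤ c.B * c.B := by nlinarith [H.one_le]
  obtain ⟨C, hC, h⟩ := H.exists_bad_set hg hK₀ hm0 hm1 hlo0 hlo1 hrate
    (ι := (Bool × Fin 2 × Fin 4) ⊕ (Bool × Fin 2 × Fin 2 × Fin 4 × Fin 4))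
    (φ := Sum.elim (fun i => sideKernel k i.1 (i.2.1 + featureExp i.2.2))
      fun i => sideKernel (fun u => k u ^ 2) i.1
        (i.2.1 + i.2.2.1 + (featureExp i.2.2.2.1 + featureExp i.2.2.2.2)))
    (by
      rintro (i | i)
      · exact hk.antiDiff.sideKernel hz _ _
      · exact (hk.antiDiff.pow 2).sideKernel hz2 _ _)
    (by
      rintro (i | i)
      · exact sideKernel_zero_of_lt hz _ _
      · exact sideKernel_zero_of_lt hz2 _ _)
    (V := Sum.elim (fun i w => c.feature w i.2.2)
      fun i w => c.feature w i.2.2.2.1 * c.feature w i.2.2.2.2)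
    (by
      rintro (i | i)
      · exact H.measurable_feature _
      · exact (H.measurable_feature _).mul (H.measurable_feature _))
    (B := c.B * c.B)
    (by
      rintro (i | i) w
      · exact (H.abs_feature_le w _).trans hBB
      · rw [Sum.elim_inr, abs_mul]
        exact mul_le_mul (H.abs_feature_le w _) (H.abs_feature_le w _) (abs_nonneg _)
          (by linarith [H.one_le])) hδ
  refine ⟨C, hC, ?_⟩
  filter_upwards [h, eventually_gt_atTop 0] with n ⟨bad, hb, hn⟩ hn0
  refine ⟨bad, hb, fun ω hω h h1 h2 => ?_⟩
  have hh : 0 < h := (hlo0 n).trans_le h1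
  have hn0' : (0 : ℝ) < n := by exact_mod_cast hn0
  have hp : 0 < (n : ℝ) * h := mul_pos hn0' hh
  have key : ∀ S I : ℝ, |S - n * I| ≤ C * √(n * h * Real.log (Real.log (hlo n)⁻¹)) →
      |(n * h)⁻¹ * S - h⁻¹ * I| ≤ C * √(Real.log (Real.log (hlo n)⁻¹) / (n * h)) := by
    intro S I hS
    have e : (n * h)⁻¹ * S - h⁻¹ * I = (n * h)⁻¹ * (S - n * I) := by
      field_simp
    rw [e, abs_mul, abs_of_pos (inv_pos.2 hp), ← sqrt_div_eq hn0' hh, mul_left_comm C]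
    exact mul_le_mul_of_nonneg_left hS (inv_pos.2 hp).le
  refine ⟨fun b p r => ?_, fun b p q r s => ?_⟩
  · have := key _ _ (hn ω hω h h1 h2 (Sum.inl (b, p, r)))
    rw [gramAt_of_ne hh.ne']
    exact this
  · have := key _ _ (hn ω hω h h1 h2 (Sum.inr (b, p, q, r, s)))
    rw [meatAt_of_ne hh.ne']
    exact this

end LocalModel.Holds

/-! ### The influence function representation -/

namespace LocalModel

variable {Ω 𝒲 : Type*} [MeasurableSpace Ω] [MeasurableSpace 𝒲] {c : LocalModel 𝒲} {μ : Measure Ω}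
  {W : ℕ → Ω → 𝒲} {k : ℝ → ℝ}

/-- The linear term of the expansion is a sample average of the influence function times the
equivalent kernel, except that it carries the kernels without the cut. -/
theorem studentScale_mul_empGram (h : ℝ) (n : ℕ) (ω : Ω) :
    studentScale (c.gramAt μ W k h) (c.meatAt μ W k h) * ∑ b, sideSign b * ∑ p,
      gramRow (c.gramAt μ W k h b) p * ∑ r, residCoef (c.gramAt μ W k h) b r *
        c.empGram W k h n ω b p r =
    (n * h)⁻¹ * ∑ j ∈ Finset.range n, ∑ i, c.coefAt μ W k h i *
      sideKernel k i.1 (degree i) (c.xc (W j ω) / h) * c.feature (W j ω) i.2.2 := by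
  have e : studentScale (c.gramAt μ W k h) (c.meatAt μ W k h) * ∑ b, sideSign b * ∑ p,
      gramRow (c.gramAt μ W k h b) p * ∑ r, residCoef (c.gramAt μ W k h) b r *
        c.empGram W k h n ω b p r =
      ∑ i : Bool × Fin 2 × Fin 4, c.coefAt μ W k h i * c.empGram W k h n ω i.1 i.2.1 i.2.2 := by
    simp only [Fintype.sum_prod_type, Finset.mul_sum, coefAt]
    exact Finset.sum_congr rfl fun b _ => Finset.sum_congr rfl fun p _ =>
      Finset.sum_congr rfl fun r _ => by ring
  rw [e, Finset.sum_comm, Finset.mul_sum]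
  refine Finset.sum_congr rfl fun i _ => ?_
  unfold empGram sampleGram sampleMoment
  rw [mul_left_comm, Finset.mul_sum]
  refine congrArg _ (Finset.sum_congr rfl fun j _ => ?_)
  exact (mul_assoc _ _ _).symm

end LocalModel

theorem mul_sqrt_sub_le {n h s T S Q R : ℝ} (hn : 0 < n) (hh : 0 < h) (hR : |Q - T| ≤ R)
    (hT : T = (n * h)⁻¹ * S) {S' K : ℝ} (hS : |S - S'| ≤ K) (hQ : s = √(n * h) * Q) :
    |s - 1 / √(n * h) * S'| ≤ √(n * h) * R + K / √(n * h) := by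
  have hp : 0 < n * h := mul_pos hn hh
  have hq : 0 < √(n * h) := Real.sqrt_pos.2 hp
  have e : s - 1 / √(n * h) * S' = √(n * h) * (Q - T) + (S - S') / √(n * h) := by
    have e1 : √(n * h) * (n * h)⁻¹ = 1 / √(n * h) := by
      rw [eq_div_iff hq.ne', mul_right_comm, Real.mul_self_sqrt hp.le, mul_inv_cancel₀ hp.ne']
    rw [hQ, hT, mul_sub, ← mul_assoc √(n * h) (n * h)⁻¹, e1]
    ring
  rw [e]
  refine (abs_add_le _ _).trans (add_le_add ?_ ?_)
  · rw [abs_mul, abs_of_pos hq]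
    exact mul_le_mul_of_nonneg_left hR hq.le
  · rw [abs_div, abs_of_pos hq]
    exact div_le_div_of_nonneg_right hS hq.le

theorem max_one_log_log_div_le {a b : ℝ} (ha : 0 < a) (hab : a ≤ b) (hb : b ≤ 1)
    (hL : 1 ≤ Real.log (Real.log a⁻¹)) :
    max 1 (Real.log (Real.log (b / a))) ≤ Real.log (Real.log a⁻¹) := by
  refine max_le hL ?_
  have h1 : 1 ≤ b / a := (one_le_div ha).2 hab
  have h2 : b / a ≤ a⁻¹ := by
    rw [div_eq_mul_inv]
    exact mul_le_of_le_one_left (inv_pos.2 ha).le hb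
  have h3 := Real.log_nonneg h1
  -- For b = a the inner logarithm is 0, and `Real.log 0 = 0`.
  rcases h3.eq_or_lt with h0 | h0
  · rw [← h0, Real.log_zero]
    linarith
  · exact Real.log_le_log h0 (Real.log_le_log (by linarith) h2)

/-- √L · √(n h) · L / (n h) = L^{3/2} / √(n h), which is largest at the smallest bandwidth and there
equals the inverse square root of n a / L³. The term K' / √(n h) is no larger in order, as L ≥ 1. -/
theorem sqrt_mul_remainder_le {m L n h a K K' : ℝ} (hm : m ≤ L) (hL : 1 ≤ L)
    (hn : 0 < n) (ha : 0 < a) (hah : a ≤ h) (hK : 0 ≤ K) (hK' : 0 ≤ K') :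
    √m * (√(n * h) * (K * √(L / (n * h)) ^ 2) + K' / √(n * h)) ≤
      (K + K') * √(n * a / L ^ 3)⁻¹ := by
  have hh : 0 < h := ha.trans_le hah
  have hp : 0 < n * h := mul_pos hn hh
  have hq : 0 < √(n * h) := Real.sqrt_pos.2 hp
  have hL0 : 0 < L := by linarith
  have e1 : √(n * h) * (K * √(L / (n * h)) ^ 2) = K * L / √(n * h) := by
    rw [Real.sq_sqrt (by positivity), eq_div_iff hq.ne']
    have := Real.mul_self_sqrt hp.le
    field_simp
    nlinarith
  rw [e1, ← add_div]
  have h1 : K * L + K' ≤ (K + K') * L := by nlinarith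
  have h2 : √m * ((K * L + K') / √(n * h)) ≤ √L * ((K + K') * L / √(n * a)) := by
    have hqa : 0 < √(n * a) := Real.sqrt_pos.2 (mul_pos hn ha)
    gcongr
  refine h2.trans (le_of_eq ?_)
  have e2 : √(n * a / L ^ 3)⁻¹ = √L * L / √(n * a) := by
    rw [inv_div, Real.sqrt_div' _ (by positivity), show L ^ 3 = L * L ^ 2 by ring,
      Real.sqrt_mul hL0.le, Real.sqrt_sq hL0.le]
  rw [e2]
  ring

theorem exists_set_of_ae {Ω : Type*} [MeasurableSpace Ω] {μ : Measure Ω} {P : Ω → Prop}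
    (h : ∀ᵐ ω ∂μ, P ω) : ∃ G : Set Ω, μ Gᶜ = 0 ∧ ∀ ω ∈ G, P ω :=
  ⟨{ω | P ω}, h, fun _ h => h⟩

namespace LocalModel.Holds

variable {Ω 𝒲 : Type*} [mΩ : MeasurableSpace Ω] [MeasurableSpace 𝒲] {c : LocalModel 𝒲}
  {μ : Measure Ω} [IsProbabilityMeasure μ] {W : ℕ → Ω → 𝒲} {k : ℝ → ℝ} {c₀ K₀ hmax : ℝ}

open LocalModel

/-- The sums differ only through observations at zeros of the factor, that is, with |x_j| = h μ₂ /
μ₁. Without ties among the |x_j| there is at most one of them at each h, and its contribution is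
bounded independently of n and h. -/
theorem abs_sum_sub_score_le (H : c.Holds μ W) (hk : KernelRegular k c.A) (hw : WellPosed k)
    (hK₀ : 0 < K₀) : ∃ K, 0 ≤ K ∧ ∀ h, 0 < h → (∀ i, |c.coefAt μ W k h i| ≤ K₀) → ∀ (n : ℕ) (ω : Ω),
      (∀ i j, i ≠ j → |c.xc (W i ω)| ≠ |c.xc (W j ω)|) →
      |(∑ j ∈ Finset.range n, ∑ i, c.coefAt μ W k h i *
        sideKernel k i.1 (degree i) (c.xc (W j ω) / h) * c.feature (W j ω) i.2.2) -
        ∑ j ∈ Finset.range n, c.score μ W k (W j ω) h * equivKernel k (c.xc (W j ω) / h)| ≤ K := by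
  obtain ⟨K, hK, hb⟩ := H.abs_sum_kernel_le fun i : Bool × Fin 2 × Fin 4 =>
    (hk.antiDiff.sideKernel (fun u hu => hk.eq_zero hu) i.1 (degree i)).sub
      (hk.antiDiff.cutKernel (fun u hu => hk.eq_zero hu) (wellPosed_moments hk hw).2.1
        i.1 (degree i))
  refine ⟨K * K₀, mul_nonneg hK hK₀.le, fun h hh hC n ω hties => ?_⟩
  rw [← Finset.sum_sub_distrib]
  have e : ∀ j, (∑ i, c.coefAt μ W k h i * sideKernel k i.1 (degree i) (c.xc (W j ω) / h) *
      c.feature (W j ω) i.2.2) - c.score μ W k (W j ω) h * equivKernel k (c.xc (W j ω) / h) =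
      ∑ i, c.coefAt μ W k h i * (sideKernel k i.1 (degree i) (c.xc (W j ω) / h) -
        cutKernel k i.1 (degree i) (c.xc (W j ω) / h)) * c.feature (W j ω) i.2.2 := by
    intro j
    rw [score_mul_kernel hh, ← Finset.sum_sub_distrib]
    exact Finset.sum_congr rfl fun i _ => by ring
  simp only [e]
  refine abs_sum_le_of_forall_ne (mul_nonneg hK hK₀.le) (fun j => hb _ K₀ hC (W j ω) _)
    fun j _ j' _ hjj' => ?_
  have hzero : ∀ j, equivFactor k (c.xc (W j ω) / h) ≠ 0 →
      ∑ i, c.coefAt μ W k h i * (sideKernel k i.1 (degree i) (c.xc (W j ω) / h) -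
        cutKernel k i.1 (degree i) (c.xc (W j ω) / h)) * c.feature (W j ω) i.2.2 = 0 := by
    intro j hj
    refine Finset.sum_eq_zero fun i _ => ?_
    rw [cutKernel, Set.indicator_of_mem (by exact hj), sub_self, mul_zero, zero_mul]
  by_cases h1 : equivFactor k (c.xc (W j ω) / h) = 0
  · by_cases h2 : equivFactor k (c.xc (W j' ω) / h) = 0
    · have h3 := abs_eq_of_equivFactor (wellPosed_moments hk hw).2.1.ne' h1 h2
      rw [abs_div, abs_div, div_left_inj' (abs_pos.2 hh.ne').ne'] at h3
      exact absurd h3 (hties j j' hjj')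
    · exact Or.inr (hzero j' h2)
  · exact Or.inl (hzero j h1)

theorem eventually_remainder_le (H : c.Holds μ W) (hk : KernelRegular k c.A) (hw : WellPosed k)
    (hg : ∀ h ∈ Set.Ioc 0 hmax, c.GoodBandwidth μ W k c₀ K₀ h) (hc₀ : 0 < c₀) (hK₀ : 0 < K₀)
    (hm1 : hmax ≤ Real.exp (-Real.exp 1))
    {est sig : ℝ → ℕ → Ω → ℝ} {target : ℝ → ℝ}
    (htarget : ∀ h ∈ Set.Ioc 0 hmax, target h = lsRatio (c.gramAt μ W k h))
    {hlo hhi : ℕ → ℝ} (hh : ∀ n, 0 < hlo n ∧ hlo n ≤ hhi n ∧ hhi n ≤ hmax)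
    (hrate : Tendsto (fun n : ℕ => n * hlo n / Real.log (Real.log (hlo n)⁻¹) ^ 3) atTop atTop)
    {good : ℕ → Set Ω} (hties : ∀ n, ∀ ω ∈ good n, ∀ i j, i ≠ j → |c.xc (W i ω)| ≠ |c.xc (W j ω)|)
    (hest : ∀ n, ∀ ω ∈ good n, ∀ h, 0 < h → 0 < n → (∀ b, 0 < c.empGram W k h n ω b 0 2) →
      (∀ b, 0 < gramDet (c.empGram W k h n ω b)) → est h n ω = lsRatio (c.empGram W k h n ω) ∧
        sig h n ω = √(sandwich (c.empGram W k h n ω) (c.empMeat W k h n ω) /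
          lsJump (c.empGram W k h n ω) 1 ^ 2)) {C : ℝ}
    (hgram : ∀ᶠ n : ℕ in atTop, ∀ ω ∈ good n, ∀ h, hlo n ≤ h → h ≤ hmax →
      (∀ b p r, |c.empGram W k h n ω b p r - c.gramAt μ W k h b p r| ≤
        C * √(Real.log (Real.log (hlo n)⁻¹) / (n * h))) ∧
      ∀ b p q r s, |c.empMeat W k h n ω b p q r s - c.meatAt μ W k h b p q r s| ≤
        C * √(Real.log (Real.log (hlo n)⁻¹) / (n * h))) {ε : ℝ} (hε : 0 < ε) :
    ∀ᶠ n : ℕ in atTop, ∀ ω ∈ good n, ∀ h ∈ Set.Icc (hlo n) (hhi n),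
      √(max 1 (Real.log (Real.log (hhi n / hlo n)))) *
        |√(n * h) * (est h n ω - target h) / sig h n ω -
          1 / √(n * h) * ∑ i ∈ Finset.range n, c.score μ W k (W i ω) h *
            equivKernel k (c.xc (W i ω) / h)| ≤ ε := by
  set LL : ℕ → ℝ := fun n => Real.log (Real.log (hlo n)⁻¹) with hLL
  have hLL1 : ∀ n, 1 ≤ LL n := fun n =>
    one_le_log_log_inv (hh n).1 (((hh n).2.1.trans (hh n).2.2).trans hm1)
  -- A filter on triples (n, h, ω) encodes uniformity: O-bounds along it hold uniformly over the
  -- good event and the bandwidth window as n → ∞, so the calculus of `Approx` applies directly.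
  set S : Set (ℕ × ℝ × Ω) := {p | p.2.2 ∈ good p.1 ∧ p.2.1 ∈ Set.Icc (hlo p.1) (hhi p.1)} with hS
  set l : Filter (ℕ × ℝ × Ω) := comap Prod.fst atTop ⊓ 𝓟 S with hl
  have hlev : ∀ {P : ℕ → ℝ → Ω → Prop}, (∀ᶠ p in l, P p.1 p.2.1 p.2.2) ↔
      ∀ᶠ n : ℕ in atTop, ∀ ω ∈ good n, ∀ h ∈ Set.Icc (hlo n) (hhi n), P n h ω := by
    intro P
    rw [hl, eventually_inf_principal, eventually_comap]
    constructor
    · intro h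
      filter_upwards [h] with n hn ω hω h hh
      exact hn (n, h, ω) rfl ⟨hω, hh⟩
    · intro h
      filter_upwards [h] with n hn p hp hpS
      subst hp
      exact hn _ hpS.1 _ hpS.2
  have hn0 : ∀ᶠ p in l, 0 < p.1 ∧ p.2.1 ∈ Set.Ioc 0 hmax :=
    (hlev (P := fun n h _ => 0 < n ∧ h ∈ Set.Ioc 0 hmax)).2 <| by
      filter_upwards [eventually_gt_atTop 0] with n hn ω _ h hhI
      exact ⟨hn, (hh n).1.trans_le hhI.1, hhI.2.trans (hh n).2.2⟩
  have hgood : ∀ᶠ p in l, c.GoodBandwidth μ W k c₀ K₀ p.2.1 := hn0.mono fun p hp => hg _ hp.2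
  set δ : ℕ × ℝ × Ω → ℝ := fun p => √(LL p.1 / (p.1 * p.2.1)) with hδdef
  have hsq : Tendsto (fun n : ℕ => √(n * hlo n / LL n ^ 3)⁻¹) atTop (𝓝 0) := by
    have := (Real.continuous_sqrt.tendsto 0).comp hrate.inv_tendsto_atTop
    rwa [Real.sqrt_zero] at this
  have hδ : Tendsto δ l (𝓝 0) := by
    have h1 : Tendsto (fun p : ℕ × ℝ × Ω => √(p.1 * hlo p.1 / LL p.1 ^ 3)⁻¹) l (𝓝 0) :=
      (hsq.comp tendsto_comap).mono_left inf_le_left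
    refine squeeze_zero' (Eventually.of_forall fun p => Real.sqrt_nonneg _) ?_ h1
    refine (hlev (P := fun n h _ => √(LL n / (n * h)) ≤ √(n * hlo n / LL n ^ 3)⁻¹)).2 ?_
    filter_upwards [eventually_gt_atTop 0] with n hn ω _ h hhI
    have hn' : (0 : ℝ) < n := by exact_mod_cast hn
    have ha := (hh n).1
    have hL := hLL1 n
    have hah := hhI.1
    rw [inv_div]
    refine Real.sqrt_le_sqrt ?_
    have h3 : LL n ≤ LL n ^ 3 := le_self_pow₀ hL (by norm_num)
    gcongr
  have hbig : ∀ {g : ℕ → ℝ → Ω → ℝ} {K : ℝ}, (∀ᶠ p in l, |g p.1 p.2.1 p.2.2| ≤ K * δ p) →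
      (fun p : ℕ × ℝ × Ω => g p.1 p.2.1 p.2.2) =O[l] δ := fun {g K} h =>
    Asymptotics.IsBigO.of_bound K <| h.mono fun p hp => by
      rwa [Real.norm_eq_abs, Real.norm_eq_abs, abs_of_nonneg (Real.sqrt_nonneg _)]
  have hgram' := (hlev (P := fun n h ω => (∀ b p r, |c.empGram W k h n ω b p r -
      c.gramAt μ W k h b p r| ≤ C * √(LL n / (n * h))) ∧
      ∀ b p q r s, |c.empMeat W k h n ω b p q r s - c.meatAt μ W k h b p q r s| ≤
        C * √(LL n / (n * h)))).2 <| by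
    filter_upwards [hgram] with n hn ω hω h hhI
    exact hn ω hω h hhI.1 (hhI.2.trans (hh n).2.2)
  have hM : ∀ b p r, Approx l δ (fun x => c.empGram W k x.2.1 x.1 x.2.2 b p r)
      fun x => c.gramAt μ W k x.2.1 b p r := fun b p r =>
    ⟨Asymptotics.IsBigO.of_bound K₀ <| hgood.mono fun x hx => by
        rw [norm_one, mul_one]
        exact hx.gram_le b p r,
      hbig (g := fun n h ω => c.empGram W k h n ω b p r - c.gramAt μ W k h b p r) <|
        hgram'.mono fun x hx => hx.1 b p r⟩
  have hN : ∀ b p q r s, Approx l δ (fun x => c.empMeat W k x.2.1 x.1 x.2.2 b p q r s)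
      fun x => c.meatAt μ W k x.2.1 b p q r s := fun b p q r s =>
    ⟨Asymptotics.IsBigO.of_bound K₀ <| hgood.mono fun x hx => by
        rw [norm_one, mul_one]
        exact hx.meat_le b p q r s,
      hbig (g := fun n h ω => c.empMeat W k h n ω b p q r s - c.meatAt μ W k h b p q r s) <|
        hgram'.mono fun x hx => hx.2 b p q r s⟩
  have hd : ∀ b, Away l fun x => gramDet (c.gramAt μ W k x.2.1 b) := fun b =>
    ⟨c₀, hc₀, hgood.mono fun x hx => (hx.det b).trans (le_abs_self _)⟩
  have hj : Away l fun x => lsJump (c.gramAt μ W k x.2.1) 1 :=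
    ⟨c₀, hc₀, hgood.mono fun x hx => hx.jump⟩
  have hpos : ∀ {g p : ℕ × ℝ × Ω → ℝ}, Approx l δ g p → (∀ᶠ x in l, c₀ ≤ p x) →
      ∀ᶠ x in l, 0 < g x := by
    intro g p hgp hp
    have h0 : Tendsto (fun i => g i - p i) l (𝓝 0) := hgp.2.trans_tendsto hδ
    filter_upwards [hp, (Metric.tendsto_nhds.1 h0) c₀ hc₀] with x h1 h2
    rw [Real.dist_eq, sub_zero] at h2
    linarith [(abs_lt.1 h2).1]
  -- Positive counts and determinants of the sample Gram matrices make the closed forms of the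
  -- estimator and its standard error available.
  have hcount := eventually_all.2 fun b => hpos (hM b 0 2) (hgood.mono fun x hx => hx.count b)
  have hdet := eventually_all.2 fun b => hpos (approx_gramDet hδ hM b)
    (hgood.mono fun x hx => hx.det b)
  obtain ⟨K, hK, hexp⟩ := (studentized_expansion hδ hM hN hd hj hc₀
    (hgood.mono fun x hx => hx.sand)).exists_nonneg
  obtain ⟨K', hK', hscore⟩ := H.abs_sum_sub_score_le hk hw hK₀ (k := k)
  have hSl : ∀ᶠ p in l, p ∈ S := mem_inf_of_right (mem_principal_self S)
  have hε' : ∀ᶠ n : ℕ in atTop, (K + K') * √(n * hlo n / LL n ^ 3)⁻¹ ≤ ε := by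
    have := hsq.const_mul (K + K')
    rw [mul_zero] at this
    exact this.eventually (Iic_mem_nhds hε)
  refine (hlev (P := fun n h ω => √(max 1 (Real.log (Real.log (hhi n / hlo n)))) *
        |√(n * h) * (est h n ω - target h) / sig h n ω -
          1 / √(n * h) * ∑ i ∈ Finset.range n, c.score μ W k (W i ω) h *
            equivKernel k (c.xc (W i ω) / h)| ≤ ε)).1 ?_
  filter_upwards [hn0, hgood, hcount, hdet, hexp.bound, hSl,
    (tendsto_comap.mono_left inf_le_left : Tendsto Prod.fst l atTop).eventually hε']
    with x hx hxg hxc hxd hxe hxS hxε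
  obtain ⟨n, h, ω⟩ := x
  dsimp only at hx hxg hxc hxd hxe hxS hxε ⊢
  obtain ⟨e1, e2⟩ := hest n ω hxS.1 h hx.2.1 hx.1 hxc hxd
  have hn' : (0 : ℝ) < n := by exact_mod_cast hx.1
  rw [Real.norm_eq_abs, norm_pow, Real.norm_eq_abs, sq_abs] at hxe
  have h1 := mul_sqrt_sub_le hn' hx.2.1 (s := √(n * h) * (est h n ω - target h) / sig h n ω) hxe
    (studentScale_mul_empGram h n ω) (hscore h hx.2.1 hxg.coef_le n ω (hties n ω hxS.1))
    (by rw [e1, e2, htarget h hx.2, mul_div_assoc])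
  refine (mul_le_mul_of_nonneg_left h1 (Real.sqrt_nonneg _)).trans (le_trans ?_ hxε)
  exact sqrt_mul_remainder_le (max_one_log_log_div_le (hh n).1 (hh n).2.1
    ((hh n).2.2.trans (hm1.trans (Real.exp_le_one_iff.2 (by linarith [Real.exp_pos 1])))) (hLL1 n))
    (hLL1 n) hn' (hh n).1 hxS.2.1 hK hK'

/-- Off a null set and a bad set of probability at most δ, the remainder is eventually at most ε for
all h in the window. Only monotonicity and subadditivity of μ enter, so the exceptional event may be
nonmeasurable. -/
theorem representation (H : c.Holds μ W) (hk : KernelRegular k c.A) (hw : WellPosed k)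
    (hg : ∀ h ∈ Set.Ioc 0 hmax, c.GoodBandwidth μ W k c₀ K₀ h) (hc₀ : 0 < c₀) (hK₀ : 0 < K₀)
    (hm0 : 0 < hmax) (hm1 : hmax ≤ Real.exp (-Real.exp 1))
    {est sig : ℝ → ℕ → Ω → ℝ} {target : ℝ → ℝ}
    (htarget : ∀ h ∈ Set.Ioc 0 hmax, target h = lsRatio (c.gramAt μ W k h))
    (hest : ∀ᵐ ω ∂μ, ∀ (n : ℕ) (h : ℝ), 0 < h → 0 < n → (∀ b, 0 < c.empGram W k h n ω b 0 2) →
      (∀ b, 0 < gramDet (c.empGram W k h n ω b)) → est h n ω = lsRatio (c.empGram W k h n ω) ∧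
        sig h n ω = √(sandwich (c.empGram W k h n ω) (c.empMeat W k h n ω) /
          lsJump (c.empGram W k h n ω) 1 ^ 2))
    {hlo hhi : ℕ → ℝ} (hh : ∀ n, 0 < hlo n ∧ hlo n ≤ hhi n ∧ hhi n ≤ hmax)
    (hrate : Tendsto (fun n : ℕ => n * hlo n / Real.log (Real.log (hlo n)⁻¹) ^ 3) atTop atTop)
    {ε : ℝ} (hε : 0 < ε) :
    Tendsto (fun n : ℕ => μ {ω | ∃ h ∈ Set.Icc (hlo n) (hhi n),
      ε < √(max 1 (Real.log (Real.log (hhi n / hlo n)))) *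
        |√(n * h) * (est h n ω - target h) / sig h n ω -
          1 / √(n * h) * ∑ i ∈ Finset.range n, c.score μ W k (W i ω) h *
            equivKernel k (c.xc (W i ω) / h)|}) atTop (𝓝 0) := by
  have hlo1 : ∀ n, hlo n ≤ hmax := fun n => (hh n).2.1.trans (hh n).2.2
  rw [ENNReal.tendsto_nhds_zero]
  intro δ hδ
  rcases eq_or_ne δ ⊤ with rfl | hδtop
  · exact Eventually.of_forall fun _ => le_top
  obtain ⟨C, -, hC⟩ := H.exists_bad_set_gram hk (hg hmax ⟨hm0, le_rfl⟩) hK₀ hm0 hm1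
    (fun n => (hh n).1) hlo1 hrate (ENNReal.toReal_pos hδ.ne' hδtop)
  obtain ⟨N, hN⟩ := eventually_atTop.1 hC
  choose! bad hbad hbound using hN
  obtain ⟨G, hGμ, hG⟩ := exists_set_of_ae (hest.and H.ae_abs_ne)
  have hev := H.eventually_remainder_le hk hw hg hc₀ hK₀ hm1 htarget hh hrate
    (good := fun n => G ∩ (bad n)ᶜ) (fun n ω hω => (hG ω hω.1).2)
    (fun n ω hω => (hG ω hω.1).1 n) (eventually_atTop.2 ⟨N, fun n hn ω hω =>
      hbound n hn ω hω.2⟩) hε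
  filter_upwards [hev, eventually_ge_atTop N] with n hn hnN
  calc _ ≤ μ (bad n ∪ Gᶜ) := by
        refine measure_mono fun ω hω => ?_
        by_contra hc
        rw [Set.mem_union, not_or, Set.mem_compl_iff, not_not] at hc
        obtain ⟨h, hhI, hlt⟩ := hω
        exact absurd (hn ω ⟨hc.2, hc.1⟩ h hhI) (not_le.2 hlt)
    _ ≤ μ (bad n) + μ Gᶜ := measure_union_le _ _
    _ ≤ δ := by
        rw [hGμ, add_zero, ← ENNReal.ofReal_toReal hδtop]
        exact (ENNReal.le_ofReal_iff_toReal_le (measure_ne_top _ _) ENNReal.toReal_nonneg).2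
          (hbad n hnN)

end LocalModel.Holds

/-! ### From the local model to the two assumptions. -/

theorem LocalModel.Holds.assumptionsHold {Ω 𝒲 : Type*} [MeasurableSpace Ω] [MeasurableSpace 𝒲]
    {c : LocalModel 𝒲} {μ : Measure Ω} [IsProbabilityMeasure μ] {W : ℕ → Ω → 𝒲} {k : ℝ → ℝ}
    (H : c.Holds μ W) (hk : KernelRegular k c.A) (hw : WellPosed k)
    {est sig : ℝ → ℕ → Ω → ℝ} {target : ℝ → ℝ}
    (htarget : ∀ h, 0 < h → (∀ b, 0 < popGram μ k (fun ω => c.xc (W 0 ω)) (fun ω => c.yc (W 0 ω))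
        (fun ω => c.dc (W 0 ω)) h b 0 2) →
      (∀ b, 0 < gramDet (popGram μ k (fun ω => c.xc (W 0 ω)) (fun ω => c.yc (W 0 ω))
        (fun ω => c.dc (W 0 ω)) h b)) →
      target h = lsRatio (popGram μ k (fun ω => c.xc (W 0 ω)) (fun ω => c.yc (W 0 ω))
        (fun ω => c.dc (W 0 ω)) h))
    (hest : ∀ᵐ ω ∂μ, ∀ (n : ℕ) (h : ℝ), 0 < h → 0 < n → (∀ b, 0 < c.empGram W k h n ω b 0 2) →
      (∀ b, 0 < gramDet (c.empGram W k h n ω b)) → est h n ω = lsRatio (c.empGram W k h n ω) ∧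
        sig h n ω = √(sandwich (c.empGram W k h n ω) (c.empMeat W k h n ω) /
          lsJump (c.empGram W k h n ω) 1 ^ 2)) :
    AssumptionsHold μ W c.xc est sig target (equivKernel k) c.A := by
  obtain ⟨c₀, K₀, hc₀, hK₀, hgood⟩ := H.exists_goodBandwidth hk hw
  obtain ⟨f, m, v, ell, h1, h2, h3, h4, h5, h6, h7, h8, hreg⟩ := H.exists_regular hk hw
  obtain ⟨η, hη, hev⟩ := mem_nhdsGT_iff_exists_Ioc_subset.1 (hgood.and hreg)
  have hη0 : (0 : ℝ) < η := hη
  -- The cap exp(-e) makes log log(1 / h) at least 1 for all admissible h.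
  set hmax := min η (Real.exp (-Real.exp 1)) with hhmax
  have hm0 : 0 < hmax := lt_min hη0 (Real.exp_pos _)
  have hsub : ∀ h ∈ Set.Ioc 0 hmax, h ∈ Set.Ioc 0 η := fun h hh =>
    ⟨hh.1, hh.2.trans (min_le_left _ _)⟩
  have hg : ∀ h ∈ Set.Ioc 0 hmax, c.GoodBandwidth μ W k c₀ K₀ h := fun h hh =>
    (hev (hsub h hh)).1
  refine ⟨hmax, hm0, c.score μ W k, ⟨hk.equivKernel hw, ?_, ?_,
    f, m, v, ell, h1, h2, h3, h4, h5, h6, h7, h8, fun t ht => (hev (hsub t ht)).2⟩,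
    fun hlo hhi hh hrate => ⟨fun h _ => H.measurable_score h,
      fun h hh => H.memLp_score hk hw (hg h hh) hh.1,
      fun h hh => H.integral_score hk hw (hg h hh) hc₀ hh.1,
      fun h hh => H.variance_score hk hw (hg h hh) hc₀ hh.1,
      H.polyUniformCovering_score hk hw hg, polyUniformCovering_kernel (hk.equivKernel hw) hmax,
      fun ε hε => ?_⟩⟩
  · obtain ⟨K, hK⟩ := H.abs_score_mul_kernel_le hk hw K₀
    exact ⟨K, fun h hh => ae_of_all _ fun ω => hK h hh.1 (hg h hh).coef_le (W 0 ω)⟩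
  · exact ⟨_, ae_of_all _ fun ω => H.abs_score_zero_le (W 0 ω)⟩
  · refine H.representation hk hw hg hc₀ hK₀ hm0 (min_le_right _ _) (fun h hh => ?_) hest hh hrate hε
    have hgh := hg h hh
    have e := gramAt_of_ne (c := c) (μ := μ) (W := W) (k := k) hh.1.ne'
    have hcount := fun b => hc₀.trans_le (hgh.count b)
    have hdet := fun b => hc₀.trans_le (hgh.det b)
    rw [e] at hcount hdet ⊢
    exact htarget h hh.1 hcount hdet

/-! ### Moduli of continuity -/

theorem eventually_one_le_log_log_inv :
    ∀ᶠ h in 𝓝[>] (0 : ℝ), 1 ≤ Real.log (Real.log h⁻¹) := by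
  filter_upwards [Ioc_mem_nhdsGT (Real.exp_pos (-Real.exp 1))] with h hh
  exact one_le_log_log_inv hh.1 hh.2

theorem LogLogSmall.tendsto_zero {ρ : ℝ → ℝ} (hρ : LogLogSmall ρ) :
    Tendsto ρ (𝓝[>] 0) (𝓝 0) := by
  refine squeeze_zero_norm' ?_ (abs_zero (α := ℝ) ▸ Tendsto.abs hρ)
  filter_upwards [eventually_one_le_log_log_inv] with h hh
  rw [Real.norm_eq_abs, abs_mul]
  exact le_mul_of_one_le_right (abs_nonneg _) (hh.trans (le_abs_self _))

/-- `ell` need not be monotone, so h is assigned the supremum of |ell| over (0, A h]. For s in this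
range log log(1 / s) is at least half of log log(1 / h), so the supremum is still o(1 / log log(1 /
h)). -/
theorem LogLogSmall.exists_majorant {ell : ℝ → ℝ} (hell : LogLogSmall ell) {A : ℝ} (hA : 0 < A) :
    ∃ ρ : ℝ → ℝ, LogLogSmall ρ ∧
      ∀ᶠ h in 𝓝[>] (0 : ℝ), ∀ s, 0 < s → s ≤ A * h → |ell s| ≤ ρ h := by
  set S : ℝ → Set ℝ := fun h => (fun s => |ell s|) '' Set.Ioc 0 (A * h) with hS
  have key : ∀ ε : ℝ, 0 < ε → ∀ᶠ h in 𝓝[>] (0 : ℝ), 0 < h ∧ 0 < Real.log (Real.log h⁻¹) ∧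
      ∀ s, 0 < s → s ≤ A * h → |ell s| ≤ 2 * ε / Real.log (Real.log h⁻¹) := by
    intro ε hε
    have h1 : ∀ᶠ s in 𝓝[>] (0 : ℝ), |ell s * Real.log (Real.log s⁻¹)| ≤ ε := by
      have := (Tendsto.abs hell).eventually (Iic_mem_nhds (by rwa [abs_zero]))
      exact this
    obtain ⟨η, hη, hsub⟩ := mem_nhdsGT_iff_exists_Ioc_subset.1 h1
    have hη0 : (0 : ℝ) < η := hη
    filter_upwards [self_mem_nhdsWithin, eventually_one_le_log_log_inv, log_log_inv_le hA,
      (tendsto_const_mul_nhdsGT hA).eventually (Ioc_mem_nhdsGT (lt_min hη0 (Real.exp_pos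
        (-Real.exp 1))))] with h hh0 hL1 hL2 hAh
    refine ⟨hh0, by linarith, fun s hs hsA => ?_⟩
    have hAη : A * h ≤ η := hAh.2.trans (min_le_left _ _)
    have hAe : A * h ≤ Real.exp (-Real.exp 1) := hAh.2.trans (min_le_right _ _)
    have h2 : |ell s * Real.log (Real.log s⁻¹)| ≤ ε := hsub ⟨hs, hsA.trans hAη⟩
    have h3 := one_le_log_log_inv hAh.1 hAe
    have h4 : 0 < Real.log (A * h)⁻¹ := by
      by_contra hc
      have h5 : 1 < (A * h)⁻¹ := (one_lt_inv₀ hAh.1).2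
        (hAe.trans_lt (by
          have := Real.exp_lt_exp.2 (by linarith [Real.exp_pos 1] : -Real.exp 1 < 0)
          rwa [Real.exp_zero] at this))
      exact hc (Real.log_pos h5)
    have h5 : Real.log (Real.log (A * h)⁻¹) ≤ Real.log (Real.log s⁻¹) :=
      Real.log_le_log h4 (Real.log_le_log (inv_pos.2 hAh.1) (inv_anti₀ hs hsA))
    rw [abs_mul, abs_of_nonneg (by linarith : 0 ≤ Real.log (Real.log s⁻¹))] at h2
    rw [le_div_iff₀ (by linarith)]
    have h6 : Real.log (Real.log h⁻¹) ≤ 2 * Real.log (Real.log s⁻¹) := by linarith [hL2.2]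
    nlinarith [abs_nonneg (ell s), mul_le_mul_of_nonneg_left h6 (abs_nonneg (ell s))]
  refine ⟨fun h => sSup (S h), ?_, ?_⟩
  · unfold LogLogSmall
    rw [Metric.tendsto_nhds]
    intro ε hε
    filter_upwards [key (ε / 4) (by linarith)] with h ⟨hh0, hL, hh⟩
    have hne : (S h).Nonempty := ⟨_, A * h, ⟨mul_pos hA hh0, le_rfl⟩, rfl⟩
    have h1 : sSup (S h) ≤ 2 * (ε / 4) / Real.log (Real.log h⁻¹) := by
      refine csSup_le hne ?_
      rintro _ ⟨s, hs, rfl⟩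
      exact hh s hs.1 hs.2
    have h2 : 0 ≤ sSup (S h) := by
      refine Real.sSup_nonneg ?_
      rintro _ ⟨s, hs, rfl⟩
      exact abs_nonneg _
    rw [Real.dist_eq, sub_zero, abs_of_nonneg (mul_nonneg h2 hL.le)]
    rw [le_div_iff₀ hL] at h1
    linarith
  · filter_upwards [key 1 one_pos] with h ⟨_, _, hh⟩ s hs hsA
    refine le_csSup ⟨2 * 1 / Real.log (Real.log h⁻¹), ?_⟩ ⟨s, ⟨hs, hsA⟩, rfl⟩
    rintro _ ⟨s, hs, rfl⟩
    exact hh s hs.1 hs.2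

/-- The value on side `b` of a pair (above, below). -/
def onSide (r l : ℝ) (b : Bool) : ℝ := if b then r else l

theorem OneSidedModulus.localApprox {ell g : ℝ → ℝ} {gR gL : ℝ}
    (h : OneSidedModulus ell g gR gL) {A : ℝ} (hA : 0 < A) {ρ : ℝ → ℝ}
    (hρ : ∀ᶠ h in 𝓝[>] (0 : ℝ), ∀ s, 0 < s → s ≤ A * h → |ell s| ≤ ρ h) (b : Bool) :
    LocalApprox A ρ b g (onSide gR gL b) := by
  refine ⟨Asymptotics.isBigO_const_const _ one_ne_zero _, Asymptotics.IsBigO.of_bound 1 ?_⟩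
  refine (eventually_localFilter (P := fun h x => ‖g x - onSide gR gL b‖ ≤ 1 * ‖ρ h‖)).2 ?_
  obtain ⟨η, hη, hR⟩ := mem_nhdsGT_iff_exists_Ioc_subset.1 h.1
  obtain ⟨η', hη', hL⟩ := mem_nhdsLT_iff_exists_Ico_subset.1 h.2
  have hη0 : (0 : ℝ) < η := hη
  have hη0' : η' < 0 := hη'
  filter_upwards [hρ, (tendsto_const_mul_nhdsGT hA).eventually
    (Ioc_mem_nhdsGT (lt_min hη0 (neg_pos.2 hη0')))] with t ht htA x hx hx0 hxA
  have h1 := ht |x| (abs_pos.2 hx0) hxA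
  have h2 : |g x - onSide gR gL b| ≤ ell |x| := by
    cases b
    · have hx' : x < 0 := hx
      rw [abs_of_neg hx'] at hxA
      exact hL ⟨by linarith [htA.2.trans (min_le_right _ _)], hx'⟩
    · have hx' : 0 ≤ x := hx
      rw [abs_of_nonneg hx'] at hxA
      exact hR ⟨lt_of_le_of_ne hx' hx0.symm, hxA.trans (htA.2.trans (min_le_left _ _))⟩
  rw [Real.norm_eq_abs, Real.norm_eq_abs, one_mul]
  exact h2.trans ((le_abs_self _).trans (h1.trans (le_abs_self _)))

/-- One-sided punctured neighbourhoods of zero. -/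
def nhdsSide (b : Bool) : Filter ℝ := if b then 𝓝[>] 0 else 𝓝[<] 0

theorem volume_ne_zero_of_mem_nhdsSide {b : Bool} {s : Set ℝ} (hs : s ∈ nhdsSide b) :
    volume s ≠ 0 := by
  intro h0
  cases b
  · obtain ⟨a, ha, hsub⟩ := mem_nhdsLT_iff_exists_Ico_subset.1 hs
    have := measure_mono_null hsub h0
    rw [Real.volume_Ico, ENNReal.ofReal_eq_zero] at this
    have ha' : a < 0 := ha
    linarith
  · obtain ⟨a, ha, hsub⟩ := mem_nhdsGT_iff_exists_Ioc_subset.1 hs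
    have := measure_mono_null hsub h0
    rw [Real.volume_Ioc, ENNReal.ofReal_eq_zero] at this
    have ha' : 0 < a := ha
    linarith

theorem OneSidedModulus.tendsto {ell g : ℝ → ℝ} {gR gL : ℝ} (h : OneSidedModulus ell g gR gL)
    (hell : Tendsto ell (𝓝[>] 0) (𝓝 0)) (b : Bool) :
    Tendsto g (nhdsSide b) (𝓝 (onSide gR gL b)) := by
  have habs : Tendsto (fun x : ℝ => |x|) (nhdsSide b) (𝓝[>] 0) := by
    have h0 : Tendsto (fun x : ℝ => |x|) (𝓝 0) (𝓝 0) := by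
      simpa using (continuous_abs (G := ℝ)).tendsto 0
    cases b
    · refine tendsto_nhdsWithin_iff.2 ⟨h0.mono_left nhdsWithin_le_nhds, ?_⟩
      filter_upwards [self_mem_nhdsWithin] with x hx
      exact abs_pos.2 (ne_of_lt (show x < 0 from hx))
    · refine tendsto_nhdsWithin_iff.2 ⟨h0.mono_left nhdsWithin_le_nhds, ?_⟩
      filter_upwards [self_mem_nhdsWithin] with x hx
      exact abs_pos.2 (ne_of_gt (show 0 < x from hx))
  have h1 : ∀ᶠ x in nhdsSide b, |g x - onSide gR gL b| ≤ ell |x| := by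
    cases b
    · exact h.2
    · exact h.1
  rw [tendsto_iff_norm_sub_tendsto_zero]
  exact squeeze_zero' (Eventually.of_forall fun _ => norm_nonneg _) h1 (hell.comp habs)

/-- The density is positive on a one-sided neighborhood of 0, so what holds almost surely at X holds
there for Lebesgue-almost every x. This rules out a negative limit. -/
theorem nonneg_of_tendsto_nhdsSide {Ω : Type*} [MeasurableSpace Ω] {μ : Measure Ω} {X : Ω → ℝ}
    (hX : Measurable X) {f : ℝ → ℝ} (hf : Measurable f)
    (hd : μ.map X = volume.withDensity fun x => ENNReal.ofReal (f x)) {b : Bool} {fl : ℝ}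
    (hfl : 0 < fl) (hfb : Tendsto f (nhdsSide b) (𝓝 fl)) {g : ℝ → ℝ} (hg : Measurable g) {l : ℝ}
    (hgl : Tendsto g (nhdsSide b) (𝓝 l)) (h : ∀ᵐ ω ∂μ, 0 ≤ g (X ω)) : 0 ≤ l := by
  by_contra hl
  have h1 : ∀ᵐ x ∂(μ.map X), 0 ≤ g x :=
    (ae_map_iff hX.aemeasurable (measurableSet_le measurable_const hg)).2 h
  rw [hd, ae_withDensity_iff hf.ennreal_ofReal] at h1
  have h2 : {x | ¬(ENNReal.ofReal (f x) ≠ 0 → 0 ≤ g x)} ∈ nhdsSide b := by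
    filter_upwards [hfb.eventually (lt_mem_nhds hfl), hgl.eventually (gt_mem_nhds (not_le.1 hl))]
      with x hx1 hx2 hc
    exact absurd (hc (ENNReal.ofReal_pos.2 hx1).ne') (not_le.2 hx2)
  exact volume_ne_zero_of_mem_nhdsSide h2 h1

/-! ### Clamping -/

/-- Truncation to `[-B, B]`. -/
noncomputable def clamp (B y : ℝ) : ℝ := max (-B) (min y B)

theorem measurable_clamp (B : ℝ) : Measurable (clamp B) :=
  measurable_const.max (measurable_id.min measurable_const)

theorem abs_clamp_le {B : ℝ} (hB : 0 ≤ B) (y : ℝ) : |clamp B y| ≤ B :=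
  abs_le.2 ⟨le_max_left _ _, max_le (by linarith) (min_le_right _ _)⟩

theorem clamp_eq {B y : ℝ} (h : |y| ≤ B) : clamp B y = y := by
  obtain ⟨h1, h2⟩ := abs_le.1 h
  rw [clamp, min_eq_left h2, max_eq_right h1]

theorem popJump_congr {Ω : Type*} [MeasurableSpace Ω] {μ : Measure Ω} {X Y Y' : Ω → ℝ}
    (h : Y =ᵐ[μ] Y') (k : ℝ → ℝ) (t : ℝ) : popJump μ k t X Y = popJump μ k t X Y' := by
  have e : ∀ S, popLoss μ k S t X Y = popLoss μ k S t X Y' := fun S => by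
    funext p
    refine integral_congr_ae ?_
    filter_upwards [h] with ω hω
    rw [hω]
  unfold popJump popFit
  simp only [e]

/-! ### Further rules for conditional moments -/

section CondMoments

variable {Ω β : Type*} [mΩ : MeasurableSpace Ω] [mβ : MeasurableSpace β] {μ : Measure Ω}
  [IsProbabilityMeasure μ] {X : Ω → β}

theorem IsCondMean.congr {V V' : Ω → ℝ} {m : β → ℝ} (hm : IsCondMean μ X V m) (h : V =ᵐ[μ] V') :
    IsCondMean μ X V' m :=
  ⟨hm.1, hm.2.trans (condExp_congr_ae h)⟩

theorem isCondMean_comp (hX : Measurable X) {a : β → ℝ} (ha : Measurable a) {K : ℝ}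
    (hK : ∀ x, |a x| ≤ K) : IsCondMean μ X (fun ω => a (X ω)) a := by
  refine ⟨ha, ?_⟩
  have hs : StronglyMeasurable[mβ.comap X] fun ω => a (X ω) :=
    (ha.comp (comap_measurable X)).stronglyMeasurable
  rw [condExp_of_stronglyMeasurable hX.comap_le hs]
  exact Integrable.of_bound (ha.comp hX).aestronglyMeasurable K (ae_of_all _ fun ω => hK _)

theorem IsCondMean.mul_comp (hX : Measurable X) {V : Ω → ℝ} (hV : Integrable V μ) {m : β → ℝ}
    (hm : IsCondMean μ X V m) {a : β → ℝ} (ha : Measurable a) {K : ℝ} (hK : ∀ x, |a x| ≤ K) :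
    IsCondMean μ X (fun ω => a (X ω) * V ω) fun x => a x * m x := by
  simpa using IsCondMean.sum_mul (Finset.univ : Finset Unit) hX (fun _ => hV) (fun _ => hm)
    (fun _ => ha) (fun _ => hK)

theorem IsCondMean.nonneg {V : Ω → ℝ} {m : β → ℝ} (hm : IsCondMean μ X V m)
    (h : ∀ᵐ ω ∂μ, 0 ≤ V ω) : ∀ᵐ ω ∂μ, 0 ≤ m (X ω) := by
  filter_upwards [hm.2, condExp_nonneg (m := mβ.comap X) h] with ω h1 h2
  rw [h1]
  exact h2

theorem IsCondCov.nonneg {V : Ω → ℝ} {v : β → ℝ} (hv : IsCondCov μ X V V v) :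
    ∀ᵐ ω ∂μ, 0 ≤ v (X ω) := by
  filter_upwards [hv.2, condExp_nonneg (m := mβ.comap X) (μ := μ)
    (f := fun ω => (V ω - (μ[V | mβ.comap X]) ω) * (V ω - (μ[V | mβ.comap X]) ω))
    (ae_of_all _ fun ω => mul_self_nonneg _)] with ω h1 h2
  rw [h1]
  exact h2

end CondMoments

/-! ### The sharp design -/

theorem LocalApprox.mul {A : ℝ} {ρ : ℝ → ℝ} {b : Bool} {g g' : ℝ → ℝ} {l l' : ℝ}
    (hρ : Tendsto ρ (𝓝[>] 0) (𝓝 0)) (h : LocalApprox A ρ b g l) (h' : LocalApprox A ρ b g' l') :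
    LocalApprox A ρ b (fun x => g x * g' x) (l * l') :=
  Approx.mul (tendsto_localFilter hρ) h h'

theorem LocalApprox.add {A : ℝ} {ρ : ℝ → ℝ} {b : Bool} {g g' : ℝ → ℝ} {l l' : ℝ}
    (h : LocalApprox A ρ b g l) (h' : LocalApprox A ρ b g' l') :
    LocalApprox A ρ b (fun x => g x + g' x) (l + l') :=
  Approx.add h h'

/-- The indicator of nonnegative values. -/
noncomputable def stepFun (x : ℝ) : ℝ := if 0 ≤ x then 1 else 0

theorem measurable_stepFun : Measurable stepFun :=
  Measurable.ite measurableSet_Ici measurable_const measurable_const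

theorem abs_stepFun_le (x : ℝ) : |stepFun x| ≤ 1 := by
  unfold stepFun
  split_ifs <;> simp

theorem localApprox_stepFun (A : ℝ) (ρ : ℝ → ℝ) (b : Bool) :
    LocalApprox A ρ b stepFun (onSide 1 0 b) := by
  refine Approx.congr_left (Approx.const (onSide 1 0 b)) ?_
  refine (eventually_localFilter (P := fun _ x => onSide 1 0 b = stepFun x)).2
    (Eventually.of_forall fun t x hx _ _ => ?_)
  cases b
  · have hx' : x < 0 := hx
    simp [onSide, stepFun, hx']
  · have hx' : 0 ≤ x := hx
    simp [onSide, stepFun, hx']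

/-- The sharp design as a fuzzy design with treatment `1{x ≥ 0}`. -/
noncomputable def sharpModel (A B : ℝ) (ρ f mY vY : ℝ → ℝ) (fR fL yR yL vR vL : ℝ) :
    LocalModel (ℝ × ℝ) where
  xc := Prod.fst
  yc w := clamp B w.2
  dc w := stepFun w.1
  A := A
  B := B
  ρ := ρ
  f := f
  fl := onSide fR fL
  mYY x := vY x + mY x * mY x
  mYD x := stepFun x * mY x
  mY := mY
  mDD x := stepFun x * stepFun x
  mD := stepFun
  lYY b := onSide vR vL b + onSide yR yL b * onSide yR yL b
  lYD b := onSide 1 0 b * onSide yR yL b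
  lY := onSide yR yL
  lDD b := onSide 1 0 b * onSide 1 0 b
  lD := onSide 1 0

/-- The treatment is constant on each side and contributes no variance, so the ratio drops out. -/
theorem residVar_sharpModel (A B : ℝ) (ρ f mY vY : ℝ → ℝ) (fR fL yR yL vR vL : ℝ) (b : Bool) :
    (sharpModel A B ρ f mY vY fR fL yR yL vR vL).residVar b = onSide vR vL b := by
  cases b <;> simp [LocalModel.residVar, LocalModel.residMean, LocalModel.ratio, sharpModel, onSide]
  all_goals ring

section

variable {Ω : Type*} [mΩ : MeasurableSpace Ω] {μ : Measure Ω} [IsProbabilityMeasure μ]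

theorem SharpConditions.holds {X Y : ℕ → Ω → ℝ} {ell f mY vY : ℝ → ℝ}
    {fR fL yR yL vR vL : ℝ} (S : SharpConditions μ X Y ell f mY vY fR fL yR yL vR vL)
    {A B : ℝ} (hA : 0 < A) (hB : 1 ≤ B) (hYB : ∀ᵐ ω ∂μ, |Y 0 ω| ≤ B) {ρ : ℝ → ℝ}
    (hρ : LogLogSmall ρ)
    (hell : ∀ᶠ h in 𝓝[>] (0 : ℝ), ∀ s, 0 < s → s ≤ A * h → |ell s| ≤ ρ h) :
    (sharpModel A B ρ f mY vY fR fL yR yL vR vL).Holds μ fun i ω => (X i ω, Y i ω) := by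
  have hX : Measurable (X 0) := measurable_fst.comp (S.iid.1 0)
  have hY : Measurable (Y 0) := measurable_snd.comp (S.iid.1 0)
  have hcl : (fun ω => clamp B (Y 0 ω)) =ᵐ[μ] Y 0 := hYB.mono fun ω h => clamp_eq h
  have hYi : Integrable (Y 0) μ := Integrable.of_bound hY.aestronglyMeasurable B hYB
  have hρ0 := hρ.tendsto_zero
  have hYl := fun b => S.modulus_mean_Y.localApprox hA hell b
  have hvl := fun b => S.modulus_var_Y.localApprox hA hell b
  have hsl := localApprox_stepFun A ρ
  -- Conditional variances have nonnegative limits, so a nonzero limit is a positive one.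
  have hvar : ∀ b, 0 ≤ onSide vR vL b := fun b =>
    nonneg_of_tendsto_nhdsSide hX S.running.measurable S.running.density
      (fl := onSide fR fL b) (by cases b; exacts [S.running.pos_left, S.running.pos_right])
      (S.running.modulus.tendsto S.small.tendsto_zero b) S.var_Y.1
      (S.modulus_var_Y.tendsto S.small.tendsto_zero b) S.var_Y.nonneg
  have hstep := isCondMean_comp (μ := μ) hX measurable_stepFun abs_stepFun_le
  exact
  { iid := S.iid
    meas_x := measurable_fst
    meas_y := (measurable_clamp B).comp measurable_snd
    meas_d := measurable_stepFun.comp measurable_fst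
    one_le := hB
    bound_y := fun w => abs_clamp_le (by linarith) _
    bound_d := fun w => (abs_stepFun_le _).trans hB
    A_pos := hA
    rho_small := hρ
    rho_tendsto := hρ0
    f_meas := S.running.measurable
    f_nonneg := S.running.nonneg
    density := S.running.density
    f_local := fun b => S.running.modulus.localApprox hA hell b
    fl_pos := fun b => by cases b; exacts [S.running.pos_left, S.running.pos_right]
    condYY := (S.var_Y.isCondMean hX hYi hYi hYB hYB S.mean_Y S.mean_Y).congr
      (hcl.mul hcl).symm
    condYD := (S.mean_Y.mul_comp hX hYi measurable_stepFun abs_stepFun_le).congr <| by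
      filter_upwards [hcl] with ω h
      simp only [sharpModel, h, mul_comm]
    condY := S.mean_Y.congr hcl.symm
    condDD := isCondMean_comp hX (measurable_stepFun.mul measurable_stepFun) (K := 1) fun x => by
      refine (abs_mul (stepFun x) (stepFun x)).trans_le ?_
      exact mul_le_one₀ (abs_stepFun_le x) (abs_nonneg _) (abs_stepFun_le x)
    condD := hstep
    localYY := fun b => (hvl b).add ((hYl b).mul hρ0 (hYl b))
    localYD := fun b => (hsl b).mul hρ0 (hYl b)
    localY := hYl
    localDD := fun b => (hsl b).mul hρ0 (hsl b)
    localD := hsl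
    jump := by simp [sharpModel, onSide]
    var_nonneg := fun b => by
      rw [residVar_sharpModel]
      exact hvar b
    var_pos := by
      rcases S.nondegenerate with h | h
      · exact ⟨true, by rw [residVar_sharpModel]; exact lt_of_le_of_ne (hvar true) h.symm⟩
      · exact ⟨false, by rw [residVar_sharpModel]; exact lt_of_le_of_ne (hvar false) h.symm⟩ }

/-- The bound on Y holds only almost surely, whereas the local model requires it pointwise. Clamping
repairs this: it leaves the population fits unchanged and, almost surely, all observations too. -/
theorem SharpConditions.assumptionsHold {X Y : ℕ → Ω → ℝ} {ell f mY vY : ℝ → ℝ}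
    {fR fL yR yL vR vL : ℝ} (S : SharpConditions μ X Y ell f mY vY fR fL yR yL vR vL)
    {k : ℝ → ℝ} {A : ℝ} (hk : KernelRegular k A) (hw : WellPosed k) :
    AssumptionsHold μ (fun i ω => (X i ω, Y i ω)) Prod.fst
      (fun h n ω => sampleJump k h n (fun i => X i ω) (fun i => Y i ω))
      (fun h n ω => sharpSigma k h n (fun i => X i ω) (fun i => Y i ω))
      (fun h => popJump μ k h (X 0) (Y 0)) (equivKernel k) A := by
  obtain ⟨B₀, hB₀⟩ := S.bounded
  obtain ⟨ρ, hρ, hell⟩ := S.small.exists_majorant hk.pos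
  have hYB : ∀ᵐ ω ∂μ, |Y 0 ω| ≤ max B₀ 1 := hB₀.mono fun ω h => h.trans (le_max_left _ _)
  have H := S.holds hk.pos (le_max_right B₀ 1) hYB hρ hell
  have hX : Measurable (X 0) := measurable_fst.comp (S.iid.1 0)
  have hcl : Y 0 =ᵐ[μ] fun ω => clamp (max B₀ 1) (Y 0 ω) := hYB.mono fun ω h => (clamp_eq h).symm
  have hz : ∀ u, A < |u| → k u = 0 := fun u hu => hk.eq_zero hu
  have hall : ∀ᵐ ω ∂μ, ∀ i, |Y i ω| ≤ max B₀ 1 := ae_all_iff.2 fun i =>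
    (S.iid.2.2 i).symm.ae_snd (p := fun w : ℝ × ℝ => |w.2| ≤ max B₀ 1)
      (measurableSet_le (measurable_norm.comp measurable_snd) measurable_const) hYB
  refine H.assumptionsHold hk hw (fun h hh hc hd => ?_) ?_
  · rw [popJump_congr hcl]
    exact popJump_eq hh hX (H.meas_y.comp (H.iid.1 0))
      (ae_of_all _ fun ω => H.bound_y (X 0 ω, Y 0 ω)) (fun ω => rfl)
      (fun b j => (hk.antiDiff.sideKernel hz b j).measurable)
      (fun b j => (hk.antiDiff.sideKernel hz b j).bounded.imp fun K h => h.2) hc hd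
  · filter_upwards [hall] with ω hω n h hh hn hc hd
    have e : (fun i => clamp (max B₀ 1) (Y i ω)) = fun i => Y i ω :=
      funext fun i => clamp_eq (hω i)
    have h := sharp_eq (k := k) (x := fun i => X i ω) (y := fun i => clamp (max B₀ 1) (Y i ω))
      (d := fun i => stepFun (X i ω)) hh hn (fun i => rfl) hc hd
    have h1 := h.1
    have h2 := h.2
    refine ⟨?_, ?_⟩
    · refine Eq.trans ?_ h1
      simp only [e]
    · refine Eq.trans ?_ h2
      simp only [e]

end

/-! ### The fuzzy design -/

section TotalVariance

/-- The law of total variance: the gap between the two sides is the conditional variance of the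
finer conditional mean. -/
theorem condExp_condVar_le {Ω : Type*} {m n : MeasurableSpace Ω} [mΩ : MeasurableSpace Ω]
    {μ : Measure Ω} [IsProbabilityMeasure μ] (hmn : m ≤ n) (hn : n ≤ mΩ) {Z : Ω → ℝ}
    {B : ℝ} (hZ : Integrable Z μ) (hB : ∀ᵐ ω ∂μ, |Z ω| ≤ B) :
    μ[μ[fun ω => (Z ω - (μ[Z | n]) ω) * (Z ω - (μ[Z | n]) ω) | n] | m] ≤ᵐ[μ]
      μ[fun ω => (Z ω - (μ[Z | m]) ω) * (Z ω - (μ[Z | m]) ω) | m] := by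
  have hR : Integrable (μ[Z | n]) μ := integrable_condExp
  have hRB : ∀ᵐ ω ∂μ, |(μ[Z | n]) ω| ≤ B := ae_bdd_abs_condExp_of_ae_bdd_abs hB
  have hRR : Integrable (fun ω => (μ[Z | n]) ω * (μ[Z | n]) ω) μ := hR.bdd_mul hR.1 hRB
  have h1 := condExp_congr_ae (m := m) (condExp_covariance hn hZ hZ hB hB)
  have h2 : μ[fun ω => (μ[fun ω => Z ω * Z ω | n]) ω - (μ[Z | n]) ω * (μ[Z | n]) ω | m] =ᵐ[μ]
      μ[μ[fun ω => Z ω * Z ω | n] | m] - μ[fun ω => (μ[Z | n]) ω * (μ[Z | n]) ω | m] :=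
    condExp_sub integrable_condExp hRR m
  have h3 := condExp_condExp_of_le (μ := μ) (f := fun ω => Z ω * Z ω) hmn hn
  have h4 := condExp_condExp_of_le (μ := μ) (f := Z) hmn hn
  have h5 := condExp_covariance (hmn.trans hn) hR hR hRB hRB
  have h6 := condExp_nonneg (m := m) (μ := μ) (f := fun ω =>
    ((μ[Z | n]) ω - (μ[μ[Z | n] | m]) ω) * ((μ[Z | n]) ω - (μ[μ[Z | n] | m]) ω))
    (ae_of_all _ fun ω => mul_self_nonneg _)
  have h7 := condExp_covariance (hmn.trans hn) hZ hZ hB hB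
  filter_upwards [h1, h2, h3, h4, h5, h6, h7] with ω h1 h2 h3 h4 h5 h6 h7
  rw [h1, h2, Pi.sub_apply, h3, h7]
  rw [Pi.zero_apply, h5, h4] at h6
  linarith

variable {Ω : Type*} [mΩ : MeasurableSpace Ω] {μ : Measure Ω} [IsProbabilityMeasure μ]
variable {β : Type*} [mβ : MeasurableSpace β] {X : Ω → β}

theorem IsCondMean.add_const_mul {V V' : Ω → ℝ} (hV : Integrable V μ) (hV' : Integrable V' μ)
    {m m' : β → ℝ} (hm : IsCondMean μ X V m) (hm' : IsCondMean μ X V' m') (a : ℝ) :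
    IsCondMean μ X (fun ω => V ω + a * V' ω) fun x => m x + a * m' x := by
  refine ⟨hm.1.add (hm'.1.const_mul a), ?_⟩
  have h1 : μ[fun ω => V ω + a * V' ω | mβ.comap X] =ᵐ[μ]
      μ[V | mβ.comap X] + μ[fun ω => a * V' ω | mβ.comap X] :=
    condExp_add hV (hV'.const_mul a) _
  have h2 : μ[fun ω => a * V' ω | mβ.comap X] =ᵐ[μ] a • μ[V' | mβ.comap X] := condExp_smul a V' _
  filter_upwards [h1, h2, hm.2, hm'.2] with ω h1 h2 h3 h4
  rw [h1, Pi.add_apply, h2, h3, h4]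
  rfl

/-- The conditional variance of `Y - θ D` given `X` is at least the part of the variance of `Y`
that comes from a subpopulation `t = 1` on which `D = d`. -/
theorem condVar_lower_bound {X D Y : Ω → ℝ} (hX : Measurable X) (hD : Measurable D)
    (hY : Measurable Y) {B : ℝ} (hDB : ∀ᵐ ω ∂μ, |D ω| ≤ B) (hYB : ∀ᵐ ω ∂μ, |Y ω| ≤ B)
    {vYD : ℝ × ℝ → ℝ} (hv : IsCondCov μ (fun ω => (D ω, X ω)) Y Y vYD) {θ : ℝ} {vz : ℝ → ℝ}
    (hz : IsCondCov μ X (fun ω => Y ω + -θ * D ω) (fun ω => Y ω + -θ * D ω) vz)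
    {t : Ω → ℝ} (ht : Integrable t μ) {d : ℝ}
    (htd : ∀ᵐ ω ∂μ, (t ω = 1 ∧ D ω = d) ∨ t ω = 0)
    {p : ℝ → ℝ} (hp : IsCondMean μ X t p) {M : ℝ} (hM : 0 ≤ M) :
    (∀ᵐ ω ∂μ, 0 ≤ clamp M (vYD (d, X ω)) * p (X ω)) ∧
      ∀ᵐ ω ∂μ, 0 ≤ vz (X ω) - clamp M (vYD (d, X ω)) * p (X ω) := by
  have hYi : Integrable Y μ := Integrable.of_bound hY.aestronglyMeasurable B hYB
  have hDi : Integrable D μ := Integrable.of_bound hD.aestronglyMeasurable B hDB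
  have hDX : Measurable fun ω => (D ω, X ω) := hD.prodMk hX
  have hn : MeasurableSpace.comap (fun ω => (D ω, X ω)) inferInstance ≤ mΩ := hDX.comap_le
  have hDn : Measurable[MeasurableSpace.comap (fun ω => (D ω, X ω)) inferInstance] D := measurable_fst.comp (comap_measurable fun ω => (D ω, X ω))
  have hXn : Measurable[MeasurableSpace.comap (fun ω => (D ω, X ω)) inferInstance] X := measurable_snd.comp (comap_measurable fun ω => (D ω, X ω))
  have hmn : MeasurableSpace.comap X inferInstance ≤
      MeasurableSpace.comap (fun ω => (D ω, X ω)) inferInstance := hXn.comap_le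
  -- Clamping makes the conditional variance bounded, so that it can be pulled out of a conditional
  -- expectation given X. Where t = 1 the product is at most the conditional variance, and elsewhere
  -- it is 0.
  have hgm : Measurable fun x => clamp M (vYD (d, x)) :=
    (measurable_clamp M).comp (hv.1.comp measurable_prodMk_left)
  have hgt : ∀ᵐ ω ∂μ, 0 ≤ clamp M (vYD (d, X ω)) * t ω ∧
      clamp M (vYD (d, X ω)) * t ω ≤ vYD (D ω, X ω) := by
    filter_upwards [hv.nonneg, htd] with ω h1 h2
    rcases h2 with ⟨h2, h3⟩ | h2
    · rw [h2, ← h3, mul_one]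
      exact ⟨(le_min h1 hM).trans (le_max_right _ _),
        max_le (by linarith) (min_le_left _ _)⟩
    · rw [h2, mul_zero]
      exact ⟨le_rfl, h1⟩
  have hgp := hp.mul_comp hX ht hgm (K := M) fun x => abs_clamp_le hM _
  refine ⟨hgp.nonneg (hgt.mono fun ω h => h.1), ?_⟩
  have hgti : Integrable (fun ω => clamp M (vYD (d, X ω)) * t ω) μ :=
    ht.bdd_mul (hgm.comp hX).aestronglyMeasurable (ae_of_all _ fun ω => abs_clamp_le hM _)
  have hvi : Integrable (fun ω => vYD (D ω, X ω)) μ := integrable_condExp.congr hv.2.symm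
  have h1 := condExp_mono (m := MeasurableSpace.comap X inferInstance) hgti hvi
    (hgt.mono fun ω h => h.2)
  set Z : Ω → ℝ := fun ω => Y ω + -θ * D ω with hZdef
  have hZi : Integrable Z μ := hYi.add (hDi.const_mul _)
  have hZB : ∀ᵐ ω ∂μ, |Z ω| ≤ B + |θ| * B := by
    filter_upwards [hDB, hYB] with ω h1 h2
    refine (abs_add_le _ _).trans (add_le_add h2 ?_)
    rw [abs_mul, abs_neg]
    exact mul_le_mul_of_nonneg_left h1 (abs_nonneg _)
  -- Given (D, X) the term θ D is known, so Y - θ D and Y have the same conditional variance.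
  have h2 : μ[Z | MeasurableSpace.comap (fun ω => (D ω, X ω)) inferInstance] =ᵐ[μ] fun ω => (μ[Y | MeasurableSpace.comap (fun ω => (D ω, X ω)) inferInstance]) ω + -θ * D ω := by
    have e1 : μ[Z | MeasurableSpace.comap (fun ω => (D ω, X ω)) inferInstance] =ᵐ[μ] μ[Y | MeasurableSpace.comap (fun ω => (D ω, X ω)) inferInstance] + μ[fun ω => -θ * D ω | MeasurableSpace.comap (fun ω => (D ω, X ω)) inferInstance] :=
      condExp_add hYi (hDi.const_mul _) _
    have e2 : μ[fun ω => -θ * D ω | MeasurableSpace.comap (fun ω => (D ω, X ω)) inferInstance] = fun ω => -θ * D ω :=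
      condExp_of_stronglyMeasurable hn (hDn.const_mul _).stronglyMeasurable (hDi.const_mul _)
    rw [e2] at e1
    exact e1
  have h3 : (fun ω => vYD (D ω, X ω)) =ᵐ[μ]
      μ[fun ω => (Z ω - (μ[Z | MeasurableSpace.comap (fun ω => (D ω, X ω)) inferInstance]) ω) * (Z ω - (μ[Z | MeasurableSpace.comap (fun ω => (D ω, X ω)) inferInstance]) ω) | MeasurableSpace.comap (fun ω => (D ω, X ω)) inferInstance] := by
    refine hv.2.trans (condExp_congr_ae ?_)
    filter_upwards [h2] with ω h2
    rw [h2]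
    simp only [hZdef]
    ring
  have h4 := condExp_congr_ae (m := MeasurableSpace.comap X inferInstance) h3
  filter_upwards [h1, h4, condExp_condVar_le hmn hn hZi hZB, hgp.2, hz.2] with ω h1 h4 h5 h6 h7
  rw [h7, h6]
  rw [h4] at h1
  linarith

end TotalVariance

/-- The fuzzy design. -/
noncomputable def fuzzyModel (A B : ℝ) (ρ f mY mD vY vD cDY : ℝ → ℝ) (fR fL yR yL dR dL vR vL
    vR' vL' cR cL : ℝ) : LocalModel (ℝ × ℝ × ℝ) where
  xc := Prod.fst
  yc w := clamp B w.2.2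
  dc w := clamp B w.2.1
  A := A
  B := B
  ρ := ρ
  f := f
  fl := onSide fR fL
  mYY x := vY x + mY x * mY x
  mYD x := cDY x + mD x * mY x
  mY := mY
  mDD x := vD x + mD x * mD x
  mD := mD
  lYY b := onSide vR vL b + onSide yR yL b * onSide yR yL b
  lYD b := onSide cR cL b + onSide dR dL b * onSide yR yL b
  lY := onSide yR yL
  lDD b := onSide vR' vL' b + onSide dR dL b * onSide dR dL b
  lD := onSide dR dL

theorem tendsto_clamp {F : Filter ℝ} {g : ℝ → ℝ} {s : ℝ} (h : Tendsto g F (𝓝 s)) :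
    Tendsto (fun x => clamp |s| (g x)) F (𝓝 s) := by
  have hc : Continuous (clamp |s|) := continuous_const.max (continuous_id.min continuous_const)
  have := (hc.tendsto s).comp h
  rwa [clamp_eq le_rfl] at this

section

variable {Ω : Type*} [mΩ : MeasurableSpace Ω] {μ : Measure Ω} [IsProbabilityMeasure μ]

theorem FuzzyConditions.holds {X D Y : ℕ → Ω → ℝ} {ell f mY mD vY vD cDY : ℝ → ℝ}
    {vYD : ℝ × ℝ → ℝ} {fR fL dR dL : ℝ}
    (S : FuzzyConditions μ X D Y ell f mY mD vY vD cDY vYD fR fL dR dL)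
    {A B : ℝ} (hA : 0 < A) (hB : 1 ≤ B) (hYB : ∀ᵐ ω ∂μ, |Y 0 ω| ≤ B) {ρ : ℝ → ℝ}
    (hρ : LogLogSmall ρ)
    (hell : ∀ᶠ h in 𝓝[>] (0 : ℝ), ∀ s, 0 < s → s ≤ A * h → |ell s| ≤ ρ h)
    {yR yL vR vL vR' vL' cR cL : ℝ} (hy : OneSidedModulus ell mY yR yL)
    (hv : OneSidedModulus ell vY vR vL) (hv' : OneSidedModulus ell vD vR' vL')
    (hc : OneSidedModulus ell cDY cR cL) :
    (fuzzyModel A B ρ f mY mD vY vD cDY fR fL yR yL dR dL vR vL vR' vL' cR cL).Holds μ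
      fun i ω => (X i ω, D i ω, Y i ω) := by
  set c := fuzzyModel A B ρ f mY mD vY vD cDY fR fL yR yL dR dL vR vL vR' vL' cR cL with hcdef
  have hX : Measurable (X 0) := measurable_fst.comp (S.iid.1 0)
  have hD : Measurable (D 0) := measurable_fst.comp (measurable_snd.comp (S.iid.1 0))
  have hY : Measurable (Y 0) := measurable_snd.comp (measurable_snd.comp (S.iid.1 0))
  have hDB : ∀ᵐ ω ∂μ, |D 0 ω| ≤ B := S.binary.mono fun ω h => by
    rcases h with h | h <;> rw [h] <;> simp <;> linarith
  have hclY : (fun ω => clamp B (Y 0 ω)) =ᵐ[μ] Y 0 := hYB.mono fun ω h => clamp_eq h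
  have hclD : (fun ω => clamp B (D 0 ω)) =ᵐ[μ] D 0 := hDB.mono fun ω h => clamp_eq h
  have hYi : Integrable (Y 0) μ := Integrable.of_bound hY.aestronglyMeasurable B hYB
  have hDi : Integrable (D 0) μ := Integrable.of_bound hD.aestronglyMeasurable B hDB
  have hρ0 := hρ.tendsto_zero
  have hell0 := S.small.tendsto_zero
  have hYl := fun b => hy.localApprox hA hell b
  have hDl := fun b => S.modulus_mean_D.localApprox hA hell b
  have hvl := fun b => hv.localApprox hA hell b
  have hvl' := fun b => hv'.localApprox hA hell b
  have hcl := fun b => hc.localApprox hA hell b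
  have hYY := S.var_Y.isCondMean hX hYi hYi hYB hYB S.mean_Y S.mean_Y
  have hDY := S.cov_DY.isCondMean hX hDi hYi hDB hYB S.mean_D S.mean_Y
  have hDD := S.var_D.isCondMean hX hDi hDi hDB hDB S.mean_D S.mean_D
  set θ := c.ratio with hθ
  -- the conditional variance of `Y - θ D`
  set vz : ℝ → ℝ := fun x => vY x + -(2 * θ) * cDY x + θ ^ 2 * vD x with hvz
  have hYYi : Integrable (fun ω => Y 0 ω * Y 0 ω) μ := hYi.bdd_mul hYi.1 hYB
  have hDYi : Integrable (fun ω => D 0 ω * Y 0 ω) μ := hYi.bdd_mul hDi.1 hDB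
  have hDDi : Integrable (fun ω => D 0 ω * D 0 ω) μ := hDi.bdd_mul hDi.1 hDB
  have hZi : Integrable (fun ω => Y 0 ω + -θ * D 0 ω) μ := hYi.add (hDi.const_mul _)
  have hZB : ∀ᵐ ω ∂μ, |Y 0 ω + -θ * D 0 ω| ≤ B + |θ| * B := by
    filter_upwards [hDB, hYB] with ω h1 h2
    refine (abs_add_le _ _).trans (add_le_add h2 ?_)
    rw [abs_mul, abs_neg]
    exact mul_le_mul_of_nonneg_left h1 (abs_nonneg _)
  have hZm := S.mean_Y.add_const_mul hYi hDi S.mean_D (-θ)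
  have hYDi : Integrable (fun ω => Y 0 ω * Y 0 ω + -(2 * θ) * (D 0 ω * Y 0 ω)) μ :=
    hYYi.add (hDYi.const_mul _)
  have hZZ : IsCondMean μ (X 0) (fun ω => (Y 0 ω + -θ * D 0 ω) * (Y 0 ω + -θ * D 0 ω)) _ :=
    ((hYY.add_const_mul hYYi hDYi hDY (-(2 * θ))).add_const_mul
      hYDi hDDi hDD (θ ^ 2)).congr (ae_of_all _ fun ω => by ring)
  have hz : IsCondCov μ (X 0) (fun ω => Y 0 ω + -θ * D 0 ω) (fun ω => Y 0 ω + -θ * D 0 ω) vz := by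
    have h := hZm.isCondCov hX hZi hZi hZB hZB hZm hZZ
    convert h using 2 with x
    simp only [hvz]
    ring
  have hvzl : ∀ b, Tendsto vz (nhdsSide b) (𝓝 (c.residVar b)) := by
    intro b
    have h := ((hv.tendsto hell0 b).add ((hc.tendsto hell0 b).const_mul (-(2 * θ)))).add
      ((hv'.tendsto hell0 b).const_mul (θ ^ 2))
    -- The products of means cancel, leaving the limit of var(Y - θ D | X).
    have e : c.residVar b = onSide vR vL b + -(2 * θ) * onSide cR cL b +
        θ ^ 2 * onSide vR' vL' b := by
      simp only [LocalModel.residVar, LocalModel.residMean, ← hθ]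
      simp only [hcdef, fuzzyModel]
      ring
    rw [e]
    exact h
  have hflpos : ∀ b, 0 < onSide fR fL b := fun b => by
    cases b; exacts [S.running.pos_left, S.running.pos_right]
  have hlim : ∀ {b : Bool} {g : ℝ → ℝ} {l : ℝ}, Measurable g → Tendsto g (nhdsSide b) (𝓝 l) →
      (∀ᵐ ω ∂μ, 0 ≤ g (X 0 ω)) → 0 ≤ l := fun {b g l} hg hgl h =>
    nonneg_of_tendsto_nhdsSide hX S.running.measurable S.running.density (hflpos b)
      (S.running.modulus.tendsto hell0 b) hg hgl h
  -- Clamping at |s| preserves the limit s. Passing to the limit in the lower bound gives 0 ≤ s · pl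
  -- ≤ residual variance, and s ≠ 0 then forces s > 0.
  have hpos : ∀ {b : Bool} {d s pl : ℝ} {t : Ω → ℝ} {p : ℝ → ℝ}, s ≠ 0 → 0 < pl →
      Tendsto (fun x => vYD (d, x)) (nhdsSide b) (𝓝 s) → Integrable t μ →
      (∀ᵐ ω ∂μ, (t ω = 1 ∧ D 0 ω = d) ∨ t ω = 0) → IsCondMean μ (X 0) t p →
      Tendsto p (nhdsSide b) (𝓝 pl) → 0 < c.residVar b := by
    intro b d s pl t p hs hpl hsl ht htd hp hpp
    obtain ⟨h1, h2⟩ := condVar_lower_bound hX hD hY hDB hYB S.var_YD hz ht htd hp (abs_nonneg s)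
    have hgm : Measurable fun x => clamp |s| (vYD (d, x)) :=
      (measurable_clamp _).comp (S.var_YD.1.comp measurable_prodMk_left)
    have h3 := hlim (hgm.mul hp.1) ((tendsto_clamp hsl).mul hpp) h1
    have h4 := hlim (hz.1.sub (hgm.mul hp.1)) ((hvzl b).sub ((tendsto_clamp hsl).mul hpp)) h2
    have h5 : 0 < s := lt_of_le_of_ne (nonneg_of_mul_nonneg_left h3 hpl) hs.symm
    have h6 := mul_pos h5 hpl
    linarith
  have hD1 : ∀ᵐ ω ∂μ, (D 0 ω = 1 ∧ D 0 ω = 1) ∨ D 0 ω = 0 :=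
    S.binary.mono fun ω h => by tauto
  have hone := isCondMean_comp (μ := μ) hX (measurable_const (a := (1 : ℝ))) (K := 1)
    fun _ => by simp
  have hD0i : Integrable (fun ω => 1 + -1 * D 0 ω) μ :=
    (integrable_const (1 : ℝ)).add (hDi.const_mul _)
  have hD0m := hone.add_const_mul (integrable_const (1 : ℝ)) hDi S.mean_D (-1)
  -- The subpopulation D = 0 is marked by t = 1 - D, whose conditional mean is 1 minus that of D.
  have hD0 : ∀ᵐ ω ∂μ, (1 + -1 * D 0 ω = 1 ∧ D 0 ω = 0) ∨ 1 + -1 * D 0 ω = 0 :=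
    S.binary.mono fun ω h => by
      rcases h with h | h
      · left; rw [h]; norm_num
      · right; rw [h]; norm_num
  have hmD := fun b => S.modulus_mean_D.tendsto hell0 b
  have hmD0 : ∀ b, Tendsto (fun x => 1 + -1 * mD x) (nhdsSide b) (𝓝 (1 - onSide dR dL b)) :=
    fun b => by
      have := ((hmD b).const_mul (-1)).const_add 1
      rwa [neg_one_mul, ← sub_eq_add_neg] at this
  exact
  { iid := S.iid
    meas_x := measurable_fst
    meas_y := (measurable_clamp B).comp (measurable_snd.comp measurable_snd)
    meas_d := (measurable_clamp B).comp (measurable_fst.comp measurable_snd)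
    one_le := hB
    bound_y := fun w => abs_clamp_le (by linarith) _
    bound_d := fun w => abs_clamp_le (by linarith) _
    A_pos := hA
    rho_small := hρ
    rho_tendsto := hρ0
    f_meas := S.running.measurable
    f_nonneg := S.running.nonneg
    density := S.running.density
    f_local := fun b => S.running.modulus.localApprox hA hell b
    fl_pos := hflpos
    condYY := hYY.congr (hclY.mul hclY).symm
    condYD := hDY.congr <| by
      filter_upwards [hclY, hclD] with ω h h'
      simp only [hcdef, fuzzyModel, h, h', mul_comm]
    condY := S.mean_Y.congr hclY.symm
    condDD := hDD.congr (hclD.mul hclD).symm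
    condD := S.mean_D.congr hclD.symm
    localYY := fun b => (hvl b).add ((hYl b).mul hρ0 (hYl b))
    localYD := fun b => (hcl b).add ((hDl b).mul hρ0 (hYl b))
    localY := hYl
    localDD := fun b => (hvl' b).add ((hDl b).mul hρ0 (hDl b))
    localD := hDl
    jump := by simpa [hcdef, fuzzyModel, onSide] using S.jump
    var_nonneg := fun b => hlim hz.1 (hvzl b) hz.nonneg
    var_pos := by
      obtain ⟨s, hs, h | h | h | h⟩ := S.nondegenerate
      · exact ⟨true, hpos hs h.2 h.1 hDi hD1 S.mean_D (hmD true)⟩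
      · exact ⟨true, hpos hs h.2 h.1 hD0i hD0 hD0m (hmD0 true)⟩
      · exact ⟨false, hpos hs h.2 h.1 hDi hD1 S.mean_D (hmD false)⟩
      · exact ⟨false, hpos hs h.2 h.1 hD0i hD0 hD0m (hmD0 false)⟩ }

theorem FuzzyConditions.assumptionsHold {X D Y : ℕ → Ω → ℝ} {ell f mY mD vY vD cDY : ℝ → ℝ}
    {vYD : ℝ × ℝ → ℝ} {fR fL dR dL : ℝ}
    (S : FuzzyConditions μ X D Y ell f mY mD vY vD cDY vYD fR fL dR dL)
    {k : ℝ → ℝ} {A : ℝ} (hk : KernelRegular k A) (hw : WellPosed k) :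
    AssumptionsHold μ (fun i ω => (X i ω, D i ω, Y i ω)) Prod.fst
      (fun h n ω => fuzzyEst k h n (fun i => X i ω) (fun i => D i ω) (fun i => Y i ω))
      (fun h n ω => fuzzySigma k h n (fun i => X i ω) (fun i => D i ω) (fun i => Y i ω))
      (fun h => fuzzyTarget μ k (X 0) (D 0) (Y 0) h) (equivKernel k) A := by
  obtain ⟨B₀, hB₀⟩ := S.bounded
  obtain ⟨ρ, hρ, hell⟩ := S.small.exists_majorant hk.pos
  obtain ⟨yR, yL, hy⟩ := S.modulus_mean_Y
  obtain ⟨vR, vL, hv⟩ := S.modulus_var_Y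
  obtain ⟨vR', vL', hv'⟩ := S.modulus_var_D
  obtain ⟨cR, cL, hc⟩ := S.modulus_cov_DY
  set B := max B₀ 1 with hBdef
  have hB1 : 1 ≤ B := le_max_right _ _
  have hYB : ∀ᵐ ω ∂μ, |Y 0 ω| ≤ B := hB₀.mono fun ω h => h.trans (le_max_left _ _)
  have hDB : ∀ᵐ ω ∂μ, |D 0 ω| ≤ B := S.binary.mono fun ω h => by
    rcases h with h | h <;> rw [h] <;> simp <;> linarith
  have H := S.holds hk.pos hB1 hYB hρ hell hy hv hv' hc
  have hX : Measurable (X 0) := measurable_fst.comp (S.iid.1 0)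
  have hclY : Y 0 =ᵐ[μ] fun ω => clamp B (Y 0 ω) := hYB.mono fun ω h => (clamp_eq h).symm
  have hclD : D 0 =ᵐ[μ] fun ω => clamp B (D 0 ω) := hDB.mono fun ω h => (clamp_eq h).symm
  have hz : ∀ u, A < |u| → k u = 0 := fun u hu => hk.eq_zero hu
  have hall : ∀ᵐ ω ∂μ, ∀ i, |D i ω| ≤ B ∧ |Y i ω| ≤ B := ae_all_iff.2 fun i =>
    (S.iid.2.2 i).symm.ae_snd (p := fun w : ℝ × ℝ × ℝ => |w.2.1| ≤ B ∧ |w.2.2| ≤ B)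
      ((measurableSet_le (measurable_norm.comp (measurable_fst.comp measurable_snd))
        measurable_const).inter (measurableSet_le (measurable_norm.comp
          (measurable_snd.comp measurable_snd)) measurable_const)) (hDB.and hYB)
  refine H.assumptionsHold hk hw (fun h hh hc hd => ?_) ?_
  · have e : fuzzyTarget μ k (X 0) (D 0) (Y 0) h = fuzzyTarget μ k (X 0)
        (fun ω => clamp B (D 0 ω)) (fun ω => clamp B (Y 0 ω)) h := by
      unfold fuzzyTarget
      rw [popJump_congr hclY, popJump_congr hclD]
    rw [e]
    exact fuzzyTarget_eq hh hX (H.meas_y.comp (H.iid.1 0)) (H.meas_d.comp (H.iid.1 0))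
      (ae_of_all _ fun ω => H.bound_y (X 0 ω, D 0 ω, Y 0 ω))
      (ae_of_all _ fun ω => H.bound_d (X 0 ω, D 0 ω, Y 0 ω))
      (fun b j => (hk.antiDiff.sideKernel hz b j).measurable)
      (fun b j => (hk.antiDiff.sideKernel hz b j).bounded.imp fun K h => h.2) hc hd
  · filter_upwards [hall] with ω hω n h hh hn hc hd
    have eY : (fun i => clamp B (Y i ω)) = fun i => Y i ω := funext fun i => clamp_eq (hω i).2
    have eD : (fun i => clamp B (D i ω)) = fun i => D i ω := funext fun i => clamp_eq (hω i).1
    have h1 := fuzzyEst_eq (k := k) (x := fun i => X i ω) (y := fun i => clamp B (Y i ω))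
      (d := fun i => clamp B (D i ω)) hh hn hc hd
    have h2 := fuzzySigma_eq (k := k) (x := fun i => X i ω) (y := fun i => clamp B (Y i ω))
      (d := fun i => clamp B (D i ω)) hh hn hc hd
    refine ⟨?_, ?_⟩
    · refine Eq.trans ?_ h1
      simp only [eY, eD]
    · refine Eq.trans ?_ h2
      simp only [eY, eD]

end

end RDSnoop

theorem mainTheorem5 {Ω : Type*} [MeasurableSpace Ω] (μ : Measure Ω) [IsProbabilityMeasure μ]
    (X D Y : ℕ → Ω → ℝ) (kstar : ℝ → ℝ) (A : ℝ)
    (hk : RDSnoop.KernelRegular kstar A) (hwell : RDSnoop.WellPosed kstar) :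
    (∀ (ell f mY vY : ℝ → ℝ) (fR fL yR yL vR vL : ℝ),
      RDSnoop.SharpConditions μ X Y ell f mY vY fR fL yR yL vR vL →
      RDSnoop.AssumptionsHold μ (fun i ω => (X i ω, Y i ω)) Prod.fst
        (fun h n ω => RDSnoop.sampleJump kstar h n (fun i => X i ω) (fun i => Y i ω))
        (fun h n ω => RDSnoop.sharpSigma kstar h n (fun i => X i ω) (fun i => Y i ω))
        (fun h => RDSnoop.popJump μ kstar h (X 0) (Y 0))
        (RDSnoop.equivKernel kstar) A) ∧
    (∀ (ell f mY mD vY vD cDY : ℝ → ℝ) (vYD : ℝ × ℝ → ℝ) (fR fL dR dL : ℝ),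
      RDSnoop.FuzzyConditions μ X D Y ell f mY mD vY vD cDY vYD fR fL dR dL →
      RDSnoop.AssumptionsHold μ (fun i ω => (X i ω, D i ω, Y i ω)) Prod.fst
        (fun h n ω => RDSnoop.fuzzyEst kstar h n (fun i => X i ω) (fun i => D i ω)
          (fun i => Y i ω))
        (fun h n ω => RDSnoop.fuzzySigma kstar h n (fun i => X i ω) (fun i => D i ω)
          (fun i => Y i ω))
        (fun h => RDSnoop.fuzzyTarget μ kstar (X 0) (D 0) (Y 0) h)
        (RDSnoop.equivKernel kstar) A) :=
  ⟨fun _ _ _ _ _ _ _ _ _ _ S => S.assumptionsHold hk hwell,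
    fun _ _ _ _ _ _ _ _ _ _ _ _ S => S.assumptionsHold hk hwell⟩
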